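/- Let $\mathfrak o$ be a compact discrete valuation ring with maximal ideal $\mathfrak p$ and residue field $k$ of odd characteristic $p$, and let $\mathfrak O/\mathfrak o$ be a quadratic unramified extension with maximal ideal $\mathfrak P$, residue field $K$ and nontrivial automorphism $x\mapsto x^\circ$. Write $\mathfrak o_m=\mathfrak o/\mathfrak p^m\subset\mathfrak O_m=\mathfrak O/\mathfrak P^m$, so that $\mathfrak o_1=k$, $\mathfrak O_1=K$. Let $\mathbf G$ be one of $\mathrm{GL}_d,\mathrm{GU}_d,\mathrm{SL}_d,\mathrm{SU}_d$ over $\mathfrak o$, with Lie algebra $\mathfrak g\subset\mathfrak{gl}_d$; here $\mathrm{GU}_d(\mathfrak o_m)=\{A\in \mathrm{GL}_d(\mathfrak O_m): (A^\circ)^{T}JA=J\}$ and $\mathfrak{gu}_d(\mathfrak o_m)=\{A : (A^\circ)^TJ+JA=0\}$ for a Hermitian matrix $J\in\mathrm{GL}_d(\mathfrak O)$, and $\mathrm{SU}_d=\mathrm{SL}_d\cap \mathrm{GU}_d$. If $\mathbf G$ is $\mathrm{SL}_d$ or $\mathrm{SU}_d$, assume $p\nmid d$. Let $\ell\ge 2$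 and fix an additive character $\psi:\mathfrak O_\ell\to\mathbb C^\times$ which is nontrivial on $\mathfrak p^{\ell-1}/\mathfrak p^{\ell}$. For a group scheme $\mathbf H\subset \mathrm{GL}_n$ of this kind and a matrix $\xi$ in its Lie algebra over $k$, $\mathrm{Irr}(\mathbf H(\mathfrak o_\ell)\mid[\xi])$ is the set of isomorphism classes of complex irreducible representations of $\mathbf H(\mathfrak o_\ell)$ whose restriction to $\ker(\mathbf H(\mathfrak o_\ell)\to\mathbf H(\mathfrak o_{\ell-1}))$ contains the character $I+\pi^{\ell-1}x\mapsto\psi(\pi^{\ell-1}\mathrm{tr}(\eta x))$, with $\pi$ a uniformiser of $\mathfrak o$, for some $\eta$ in the $\mathbf H(k)$-orbit $[\xi]$ of $\xi$; and $\zeta_{\mathbf H(\mathfrak o_\ell),[\xi]}(s)=\sum_{\chi\in\mathrm{Irr}(\mathbf H(\mathfrak o_\ell)\mid[\xi])}(\dim\chi)^{-s}$ for $s \in \mathbb C$. Let $d=d_1+d_2$, let $J_i\in \mathrm{GL}_{d_i}(\mathfrak O)$ be Hermitian, and let $\mathbf L$ be the block diagonal subgroup $\mathbf G\cap(\mathrm{GL}_{d_1}\times\mathrm{GL}_{d_2})$,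 where in the unitary cases $\mathbf G$ is here taken with respect to the form $\mathrm{diag}(J_1,J_2)$. Thus $\mathbf L$ is $\mathbf G_1\times\mathbf G_2$ with $\mathbf G_i=\mathrm{GL}_{d_i}$, respectively $\mathrm{GU}_{d_i}$ for the form $J_i$, if $\mathbf G$ is $\mathrm{GL}_d$, respectively $\mathrm{GU}_d$; and it is the subgroup of elements of determinant $1$ in $\mathrm{GL}_{d_1}\times\mathrm{GL}_{d_2}$, respectively $\mathrm{GU}_{d_1}\times\mathrm{GU}_{d_2}$, if $\mathbf G$ is $\mathrm{SL}_d$, respectively $\mathrm{SU}_d$. Let $\xi\in\mathfrak g(k)$ be conjugate under $\mathrm{GL}_d(K)$ to a matrix $\mathrm{diag}(\xi_1,\xi_2)$ in the Lie algebra of $\mathbf L$ over $k$, with $\xi_i\in\mathfrak{gl}_{d_i}(K)$, such that the characteristic polynomials of $\xi_1$ and $\xi_2$ are coprime in $K[t]$. (1) There is a bijection $\mathrm{Irr}(\mathbf G(\mathfrak o_\ell)\mid[\xi])\to\mathrm{Irr}(\mathbf L(\mathfrak o_\ell)\mid[\mathrm{diag}(\xi_1,\xi_2)])$ such that the quotient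 of the dimension of a representation by the dimension of its image is always $$\frac{|\mathbf G(k)|}{|\mathbf L(k)|}\,|k|^{\frac12(\dim\mathbf G-\dim\mathbf L)(\ell-2)}.$$ Consequently, for all $s\in\mathbb C$, $$\zeta_{\mathbf G(\mathfrak o_\ell),[\xi]}(s)=\frac{|\mathbf G(k)|^{-s}}{|\mathbf L(k)|^{-s}}\,|k|^{-\frac12(\dim\mathbf G-\dim\mathbf L)(\ell-2)s}\,\zeta_{\mathbf L(\mathfrak o_\ell),[\mathrm{diag}(\xi_1,\xi_2)]}(s).$$ (2) If $\mathbf G$ is $\mathrm{GL}_d$ or $\mathrm{GU}_d$, there is a bijection $\mathrm{Irr}(\mathbf G(\mathfrak o_\ell)\mid[\xi])\to\mathrm{Irr}(\mathbf G_1(\mathfrak o_\ell)\mid[\xi_1])\times\mathrm{Irr}(\mathbf G_2(\mathfrak o_\ell)\mid[\xi_2])$ such that, whenever $\chi$ corresponds to $(\chi_1,\chi_2)$, $$\dim \chi=\frac{|\mathbf G(k)|}{|\mathbf G_1(k)|\,|\mathbf G_2(k)|}\,|k|^{\frac12(\dim\mathbf G-\dim\mathbf G_1-\dim\mathbf G_2)(\ell-2)}\dim\chi_1\dim\chi_2,$$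 and for all $s\in\mathbb C$ $$\zeta_{\mathbf G(\mathfrak o_\ell),[\xi]}(s)=\frac{|\mathbf G(k)|^{-s}}{|\mathbf G_1(k)|^{-s}|\mathbf G_2(k)|^{-s}}\,|k|^{-\frac12(\dim\mathbf G-\dim\mathbf G_1-\dim\mathbf G_2)(\ell-2)s}\,\zeta_{\mathbf G_1(\mathfrak o_\ell),[\xi_1]}(s)\,\zeta_{\mathbf G_2(\mathfrak o_\ell),[\xi_2]}(s).$$ -/

import Mathlib

open Matrix IsLocalRing

universe u v w

namespace DimRed

/-! ### Finite quotients of a local ring and congruence quotients of matrix groups -/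

/-- The quotient `R_m = R / 𝔪 ^ m` of a local ring. -/
abbrev Lvl (R : Type u) [CommRing R] [IsLocalRing R] (m : ℕ) : Type u :=
  R ⧸ (maximalIdeal R ^ m)

/-- The reduction map `R_m → R_{m'}` for `m' ≤ m`. -/
def red (R : Type u) [CommRing R] [IsLocalRing R] {m' m : ℕ} (h : m' ≤ m) :
    Lvl R m →+* Lvl R m' :=
  Ideal.Quotient.factor (Ideal.pow_le_pow_right h)

/-- The reduction map `R → R_m`. -/
abbrev toLvl (R : Type u) [CommRing R] [IsLocalRing R] (m : ℕ) : R →+* Lvl R m :=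
  Ideal.Quotient.mk (maximalIdeal R ^ m)

theorem maximalIdeal_pow_le_comap {R : Type u} [CommRing R] [IsLocalRing R] (σ : R ≃+* R)
    (m : ℕ) : maximalIdeal R ^ m ≤ (maximalIdeal R ^ m).comap (σ : R →+* R) := by
  have h : maximalIdeal R ≤ (maximalIdeal R).comap (σ : R →+* R) := by
    intro x hx
    rw [Ideal.mem_comap, mem_maximalIdeal, mem_nonunits_iff]
    rw [mem_maximalIdeal, mem_nonunits_iff] at hx
    intro hu
    exact hx ((MulEquiv.isUnit_map σ).1 hu)
  exact (Ideal.pow_right_mono h m).trans (Ideal.le_comap_pow _ m)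

/-- The automorphism of `R_m` induced by an automorphism of `R`. -/
def lvlAut {R : Type u} [CommRing R] [IsLocalRing R] (σ : R ≃+* R) (m : ℕ) :
    Lvl R m →+* Lvl R m :=
  Ideal.quotientMap _ (σ : R →+* R) (maximalIdeal_pow_le_comap σ m)

/-- The image of the base ring `o` in `O_m`. For `O / o` unramified this is a copy of
`o_m = o / 𝔭 ^ m`, as `𝔓 ^ m ∩ o = 𝔭 ^ m`. -/
def baseRing (o : Type u) (O : Type v) [CommRing o] [CommRing O] [IsLocalRing O] [Algebra o O]
    (m : ℕ) : Subring (Lvl O m) :=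
  ((toLvl O m).comp (algebraMap o O)).range

/-! ### The four classical groups and their Lie algebras

All groups of `o_m`-points are realised as subgroups of `GL_n(O_m)`. -/

/-- `GL_n(o_m)` inside `GL_n(O_m)`. -/
def linearGroup (o : Type u) (O : Type v) [CommRing o] [CommRing O] [IsLocalRing O]
    [Algebra o O] (n : Type w) [Fintype n] [DecidableEq n] (m : ℕ) :
    Subgroup (GL n (Lvl O m)) :=
  (GeneralLinearGroup.map (n := n) (baseRing o O m).subtype).range

/-- The unitary group over `O_m` of the Hermitian form `(x, y) ↦ (x^σ)ᵀ J y`. -/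
def unitaryGrp {O : Type v} [CommRing O] [IsLocalRing O] (σ : O ≃+* O)
    {n : Type w} [Fintype n] [DecidableEq n] (J : Matrix n n O) (m : ℕ) :
    Subgroup (GL n (Lvl O m)) where
  carrier := {g | ((g : Matrix n n (Lvl O m)).map (lvlAut σ m))ᵀ * J.map (toLvl O m) *
    (g : Matrix n n (Lvl O m)) = J.map (toLvl O m)}
  one_mem' := by
    simp [Matrix.map_one]
  mul_mem' := by
    intro a b ha hb
    simp only [Set.mem_ofPred_eq, Units.val_mul, Matrix.map_mul, Matrix.transpose_mul] at *
    calc _ = ((b : Matrix n n (Lvl O m)).map (lvlAut σ m))ᵀ *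
          (((a : Matrix n n (Lvl O m)).map (lvlAut σ m))ᵀ * J.map (toLvl O m) *
            (a : Matrix n n (Lvl O m))) * (b : Matrix n n (Lvl O m)) := by
            simp only [Matrix.mul_assoc]
      _ = _ := by rw [ha, hb]
  inv_mem' := by
    intro a ha
    simp only [Set.mem_ofPred_eq] at *
    have h1 : (a : Matrix n n (Lvl O m)) * ((a⁻¹ : GL n (Lvl O m)) : Matrix n n (Lvl O m)) = 1 := by
      rw [← Units.val_mul, mul_inv_cancel, Units.val_one]
    have h2 : (((a⁻¹ : GL n (Lvl O m)) : Matrix n n (Lvl O m)).map (lvlAut σ m))ᵀ *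
        ((a : Matrix n n (Lvl O m)).map (lvlAut σ m))ᵀ = 1 := by
      rw [← Matrix.transpose_mul, ← Matrix.map_mul, h1]
      simp [Matrix.map_one]
    calc _ = (((a⁻¹ : GL n (Lvl O m)) : Matrix n n (Lvl O m)).map (lvlAut σ m))ᵀ *
          (((a : Matrix n n (Lvl O m)).map (lvlAut σ m))ᵀ * J.map (toLvl O m) *
            (a : Matrix n n (Lvl O m))) *
            ((a⁻¹ : GL n (Lvl O m)) : Matrix n n (Lvl O m)) := by rw [ha]
      _ = ((((a⁻¹ : GL n (Lvl O m)) : Matrix n n (Lvl O m)).map (lvlAut σ m))ᵀ *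
          ((a : Matrix n n (Lvl O m)).map (lvlAut σ m))ᵀ) * J.map (toLvl O m) *
            ((a : Matrix n n (Lvl O m)) *
            ((a⁻¹ : GL n (Lvl O m)) : Matrix n n (Lvl O m))) := by
            simp only [Matrix.mul_assoc]
      _ = _ := by rw [h1, h2, Matrix.one_mul, Matrix.mul_one]

/-- The four types of groups: `GL`, `GU`, `SL`, `SU`. -/
inductive GroupType
  | GL
  | GU
  | SL
  | SU

/-- `G(o_m) ≤ GL_n(O_m)` for `G` of the given type. The form `J` plays no role in the linear
cases. -/
def classicalGroup (o : Type u) {O : Type v} [CommRing o] [CommRing O] [IsLocalRing O]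
    [Algebra o O] (σ : O ≃+* O) {n : Type w} [Fintype n] [DecidableEq n] (J : Matrix n n O) :
    GroupType → (m : ℕ) → Subgroup (GL n (Lvl O m))
  | .GL, m => linearGroup o O n m
  | .GU, m => unitaryGrp σ J m
  | .SL, m => linearGroup o O n m ⊓ (GeneralLinearGroup.det (n := n) (R := Lvl O m)).ker
  | .SU, m => unitaryGrp σ J m ⊓ (GeneralLinearGroup.det (n := n) (R := Lvl O m)).ker

/-- The Lie algebra `𝔤(o_m) ⊆ 𝔤𝔩_n(O_m)` for `G` of the given type. -/
def lieAlg (o : Type u) {O : Type v} [CommRing o] [CommRing O] [IsLocalRing O]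
    [Algebra o O] (σ : O ≃+* O) {n : Type w} [Fintype n] [DecidableEq n] (J : Matrix n n O) :
    GroupType → (m : ℕ) → Set (Matrix n n (Lvl O m))
  | .GL, m => {A | ∀ i j, A i j ∈ baseRing o O m}
  | .GU, m => {A | (A.map (lvlAut σ m))ᵀ * J.map (toLvl O m) + J.map (toLvl O m) * A = 0}
  | .SL, m => {A | (∀ i j, A i j ∈ baseRing o O m) ∧ A.trace = 0}
  | .SU, m => {A | (A.map (lvlAut σ m))ᵀ * J.map (toLvl O m) + J.map (toLvl O m) * A = 0 ∧
      A.trace = 0}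

/-- The embedding `GL_{n₁} × GL_{n₂} → GL_{n₁ + n₂}`, `(a, b) ↦ diag(a, b)`. -/
def blockDiag (R : Type u) [CommRing R] (n₁ n₂ : Type w) [Fintype n₁] [DecidableEq n₁]
    [Fintype n₂] [DecidableEq n₂] : GL n₁ R × GL n₂ R →* GL (n₁ ⊕ n₂) R where
  toFun x :=
    { val := fromBlocks (x.1 : Matrix n₁ n₁ R) 0 0 (x.2 : Matrix n₂ n₂ R)
      inv := fromBlocks ((x.1⁻¹ : GL n₁ R) : Matrix n₁ n₁ R) 0 0
        ((x.2⁻¹ : GL n₂ R) : Matrix n₂ n₂ R)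
      val_inv := by
        simp only [fromBlocks_multiply, ← Units.val_mul, mul_inv_cancel]
        simp
      inv_val := by
        simp only [fromBlocks_multiply, ← Units.val_mul, inv_mul_cancel]
        simp }
  map_one' := by
    ext1
    simp
  map_mul' := by
    intro x y
    ext1
    simp [fromBlocks_multiply]

/-- The block diagonal subgroup `L = G ∩ (GL_{d₁} × GL_{d₂})`, where in the unitary cases the
form is the orthogonal sum of `J₁` and `J₂`. -/
def leviGroup (o : Type u) {O : Type v} [CommRing o] [CommRing O] [IsLocalRing O]
    [Algebra o O] (σ : O ≃+* O) {n₁ n₂ : Type w} [Fintype n₁] [DecidableEq n₁]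
    [Fintype n₂] [DecidableEq n₂] (J₁ : Matrix n₁ n₁ O) (J₂ : Matrix n₂ n₂ O)
    (T : GroupType) (m : ℕ) : Subgroup (GL (n₁ ⊕ n₂) (Lvl O m)) :=
  classicalGroup o σ (fromBlocks J₁ 0 0 J₂) T m ⊓ (blockDiag (Lvl O m) n₁ n₂).range

/-- The dimension of `GL_d`, `GU_d`, `SL_d`, `SU_d` as a group scheme. -/
def GroupType.dim : GroupType → ℕ → ℤ
  | .GL, d => (d : ℤ) ^ 2
  | .GU, d => (d : ℤ) ^ 2
  | .SL, d => (d : ℤ) ^ 2 - 1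
  | .SU, d => (d : ℤ) ^ 2 - 1

/-- The dimension of the block diagonal subgroup `G ∩ (GL_{d₁} × GL_{d₂})`. -/
def GroupType.leviDim : GroupType → ℕ → ℕ → ℤ
  | .GL, d₁, d₂ => (d₁ : ℤ) ^ 2 + (d₂ : ℤ) ^ 2
  | .GU, d₁, d₂ => (d₁ : ℤ) ^ 2 + (d₂ : ℤ) ^ 2
  | .SL, d₁, d₂ => (d₁ : ℤ) ^ 2 + (d₂ : ℤ) ^ 2 - 1
  | .SU, d₁, d₂ => (d₁ : ℤ) ^ 2 + (d₂ : ℤ) ^ 2 - 1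

/-! ### Irreducible representations -/

/-- A complex irreducible representation of `G` on some `ℂ ^ n`. -/
structure IrrRep (G : Type u) [Group G] where
  /-- the dimension -/
  dim : ℕ
  /-- the action -/
  ρ : Representation ℂ G (Fin dim → ℂ)
  irr : ρ.IsIrreducible

/-- Isomorphism of irreducible representations. -/
instance IrrRep.setoid (G : Type u) [Group G] : Setoid (IrrRep G) where
  r π π' := Nonempty (π.ρ.Equiv π'.ρ)
  iseqv :=
    { refl := fun π => ⟨Representation.Equiv.refl π.ρ⟩
      symm := fun ⟨e⟩ => ⟨e.symm⟩
      trans := fun ⟨e⟩ ⟨f⟩ => ⟨e.trans f⟩ }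

/-- `Irr(G)`: the isomorphism classes of finite-dimensional complex irreducible
representations. -/
def Irr (G : Type u) [Group G] : Type u := Quotient (IrrRep.setoid G)

/-- The dimension of an isomorphism class. -/
def Irr.dim {G : Type u} [Group G] (χ : Irr G) : ℕ :=
  Quotient.lift IrrRep.dim (by
    rintro π π' ⟨e⟩
    have h := LinearEquiv.finrank_eq e.toLinearEquiv
    simpa using h) χ

/-! ### Representations over an orbit -/

/-- `Irr(𝒢(o_ℓ) | [ξ])`, for a family of groups `𝒢(o_m) ≤ GL_n(R_m)` and `ξ ∈ 𝔤𝔩_n(R_1)`.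
A representation of `𝒢(o_ℓ)` lies above the `𝒢(k)`-orbit of `ξ` if for some `η = h ξ h⁻¹` in
that orbit its restriction to `ker (𝒢(o_ℓ) → 𝒢(o_{ℓ-1}))` contains the character
`g ↦ ψ (tr (η' (g - 1)))`, where `η'` is a lift of `η` to `R`. For `g = 1 + π ^ (ℓ-1) x`,
`ℓ ≥ 2`, this is `ψ (π ^ (ℓ-1) tr (η x))`, so that the lift does not matter. -/
def IrrOver {R : Type u} [CommRing R] [IsLocalRing R] {n : Type w} [Fintype n] [DecidableEq n]
    (𝒢 : (m : ℕ) → Subgroup (GL n (Lvl R m))) (ℓ : ℕ) (ψ : AddChar (Lvl R ℓ) ℂ)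
    (ξ : Matrix n n (Lvl R 1)) : Set (Irr (𝒢 ℓ)) :=
  {χ | ∃ π : IrrRep (𝒢 ℓ), Quotient.mk _ π = χ ∧
    ∃ h ∈ 𝒢 1, ∃ v : Fin π.dim → ℂ, v ≠ 0 ∧
      ∀ g : 𝒢 ℓ, GeneralLinearGroup.map (red R (Nat.sub_le ℓ 1)) (g : GL n (Lvl R ℓ)) = 1 →
        ∀ η' : Matrix n n R,
          η'.map (toLvl R 1) = (h : Matrix n n (Lvl R 1)) * ξ *
            ((h⁻¹ : GL n (Lvl R 1)) : Matrix n n (Lvl R 1)) →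
          π.ρ g v = ψ (η'.map (toLvl R ℓ) *
            (((g : GL n (Lvl R ℓ)) : Matrix n n (Lvl R ℓ)) - 1)).trace • v}

/-- The zeta function `∑ (dim χ) ^ (-s)` of a set of (classes of) irreducible representations;
for a finite group this is a finite sum. -/
noncomputable def zeta {G : Type u} [Group G] (S : Set (Irr G)) (s : ℂ) : ℂ :=
  ∑' χ : S, (χ.1.dim : ℂ) ^ (-s)

end DimRed

/-! Conjugation by `diag(1, -1)` is an involution `T` of `G(o_ℓ)` whose fixed points are `L(o_ℓ)`,
and representations of `G` are compared with those of `L` through `T`. Suppose first that `ξ` is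
block diagonal. Since the two characteristic polynomials are coprime, Bézout and Cayley–Hamilton
give a polynomial in `ξ` equal to the projector `diag(1, 0)` modulo the maximal ideal. A matrix that
commutes with `ξ` to one more order than its own size therefore has off-diagonal blocks that are
small to that order. This has two consequences for the character `φ(1 + x) = ψ(tr(ξ x))` of the last
congruence subgroup `K_{ℓ-1}`: its stabiliser is `T`-fixed modulo `K_1` (`LeviDatum.stab`), and the
commutator pairing of `K_i` with `K_{ℓ-1-i}` through `φ` is nondegenerate on the elements inverted
by `T` (`LeviDatum.nondeg`). Together with the odd order of `K_1` and the count `|K_i| = |K_i ∩ L|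
M^{2(ℓ-i)}`, where `M = q^{d₁d₂}`, these facts form `FilteredInvolution`, and the correspondence is
proved for an abstract finite group with such a filtration.

Put `a = ⌈ℓ/2⌉` and `b = ⌊ℓ/2⌋`, so that `K_a` is abelian. Every extension of `φ` to `K_a` is
conjugate to a `T`-invariant one. Restriction to `L` identifies the `T`-invariant extensions with
the extensions of `φ` restricted to `K_{ℓ-1} ∩ L`, and it respects conjugacy. For a `T`-invariant
`θ` with stabiliser `S` one has `S = (S ∩ L) H`, where `H` consists of the `h` in `K_b` with `h
T(h)` in `K_a`. On `H` the character `θ` determines a Heisenberg representation `ω` of dimension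
`M^{a-b}`. Since `T` inverts `H / K_a`, it is implemented on `ω` by an involution of trace 1, whose
two eigenspaces differ in dimension by one. Requiring the quotient of the determinants on these
eigenspaces to be 1 removes the scalar ambiguity of every implementer commuting with it, so `ω`
extends canonically to `S ∩ L` (`HeisenbergDatum.exists_extension`). Tensoring with this extension
matches the representations of `S ∩ L` over `θ` with those of `S` over `θ`, and Clifford theory on
both sides finishes the correspondence.

Since `|S| = |S ∩ L| M^{2a}`, the dimensions differ by `|G(o_ℓ)| / |L(o_ℓ)|` divided by `M^ℓ`. The
kernels of reduction to `k` account for a factor `M^{2(ℓ-1)}`, which leaves `M^{ℓ-2}`, and `dim G -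
dim L = 2 d₁ d₂`.

The four types are treated together: the group is the set of fixed points of an involution `F` of
`GL_n(O_ℓ)`, with determinant 1 in the special cases, and `D` is the differential of `F`. As 2 is a
unit, the Cayley transform passes between `D`-fixed small matrices and `F`-fixed group elements. If
`ξ` is only conjugate over `K` to a block diagonal matrix, the conjugating element is corrected to
respect the forms by Hilbert 90 in the linear case, or by surjectivity of the norm in the unitary
case, inside the commutative algebra generated by one matrix. For `GL` and `GU` the group `L` is `G₁
× G₂`, whose irreducible representations are exterior tensor products. -/

namespace DimRed

/-! ### Irreducibility and Schur's lemma. -/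

section Irreducible

variable {G : Type*} [Group G] {V W : Type*} [AddCommGroup V] [Module ℂ V] [AddCommGroup W]
  [Module ℂ W]

theorem isIrreducible_iff (ρ : Representation ℂ G V) : ρ.IsIrreducible ↔
    Nontrivial V ∧ ∀ U : Submodule ℂ V, (∀ g, ∀ v ∈ U, ρ g v ∈ U) → U = ⊥ ∨ U = ⊤ := by
  constructor
  · intro h
    have h1 : (⊥ : Subrepresentation ρ) ≠ ⊤ := bot_ne_top
    refine ⟨?_, ?_⟩
    · by_contra hn
      rw [not_nontrivial_iff_subsingleton] at hn
      exact h1 (Subrepresentation.toSubmodule_injective (Subsingleton.elim _ _))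
    · intro U hU
      rcases eq_bot_or_eq_top (⟨U, fun g v hv => hU g v hv⟩ : Subrepresentation ρ) with h | h
      · exact Or.inl (congrArg Subrepresentation.toSubmodule h)
      · exact Or.inr (congrArg Subrepresentation.toSubmodule h)
  · rintro ⟨hn, h⟩
    have : Nontrivial (Subrepresentation ρ) := by
      refine ⟨⊥, ⊤, fun h1 => ?_⟩
      have h2 : (⊥ : Submodule ℂ V) = ⊤ := congrArg Subrepresentation.toSubmodule h1
      exact bot_ne_top h2
    refine ⟨fun U => ?_⟩
    rcases h U.toSubmodule (fun g v hv => U.apply_mem_toSubmodule g hv) with h1 | h1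
    · exact Or.inl (Subrepresentation.toSubmodule_injective h1)
    · exact Or.inr (Subrepresentation.toSubmodule_injective h1)

theorem eq_top_of_stable {ρ : Representation ℂ G V} (h : ρ.IsIrreducible) (U : Submodule ℂ V)
    (hU : ∀ g, ∀ v ∈ U, ρ g v ∈ U) {u : V} (hu : u ∈ U) (h0 : u ≠ 0) : U = ⊤ :=
  (((isIrreducible_iff ρ).1 h).2 U hU).resolve_left fun hb => h0 (by simpa [hb] using hu)

/-- Schur's lemma: an eigenspace of `f` is a nonzero stable subspace, hence everything. -/
theorem exists_eq_smul_of_commute {ρ : Representation ℂ G V} [FiniteDimensional ℂ V]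
    (h : ρ.IsIrreducible) (f : V →ₗ[ℂ] V) (hf : ∀ g v, f (ρ g v) = ρ g (f v)) :
    ∃ c : ℂ, ∀ v, f v = c • v := by
  have := ((isIrreducible_iff ρ).1 h).1
  obtain ⟨c, hc⟩ := Module.End.exists_eigenvalue f
  obtain ⟨v, hv⟩ := hc.exists_hasEigenvector
  refine ⟨c, fun w => ?_⟩
  have ht : Module.End.eigenspace f c = ⊤ := by
    refine eq_top_of_stable h _ ?_ hv.1 hv.2
    intro g v hv
    rw [Module.End.mem_eigenspace_iff] at *
    rw [hf, hv, map_smul]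
  have : w ∈ Module.End.eigenspace f c := ht ▸ Submodule.mem_top
  exact Module.End.mem_eigenspace_iff.1 this

/-- A linear map between representations that is equivariant, as an intertwining map. -/
def intertwiner {ρ : Representation ℂ G V} {τ : Representation ℂ G W} (f : V →ₗ[ℂ] W)
    (hf : ∀ g v, f (ρ g v) = τ g (f v)) : Representation.IntertwiningMap ρ τ :=
  ⟨f, fun g => LinearMap.ext fun v => hf g v⟩

theorem nonempty_equiv_of_ne_zero {ρ : Representation ℂ G V} {τ : Representation ℂ G W}
    (h : ρ.IsIrreducible) (h' : τ.IsIrreducible) (f : V →ₗ[ℂ] W)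
    (hf : ∀ g v, f (ρ g v) = τ g (f v)) {v : V} (hv : f v ≠ 0) : Nonempty (ρ.Equiv τ) := by
  rcases Representation.IsIrreducible.bijective_or_eq_zero (intertwiner f hf) with h1 | h1
  · exact ⟨Representation.IntertwiningMap.ofBijective _ h1⟩
  · exact absurd (congrArg (fun F => F v) h1) hv

/-- Descent on the dimension reaches a nonzero subrepresentation of minimal dimension, and
minimality is irreducibility. -/
theorem exists_irreducible_sub [FiniteDimensional ℂ V] [Nontrivial V]
    (ρ : Representation ℂ G V) :
    ∃ U : Subrepresentation ρ, U.toRepresentation.IsIrreducible := by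
  obtain ⟨n, hn⟩ : ∃ n, ∃ U : Subrepresentation ρ, U.toSubmodule ≠ ⊥ ∧
      Module.finrank ℂ U.toSubmodule = n := ⟨_, ⊤, fun h => bot_ne_top (α := Submodule ℂ V) h.symm, rfl⟩
  induction n using Nat.strong_induction_on with
  | _ n ih =>
    obtain ⟨U, hU0, hU⟩ := hn
    by_cases hm : ∃ U' : Subrepresentation ρ, U'.toSubmodule ≠ ⊥ ∧
        Module.finrank ℂ U'.toSubmodule < n
    · obtain ⟨U', h1, h2⟩ := hm
      exact ih _ h2 ⟨U', h1, rfl⟩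
    · push Not at hm
      refine ⟨U, (isIrreducible_iff _).2 ⟨Submodule.nontrivial_iff_ne_bot.2 hU0, fun M hM => ?_⟩⟩
      by_cases hb : M = ⊥
      · exact Or.inl hb
      right
      have h1 := hm ⟨M.map U.toSubmodule.subtype, by
        rintro g _ ⟨x, hx, rfl⟩
        exact ⟨_, hM g x hx, rfl⟩⟩ (by
          intro h
          exact hb (Submodule.map_injective_of_injective U.toSubmodule.injective_subtype
            (by simpa using h)))
      have h2 : Module.finrank ℂ (M.map U.toSubmodule.subtype) = Module.finrank ℂ M :=
        (Submodule.equivMapOfInjective _ U.toSubmodule.injective_subtype M).finrank_eq.symm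
      apply Submodule.eq_top_of_finrank_eq
      apply le_antisymm (Submodule.finrank_le M)
      rw [hU]
      exact h1.trans h2.le

end Irreducible

/-! ### Isomorphism classes and their representatives. -/

section Classes

variable {G : Type u} [Group G]

/-- Transport of a representation along a linear equivalence. -/
def conjRep {V W : Type*} [AddCommGroup V] [Module ℂ V] [AddCommGroup W]
    [Module ℂ W] (e : V ≃ₗ[ℂ] W) (ρ : Representation ℂ G V) : Representation ℂ G W where
  toFun g := e.conj (ρ g)
  map_one' := by ext; simp
  map_mul' x y := by ext; simp

theorem equiv_apply {V W : Type*} [AddCommMonoid V] [Module ℂ V] [AddCommMonoid W]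
    [Module ℂ W] {ρ : Representation ℂ G V} {τ : Representation ℂ G W} (e : ρ.Equiv τ) (g : G)
    (v : V) : e (ρ g v) = τ g (e v) :=
  Representation.IntertwiningMap.isIntertwining ρ τ e.toIntertwiningMap g v

theorem isIrreducible_of_equiv {V W : Type*} [AddCommGroup V] [Module ℂ V] [AddCommGroup W]
    [Module ℂ W] {ρ : Representation ℂ G V} {τ : Representation ℂ G W} (e : ρ.Equiv τ)
    (h : ρ.IsIrreducible) : τ.IsIrreducible := by
  rw [isIrreducible_iff] at *
  obtain ⟨h1, h2⟩ := h
  refine ⟨e.symm.toLinearEquiv.toEquiv.nontrivial, fun U hU => ?_⟩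
  have hinj : Function.Injective (Submodule.comap e.toLinearEquiv.toLinearMap) :=
    Submodule.comap_injective_of_surjective e.toLinearEquiv.surjective
  rcases h2 (U.comap e.toLinearEquiv.toLinearMap) (fun g v hv => by
    have : e.toLinearEquiv (ρ g v) = τ g (e.toLinearEquiv v) :=
      equiv_apply e g v
    change e.toLinearEquiv (ρ g v) ∈ U
    rw [this]
    exact hU g _ hv) with h | h
  · left
    apply hinj
    rw [h]
    simp [Submodule.comap_bot, LinearMap.ker_eq_bot.2 e.toLinearEquiv.injective]
  · right
    apply hinj
    rw [h]
    simp

/-- The equivalence of a representation with its transport along a linear equivalence. -/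
def equivConjRep {V W : Type*} [AddCommGroup V] [Module ℂ V] [AddCommGroup W]
    [Module ℂ W] (e : V ≃ₗ[ℂ] W) (ρ : Representation ℂ G V) : ρ.Equiv (conjRep e ρ) :=
  .mk e fun g => by ext v; simp [conjRep]

variable {V : Type*} [AddCommGroup V] [Module ℂ V] [FiniteDimensional ℂ V]

/-- An irreducible representation on a finite-dimensional space, as an `IrrRep`. -/
noncomputable def IrrRep.of (ρ : Representation ℂ G V) (h : ρ.IsIrreducible) : IrrRep G where
  dim := Module.finrank ℂ V
  ρ := conjRep (Module.finBasis ℂ V).equivFun ρ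
  irr := isIrreducible_of_equiv (equivConjRep _ ρ) h

/-- The defining equivalence of `IrrRep.of`. -/
noncomputable def IrrRep.ofEquiv (ρ : Representation ℂ G V) (h : ρ.IsIrreducible) :
    ρ.Equiv (IrrRep.of ρ h).ρ := equivConjRep _ ρ

theorem IrrRep.dim_eq_finrank (π : IrrRep G) : π.dim = Module.finrank ℂ (Fin π.dim → ℂ) := by
  simp

omit [FiniteDimensional ℂ V] in
theorem IrrRep.dim_eq_of_equiv (π : IrrRep G) {ρ : Representation ℂ G V} (e : π.ρ.Equiv ρ) :
    π.dim = Module.finrank ℂ V := by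
  rw [π.dim_eq_finrank]
  exact e.toLinearEquiv.finrank_eq

/-- The isomorphism class of an irreducible representation. -/
def Irr.mk (π : IrrRep G) : Irr G := Quotient.mk _ π

/-- A representative of an isomorphism class. -/
noncomputable def Irr.rep (χ : Irr G) : IrrRep G := Quotient.out χ

theorem Irr.mk_rep (χ : Irr G) : Irr.mk χ.rep = χ := Quotient.out_eq _

theorem Irr.sound {π π' : IrrRep G} (h : Nonempty (π.ρ.Equiv π'.ρ)) : Irr.mk π = Irr.mk π' :=
  Quotient.sound h

theorem Irr.exact {π π' : IrrRep G} (h : Irr.mk π = Irr.mk π') : Nonempty (π.ρ.Equiv π'.ρ) :=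
  Quotient.exact h

theorem Irr.rep_mk (π : IrrRep G) : Nonempty (π.ρ.Equiv (Irr.mk π).rep.ρ) :=
  Irr.exact (Irr.mk_rep _).symm

theorem Irr.dim_mk (π : IrrRep G) : (Irr.mk π).dim = π.dim := rfl

theorem Irr.dim_rep (χ : Irr G) : χ.rep.dim = χ.dim := by
  conv_rhs => rw [← Irr.mk_rep χ, Irr.dim_mk]

theorem IrrRep.dim_pos (π : IrrRep G) : 0 < π.dim := by
  have := ((isIrreducible_iff π.ρ).1 π.irr).1
  rw [π.dim_eq_finrank]
  exact Module.finrank_pos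

/-- A correspondence between irreducible representations that is total and single-valued up to
isomorphism in both directions gives a bijection of isomorphism classes. -/
theorem exists_equiv_of_correspondence {G' : Type v} [Group G'] (A : Set (Irr G))
    (B : Set (Irr G')) (R : IrrRep G → IrrRep G' → Prop)
    (hR : ∀ π π₁ π' π₁', Nonempty (π.ρ.Equiv π₁.ρ) → Nonempty (π'.ρ.Equiv π₁'.ρ) →
      R π π' → R π₁ π₁')
    (total : ∀ π, Irr.mk π ∈ A → ∃ π', Irr.mk π' ∈ B ∧ R π π')
    (total' : ∀ π', Irr.mk π' ∈ B → ∃ π, Irr.mk π ∈ A ∧ R π π')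
    (single : ∀ π π₁' π₂', Irr.mk π ∈ A → Irr.mk π₁' ∈ B → Irr.mk π₂' ∈ B →
      R π π₁' → R π π₂' → Nonempty (π₁'.ρ.Equiv π₂'.ρ))
    (single' : ∀ π₁ π₂ π', Irr.mk π₁ ∈ A → Irr.mk π₂ ∈ A → Irr.mk π' ∈ B →
      R π₁ π' → R π₂ π' → Nonempty (π₁.ρ.Equiv π₂.ρ)) :
    ∃ e : A ≃ B, ∀ χ, R χ.1.rep (e χ).1.rep := by
  have key : ∀ χ : A, ∃ χ' : B, R χ.1.rep χ'.1.rep := by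
    intro χ
    obtain ⟨π', h1, h2⟩ := total χ.1.rep (by rw [Irr.mk_rep]; exact χ.2)
    refine ⟨⟨Irr.mk π', h1⟩, hR _ _ _ _ ⟨.refl _⟩ ?_ h2⟩
    exact Irr.rep_mk π'
  choose f hf using key
  have outA : ∀ χ : A, Irr.mk χ.1.rep ∈ A := fun χ => by rw [Irr.mk_rep]; exact χ.2
  have outB : ∀ χ : B, Irr.mk χ.1.rep ∈ B := fun χ => by rw [Irr.mk_rep]; exact χ.2
  have hbij : Function.Bijective f := by
    constructor
    · intro χ₁ χ₂ h
      have h1 := hf χ₁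
      rw [h] at h1
      have h2 := single' _ _ _ (outA χ₁) (outA χ₂) (outB _) h1 (hf χ₂)
      apply Subtype.ext
      rw [← Irr.mk_rep χ₁.1, ← Irr.mk_rep χ₂.1]
      exact Irr.sound h2
    · intro χ'
      obtain ⟨π, h1, h2⟩ := total' χ'.1.rep (outB χ')
      refine ⟨⟨Irr.mk π, h1⟩, ?_⟩
      have h3 : R (Irr.mk π).rep χ'.1.rep :=
        hR _ _ _ _ (Irr.rep_mk π) ⟨.refl _⟩ h2
      have h2 := single _ _ _ (outA ⟨Irr.mk π, h1⟩) (outB (f ⟨Irr.mk π, h1⟩)) (outB χ') (hf _) h3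
      apply Subtype.ext
      rw [← Irr.mk_rep χ'.1, ← Irr.mk_rep (f ⟨Irr.mk π, h1⟩).1]
      exact Irr.sound h2
  exact ⟨Equiv.ofBijective f hbij, hf⟩

/-- The representations whose restriction along `κ` contains the character `θ`. -/
def Irr.over {N : Type*} [Group N] (κ : N →* G) (θ : N →* ℂˣ) : Set (Irr G) :=
  {χ | ∃ π : IrrRep G, Irr.mk π = χ ∧ ∃ v : Fin π.dim → ℂ, v ≠ 0 ∧ ∀ n, π.ρ (κ n) v = (θ n : ℂ) • v}

theorem Irr.mem_over_iff {N : Type*} [Group N] (κ : N →* G) (θ : N →* ℂˣ) (π : IrrRep G) :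
    Irr.mk π ∈ Irr.over κ θ ↔ ∃ v, v ≠ 0 ∧ ∀ n, π.ρ (κ n) v = (θ n : ℂ) • v := by
  constructor
  · rintro ⟨π', h, v, hv, hv'⟩
    obtain ⟨e⟩ := Irr.exact h
    refine ⟨e v, ?_, fun n => ?_⟩
    · simpa using hv
    · rw [← equiv_apply e (κ n) v, hv']
      exact map_smul e _ _
  · rintro ⟨v, hv⟩
    exact ⟨π, rfl, v, hv⟩

theorem Irr.of_mem_over_iff {N : Type*} [Group N] (κ : N →* G) (θ : N →* ℂˣ)
    (ρ : Representation ℂ G V) (h : ρ.IsIrreducible) :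
    Irr.mk (IrrRep.of ρ h) ∈ Irr.over κ θ ↔
      ∃ v, v ≠ 0 ∧ ∀ n, ρ (κ n) v = (θ n : ℂ) • v := by
  rw [Irr.mem_over_iff]
  have e := IrrRep.ofEquiv ρ h
  constructor
  · rintro ⟨v, hv, hv'⟩
    refine ⟨e.symm v, by simpa using hv, fun n => ?_⟩
    have := equiv_apply e.symm (κ n) v
    rw [hv'] at this
    exact this.symm.trans (map_smul e.symm _ _)
  · rintro ⟨v, hv, hv'⟩
    refine ⟨e v, by simpa using hv, fun n => ?_⟩
    have := equiv_apply e (κ n) v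
    rw [hv'] at this
    exact this.symm.trans (map_smul e _ _)

end Classes

/-! ### Clifford theory for a one-dimensional character -/

section Clifford

variable {N : Type*} [Group N] [Finite N] {V : Type*} [AddCommGroup V] [Module ℂ V]

/-- The projection of a representation onto the eigenspace of a linear character. -/
noncomputable def charProj (ρ : Representation ℂ N V) (θ : N →* ℂˣ) : V →ₗ[ℂ] V :=
  (Nat.card N : ℂ)⁻¹ • ∑ᶠ n, ((θ n)⁻¹ : ℂˣ).val • ρ n

/-- The eigenspace of a linear character. -/
def charSpace (ρ : Representation ℂ N V) (θ : N →* ℂˣ) : Submodule ℂ V where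
  carrier := {v | ∀ n, ρ n v = (θ n : ℂ) • v}
  add_mem' {x y} hx hy n := by rw [map_add, hx n, hy n, smul_add]
  zero_mem' n := by simp
  smul_mem' c x hx n := by rw [map_smul, hx n, smul_comm]

omit [Finite N] in
theorem mem_charSpace {ρ : Representation ℂ N V} {θ : N →* ℂˣ} {v : V} :
    v ∈ charSpace ρ θ ↔ ∀ n, ρ n v = (θ n : ℂ) • v := Iff.rfl

omit [Finite N] in
theorem charProj_apply [Fintype N] (ρ : Representation ℂ N V) (θ : N →* ℂˣ) (v : V) :
    charProj ρ θ v = (Nat.card N : ℂ)⁻¹ • ∑ n, ((θ n)⁻¹ : ℂˣ).val • ρ n v := by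
  rw [charProj, finsum_eq_sum_of_fintype]
  simp

theorem charProj_mem (ρ : Representation ℂ N V) (θ : N →* ℂˣ) (v : V) :
    charProj ρ θ v ∈ charSpace ρ θ := by
  have := Fintype.ofFinite N
  intro m
  rw [charProj_apply, map_smul, smul_comm (θ m : ℂ), map_sum, Finset.smul_sum (r := (θ m : ℂ))]
  congr 1
  rw [← (Group.mulLeft_bijective m).sum_comp (fun n => (θ m : ℂ) • ((θ n)⁻¹ : ℂˣ).val • ρ n v)]
  refine Finset.sum_congr rfl fun n _ => ?_
  rw [map_smul, smul_smul, map_mul, map_mul, _root_.mul_inv_rev, mul_comm (θ n)⁻¹,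
    ← Units.val_mul, mul_inv_cancel_left, Module.End.mul_apply]

theorem charProj_eq_self {ρ : Representation ℂ N V} {θ : N →* ℂˣ} {v : V}
    (hv : v ∈ charSpace ρ θ) : charProj ρ θ v = v := by
  have := Fintype.ofFinite N
  rw [charProj_apply, Finset.sum_congr rfl (fun n _ => by
    rw [mem_charSpace.1 hv n, smul_smul, ← Units.val_mul, inv_mul_cancel, Units.val_one, one_smul] :
      ∀ n ∈ Finset.univ, ((θ n)⁻¹ : ℂˣ).val • ρ n v = v)]
  rw [Finset.sum_const, Finset.card_univ, ← Nat.card_eq_fintype_card, ← Nat.cast_smul_eq_nsmul ℂ,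
    smul_smul, inv_mul_cancel₀ (by exact_mod_cast Nat.card_pos.ne'), one_smul]

/-- Every `ρ n v` is a multiple of `v`, so the average inherits the eigenvalues `θ'`. It also lies
in the eigenspace of `θ`, and at an element where the characters differ this forces it to vanish. -/
theorem charProj_eq_zero {ρ : Representation ℂ N V} {θ θ' : N →* ℂˣ} {v : V}
    (hv : v ∈ charSpace ρ θ') (h : θ ≠ θ') : charProj ρ θ v = 0 := by
  obtain ⟨m, hm⟩ : ∃ m, θ m ≠ θ' m := by
    by_contra hc
    push Not at hc
    exact h (MonoidHom.ext hc)
  set P := charProj ρ θ v with hP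
  have h2 : ρ m P = (θ' m : ℂ) • P := by
    have := Fintype.ofFinite N
    rw [hP, charProj_apply, map_smul, map_sum, smul_comm (θ' m : ℂ), Finset.smul_sum (r := (θ' m : ℂ))]
    congr 1
    refine Finset.sum_congr rfl fun n _ => ?_
    rw [map_smul, mem_charSpace.1 hv n, map_smul, mem_charSpace.1 hv m, smul_comm (θ' m : ℂ),
      smul_comm (θ' m : ℂ)]
  rw [mem_charSpace.1 (charProj_mem ρ θ v) m, ← sub_eq_zero, ← sub_smul] at h2
  refine (smul_eq_zero.1 h2).resolve_left fun h3 => hm ?_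
  exact Units.ext (sub_eq_zero.1 h3)

theorem finrank_charSpace [FiniteDimensional ℂ V] (ρ : Representation ℂ N V) (θ : N →* ℂˣ) :
    LinearMap.trace ℂ V (charProj ρ θ) = Module.finrank ℂ (charSpace ρ θ) :=
  LinearMap.IsProj.trace ⟨charProj_mem ρ θ, fun _ hv => charProj_eq_self hv⟩

omit [Finite N] in
theorem map_charProj [Finite N] {W : Type*} [AddCommGroup W] [Module ℂ W]
    {ρ : Representation ℂ N V}
    {τ : Representation ℂ N W} (f : V →ₗ[ℂ] W) (hf : ∀ n v, f (ρ n v) = τ n (f v)) (θ : N →* ℂˣ)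
    (v : V) : f (charProj ρ θ v) = charProj τ θ (f v) := by
  have := Fintype.ofFinite N
  rw [charProj_apply, charProj_apply, map_smul, map_sum]
  congr 1
  refine Finset.sum_congr rfl fun n _ => ?_
  rw [map_smul, hf]

end Clifford

/-- The data of Clifford theory: a normal subgroup `N` of `G`, a character `θ` of `N` and its
stabiliser `S`. -/
structure CliffordDatum {G : Type u} {S : Type v} {N : Type w} [Group G] [Group S] [Group N]
    (ι : S →* G) (κ : N →* S) (θ : N →* ℂˣ) : Prop where
  inj : Function.Injective ι
  normal : ∀ g n, ∃ n', ι (κ n') = g * ι (κ n) * g⁻¹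
  inj' : Function.Injective κ
  stab : ∀ g, (∀ n n', ι (κ n') = g * ι (κ n) * g⁻¹ → θ n' = θ n) ↔ g ∈ ι.range

section Clifford

variable {G : Type u} {S : Type v} {N : Type w} [Group G] [Group S] [Group N]
    {ι : S →* G} {κ : N →* S} {θ : N →* ℂˣ} {V W : Type*} [AddCommGroup V] [Module ℂ V]
    [AddCommGroup W] [Module ℂ W]

/-- Conjugation by `g` on the normal subgroup `N`. -/
noncomputable def CliffordDatum.conj (hD : CliffordDatum ι κ θ) (g : G) : N →* N where
  toFun n := (hD.normal g n).choose
  map_one' := by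
    apply hD.inj'
    apply hD.inj
    rw [(hD.normal g 1).choose_spec]
    simp
  map_mul' m n := by
    apply hD.inj'
    apply hD.inj
    rw [(hD.normal g (m * n)).choose_spec, map_mul, map_mul, map_mul, map_mul,
      (hD.normal g m).choose_spec, (hD.normal g n).choose_spec]
    group

theorem CliffordDatum.conj_spec (hD : CliffordDatum ι κ θ) (g : G) (n : N) :
    ι (κ (hD.conj g n)) = g * ι (κ n) * g⁻¹ := (hD.normal g n).choose_spec

theorem CliffordDatum.conj_eq_iff (hD : CliffordDatum ι κ θ) (g : G) :
    θ.comp (hD.conj g) = θ ↔ g ∈ ι.range := by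
  rw [← hD.stab]
  constructor
  · intro h n n' hn
    rw [← hD.conj_spec] at hn
    rw [hD.inj' (hD.inj hn)]
    exact DFunLike.congr_fun h n
  · intro h
    ext1 n
    exact h n _ (hD.conj_spec g n)

theorem CliffordDatum.apply_mem (hD : CliffordDatum ι κ θ) (ρ : Representation ℂ G V) (g : G)
    {v : V} (hv : v ∈ charSpace (ρ.comp (ι.comp κ)) θ) :
    ρ g v ∈ charSpace (ρ.comp (ι.comp κ)) (θ.comp (hD.conj g⁻¹)) := by
  intro n
  have h := hv (hD.conj g⁻¹ n)
  simp only [MonoidHom.comp_apply, hD.conj_spec] at h ⊢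
  rw [← map_smul, ← h, ← Module.End.mul_apply, ← Module.End.mul_apply, ← map_mul, ← map_mul]
  congr 2
  group

theorem CliffordDatum.apply_mem_self (hD : CliffordDatum ι κ θ) (ρ : Representation ℂ G V) (s : S)
    {v : V} (hv : v ∈ charSpace (ρ.comp (ι.comp κ)) θ) :
    ρ (ι s) v ∈ charSpace (ρ.comp (ι.comp κ)) θ := by
  have h := hD.apply_mem ρ (ι s) hv
  rwa [(hD.conj_eq_iff _).2 ⟨s⁻¹, by simp⟩] at h

/-- The representation of the stabiliser on the eigenspace. -/
def CliffordDatum.charRep (hD : CliffordDatum ι κ θ) (ρ : Representation ℂ G V) :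
    Representation ℂ S (charSpace (ρ.comp (ι.comp κ)) θ) where
  toFun s := (ρ (ι s)).restrict fun _ hv => hD.apply_mem_self ρ s hv
  map_one' := by ext; simp
  map_mul' x y := by ext; simp

/-- Outside the stabiliser, `g` moves the `θ`-eigenspace into that of a different conjugate of `θ`,
which the projection kills. -/
theorem CliffordDatum.charProj_apply_eq_zero [Finite N] (hD : CliffordDatum ι κ θ)
    (ρ : Representation ℂ G V)
    {g : G} (hg : g ∉ ι.range) {v : V} (hv : v ∈ charSpace (ρ.comp (ι.comp κ)) θ) :
    charProj (ρ.comp (ι.comp κ)) θ (ρ g v) = 0 :=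
  charProj_eq_zero (hD.apply_mem ρ g hv) fun h =>
    hg (by simpa using inv_mem ((hD.conj_eq_iff g⁻¹).1 h.symm))

/-- The `G`-translates of a nonzero `S`-stable subspace `U` of the eigenspace span `V`. The
projection to the eigenspace returns translates by stabiliser elements to `U` and kills all others,
so it maps `V` into `U`, while being the identity on the eigenspace. -/
theorem CliffordDatum.irreducible [Finite N] (hD : CliffordDatum ι κ θ) {ρ : Representation ℂ G V}
    (hρ : ρ.IsIrreducible) (hne : charSpace (ρ.comp (ι.comp κ)) θ ≠ ⊥) :
    (hD.charRep ρ).IsIrreducible := by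
  refine (isIrreducible_iff _).2 ⟨Submodule.nontrivial_iff_ne_bot.2 hne, fun U hU => ?_⟩
  by_cases hb : U = ⊥
  · exact Or.inl hb
  right
  obtain ⟨u, hu, hu0⟩ := Submodule.exists_mem_ne_zero_of_ne_bot hb
  set M : Submodule ℂ V := Submodule.span ℂ {x | ∃ g, ∃ y ∈ U, ρ g (y : V) = x} with hM
  have hMt : M = ⊤ := by
    refine eq_top_of_stable hρ M ?_ (u := (u : V)) (Submodule.subset_span ⟨1, u, hu, by simp⟩)
      (by simpa using hu0)
    intro g v hv
    rw [hM] at hv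
    induction hv using Submodule.span_induction with
    | mem x hx =>
      obtain ⟨g', y, hy, rfl⟩ := hx
      exact Submodule.subset_span ⟨g * g', y, hy, by simp⟩
    | zero => simp
    | add x y _ _ hx hy => rw [map_add]; exact add_mem hx hy
    | smul c x _ hx => rw [map_smul]; exact M.smul_mem c hx
  have hproj : ∀ v ∈ M, ∃ y ∈ U, charProj (ρ.comp (ι.comp κ)) θ v = y := by
    intro v hv
    rw [hM] at hv
    induction hv using Submodule.span_induction with
    | mem x hx =>
      obtain ⟨g, y, hy, rfl⟩ := hx
      by_cases hg : g ∈ ι.range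
      · obtain ⟨s, rfl⟩ := hg
        exact ⟨_, hU s y hy, charProj_eq_self (hD.apply_mem_self ρ s y.2)⟩
      · exact ⟨0, zero_mem _, by simpa using hD.charProj_apply_eq_zero ρ hg y.2⟩
    | zero => exact ⟨0, zero_mem _, by simp⟩
    | add x y _ _ hx hy =>
      obtain ⟨a, ha, ha'⟩ := hx
      obtain ⟨b, hb, hb'⟩ := hy
      exact ⟨a + b, add_mem ha hb, by rw [map_add, ha', hb']; rfl⟩
    | smul c x _ hx =>
      obtain ⟨a, ha, ha'⟩ := hx
      exact ⟨c • a, U.smul_mem c ha, by rw [map_smul, ha']; rfl⟩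
  refine eq_top_iff.2 fun x _ => ?_
  obtain ⟨y, hy, h⟩ := hproj x (hMt ▸ Submodule.mem_top)
  rw [charProj_eq_self x.2] at h
  rwa [Subtype.ext h]

/-- The sum `F` of the conjugates of the eigenprojection is scalar by Schur. Its scalar is `|S|`,
and comparing traces yields the index formula without introducing induced representations. -/
theorem CliffordDatum.finrank_mul [Finite G] [Finite N] [FiniteDimensional ℂ V]
    (hD : CliffordDatum ι κ θ)
    {ρ : Representation ℂ G V}
    (hρ : ρ.IsIrreducible) (hne : charSpace (ρ.comp (ι.comp κ)) θ ≠ ⊥) :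
    Nat.card S * Module.finrank ℂ V =
      Nat.card G * Module.finrank ℂ (charSpace (ρ.comp (ι.comp κ)) θ) := by
  have := Fintype.ofFinite G
  set P := charProj (ρ.comp (ι.comp κ)) θ with hP
  set F : V →ₗ[ℂ] V := ∑ g : G, ρ g ∘ₗ P ∘ₗ ρ g⁻¹ with hF
  have hcomm : ∀ g v, F (ρ g v) = ρ g (F v) := by
    intro g v
    rw [hF, LinearMap.sum_apply, LinearMap.sum_apply, map_sum,
      ← (Group.mulLeft_bijective g).sum_comp]
    refine Finset.sum_congr rfl fun x _ => ?_
    simp only [LinearMap.comp_apply, ← Module.End.mul_apply, ← map_mul]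
    simp [Module.End.mul_apply]
  obtain ⟨c, hc⟩ := exists_eq_smul_of_commute hρ F hcomm
  obtain ⟨w, hw, hw0⟩ := Submodule.exists_mem_ne_zero_of_ne_bot hne
  -- On an eigenvector, the terms of `F` indexed by the stabiliser each return the vector and all
  -- others vanish.
  have hcS : c = Nat.card S := by
    have h1 : F w = (Nat.card S : ℂ) • w := by
      classical
      rw [hF, LinearMap.sum_apply]
      have : ∀ g : G, (ρ g ∘ₗ P ∘ₗ ρ g⁻¹) w = if g ∈ ι.range then w else 0 := by
        intro g
        simp only [LinearMap.comp_apply]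
        split_ifs with hg
        · obtain ⟨s, rfl⟩ := hg
          rw [hP, charProj_eq_self (by simpa using hD.apply_mem_self ρ s⁻¹ hw),
            ← Module.End.mul_apply, ← map_mul]
          simp
        · rw [hP, hD.charProj_apply_eq_zero ρ (by simpa using hg) hw, map_zero]
      rw [Finset.sum_congr rfl fun g _ => this g, ← Finset.sum_filter, Finset.sum_const,
        ← Nat.cast_smul_eq_nsmul ℂ]
      congr 2
      rw [Nat.card_congr (MonoidHom.ofInjective hD.inj).toEquiv, Nat.card_eq_fintype_card,
        Fintype.card_subtype]
    rw [hc] at h1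
    rw [← sub_eq_zero, ← sub_smul] at h1
    exact sub_eq_zero.1 ((smul_eq_zero.1 h1).resolve_right hw0)
  have htr : LinearMap.trace ℂ V F = Nat.card G * LinearMap.trace ℂ V P := by
    rw [hF, map_sum, Finset.sum_congr rfl (fun g _ => by
      rw [← LinearMap.comp_assoc, LinearMap.trace_comp_comm', ← LinearMap.comp_assoc]
      have : ρ g⁻¹ ∘ₗ ρ g = LinearMap.id := by
        ext v
        rw [LinearMap.comp_apply, ← Module.End.mul_apply, ← map_mul]
        simp
      rw [this, LinearMap.id_comp] : ∀ g ∈ Finset.univ,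
        LinearMap.trace ℂ V (ρ g ∘ₗ P ∘ₗ ρ g⁻¹) = LinearMap.trace ℂ V P)]
    rw [Finset.sum_const, Finset.card_univ, nsmul_eq_mul, Nat.card_eq_fintype_card]
  have hF' : F = c • LinearMap.id := LinearMap.ext fun v => by simpa using hc v
  rw [hF', map_smul, LinearMap.trace_id, hP, finrank_charSpace, hcS, smul_eq_mul] at htr
  exact_mod_cast htr

/-- An equivalence of eigenspaces, precomposed with the projection and averaged over `G`, is an
intertwiner. On an eigenvector `w` it equals `|S|` times `e w`, so it is nonzero. -/
theorem CliffordDatum.nonempty_equiv [Finite G] [Finite N] (hD : CliffordDatum ι κ θ)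
    {ρ : Representation ℂ G V} {τ : Representation ℂ G W}
    (hρ : ρ.IsIrreducible) (hτ : τ.IsIrreducible) (hne : charSpace (ρ.comp (ι.comp κ)) θ ≠ ⊥)
    (e : (hD.charRep ρ).Equiv (hD.charRep τ)) : Nonempty (ρ.Equiv τ) := by
  have := Fintype.ofFinite G
  set P : V →ₗ[ℂ] charSpace (ρ.comp (ι.comp κ)) θ :=
    (charProj (ρ.comp (ι.comp κ)) θ).codRestrict _ (charProj_mem _ _) with hP
  set f : V →ₗ[ℂ] W := (charSpace (τ.comp (ι.comp κ)) θ).subtype ∘ₗ e.toLinearEquiv.toLinearMap ∘ₗ P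
    with hf
  set F : V →ₗ[ℂ] W := ∑ g : G, τ g ∘ₗ f ∘ₗ ρ g⁻¹ with hF
  have hcomm : ∀ g v, F (ρ g v) = τ g (F v) := by
    intro g v
    rw [hF, LinearMap.sum_apply, LinearMap.sum_apply, map_sum,
      ← (Group.mulLeft_bijective g).sum_comp]
    refine Finset.sum_congr rfl fun x _ => ?_
    simp only [LinearMap.comp_apply, ← Module.End.mul_apply, ← map_mul]
    simp [Module.End.mul_apply]
  obtain ⟨w, hw, hw0⟩ := Submodule.exists_mem_ne_zero_of_ne_bot hne
  have hFw : F w = (Nat.card S : ℂ) • (e ⟨w, hw⟩ : W) := by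
    classical
    rw [hF, LinearMap.sum_apply]
    have : ∀ g : G, (τ g ∘ₗ f ∘ₗ ρ g⁻¹) w = if g ∈ ι.range then (e ⟨w, hw⟩ : W) else 0 := by
      intro g
      simp only [LinearMap.comp_apply]
      split_ifs with hg
      · obtain ⟨s, rfl⟩ := hg
        have h1 : P (ρ (ι s)⁻¹ w) = hD.charRep ρ s⁻¹ ⟨w, hw⟩ := by
          apply Subtype.ext
          rw [← map_inv]
          exact charProj_eq_self (hD.apply_mem_self ρ s⁻¹ hw)
        have h2 : f (ρ (ι s)⁻¹ w) = τ (ι s⁻¹) (e ⟨w, hw⟩ : W) := by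
          change ((e (P (ρ (ι s)⁻¹ w)) : _) : W) = _
          rw [h1, equiv_apply]
          rfl
        rw [h2, ← Module.End.mul_apply, ← map_mul]
        simp
      · have h1 : P (ρ g⁻¹ w) = 0 :=
          Subtype.ext (hD.charProj_apply_eq_zero ρ (by simpa using hg) hw)
        simp [hf, h1]
    rw [Finset.sum_congr rfl fun g _ => this g, ← Finset.sum_filter, Finset.sum_const,
      ← Nat.cast_smul_eq_nsmul ℂ]
    congr 2
    rw [Nat.card_congr (MonoidHom.ofInjective hD.inj).toEquiv, Nat.card_eq_fintype_card,
      Fintype.card_subtype]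
  refine nonempty_equiv_of_ne_zero hρ hτ F hcomm (v := w) ?_
  have : Finite S := Finite.of_injective ι hD.inj
  rw [hFw]
  refine smul_ne_zero (by exact_mod_cast Nat.card_pos.ne') ?_
  intro h
  have : e ⟨w, hw⟩ = 0 := Subtype.ext h
  exact hw0 (congrArg Subtype.val ((map_eq_zero_iff e e.toLinearEquiv.injective).1 this))

/-- A nonzero representation of a subgroup is related by a nonzero homomorphism to the restriction
of some irreducible representation. -/
theorem exists_irrRep_of_injective [Finite G] [FiniteDimensional ℂ W] [Nontrivial W]
    (hι : Function.Injective ι) (τ : Representation ℂ S W) :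
    ∃ π : IrrRep G, ∃ f : (Fin π.dim → ℂ) →ₗ[ℂ] W, f ≠ 0 ∧ ∀ s v, f (π.ρ (ι s) v) = τ s (f v) := by
  have := Fintype.ofFinite G
  have hfd : FiniteDimensional ℂ (Representation.coindV ι τ) := inferInstance
  have hnt : Nontrivial (Representation.coindV ι τ) := by
    classical
    obtain ⟨w, hw⟩ := exists_ne (0 : W)
    -- An element of the coinduced space supported on the image of `S` shows that this space is
    -- nonzero.
    let φ : G → W := fun g => if h : ∃ s, ι s = g then τ h.choose w else 0
    have hφ : ∀ s, φ (ι s) = τ s w := by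
      intro s
      have h : ∃ s', ι s' = ι s := ⟨s, rfl⟩
      simp only [φ, dif_pos h]
      rw [hι h.choose_spec]
    have hφ' : ∀ g, g ∉ ι.range → φ g = 0 := fun g hg => dif_neg hg
    refine ⟨⟨φ, ?_⟩, 0, ?_⟩
    · intro s g
      by_cases hg : g ∈ ι.range
      · obtain ⟨s', rfl⟩ := hg
        rw [← map_mul, hφ, hφ, map_mul, Module.End.mul_apply]
      · rw [hφ' g hg, hφ' _ (fun h => hg ?_), map_zero]
        simpa using mul_mem (inv_mem (⟨s, rfl⟩ : ι s ∈ ι.range)) h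
    · intro h
      apply hw
      have := congrFun (congrArg Subtype.val h) (ι 1)
      change φ (ι 1) = 0 at this
      rw [hφ] at this
      simpa using this
  obtain ⟨U, hU⟩ := exists_irreducible_sub (Representation.coind ι τ)
  have e := IrrRep.ofEquiv _ hU
  let f₀ : U.toSubmodule →ₗ[ℂ] W :=
    LinearMap.proj (1 : G) ∘ₗ (Representation.coindV ι τ).subtype ∘ₗ U.toSubmodule.subtype
  refine ⟨IrrRep.of _ hU, f₀ ∘ₗ e.symm.toLinearEquiv.toLinearMap, ?_, ?_⟩
  · intro h
    have hz : f₀ = 0 := by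
      ext x
      have := LinearMap.congr_fun h (e x)
      change f₀ (e.symm (e x)) = 0 at this
      simpa using this
    have := ((isIrreducible_iff _).1 hU).1
    obtain ⟨x, hx⟩ := exists_ne (0 : U.toSubmodule)
    apply hx
    apply Subtype.ext
    apply Subtype.ext
    -- The value of `x` at `g` is the value at 1 of the translate of `x` by `g`, so evaluation at 1
    -- cannot vanish on a nonzero subrepresentation.
    funext g
    have := LinearMap.congr_fun hz (U.toRepresentation g x)
    change ((x : Representation.coindV ι τ) : G → W) (1 * g) = 0 at this
    simpa using this
  · intro s v
    change f₀ (e.symm ((IrrRep.of _ hU).ρ (ι s) v)) = τ s (f₀ (e.symm v))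
    rw [equiv_apply e.symm (ι s) v]
    change ((e.symm v : Representation.coindV ι τ) : G → W) (1 * ι s) =
      τ s (((e.symm v : Representation.coindV ι τ) : G → W) 1)
    rw [one_mul, ← ((e.symm v : Representation.coindV ι τ)).2 s 1, mul_one]

/-- The stabiliser fixes `θ`, so the `θ`-eigenspace in `τ` is stable under `S` and fills the
irreducible `τ`. -/
theorem CliffordDatum.smul_of_mem [Finite N] (hD : CliffordDatum ι κ θ) {τ : Representation ℂ S W}
    (hτ : τ.IsIrreducible) (hw : ∃ w : W, w ≠ 0 ∧ ∀ n, τ (κ n) w = (θ n : ℂ) • w) :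
    ∀ n w, τ (κ n) w = (θ n : ℂ) • w := by
  obtain ⟨w, hw0, hw⟩ := hw
  have ht : charSpace (τ.comp κ) θ = ⊤ := by
    refine eq_top_of_stable hτ _ ?_ (u := w) hw hw0
    intro s v hv n
    have h1 := hv (hD.conj (ι s⁻¹) n)
    have h2 := DFunLike.congr_fun ((hD.conj_eq_iff (ι s⁻¹)).2 ⟨_, rfl⟩) n
    have h3 : κ (hD.conj (ι s⁻¹) n) = s⁻¹ * κ n * s := hD.inj (by
      rw [hD.conj_spec]; simp)
    simp only [MonoidHom.comp_apply] at h1 h2 ⊢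
    rw [h2, h3] at h1
    rw [← map_smul, ← h1, ← Module.End.mul_apply, ← Module.End.mul_apply, ← map_mul, ← map_mul]
    congr 2
    group
  intro n w
  exact (ht ▸ Submodule.mem_top : w ∈ charSpace (τ.comp κ) θ) n

/-- The existence of a nonzero homomorphism from the restriction of `V` to `W`. -/
def RestrictionRelated (ι : S →* G) (ρ : Representation ℂ G V) (τ : Representation ℂ S W) : Prop :=
  ∃ f : V →ₗ[ℂ] W, f ≠ 0 ∧ ∀ s v, f (ρ (ι s) v) = τ s (f v)

/-- Clifford correspondence. -/
theorem CliffordDatum.exists_equiv [Finite G] [Finite N] (hD : CliffordDatum ι κ θ) :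
    ∃ e : Irr.over (ι.comp κ) θ ≃ Irr.over κ θ, ∀ χ,
      (Nat.card S : ℝ) * (χ.1.dim : ℝ) = Nat.card G * ((e χ).1.dim : ℝ) := by
  -- All of `W` is `θ`-isotypic and `f` commutes with the projections, so `f` depends only on the
  -- `θ`-component of its argument. A nonzero `f` thus stays nonzero on the eigenspace of `V`, and
  -- Schur applies there.
  have toSpace : ∀ {V W : Type} [AddCommGroup V] [Module ℂ V] [AddCommGroup W] [Module ℂ W]
      {ρ : Representation ℂ G V} {τ : Representation ℂ S W}
      (_ : ρ.IsIrreducible) (_ : τ.IsIrreducible)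
      (_ : ∃ w : V, w ≠ 0 ∧ ∀ n, ρ (ι (κ n)) w = (θ n : ℂ) • w)
      (_ : ∃ w : W, w ≠ 0 ∧ ∀ n, τ (κ n) w = (θ n : ℂ) • w)
      (f : V →ₗ[ℂ] W) (_ : f ≠ 0) (_ : ∀ s v, f (ρ (ι s) v) = τ s (f v)),
      Nonempty ((hD.charRep ρ).Equiv τ) := by
    intro V W _ _ _ _ ρ τ hρ hτ hv hw f hf0 hf
    obtain ⟨v, hv0, hv⟩ := hv
    have hne : charSpace (ρ.comp (ι.comp κ)) θ ≠ ⊥ := fun h => hv0 (by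
      simpa [h] using (show v ∈ charSpace (ρ.comp (ι.comp κ)) θ from hv))
    have hall := hD.smul_of_mem hτ hw
    obtain ⟨x, hx⟩ : ∃ x, f x ≠ 0 := by
      by_contra hc
      push Not at hc
      exact hf0 (LinearMap.ext hc)
    refine nonempty_equiv_of_ne_zero (hD.irreducible hρ hne) hτ
      (f ∘ₗ (charSpace (ρ.comp (ι.comp κ)) θ).subtype) (fun s v => hf s v)
      (v := ⟨_, charProj_mem (ρ.comp (ι.comp κ)) θ x⟩) ?_
    change f (charProj (ρ.comp (ι.comp κ)) θ x) ≠ 0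
    rw [map_charProj (τ := τ.comp κ) f (fun n v => hf (κ n) v) θ x, charProj_eq_self]
    · exact hx
    · exact fun n => hall n _
  have corr := exists_equiv_of_correspondence (Irr.over (ι.comp κ) θ) (Irr.over κ θ)
    (fun π π' => RestrictionRelated ι π.ρ π'.ρ)
  obtain ⟨e, he⟩ : ∃ e : Irr.over (ι.comp κ) θ ≃ Irr.over κ θ, ∀ χ,
      RestrictionRelated ι χ.1.rep.ρ (e χ).1.rep.ρ := by
    refine corr ?_ ?_ ?_ ?_ ?_
    · rintro π π₁ π' π₁' ⟨e⟩ ⟨e'⟩ ⟨f, hf0, hf⟩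
      refine ⟨e'.toLinearEquiv.toLinearMap ∘ₗ f ∘ₗ e.symm.toLinearEquiv.toLinearMap, ?_, ?_⟩
      · intro h
        apply hf0
        refine LinearMap.ext fun x => ?_
        have := LinearMap.congr_fun h (e x)
        change e' (f (e.symm (e x))) = 0 at this
        rw [Representation.Equiv.symm_apply_apply] at this
        exact (map_eq_zero_iff e' e'.toLinearEquiv.injective).1 this
      · intro s v
        change e' (f (e.symm (π₁.ρ (ι s) v))) = π₁'.ρ s (e' (f (e.symm v)))
        rw [equiv_apply, hf, equiv_apply]
    · intro π hπ
      rw [Irr.mem_over_iff] at hπ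
      obtain ⟨v, hv0, hv⟩ := hπ
      have hvm : v ∈ charSpace (π.ρ.comp (ι.comp κ)) θ := hv
      have hne : charSpace (π.ρ.comp (ι.comp κ)) θ ≠ ⊥ := fun h => hv0 (by simpa [h] using hvm)
      have hirr := hD.irreducible π.irr hne
      refine ⟨IrrRep.of _ hirr, ?_, ?_⟩
      · rw [Irr.of_mem_over_iff]
        exact ⟨⟨v, hvm⟩, fun h => hv0 (congrArg Subtype.val h), fun n => Subtype.ext (hv n)⟩
      · have e := IrrRep.ofEquiv _ hirr
        let P : (Fin π.dim → ℂ) →ₗ[ℂ] charSpace (π.ρ.comp (ι.comp κ)) θ :=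
          (charProj (π.ρ.comp (ι.comp κ)) θ).codRestrict _ (charProj_mem _ _)
        refine ⟨e.toLinearEquiv.toLinearMap ∘ₗ P, ?_, ?_⟩
        · intro h
          have := LinearMap.congr_fun h v
          change e (P v) = 0 at this
          have h2 := (map_eq_zero_iff e e.toLinearEquiv.injective).1 this
          apply hv0
          rw [← charProj_eq_self hvm]
          exact congrArg Subtype.val h2
        · intro s x
          change e (P _) = _ 
          -- The projection is `S`-equivariant because conjugation by `s` permutes `N` and preserves
          -- `θ`.
          have : P (π.ρ (ι s) x) = hD.charRep π.ρ s (P x) := by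
            apply Subtype.ext
            change charProj _ θ _ = π.ρ (ι s) (charProj _ θ x)
            have := Fintype.ofFinite N
            rw [charProj_apply, charProj_apply, map_smul, map_sum]
            congr 1
            have hs := (hD.conj_eq_iff (ι s)).2 ⟨_, rfl⟩
            have hbij : Function.Bijective (hD.conj (ι s)) :=
              Finite.injective_iff_bijective.1 fun m n h => by
                have h2 := congrArg (fun z => ι (κ z)) h
                simp only [hD.conj_spec] at h2
                exact hD.inj' (hD.inj (by simpa using h2))
            rw [← hbij.sum_comp]
            refine Finset.sum_congr rfl fun n _ => ?_
            rw [← MonoidHom.comp_apply θ, hs, map_smul]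
            congr 1
            simp only [MonoidHom.comp_apply, hD.conj_spec, ← Module.End.mul_apply, ← map_mul]
            simp
          rw [this, equiv_apply]
          rfl
    · intro π' hπ'
      rw [Irr.mem_over_iff] at hπ'
      have hall := hD.smul_of_mem π'.irr hπ'
      have := ((isIrreducible_iff _).1 π'.irr).1
      obtain ⟨π, f, hf0, hf⟩ := exists_irrRep_of_injective hD.inj π'.ρ
      refine ⟨π, ?_, f, hf0, hf⟩
      rw [Irr.mem_over_iff]
      obtain ⟨x, hx⟩ : ∃ x, f x ≠ 0 := by
        by_contra hc
        push Not at hc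
        exact hf0 (LinearMap.ext hc)
      refine ⟨charProj (π.ρ.comp (ι.comp κ)) θ x, fun h => hx ?_,
        fun n => charProj_mem (π.ρ.comp (ι.comp κ)) θ x n⟩
      have h1 := map_charProj (ρ := π.ρ.comp (ι.comp κ)) (τ := π'.ρ.comp κ) f
        (fun n v => hf (κ n) v) θ x
      rw [h, map_zero, charProj_eq_self] at h1
      · exact h1.symm
      · exact fun n => hall n _
    · rintro π π₁ π₂ hπ h1 h2 ⟨f, hf0, hf⟩ ⟨f', hf0', hf'⟩
      rw [Irr.mem_over_iff] at hπ h1 h2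
      obtain ⟨e₁⟩ := toSpace π.irr π₁.irr hπ h1 f hf0 hf
      obtain ⟨e₂⟩ := toSpace π.irr π₂.irr hπ h2 f' hf0' hf'
      exact ⟨e₁.symm.trans e₂⟩
    · rintro π₁ π₂ π h1 h2 hπ ⟨f, hf0, hf⟩ ⟨f', hf0', hf'⟩
      rw [Irr.mem_over_iff] at hπ h1 h2
      obtain ⟨e₁⟩ := toSpace π₁.irr π.irr h1 hπ f hf0 hf
      obtain ⟨e₂⟩ := toSpace π₂.irr π.irr h2 hπ f' hf0' hf'
      obtain ⟨v, hv0, hv⟩ := h1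
      exact hD.nonempty_equiv π₁.irr π₂.irr (fun h => hv0 (by
        simpa [h] using (show v ∈ charSpace (π₁.ρ.comp (ι.comp κ)) θ from hv))) (e₁.trans e₂.symm)
  refine ⟨e, fun χ => ?_⟩
  obtain ⟨f, hf0, hf⟩ := he χ
  have h1 := χ.2
  have h2 := (e χ).2
  rw [← Irr.mk_rep χ.1, Irr.mem_over_iff] at h1
  rw [← Irr.mk_rep (e χ).1, Irr.mem_over_iff] at h2
  obtain ⟨e₁⟩ := toSpace χ.1.rep.irr (e χ).1.rep.irr h1 h2 f hf0 hf
  obtain ⟨v, hv0, hv⟩ := h1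
  have h3 := hD.finrank_mul χ.1.rep.irr (fun h => hv0 (by
    simpa [h] using (show v ∈ charSpace (χ.1.rep.ρ.comp (ι.comp κ)) θ from hv)))
  rw [e₁.toLinearEquiv.finrank_eq, ← IrrRep.dim_eq_finrank, ← IrrRep.dim_eq_finrank,
    Irr.dim_rep, Irr.dim_rep] at h3
  exact_mod_cast h3

end Clifford

/-! ### Extension of an irreducible representation from a normal subgroup -/

open scoped TensorProduct

/-- Two compatible homomorphisms on subgroups `Q` and `H`, with `H` normalised by `Q` and
`S = Q H`, have a common extension to `S`. -/
theorem exists_monoidHom_of_factorization {S Q H M : Type*} [Group S] [Group Q] [Group H]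
    [Monoid M] (iQ : Q →* S) (iH : H →* S) (fQ : Q →* M) (fH : H →* M)
    (agree : ∀ q h, iQ q = iH h → fQ q = fH h)
    (act : ∀ q h, ∃ h', iH h' = iQ q * iH h * (iQ q)⁻¹ ∧ fQ q * fH h = fH h' * fQ q)
    (cover : ∀ s, ∃ q h, s = iQ q * iH h) :
    ∃ F : S →* M, (∀ q, F (iQ q) = fQ q) ∧ ∀ h, F (iH h) = fH h := by
  choose a b hab using cover
  -- Independence of the factorisation: two factorisations differ by an element common to the images
  -- of `Q` and `H`, where `fQ` and `fH` agree.
  have key : ∀ q h q' h', iQ q * iH h = iQ q' * iH h' → fQ q * fH h = fQ q' * fH h' := by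
    intro q h q' h' e
    have h1 : iQ (q'⁻¹ * q) = iH (h' * h⁻¹) := by
      rw [map_mul, map_mul, map_inv, map_inv, inv_mul_eq_iff_eq_mul, ← mul_assoc,
        eq_mul_inv_iff_mul_eq, e]
    have h2 := agree _ _ h1
    calc fQ q * fH h = fQ q' * fQ (q'⁻¹ * q) * fH h := by rw [← map_mul]; simp
      _ = fQ q' * fH h' := by rw [h2, mul_assoc, ← map_mul]; simp
  refine ⟨{ toFun := fun s => fQ (a s) * fH (b s), map_one' := ?_, map_mul' := ?_ }, ?_, ?_⟩
  · rw [key _ _ 1 1 (by rw [← hab]; simp)]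
    simp
  · intro s t
    obtain ⟨h', h1, h2⟩ := act (a t)⁻¹ (b s)
    have h3 : fH (b s) * fQ (a t) = fQ (a t) * fH h' := by
      calc fH (b s) * fQ (a t) = fQ (a t) * (fQ (a t)⁻¹ * fH (b s)) * fQ (a t) := by
            rw [← mul_assoc, ← map_mul]; simp
        _ = _ := by rw [h2, mul_assoc, mul_assoc, ← map_mul]; simp
    rw [key _ _ (a s * a t) (h' * b t) (by
      rw [← hab, map_mul, map_mul, h1]
      conv_lhs => rw [hab s, hab t]
      simp [mul_assoc]), map_mul, map_mul]
    calc _ = fQ (a s) * (fQ (a t) * fH h') * fH (b t) := by simp only [mul_assoc]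
      _ = _ := by rw [← h3]; simp only [mul_assoc]
  · intro q
    change fQ (a (iQ q)) * fH (b (iQ q)) = _
    rw [key _ _ q 1 (by rw [← hab]; simp)]
    simp
  · intro h
    change fQ (a (iH h)) * fH (b (iH h)) = _
    rw [key _ _ 1 h (by rw [← hab]; simp)]
    simp

/-! ### Schur orthogonality. -/

section Orthogonality

variable {H : Type*} [Group H] [Fintype H] {Ω V : Type*} [AddCommGroup Ω] [Module ℂ Ω]
  [FiniteDimensional ℂ Ω] [AddCommGroup V] [Module ℂ V]

/-- The averaged operator is scalar by Schur, and its trace, `|H|` times that of `P`, determines the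
scalar. -/
theorem sum_conj_of_irreducible {ω : Representation ℂ H Ω} (hω : ω.IsIrreducible)
    (P : Ω →ₗ[ℂ] Ω) (w : Ω) : ∑ h, ω h (P (ω h⁻¹ w)) =
      ((Nat.card H : ℂ) / Module.finrank ℂ Ω * LinearMap.trace ℂ Ω P) • w := by
  set F : Ω →ₗ[ℂ] Ω := ∑ h, ω h ∘ₗ P ∘ₗ ω h⁻¹ with hF
  have hFw : ∀ x, F x = ∑ h, ω h (P (ω h⁻¹ x)) := by
    intro x
    simp [hF]
  have hcomm : ∀ g v, F (ω g v) = ω g (F v) := by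
    intro g v
    rw [hF, LinearMap.sum_apply, LinearMap.sum_apply, map_sum,
      ← (Group.mulLeft_bijective g).sum_comp]
    refine Finset.sum_congr rfl fun x _ => ?_
    simp only [LinearMap.comp_apply, ← Module.End.mul_apply, ← map_mul]
    simp [Module.End.mul_apply]
  obtain ⟨c, hc⟩ := exists_eq_smul_of_commute hω F hcomm
  have htr : LinearMap.trace ℂ Ω F = Nat.card H * LinearMap.trace ℂ Ω P := by
    rw [hF, map_sum, Finset.sum_congr rfl (fun g _ => by
      rw [← LinearMap.comp_assoc, LinearMap.trace_comp_comm', ← LinearMap.comp_assoc]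
      have : ω g⁻¹ ∘ₗ ω g = LinearMap.id := by
        ext v
        rw [LinearMap.comp_apply, ← Module.End.mul_apply, ← map_mul]
        simp
      rw [this, LinearMap.id_comp] : ∀ g ∈ Finset.univ,
        LinearMap.trace ℂ Ω (ω g ∘ₗ P ∘ₗ ω g⁻¹) = LinearMap.trace ℂ Ω P)]
    rw [Finset.sum_const, Finset.card_univ, nsmul_eq_mul, Nat.card_eq_fintype_card]
  have hF' : F = c • LinearMap.id := LinearMap.ext fun v => by simpa using hc v
  rw [hF', map_smul, LinearMap.trace_id, smul_eq_mul] at htr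
  have := ((isIrreducible_iff ω).1 hω).1
  have hD : (Module.finrank ℂ Ω : ℂ) ≠ 0 := by exact_mod_cast Module.finrank_pos.ne'
  rw [← hFw, hc]
  congr 1
  field_simp
  exact htr

/-- This is the averaging formula for the rank-one operator `x ↦ l(x) w`, whose trace is `l w`. -/
theorem sum_dual_smul_of_irreducible {ω : Representation ℂ H Ω} (hω : ω.IsIrreducible)
    (l : Module.Dual ℂ Ω) (w w' : Ω) : ∑ h, l (ω h⁻¹ w') • ω h w =
      ((Nat.card H : ℂ) / Module.finrank ℂ Ω * l w) • w' := by
  have h1 := sum_conj_of_irreducible hω (l.smulRight w) w'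
  have h2 : LinearMap.trace ℂ Ω (l.smulRight w) = l w := by
    have := LinearMap.congr_fun (LinearMap.trace_eq_contract (R := ℂ) (M := Ω)) (l ⊗ₜ w)
    rw [contractLeft_apply, LinearMap.comp_apply] at this
    rw [← this]
    congr 1
  simpa [h2] using h1

theorem sum_dual_smul_map {ω : Representation ℂ H Ω} (hω : ω.IsIrreducible)
    {ρ : Representation ℂ H V} (f : Ω →ₗ[ℂ] V) (hf : ∀ h w, f (ω h w) = ρ h (f w))
    (l : Module.Dual ℂ Ω) (w w' : Ω) : ∑ h, l (ω h⁻¹ w') • ρ h (f w) =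
      ((Nat.card H : ℂ) / Module.finrank ℂ Ω * l w) • f w' := by
  rw [← map_smul, ← sum_dual_smul_of_irreducible hω l w w', map_sum]
  exact Finset.sum_congr rfl fun h _ => by rw [map_smul, hf]

end Orthogonality

/-- An irreducible representation `ω` of a normal subgroup `H` of `S = Q H`, together with an
action `ω'` of `Q` on its space that is compatible with the action of `Q` on `H`. On `Q ∩ H` the
two actions differ by the scalars `c`. -/
structure ExtensionDatum {S : Type u} {Q : Type v} {H : Type w} [Group S] [Group Q] [Group H]
    (iQ : Q →* S) (iH : H →* S) {Ω : Type} [AddCommGroup Ω] [Module ℂ Ω]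
    (ω : Representation ℂ H Ω) (ω' : Representation ℂ Q Ω) (c : Q → ℂ) : Prop where
  irr : ω.IsIrreducible
  act : ∀ q h, ∃ h', iH h' = iQ q * iH h * (iQ q)⁻¹ ∧ ω' q * ω h = ω h' * ω' q
  cover : ∀ s, ∃ q h, s = iQ q * iH h
  compat : ∀ q h, iQ q = iH h → ω h = c q • ω' q

section Extension

variable {S : Type u} {Q : Type v} {H : Type w} [Group S] [Group Q] [Group H]
    {iQ : Q →* S} {iH : H →* S} {Ω : Type} [AddCommGroup Ω] [Module ℂ Ω]
    {ω : Representation ℂ H Ω} {ω' : Representation ℂ Q Ω} {c : Q → ℂ}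
    {V W : Type*} [AddCommGroup V] [Module ℂ V] [AddCommGroup W] [Module ℂ W]

theorem apply_inv_apply_rep {G : Type*} [Group G] (ρ : Representation ℂ G V) (g : G) (v : V) :
    ρ g (ρ g⁻¹ v) = v := by
  rw [← Module.End.mul_apply, ← map_mul]
  simp

theorem inv_apply_apply_rep {G : Type*} [Group G] (ρ : Representation ℂ G V) (g : G) (v : V) :
    ρ g⁻¹ (ρ g v) = v := by
  rw [← Module.End.mul_apply, ← map_mul]
  simp

/-- The space of `H`-homomorphisms. -/
def homSpace (iH : H →* S) (ω : Representation ℂ H Ω) (ρ : Representation ℂ S V) :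
    Submodule ℂ (Ω →ₗ[ℂ] V) where
  carrier := {f | ∀ h w, f (ω h w) = ρ (iH h) (f w)}
  add_mem' {f g} hf hg h w := by simp [hf h w, hg h w]
  zero_mem' h w := by simp
  smul_mem' a f hf h w := by simp [hf h w]

theorem ExtensionDatum.hom_mem (hE : ExtensionDatum iQ iH ω ω' c) (ρ : Representation ℂ S V)
    (q : Q) {f : Ω →ₗ[ℂ] V} (hf : f ∈ homSpace iH ω ρ) :
    ρ (iQ q) ∘ₗ f ∘ₗ ω' q⁻¹ ∈ homSpace iH ω ρ := by
  intro h w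
  obtain ⟨h', h1, h2⟩ := hE.act q⁻¹ h
  have h3 : ω' q⁻¹ (ω h w) = ω h' (ω' q⁻¹ w) := LinearMap.congr_fun h2 w
  simp only [LinearMap.comp_apply]
  rw [h3, hf, ← Module.End.mul_apply, ← map_mul, h1, ← Module.End.mul_apply, ← map_mul]
  congr 2
  simp [mul_assoc]

/-- The representation of `Q` on the space of `H`-homomorphisms. -/
def ExtensionDatum.homRep (hE : ExtensionDatum iQ iH ω ω' c) (ρ : Representation ℂ S V) :
    Representation ℂ Q (homSpace iH ω ρ) where
  toFun q :=
    { toFun := fun f => ⟨ρ (iQ q) ∘ₗ f.1 ∘ₗ ω' q⁻¹, hE.hom_mem ρ q f.2⟩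
      map_add' := fun f g => by ext; simp
      map_smul' := fun a f => by ext; simp }
  map_one' := by ext; simp
  map_mul' x y := by ext; simp

theorem ExtensionDatum.homRep_apply (hE : ExtensionDatum iQ iH ω ω' c) (ρ : Representation ℂ S V)
    (q : Q) (f : homSpace iH ω ρ) (w : Ω) :
    (hE.homRep ρ q f).1 (ω' q w) = ρ (iQ q) (f.1 w) := by
  change ρ (iQ q) (f.1 (ω' q⁻¹ (ω' q w))) = _
  rw [inv_apply_apply_rep]

/-- Let `U` be a nonzero `Q`-stable space of homomorphisms. The images of its members span `V`, as
`S = Q H`. A weighted sum over `H` turns a vector `g y` with `g` in `U` back into a multiple of `g`,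
so it sends every vector of `V` to a member of `U`. Applied to `f w` it gives a nonzero multiple of
an arbitrary `f`. -/
theorem ExtensionDatum.irreducible_homRep [Finite H] [FiniteDimensional ℂ Ω]
    (hE : ExtensionDatum iQ iH ω ω' c) {ρ : Representation ℂ S V}
    (hρ : ρ.IsIrreducible) (hne : homSpace iH ω ρ ≠ ⊥) : (hE.homRep ρ).IsIrreducible := by
  have := Fintype.ofFinite H
  refine (isIrreducible_iff _).2 ⟨Submodule.nontrivial_iff_ne_bot.2 hne, fun U hU => ?_⟩
  by_cases hb : U = ⊥
  · exact Or.inl hb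
  right
  obtain ⟨u, hu, hu0⟩ := Submodule.exists_mem_ne_zero_of_ne_bot hb
  obtain ⟨w₀, hw₀⟩ : ∃ w, u.1 w ≠ 0 := by
    by_contra hc
    push Not at hc
    exact hu0 (Subtype.ext (LinearMap.ext hc))
  set M : Submodule ℂ V := Submodule.span ℂ {x | ∃ f ∈ U, ∃ w, f.1 w = x} with hM
  have hMt : M = ⊤ := by
    refine eq_top_of_stable hρ M ?_ (u := u.1 w₀) (Submodule.subset_span ⟨u, hu, w₀, rfl⟩) hw₀
    intro s v hv
    rw [hM] at hv
    induction hv using Submodule.span_induction with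
    | mem x hx =>
      obtain ⟨f, hf, w, rfl⟩ := hx
      obtain ⟨q, h, rfl⟩ := hE.cover s
      refine Submodule.subset_span ⟨hE.homRep ρ q f, hU q f hf, ω' q (ω h w), ?_⟩
      rw [hE.homRep_apply, f.2 h, map_mul, Module.End.mul_apply]
    | zero => simp
    | add x y _ _ hx hy => rw [map_add]; exact add_mem hx hy
    | smul c x _ hx => rw [map_smul]; exact M.smul_mem c hx
  have hD : ((Nat.card H : ℂ) / Module.finrank ℂ Ω) ≠ 0 := by
    have := ((isIrreducible_iff ω).1 hE.irr).1
    refine div_ne_zero (by exact_mod_cast Nat.card_pos.ne') ?_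
    exact_mod_cast Module.finrank_pos.ne'
  refine eq_top_iff.2 fun f _ => ?_
  have := ((isIrreducible_iff ω).1 hE.irr).1
  obtain ⟨w, hw⟩ := exists_ne (0 : Ω)
  obtain ⟨l, hl⟩ : ∃ l : Module.Dual ℂ Ω, l w ≠ 0 := by
    by_contra hc
    push Not at hc
    exact hw ((Module.forall_dual_apply_eq_zero_iff ℂ w).1 hc)
  have key : ∀ x ∈ M, ∃ g ∈ U, ∀ w', ∑ h, l (ω h⁻¹ w') • ρ (iH h) x = g.1 w' := by
    intro x hx
    rw [hM] at hx
    induction hx using Submodule.span_induction with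
    | mem x hx =>
      obtain ⟨g, hg, y, rfl⟩ := hx
      exact ⟨_, U.smul_mem ((Nat.card H : ℂ) / Module.finrank ℂ Ω * l y) hg, fun w' =>
        sum_dual_smul_map hE.irr (ρ := ρ.comp iH) g.1 (fun h w => g.2 h w) l y w'⟩
    | zero => exact ⟨0, zero_mem _, fun w' => by simp⟩
    | add x y _ _ hx hy =>
      obtain ⟨a, ha, ha'⟩ := hx
      obtain ⟨b, hb, hb'⟩ := hy
      refine ⟨a + b, add_mem ha hb, fun w' => ?_⟩
      change _ = a.1 w' + b.1 w'
      rw [← ha', ← hb', ← Finset.sum_add_distrib]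
      exact Finset.sum_congr rfl fun h _ => by rw [map_add, smul_add]
    | smul c x _ hx =>
      obtain ⟨a, ha, ha'⟩ := hx
      refine ⟨c • a, U.smul_mem c ha, fun w' => ?_⟩
      change _ = c • a.1 w'
      rw [← ha', Finset.smul_sum]
      exact Finset.sum_congr rfl fun h _ => by rw [map_smul, smul_comm]
  obtain ⟨g, hg, hg'⟩ := key (f.1 w) (hMt ▸ Submodule.mem_top)
  have h1 : g = ((Nat.card H : ℂ) / Module.finrank ℂ Ω * l w) • f := by
    apply Subtype.ext
    refine LinearMap.ext fun w' => ?_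
    rw [← hg']
    exact sum_dual_smul_map hE.irr (ρ := ρ.comp iH) f.1 (fun h w => f.2 h w) l w w'
  have h2 : f = ((Nat.card H : ℂ) / Module.finrank ℂ Ω * l w)⁻¹ • g := by
    rw [h1, smul_smul, inv_mul_cancel₀ (mul_ne_zero hD hl), one_smul]
  rw [h2]
  exact U.smul_mem _ hg

/-- `Q` acts by `ω' ⊗ τ` and `H` by `ω ⊗ 1`. On common elements `ω = c ω'` while `τ` is the scalar
`c`, so the scalar moves across the tensor sign and the two prescriptions glue. -/
theorem ExtensionDatum.exists_tensorRep (hE : ExtensionDatum iQ iH ω ω' c)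
    {τ : Representation ℂ Q W} (hτ : ∀ q h, iQ q = iH h → ∀ x, τ q x = c q • x) :
    ∃ F : Representation ℂ S (Ω ⊗[ℂ] W),
      (∀ q, F (iQ q) = TensorProduct.map (ω' q) (τ q)) ∧
      ∀ h, F (iH h) = TensorProduct.map (ω h) LinearMap.id := by
  refine exists_monoidHom_of_factorization iQ iH (M := Module.End ℂ (Ω ⊗[ℂ] W))
    { toFun := fun q => TensorProduct.map (ω' q) (τ q), map_one' := ?_, map_mul' := ?_ }
    { toFun := fun h => TensorProduct.map (ω h) LinearMap.id, map_one' := ?_, map_mul' := ?_ }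
    ?_ ?_ hE.cover
  · simp [Module.End.one_eq_id]
  · intro x y
    ext
    simp
  · simp [Module.End.one_eq_id]
  · intro x y
    ext
    simp
  · intro q h e
    refine TensorProduct.ext' fun w x => ?_
    change ω' q w ⊗ₜ τ q x = ω h w ⊗ₜ x
    rw [hτ q h e, hE.compat q h e, LinearMap.smul_apply, TensorProduct.smul_tmul]
  · intro q h
    obtain ⟨h', h1, h2⟩ := hE.act q h
    refine ⟨h', h1, TensorProduct.ext' fun w x => ?_⟩
    change ω' q (ω h w) ⊗ₜ τ q x = ω h' (ω' q w) ⊗ₜ τ q x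
    rw [← Module.End.mul_apply, h2, Module.End.mul_apply]

/-- Orthogonality for `ω` extracts from a nonzero vector of a stable `U` all tensors `w' ⊗ x` for
some nonzero `x` in `W`. Irreducibility of `τ` then makes every `x` occur. -/
theorem ExtensionDatum.irreducible_tensorRep [Finite H] [FiniteDimensional ℂ Ω]
    [FiniteDimensional ℂ W]
    (hE : ExtensionDatum iQ iH ω ω' c) {τ : Representation ℂ Q W} (hτ : τ.IsIrreducible)
    {F : Representation ℂ S (Ω ⊗[ℂ] W)}
    (hF : ∀ q, F (iQ q) = TensorProduct.map (ω' q) (τ q))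
    (hF' : ∀ h, F (iH h) = TensorProduct.map (ω h) LinearMap.id) : F.IsIrreducible := by
  have := Fintype.ofFinite H
  have := ((isIrreducible_iff ω).1 hE.irr).1
  have := ((isIrreducible_iff τ).1 hτ).1
  have hD : ((Nat.card H : ℂ) / Module.finrank ℂ Ω) ≠ 0 := by
    refine div_ne_zero (by exact_mod_cast Nat.card_pos.ne') ?_
    exact_mod_cast Module.finrank_pos.ne'
  have hpos : 0 < Module.finrank ℂ (Ω ⊗[ℂ] W) := by
    rw [Module.finrank_tensorProduct]
    exact mul_pos Module.finrank_pos Module.finrank_pos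
  refine (isIrreducible_iff _).2 ⟨Module.nontrivial_of_finrank_pos hpos, fun U hU => ?_⟩
  by_cases hb : U = ⊥
  · exact Or.inl hb
  right
  obtain ⟨u, hu, hu0⟩ := Submodule.exists_mem_ne_zero_of_ne_bot hb
  -- contraction against a functional of `Ω`
  let ct : Module.Dual ℂ Ω → (Ω ⊗[ℂ] W →ₗ[ℂ] W) := fun l =>
    (TensorProduct.lid ℂ W).toLinearMap ∘ₗ LinearMap.rTensor W l
  have hct : ∀ (l : Module.Dual ℂ Ω) (w' : Ω) (y : Ω ⊗[ℂ] W),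
      ∑ h, l (ω h⁻¹ w') • F (iH h) y =
        ((Nat.card H : ℂ) / Module.finrank ℂ Ω) • (w' ⊗ₜ[ℂ] ct l y) := by
    intro l w' y
    induction y using TensorProduct.induction_on with
    | zero => simp
    | tmul w x =>
      have h1 : ∀ h, l (ω h⁻¹ w') • F (iH h) (w ⊗ₜ[ℂ] x) =
          (l (ω h⁻¹ w') • ω h w) ⊗ₜ[ℂ] x := by
        intro h
        rw [hF']
        rfl
      rw [Finset.sum_congr rfl fun h _ => h1 h, ← TensorProduct.sum_tmul,
        sum_dual_smul_of_irreducible hE.irr]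
      simp only [ct, LinearMap.comp_apply, LinearMap.rTensor_tmul, LinearEquiv.coe_coe,
        TensorProduct.lid_tmul]
      rw [mul_smul, ← TensorProduct.smul_tmul', ← TensorProduct.smul_tmul' (l w),
        TensorProduct.tmul_smul]
    | add a b ha hb =>
      simp only [map_add, smul_add, Finset.sum_add_distrib, ha, hb, TensorProduct.tmul_add]
  -- The largest subspace of `W` whose tensor product with `Ω` lies in `U`.
  let U' : Submodule ℂ W :=
    { carrier := {x | ∀ w' : Ω, w' ⊗ₜ[ℂ] x ∈ U}
      add_mem' := fun {x y} hx hy w' => by rw [TensorProduct.tmul_add]; exact add_mem (hx w') (hy w')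
      zero_mem' := fun w' => by simp
      smul_mem' := fun a x hx w' => by rw [TensorProduct.tmul_smul]; exact U.smul_mem a (hx w') }
  have hmem : ∀ l, ct l u ∈ U' := by
    intro l w'
    have h1 := hct l w' u
    have h2 : w' ⊗ₜ[ℂ] ct l u = ((Nat.card H : ℂ) / Module.finrank ℂ Ω)⁻¹ •
        ∑ h, l (ω h⁻¹ w') • F (iH h) u := by
      rw [h1, smul_smul, inv_mul_cancel₀ hD, one_smul]
    rw [h2]
    exact U.smul_mem _ (sum_mem fun h _ => U.smul_mem _ (hU _ _ hu))
  obtain ⟨l, hl⟩ : ∃ l, ct l u ≠ 0 := by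
    by_contra hc
    push Not at hc
    let b := Module.finBasis ℂ Ω
    apply hu0
    have hid : ∀ y : Ω ⊗[ℂ] W, y = ∑ i, b i ⊗ₜ[ℂ] ct (b.coord i) y := by
      intro y
      induction y using TensorProduct.induction_on with
      | zero => simp
      | tmul w x =>
        simp only [ct, LinearMap.comp_apply, LinearMap.rTensor_tmul, LinearEquiv.coe_coe,
          TensorProduct.lid_tmul]
        conv_lhs => rw [← b.sum_repr w, TensorProduct.sum_tmul]
        refine Finset.sum_congr rfl fun i _ => ?_
        rw [TensorProduct.smul_tmul]
        rfl
      | add a b ha hb =>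
        simp only [map_add, TensorProduct.tmul_add, Finset.sum_add_distrib]
        rw [← ha, ← hb]
    rw [hid u]
    simp [hc]
  have hU't : U' = ⊤ := by
    refine eq_top_of_stable hτ U' ?_ (hmem l) hl
    intro q x hx w'
    have h1 := hU (iQ q) _ (hx (ω' q⁻¹ w'))
    rw [hF, TensorProduct.map_tmul, apply_inv_apply_rep] at h1
    exact h1
  refine eq_top_iff.2 fun y _ => ?_
  induction y using TensorProduct.induction_on with
  | zero => exact zero_mem _
  | tmul w x => exact (hU't ▸ Submodule.mem_top : x ∈ U') w
  | add a b ha hb => exact add_mem (ha trivial) (hb trivial)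

/-- The irreducible representations of `S` whose restriction along `iH` contains `ω`. -/
def Irr.containing (iH : H →* S) (ω : Representation ℂ H Ω) : Set (Irr S) :=
  {χ | ∃ π : IrrRep S, Irr.mk π = χ ∧ homSpace iH ω π.ρ ≠ ⊥}

/-- The irreducible representations of `Q` on which the elements of `Q ∩ H` act by the scalars
`c`. -/
def Irr.scalarOn (iQ : Q →* S) (iH : H →* S) (c : Q → ℂ) : Set (Irr Q) :=
  {χ | ∃ π : IrrRep Q, Irr.mk π = χ ∧ ∀ q h, iQ q = iH h → ∀ x, π.ρ q x = c q • x}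

theorem Irr.mem_containing_iff (π : IrrRep S) :
    Irr.mk π ∈ Irr.containing iH ω ↔ homSpace iH ω π.ρ ≠ ⊥ := by
  refine ⟨?_, fun h => ⟨π, rfl, h⟩⟩
  rintro ⟨π', h, hne⟩
  obtain ⟨e⟩ := Irr.exact h
  obtain ⟨f, hf, hf0⟩ := Submodule.exists_mem_ne_zero_of_ne_bot hne
  intro hb
  have h1 : e.toLinearEquiv.toLinearMap ∘ₗ f ∈ homSpace iH ω π.ρ := by
    intro h w
    change e (f (ω h w)) = π.ρ (iH h) (e (f w))
    rw [hf, equiv_apply]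
  rw [hb] at h1
  apply hf0
  refine LinearMap.ext fun w => ?_
  have h2 := LinearMap.congr_fun ((Submodule.mem_bot _).1 h1) w
  exact (map_eq_zero_iff e e.toLinearEquiv.injective).1 h2

theorem Irr.mem_scalarOn_iff (π : IrrRep Q) :
    Irr.mk π ∈ Irr.scalarOn iQ iH c ↔ ∀ q h, iQ q = iH h → ∀ x, π.ρ q x = c q • x := by
  refine ⟨?_, fun h => ⟨π, rfl, h⟩⟩
  rintro ⟨π', h, hne⟩ q h' hq x
  obtain ⟨e⟩ := Irr.exact h
  have h1 := hne q h' hq (e.symm x)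
  have h2 := congrArg e h1
  rw [equiv_apply, Representation.Equiv.apply_symm_apply] at h2
  rw [h2, map_smul e, Representation.Equiv.apply_symm_apply]

/-- `V` is the tensor product of `Ω` and `W`, expressed by the existence of an equivariant bilinear
map. -/
def TensorRelated (iQ : Q →* S) (iH : H →* S) (ω : Representation ℂ H Ω)
    (ω' : Representation ℂ Q Ω) (ρ : Representation ℂ S V) (τ : Representation ℂ Q W) : Prop :=
  ∃ B : Ω →ₗ[ℂ] W →ₗ[ℂ] V, B ≠ 0 ∧ (∀ q w x, B (ω' q w) (τ q x) = ρ (iQ q) (B w x)) ∧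
    ∀ h w x, B (ω h w) x = ρ (iH h) (B w x)

theorem ExtensionDatum.nonempty_equiv_homRep [Finite H] [FiniteDimensional ℂ Ω]
    (hE : ExtensionDatum iQ iH ω ω' c) {ρ : Representation ℂ S V} {τ : Representation ℂ Q W}
    (hρ : ρ.IsIrreducible) (hτ : τ.IsIrreducible) (hne : homSpace iH ω ρ ≠ ⊥)
    (h : TensorRelated iQ iH ω ω' ρ τ) : Nonempty (τ.Equiv (hE.homRep ρ)) := by
  obtain ⟨B, hB0, hB, hB'⟩ := h
  let f : W →ₗ[ℂ] homSpace iH ω ρ := B.flip.codRestrict _ fun x h w => hB' h w x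
  obtain ⟨x, hx⟩ : ∃ x, f x ≠ 0 := by
    by_contra hc
    push Not at hc
    apply hB0
    refine LinearMap.ext fun w => LinearMap.ext fun x => ?_
    exact LinearMap.congr_fun (congrArg Subtype.val (hc x)) w
  refine nonempty_equiv_of_ne_zero hτ (hE.irreducible_homRep hρ hne) f (fun q x => ?_) hx
  apply Subtype.ext
  refine LinearMap.ext fun w => ?_
  have h1 := hE.homRep_apply ρ q (f x) (ω' q⁻¹ w)
  rw [apply_inv_apply_rep] at h1
  rw [h1]
  change B w (τ q x) = ρ (iQ q) (B (ω' q⁻¹ w) x)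
  rw [← hB, apply_inv_apply_rep]

theorem ExtensionDatum.nonempty_tensorRep_equiv [Finite H] [FiniteDimensional ℂ Ω]
    [FiniteDimensional ℂ W]
    (hE : ExtensionDatum iQ iH ω ω' c) {ρ : Representation ℂ S V} {τ : Representation ℂ Q W}
    (hρ : ρ.IsIrreducible) (hτ : τ.IsIrreducible) {F : Representation ℂ S (Ω ⊗[ℂ] W)}
    (hF : ∀ q, F (iQ q) = TensorProduct.map (ω' q) (τ q))
    (hF' : ∀ h, F (iH h) = TensorProduct.map (ω h) LinearMap.id)
    (h : TensorRelated iQ iH ω ω' ρ τ) : Nonempty (F.Equiv ρ) := by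
  obtain ⟨B, hB0, hB, hB'⟩ := h
  obtain ⟨w, x, hx⟩ : ∃ w x, B w x ≠ 0 := by
    by_contra hc
    push Not at hc
    exact hB0 (LinearMap.ext fun w => LinearMap.ext fun x => hc w x)
  refine nonempty_equiv_of_ne_zero (hE.irreducible_tensorRep hτ hF hF') hρ (TensorProduct.lift B)
    (fun s y => ?_) (v := w ⊗ₜ[ℂ] x) (by simpa using hx)
  obtain ⟨q, h, rfl⟩ := hE.cover s
  induction y using TensorProduct.induction_on with
  | zero => simp
  | tmul w x =>
    rw [map_mul, Module.End.mul_apply, hF, hF', TensorProduct.map_tmul, TensorProduct.map_tmul,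
      TensorProduct.lift.tmul, TensorProduct.lift.tmul, LinearMap.id_apply, hB, hB', map_mul,
      Module.End.mul_apply]
  | add a b ha hb => simp only [map_add, ha, hb]

/-- Representations of `S` containing `ω` correspond to representations of `Q`. -/
theorem ExtensionDatum.exists_equiv [Finite H] [FiniteDimensional ℂ Ω]
    (hE : ExtensionDatum iQ iH ω ω' c) :
    ∃ e : Irr.containing iH ω ≃ Irr.scalarOn iQ iH c, ∀ χ,
      TensorRelated iQ iH ω ω' χ.1.rep.ρ (e χ).1.rep.ρ ∧
      χ.1.dim = Module.finrank ℂ Ω * (e χ).1.dim := by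
  have nz : ∀ {V W : Type} [AddCommGroup V] [Module ℂ V] [AddCommGroup W] [Module ℂ W]
      {ρ : Representation ℂ S V} {τ : Representation ℂ Q W},
      TensorRelated iQ iH ω ω' ρ τ → homSpace iH ω ρ ≠ ⊥ := by
    rintro V W _ _ _ _ ρ τ ⟨B, hB0, hB, hB'⟩ hb
    apply hB0
    refine LinearMap.ext fun w => LinearMap.ext fun x => ?_
    have h1 : B.flip x ∈ homSpace iH ω ρ := fun h w => hB' h w x
    rw [hb] at h1
    exact LinearMap.congr_fun ((Submodule.mem_bot _).1 h1) w
  have dims : ∀ (π : IrrRep S) (π' : IrrRep Q), Irr.mk π' ∈ Irr.scalarOn iQ iH c →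
      TensorRelated iQ iH ω ω' π.ρ π'.ρ → ∃ F : Representation ℂ S (Ω ⊗[ℂ] (Fin π'.dim → ℂ)),
      (∀ q, F (iQ q) = TensorProduct.map (ω' q) (π'.ρ q)) ∧
      (∀ h, F (iH h) = TensorProduct.map (ω h) LinearMap.id) ∧ Nonempty (F.Equiv π.ρ) := by
    intro π π' h h'
    obtain ⟨F, hF, hF'⟩ := hE.exists_tensorRep ((Irr.mem_scalarOn_iff π').1 h)
    exact ⟨F, hF, hF', hE.nonempty_tensorRep_equiv π.irr π'.irr hF hF' h'⟩
  have corr := exists_equiv_of_correspondence (Irr.containing iH ω) (Irr.scalarOn iQ iH c)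
    (fun π π' => TensorRelated iQ iH ω ω' π.ρ π'.ρ)
  obtain ⟨e, he⟩ : ∃ e : Irr.containing iH ω ≃ Irr.scalarOn iQ iH c, ∀ χ,
      TensorRelated iQ iH ω ω' χ.1.rep.ρ (e χ).1.rep.ρ := by
    refine corr ?_ ?_ ?_ ?_ ?_
    · rintro π π₁ π' π₁' ⟨e⟩ ⟨e'⟩ ⟨B, hB0, hB, hB'⟩
      refine ⟨(B.compr₂ e.toLinearEquiv.toLinearMap).compl₂ e'.symm.toLinearEquiv.toLinearMap,
        ?_, ?_, ?_⟩
      · intro h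
        apply hB0
        refine LinearMap.ext fun w => LinearMap.ext fun x => ?_
        have h1 := LinearMap.congr_fun (LinearMap.congr_fun h w) (e' x)
        change e (B w (e'.symm (e' x))) = 0 at h1
        rw [Representation.Equiv.symm_apply_apply] at h1
        exact (map_eq_zero_iff e e.toLinearEquiv.injective).1 h1
      · intro q w x
        change e (B (ω' q w) (e'.symm (π₁'.ρ q x))) = π₁.ρ (iQ q) (e (B w (e'.symm x)))
        rw [equiv_apply, hB, equiv_apply]
      · intro h w x
        change e (B (ω h w) (e'.symm x)) = π₁.ρ (iH h) (e (B w (e'.symm x)))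
        rw [hB', equiv_apply]
    · intro π hπ
      have hne := (Irr.mem_containing_iff π).1 hπ
      have hirr := hE.irreducible_homRep π.irr hne
      have e := IrrRep.ofEquiv _ hirr
      -- For an element common to `Q` and `H`, equivariance under `H` replaces its action by `ω`,
      -- which is `c` times `ω'`. The operator `ω'` cancels and the scalar remains.
      have hsc : ∀ q h, iQ q = iH h → ∀ x, hE.homRep π.ρ q x = c q • x := by
        intro q h hq x
        apply Subtype.ext
        refine LinearMap.ext fun w => ?_
        have h1 := hE.homRep_apply π.ρ q x (ω' q⁻¹ w)
        rw [apply_inv_apply_rep, hq, ← x.2 h, hE.compat q h hq, LinearMap.smul_apply,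
          apply_inv_apply_rep, map_smul] at h1
        exact h1
      refine ⟨IrrRep.of _ hirr, ?_, ?_⟩
      · rw [Irr.mem_scalarOn_iff]
        intro q h hq x
        have h1 := congrArg e (hsc q h hq (e.symm x))
        rw [equiv_apply, Representation.Equiv.apply_symm_apply, map_smul e,
          Representation.Equiv.apply_symm_apply] at h1
        exact h1
      · refine ⟨((homSpace iH ω π.ρ).subtype ∘ₗ e.symm.toLinearEquiv.toLinearMap).flip, ?_, ?_, ?_⟩
        · intro h
          obtain ⟨f, hf, hf0⟩ := Submodule.exists_mem_ne_zero_of_ne_bot hne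
          apply hf0
          refine LinearMap.ext fun w => ?_
          have h1 := LinearMap.congr_fun (LinearMap.congr_fun h w) (e ⟨f, hf⟩)
          change (e.symm (e ⟨f, hf⟩)).1 w = 0 at h1
          rwa [Representation.Equiv.symm_apply_apply] at h1
        · intro q w x
          change (e.symm ((IrrRep.of _ hirr).ρ q x)).1 (ω' q w) = π.ρ (iQ q) ((e.symm x).1 w)
          rw [equiv_apply, hE.homRep_apply]
        · intro h w x
          exact (e.symm x).2 h w
    · intro π' hπ'
      have hs := (Irr.mem_scalarOn_iff π').1 hπ'
      obtain ⟨F, hF, hF'⟩ := hE.exists_tensorRep hs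
      have hirr := hE.irreducible_tensorRep π'.irr hF hF'
      have e := IrrRep.ofEquiv _ hirr
      have hR : TensorRelated iQ iH ω ω' (IrrRep.of _ hirr).ρ π'.ρ := by
        refine ⟨(TensorProduct.mk ℂ Ω (Fin π'.dim → ℂ)).compr₂ e.toLinearEquiv.toLinearMap,
          ?_, ?_, ?_⟩
        · intro h
          have hn := ((isIrreducible_iff _).1 hirr).1
          obtain ⟨y, hy⟩ := exists_ne (0 : Ω ⊗[ℂ] (Fin π'.dim → ℂ))
          apply hy
          induction y using TensorProduct.induction_on with
          | zero => rfl
          | tmul w x =>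
            have h1 := LinearMap.congr_fun (LinearMap.congr_fun h w) x
            exact (map_eq_zero_iff e e.toLinearEquiv.injective).1 h1
          | add a b ha hb =>
            have ha' : a = 0 := by by_contra h0; exact h0 (ha h0)
            have hb' : b = 0 := by by_contra h0; exact h0 (hb h0)
            rw [ha', hb', add_zero]
        · intro q w x
          change e (ω' q w ⊗ₜ π'.ρ q x) = (IrrRep.of _ hirr).ρ (iQ q) (e (w ⊗ₜ x))
          rw [← equiv_apply, hF, TensorProduct.map_tmul]
        · intro h w x
          change e (ω h w ⊗ₜ x) = (IrrRep.of _ hirr).ρ (iH h) (e (w ⊗ₜ x))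
          rw [← equiv_apply, hF', TensorProduct.map_tmul, LinearMap.id_apply]
      exact ⟨IrrRep.of _ hirr, (Irr.mem_containing_iff _).2 (nz hR), hR⟩
    · rintro π π₁ π₂ hπ h1 h2 hR₁ hR₂
      have hne := (Irr.mem_containing_iff π).1 hπ
      obtain ⟨e₁⟩ := hE.nonempty_equiv_homRep π.irr π₁.irr hne hR₁
      obtain ⟨e₂⟩ := hE.nonempty_equiv_homRep π.irr π₂.irr hne hR₂
      exact ⟨e₁.trans e₂.symm⟩
    · rintro π₁ π₂ π' h1 h2 hπ' hR₁ hR₂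
      obtain ⟨F, hF, hF', ⟨e₁⟩⟩ := dims _ _ hπ' hR₁
      obtain ⟨e₂⟩ := hE.nonempty_tensorRep_equiv π₂.irr π'.irr hF hF' hR₂
      exact ⟨e₁.symm.trans e₂⟩
  refine ⟨e, fun χ => ⟨he χ, ?_⟩⟩
  have h2 := (e χ).2
  rw [← Irr.mk_rep (e χ).1] at h2
  obtain ⟨F, -, -, ⟨e₁⟩⟩ := dims _ _ h2 (he χ)
  rw [← Irr.dim_rep, ← Irr.dim_rep, IrrRep.dim_eq_finrank, ← e₁.toLinearEquiv.finrank_eq,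
    Module.finrank_tensorProduct, ← IrrRep.dim_eq_finrank]

end Extension

/-! ### Heisenberg representations and their canonical extension

`H` is a finite group with a central subgroup `Z` such that commutators lie in `Z`, and `χ` is a
faithful enough linear character of `Z`, extended by zero to `H`. -/

/-- A central character `χ` of `Z ≤ H`, extended by zero to `H`, whose commutator pairing on `H / Z`
is nondegenerate. -/
structure HeisenbergDatum {H : Type u} [Group H] (Z : Subgroup H) (χ : H → ℂ) : Prop where
  central : ∀ z ∈ Z, ∀ h, z * h = h * z
  commutator_mem : ∀ h h' : H, h * h' * h⁻¹ * h'⁻¹ ∈ Z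
  map_one : χ 1 = 1
  map_mul : ∀ z ∈ Z, ∀ z' ∈ Z, χ (z * z') = χ z * χ z'
  map_eq_zero : ∀ h, h ∉ Z → χ h = 0
  nondeg : ∀ h, (∀ h', χ (h' * h * h'⁻¹ * h⁻¹) = 1) → h ∈ Z

section Heisenberg

variable {H : Type u} [Group H] {Z : Subgroup H} {χ : H → ℂ}

theorem HeisenbergDatum.ne_zero (hd : HeisenbergDatum Z χ) {z : H} (hz : z ∈ Z) : χ z ≠ 0 := by
  intro h
  have := hd.map_mul z hz z⁻¹ (inv_mem hz)
  rw [mul_inv_cancel, hd.map_one, h, zero_mul] at this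
  exact one_ne_zero this

theorem HeisenbergDatum.map_inv (hd : HeisenbergDatum Z χ) {z : H} (hz : z ∈ Z) :
    χ z⁻¹ = (χ z)⁻¹ := by
  have := hd.map_mul z hz z⁻¹ (inv_mem hz)
  rw [mul_inv_cancel, hd.map_one] at this
  exact (inv_eq_of_mul_eq_one_right this.symm).symm

theorem HeisenbergDatum.mem_iff (hd : HeisenbergDatum Z χ) {h : H} : h ∈ Z ↔ χ h ≠ 0 :=
  ⟨hd.ne_zero, fun h0 => by_contra fun hn => h0 (hd.map_eq_zero h hn)⟩

/-- An irreducible representation whose restriction to `Z` maps nontrivially to `χ` will do: by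
Schur the central `Z` acts through scalars, and the map identifies them with `χ`. -/
theorem HeisenbergDatum.exists_irrRep [Finite H] (hd : HeisenbergDatum Z χ) :
    ∃ π : IrrRep H, ∀ z ∈ Z, ∀ v, π.ρ z v = χ z • v := by
  let τ : Representation ℂ Z ℂ :=
    { toFun := fun z => χ z • LinearMap.id
      map_one' := by
        ext
        simp [hd.map_one]
      map_mul' := fun x y => by
        ext
        simp [hd.map_mul x x.2 y y.2, mul_comm] }
  obtain ⟨π, f, hf0, hf⟩ := exists_irrRep_of_injective (ι := Z.subtype) Z.subtype_injective τ
  refine ⟨π, fun z hz v => ?_⟩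
  obtain ⟨c, hc⟩ := exists_eq_smul_of_commute π.irr (π.ρ z) (fun g v => by
    rw [← Module.End.mul_apply, ← Module.End.mul_apply, ← MonoidHom.map_mul, ← MonoidHom.map_mul,
      hd.central z hz])
  obtain ⟨x, hx⟩ : ∃ x, f x ≠ 0 := by
    by_contra hc
    push Not at hc
    exact hf0 (LinearMap.ext hc)
  have h1 : f (π.ρ z x) = χ z • f x := hf ⟨z, hz⟩ x
  rw [hc, map_smul] at h1
  rw [hc v]
  congr 1
  exact mul_right_cancel₀ hx h1

variable {Ω V : Type*} [AddCommGroup Ω] [Module ℂ Ω] [FiniteDimensional ℂ Ω]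
  [AddCommGroup V] [Module ℂ V] {ω : Representation ℂ H Ω}

/-- For `h` outside `Z`, nondegeneracy gives a conjugate of `h` that acts as a scalar other than 1
times `ω h`. Conjugation preserves the trace, so the trace is zero. -/
theorem HeisenbergDatum.trace_eq (hd : HeisenbergDatum Z χ) (hω : ∀ z ∈ Z, ∀ v, ω z v = χ z • v)
    (h : H) : LinearMap.trace ℂ Ω (ω h) = Module.finrank ℂ Ω * χ h := by
  by_cases hz : h ∈ Z
  · have : ω h = χ h • LinearMap.id := LinearMap.ext fun v => by simpa using hω h hz v
    rw [this, map_smul, LinearMap.trace_id, smul_eq_mul, mul_comm]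
  · rw [hd.map_eq_zero h hz, mul_zero]
    obtain ⟨h', hh'⟩ : ∃ h', χ (h' * h * h'⁻¹ * h⁻¹) ≠ 1 := by
      by_contra hc
      push Not at hc
      exact hz (hd.nondeg h hc)
    have h1 : ω (h' * h * h'⁻¹) = χ (h' * h * h'⁻¹ * h⁻¹) • ω h := by
      refine LinearMap.ext fun v => ?_
      rw [LinearMap.smul_apply, ← hω _ (hd.commutator_mem h' h), ← Module.End.mul_apply,
        ← MonoidHom.map_mul]
      simp
    have h2 : LinearMap.trace ℂ Ω (ω (h' * h * h'⁻¹)) = LinearMap.trace ℂ Ω (ω h) := by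
      rw [mul_assoc, MonoidHom.map_mul, LinearMap.trace_mul_comm, ← MonoidHom.map_mul]
      simp
    rw [h1, map_smul, smul_eq_mul] at h2
    have h3 : (χ (h' * h * h'⁻¹ * h⁻¹) - 1) * LinearMap.trace ℂ Ω (ω h) = 0 := by
      rw [sub_mul, h2, one_mul, sub_self]
    exact (mul_eq_zero.1 h3).resolve_left (sub_ne_zero.2 hh')

theorem HeisenbergDatum.sum_trace_smul [Fintype H] (hd : HeisenbergDatum Z χ)
    (hω : ∀ z ∈ Z, ∀ v, ω z v = χ z • v) {ρ : Representation ℂ H V} {v : V}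
    (hv : ∀ z ∈ Z, ρ z v = χ z • v) : ∑ h, LinearMap.trace ℂ Ω (ω h⁻¹) • ρ h v =
      ((Module.finrank ℂ Ω : ℂ) * Nat.card Z) • v := by
  classical
  have h1 : ∀ h, LinearMap.trace ℂ Ω (ω h⁻¹) • ρ h v =
      if h ∈ Z then (Module.finrank ℂ Ω : ℂ) • v else 0 := by
    intro h
    rw [hd.trace_eq hω]
    split_ifs with hz
    · rw [hv h hz, hd.map_inv hz, smul_smul, mul_assoc, inv_mul_cancel₀ (hd.ne_zero hz), mul_one]
    · rw [hd.map_eq_zero _ (fun h' => hz (by simpa using h')), mul_zero, zero_smul]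
  rw [Finset.sum_congr rfl fun h _ => h1 h, ← Finset.sum_filter, Finset.sum_const,
    ← Nat.cast_smul_eq_nsmul ℂ, smul_smul, mul_comm]
  congr 3
  rw [Nat.card_eq_fintype_card, Fintype.card_subtype]

/-- Uniqueness of the Heisenberg representation in terms of maps: `∑ tr(ω h⁻¹) ρ h v` is a nonzero
multiple of `v`, and expanding the trace in a basis writes it as a sum of values of intertwiners.
One of these must be nonzero. -/
theorem HeisenbergDatum.exists_hom [Finite H] (hd : HeisenbergDatum Z χ)
    (hirr : ω.IsIrreducible)
    (hω : ∀ z ∈ Z, ∀ v, ω z v = χ z • v) {ρ : Representation ℂ H V} {v : V} (hv0 : v ≠ 0)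
    (hv : ∀ z ∈ Z, ρ z v = χ z • v) :
    ∃ f : Ω →ₗ[ℂ] V, f ≠ 0 ∧ ∀ h w, f (ω h w) = ρ h (f w) := by
  have := Fintype.ofFinite H
  have := ((isIrreducible_iff ω).1 hirr).1
  let f : Module.Dual ℂ Ω → Ω →ₗ[ℂ] V := fun l => ∑ h, (l ∘ₗ ω h⁻¹).smulRight (ρ h v)
  have hfa : ∀ l w, f l w = ∑ h, l (ω h⁻¹ w) • ρ h v := fun l w => by simp [f]
  have hf : ∀ l h w, f l (ω h w) = ρ h (f l w) := by
    intro l g w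
    rw [hfa, hfa, map_sum, ← (Group.mulLeft_bijective g).sum_comp]
    refine Finset.sum_congr rfl fun x _ => ?_
    rw [map_smul, ← Module.End.mul_apply, ← Module.End.mul_apply, ← MonoidHom.map_mul,
      ← MonoidHom.map_mul]
    simp
  by_contra hc
  push Not at hc
  have h0 : ∀ l, f l = 0 := by
    intro l
    by_contra hl
    obtain ⟨h, w, hw⟩ := hc (f l) hl
    exact hw (hf l h w)
  have h1 := hd.sum_trace_smul hω hv
  let b := Module.finBasis ℂ Ω
  have h2 : ∑ h, LinearMap.trace ℂ Ω (ω h⁻¹) • ρ h v = ∑ i, f (b.coord i) (b i) := by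
    simp_rw [hfa]
    rw [Finset.sum_comm]
    refine Finset.sum_congr rfl fun h _ => ?_
    rw [LinearMap.trace_eq_matrix_trace ℂ b, Matrix.trace, Finset.sum_smul]
    refine Finset.sum_congr rfl fun i _ => ?_
    rw [Matrix.diag_apply, LinearMap.toMatrix_apply]
    rfl
  rw [h2] at h1
  simp only [h0, LinearMap.zero_apply, Finset.sum_const_zero] at h1
  refine hv0 ((smul_eq_zero.1 h1.symm).resolve_left (mul_ne_zero ?_ ?_))
  · exact_mod_cast Module.finrank_pos.ne'
  · exact_mod_cast Nat.card_pos.ne'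

/-- Two evaluations of `∑ tr(ω h⁻¹) ω h w` are compared: the character formula gives `dim Ω · |Z| ·
w`, Schur orthogonality gives `(|H| / dim Ω) · w`. -/
theorem HeisenbergDatum.finrank_sq [Finite H] (hd : HeisenbergDatum Z χ)
    (hirr : ω.IsIrreducible) (hω : ∀ z ∈ Z, ∀ v, ω z v = χ z • v) :
    Module.finrank ℂ Ω ^ 2 * Nat.card Z = Nat.card H := by
  have := Fintype.ofFinite H
  have := ((isIrreducible_iff ω).1 hirr).1
  obtain ⟨w, hw⟩ := exists_ne (0 : Ω)
  have h1 := hd.sum_trace_smul hω (ρ := ω) (v := w) (fun z hz => hω z hz w)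
  let b := Module.finBasis ℂ Ω
  have h2 : ∑ h, LinearMap.trace ℂ Ω (ω h⁻¹) • ω h w =
      ∑ i, ∑ h, b.coord i (ω h⁻¹ (b i)) • ω h w := by
    rw [Finset.sum_comm]
    refine Finset.sum_congr rfl fun h _ => ?_
    rw [LinearMap.trace_eq_matrix_trace ℂ b, Matrix.trace, Finset.sum_smul]
    refine Finset.sum_congr rfl fun i _ => ?_
    rw [Matrix.diag_apply, LinearMap.toMatrix_apply]
    rfl
  rw [h1] at h2
  simp_rw [sum_dual_smul_of_irreducible hirr, mul_smul] at h2
  rw [← Finset.smul_sum] at h2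
  have h3 : ∑ i, b.coord i w • b i = w := b.sum_repr w
  rw [h3, ← sub_eq_zero, smul_smul, ← sub_smul] at h2
  have h4 := sub_eq_zero.1 ((smul_eq_zero.1 h2).resolve_right hw)
  have hD : (Module.finrank ℂ Ω : ℂ) ≠ 0 := by exact_mod_cast Module.finrank_pos.ne'
  field_simp at h4
  exact_mod_cast h4

/-- `U` implements the automorphism `α` on the representation `ω`. -/
def Implements (ω : Representation ℂ H Ω) (α : MulAut H) (U : (Module.End ℂ Ω)ˣ) : Prop :=
  ∀ h, U.val * ω h = ω (α h) * U.val

omit [FiniteDimensional ℂ Ω] in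
theorem Implements.mul {α β : MulAut H} {U U' : (Module.End ℂ Ω)ˣ} (h : Implements ω α U)
    (h' : Implements ω β U') : Implements ω (α * β) (U * U') := fun x => by
  rw [Units.val_mul, mul_assoc, h' x, ← mul_assoc, h, mul_assoc]
  rfl

omit [FiniteDimensional ℂ Ω] in
theorem Implements.inv {α : MulAut H} {U : (Module.End ℂ Ω)ˣ} (h : Implements ω α U) :
    Implements ω α⁻¹ U⁻¹ := fun x => by
  have h1 := h (α⁻¹ x)
  rw [MulAut.apply_inv_self] at h1
  rw [Units.inv_mul_eq_iff_eq_mul, ← mul_assoc, h1, Units.mul_inv_cancel_right]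

omit [FiniteDimensional ℂ Ω] in
theorem implements_one : Implements ω 1 1 := fun x => by simp

theorem Implements.eq_smul (hirr : ω.IsIrreducible) {α : MulAut H}
    {U U' : (Module.End ℂ Ω)ˣ} (h : Implements ω α U) (h' : Implements ω α U') :
    ∃ c : ℂ, U.val = c • U'.val := by
  have h1 := h'.inv.mul h
  rw [inv_mul_cancel] at h1
  obtain ⟨c, hc⟩ := exists_eq_smul_of_commute hirr (U'⁻¹ * U).val
    (fun g v => LinearMap.congr_fun (h1 g) v)
  refine ⟨c, ?_⟩
  have h2 : (U'⁻¹ * U).val = c • 1 := LinearMap.ext fun v => by simpa using hc v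
  calc U.val = U'.val * (U'⁻¹ * U).val := by rw [Units.val_mul, Units.mul_inv_cancel_left]
    _ = c • U'.val := by rw [h2, mul_smul_comm, mul_one]

omit [FiniteDimensional ℂ Ω] in
theorem Implements.smul {α : MulAut H} {U : (Module.End ℂ Ω)ˣ} (h : Implements ω α U) (c : ℂˣ) :
    Implements ω α (c • U) := fun x => by
  rw [Units.val_smul, smul_mul_assoc, h x, mul_smul_comm]

/-- The twist of `ω` by `α` has the same central character, so there is a nonzero intertwiner from
`ω`. Its kernel is stable, hence zero. -/
theorem HeisenbergDatum.exists_implements [Finite H] (hd : HeisenbergDatum Z χ)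
    (hirr : ω.IsIrreducible) (hω : ∀ z ∈ Z, ∀ v, ω z v = χ z • v) {α : MulAut H}
    (hα : ∀ h, χ (α h) = χ h) : ∃ U, Implements ω α U := by
  have hnt := ((isIrreducible_iff ω).1 hirr)
  have := hnt.1
  obtain ⟨w, hw⟩ := exists_ne (0 : Ω)
  obtain ⟨f, hf0, hf⟩ := hd.exists_hom hirr hω (ρ := ω.comp α.toMonoidHom) (v := w) hw (by
    intro z hz
    have : α z ∈ Z := hd.mem_iff.2 (by rw [hα]; exact hd.ne_zero hz)
    exact (hω (α z) this w).trans (by rw [hα]))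
  have hinj : LinearMap.ker f = ⊥ := by
    refine (hnt.2 (LinearMap.ker f) (fun g v hv => ?_)).resolve_right (fun h => ?_)
    · rw [LinearMap.mem_ker] at *
      rw [hf, hv, map_zero]
    · exact hf0 (LinearMap.ker_eq_top.1 h)
  let e := LinearEquiv.ofInjectiveEndo f (LinearMap.ker_eq_bot.1 hinj)
  refine ⟨⟨f, e.symm.toLinearMap, ?_, ?_⟩, fun h => LinearMap.ext fun w => hf h w⟩
  · exact LinearMap.ext fun x => e.apply_symm_apply x
  · exact LinearMap.ext fun x => e.symm_apply_apply x

/-- The implementer of an involution that inverts `H / Z` has trace `± 1`. -/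
theorem HeisenbergDatum.exists_involution [Finite H] (hd : HeisenbergDatum Z χ)
    (hirr : ω.IsIrreducible) (hω : ∀ z ∈ Z, ∀ v, ω z v = χ z • v) {t : MulAut H}
    (ht : ∀ h, χ (t h) = χ h) (ht2 : t * t = 1) (htinv : ∀ h, h * t h ∈ Z)
    (hsq : ∀ h, h * h ∈ Z → h ∈ Z) :
    ∃ τ, Implements ω t τ ∧ τ * τ = 1 ∧ LinearMap.trace ℂ Ω τ.val = 1 := by
  have := Fintype.ofFinite H
  have := ((isIrreducible_iff ω).1 hirr).1
  have hD : (Module.finrank ℂ Ω : ℂ) ≠ 0 := by exact_mod_cast Module.finrank_pos.ne'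
  -- The square of an implementer of `t` implements the identity, so it is a scalar; a square root
  -- of its inverse normalises the implementer.
  obtain ⟨τ, hτ, hτ2⟩ : ∃ τ, Implements ω t τ ∧ τ * τ = 1 := by
    obtain ⟨U, hU⟩ := hd.exists_implements hirr hω ht
    have h1 := hU.mul hU
    rw [ht2] at h1
    obtain ⟨c, hc⟩ := h1.eq_smul hirr implements_one
    have hc0 : c ≠ 0 := by
      rintro rfl
      rw [zero_smul] at hc
      exact (U * U).ne_zero hc
    obtain ⟨s, hs⟩ := IsAlgClosed.exists_pow_nat_eq c⁻¹ (n := 2) (by norm_num)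
    have hs0 : s ≠ 0 := by
      rintro rfl
      exact inv_ne_zero hc0 (by rw [← hs]; norm_num)
    refine ⟨Units.mk0 s hs0 • U, hU.smul _, ?_⟩
    apply Units.ext
    rw [Units.val_mul] at hc ⊢
    rw [Units.val_smul, smul_mul_smul_comm, hc]
    change (s * s) • c • (1 : Module.End ℂ Ω) = 1
    rw [← pow_two, hs, smul_smul, inv_mul_cancel₀ hc0, one_smul]
  -- Averaging `τ` over conjugation by `H` gives a scalar containing `tr τ`. Moving `τ` to the right
  -- in each term turns this into a formula for `∑ ω(h t(h)⁻¹)`, whose trace then contains the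
  -- square of `tr τ`.
  have htr : LinearMap.trace ℂ Ω τ.val ^ 2 = 1 := by
    have h1 : ∀ h, ω (h * t h⁻¹) * τ.val = ω h * τ.val * ω h⁻¹ := by
      intro h
      rw [mul_assoc, hτ, ← mul_assoc, ← MonoidHom.map_mul]
    have h2 : (∑ h, ω (h * t h⁻¹)) * τ.val = ((Nat.card H : ℂ) / Module.finrank ℂ Ω *
        LinearMap.trace ℂ Ω τ.val) • 1 := by
      rw [Finset.sum_mul, Finset.sum_congr rfl fun h _ => h1 h]
      refine LinearMap.ext fun w => ?_
      rw [LinearMap.sum_apply, LinearMap.smul_apply]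
      exact sum_conj_of_irreducible hirr τ.val w
    have h3 : (∑ h, ω (h * t h⁻¹)) = ((Nat.card H : ℂ) / Module.finrank ℂ Ω *
        LinearMap.trace ℂ Ω τ.val) • τ.val := by
      have := congrArg (· * τ.val) h2
      simp only [mul_assoc, smul_mul_assoc, one_mul] at this
      rwa [← Units.val_mul, hτ2, Units.val_one, mul_one] at this
    have h4 := congrArg (LinearMap.trace ℂ Ω) h3
    rw [map_sum, map_smul, smul_eq_mul] at h4
    classical
    -- As `h t(h)` lies in `Z`, the element `h t(h)⁻¹` is `h²` modulo `Z`. By `hsq` it is central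
    -- only for `h` in `Z`, and then `χ` takes the value 1 on it. The total trace is thus `dim Ω ·
    -- |Z|`.
    have h5 : ∀ h, LinearMap.trace ℂ Ω (ω (h * t h⁻¹)) =
        if h ∈ Z then (Module.finrank ℂ Ω : ℂ) else 0 := by
      intro h
      rw [hd.trace_eq hω]
      have h6 : h * t h⁻¹ = (h * t h)⁻¹ * (h * h) := by
        rw [hd.central _ (inv_mem (htinv h)), _root_.mul_inv_rev, MulEquiv.map_inv, ← mul_assoc]
        have := hd.central _ (htinv h) h
        have h7 : h * h * (t h)⁻¹ * h⁻¹ = h * (h * (t h)⁻¹ * h⁻¹) := by group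
        have h8 : t h * h = h * t h := by
          have h9 : h * t h * h = h * (h * t h) := this
          rw [mul_assoc] at h9
          exact mul_left_cancel h9
        have h10 : h * (t h)⁻¹ * h⁻¹ = (t h)⁻¹ := by
          rw [mul_inv_eq_iff_eq_mul, eq_inv_mul_iff_mul_eq, ← mul_assoc, h8, mul_assoc,
            mul_inv_cancel, mul_one]
        rw [h7, h10]
      split_ifs with hz
      · have hz' : t h⁻¹ ∈ Z := hd.mem_iff.2 (by rw [ht]; exact hd.ne_zero (inv_mem hz))
        rw [hd.map_mul h hz _ hz', ht, hd.map_inv hz, mul_inv_cancel₀ (hd.ne_zero hz), mul_one]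
      · rw [hd.map_eq_zero, mul_zero]
        intro hm
        apply hz
        apply hsq
        rw [h6] at hm
        simpa using mul_mem (htinv h) hm
    rw [Finset.sum_congr rfl fun h _ => h5 h, ← Finset.sum_filter, Finset.sum_const,
      nsmul_eq_mul] at h4
    have h6 : (Finset.univ.filter (· ∈ Z)).card = Nat.card Z := by
      rw [Nat.card_eq_fintype_card, Fintype.card_subtype]
    rw [h6] at h4
    have h7 : ((Module.finrank ℂ Ω : ℂ) ^ 2 * Nat.card Z) = Nat.card H := by
      exact_mod_cast hd.finrank_sq hirr hω
    have h8 : (Nat.card H : ℂ) ≠ 0 := by exact_mod_cast Nat.card_pos.ne'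
    field_simp at h4
    apply mul_left_cancel₀ h8
    rw [mul_one, ← h4, ← h7]
    ring
  rcases (show LinearMap.trace ℂ Ω τ.val = 1 ∨ LinearMap.trace ℂ Ω τ.val = -1 by
    simpa using htr) with h | h
  · exact ⟨τ, hτ, hτ2, h⟩
  · refine ⟨(-1 : ℂˣ) • τ, hτ.smul _, ?_, ?_⟩
    · apply Units.ext
      have : τ.val * τ.val = 1 := by rw [← Units.val_mul, hτ2, Units.val_one]
      simp [this]
    · rw [Units.val_smul, Units.smul_def, map_smul, h]
      simp

/-- The quotient of the determinants of an operator on the two eigenspaces of an involution. -/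
noncomputable def detQuotient (τ U : Module.End ℂ Ω) (h : Commute U τ) : ℂ :=
  LinearMap.det (U.restrict (p := Module.End.eigenspace τ 1) (q := Module.End.eigenspace τ 1)
      fun x hx => by
        rw [Module.End.mem_eigenspace_iff] at *
        rw [← Module.End.mul_apply, ← h.eq, Module.End.mul_apply, hx, map_smul]) /
    LinearMap.det (U.restrict (p := Module.End.eigenspace τ (-1))
      (q := Module.End.eigenspace τ (-1)) fun x hx => by
        rw [Module.End.mem_eigenspace_iff] at *
        rw [← Module.End.mul_apply, ← h.eq, Module.End.mul_apply, hx, map_smul])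

omit [FiniteDimensional ℂ Ω] in
theorem detQuotient_mul {τ U U' : Module.End ℂ Ω} (h : Commute U τ) (h' : Commute U' τ)
    (h'' : Commute (U * U') τ) :
    detQuotient τ (U * U') h'' = detQuotient τ U h * detQuotient τ U' h' := by
  rw [detQuotient, detQuotient, detQuotient, div_mul_div_comm, ← LinearMap.det_comp,
    ← LinearMap.det_comp]
  rfl

omit [FiniteDimensional ℂ Ω] in
theorem detQuotient_one {τ : Module.End ℂ Ω} (h : Commute 1 τ) : detQuotient τ 1 h = 1 := by
  have h1 : ∀ (p : Submodule ℂ Ω) (hp : ∀ x ∈ p, (1 : Module.End ℂ Ω) x ∈ p),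
      (1 : Module.End ℂ Ω).restrict hp = LinearMap.id := fun p hp => rfl
  rw [detQuotient, h1, h1, LinearMap.det_id, LinearMap.det_id, div_one]

/-- The eigenspaces are the images of the projections `(1 ± τ)/2`, with traces `(dim Ω ± 1)/2`. -/
theorem finrank_eigenspace_of_involution {τ : Module.End ℂ Ω} (h2 : τ * τ = 1)
    (htr : LinearMap.trace ℂ Ω τ = 1) : Module.finrank ℂ (Module.End.eigenspace τ 1) =
      Module.finrank ℂ (Module.End.eigenspace τ (-1)) + 1 := by
  have h2' : ∀ x, τ (τ x) = x := fun x => LinearMap.congr_fun h2 x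
  have hp : LinearMap.IsProj (Module.End.eigenspace τ 1) ((2 : ℂ)⁻¹ • (1 + τ)) := by
    refine ⟨fun x => ?_, fun x hx => ?_⟩
    · rw [Module.End.mem_eigenspace_iff]
      simp [h2', add_comm]
    · rw [Module.End.mem_eigenspace_iff, one_smul] at hx
      rw [LinearMap.smul_apply, LinearMap.add_apply, hx, Module.End.one_apply, ← two_smul ℂ x,
        smul_smul]
      norm_num
  have hq : LinearMap.IsProj (Module.End.eigenspace τ (-1)) ((2 : ℂ)⁻¹ • (1 - τ)) := by
    refine ⟨fun x => ?_, fun x hx => ?_⟩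
    · rw [Module.End.mem_eigenspace_iff]
      simp [h2', ← smul_neg]
    · rw [Module.End.mem_eigenspace_iff, neg_one_smul] at hx
      rw [LinearMap.smul_apply, LinearMap.sub_apply, hx, Module.End.one_apply, sub_neg_eq_add,
        ← two_smul ℂ x, smul_smul]
      norm_num
  have h3 := hp.trace
  have h4 := hq.trace
  rw [map_smul, map_add, LinearMap.trace_one, htr, smul_eq_mul] at h3
  rw [map_smul, map_sub, LinearMap.trace_one, htr, smul_eq_mul] at h4
  have h5 : (Module.finrank ℂ (Module.End.eigenspace τ 1) : ℂ) =
      Module.finrank ℂ (Module.End.eigenspace τ (-1)) + 1 := by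
    rw [← h3, ← h4]
    ring
  exact_mod_cast h5

/-- The eigenspaces have dimensions `m + 1` and `m`, so scaling changes the determinants by
`c^(m+1)` and `c^m`. Consequently exactly one multiple of an invertible `U` has quotient 1. -/
theorem detQuotient_smul {τ U : Module.End ℂ Ω} (h2 : τ * τ = 1)
    (htr : LinearMap.trace ℂ Ω τ = 1) (h : Commute U τ) {c : ℂ} (hc : c ≠ 0)
    (h' : Commute (c • U) τ) : detQuotient τ (c • U) h' = c * detQuotient τ U h := by
  have h1 : ∀ (p : Submodule ℂ Ω) (hp : ∀ x ∈ p, (c • U) x ∈ p) (hp' : ∀ x ∈ p, U x ∈ p),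
      (c • U).restrict hp = c • U.restrict hp' := fun p hp hp' => rfl
  rw [detQuotient, detQuotient, h1 _ _ (fun x hx => by
        rw [Module.End.mem_eigenspace_iff] at *
        rw [← Module.End.mul_apply, ← h.eq, Module.End.mul_apply, hx, map_smul]), h1 _ _ (fun x hx => by
        rw [Module.End.mem_eigenspace_iff] at *
        rw [← Module.End.mul_apply, ← h.eq, Module.End.mul_apply, hx, map_smul]),
    LinearMap.det_smul, LinearMap.det_smul, finrank_eigenspace_of_involution h2 htr, pow_succ']
  rw [mul_assoc, mul_div_assoc, mul_div_mul_left _ _ (pow_ne_zero _ hc)]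

/-- The Heisenberg representation extends canonically to any group acting on `H` and commuting with
the involution `t`. -/
theorem HeisenbergDatum.exists_extension [Finite H] (hd : HeisenbergDatum Z χ)
    (hirr : ω.IsIrreducible) (hω : ∀ z ∈ Z, ∀ v, ω z v = χ z • v) {t : MulAut H}
    (ht : ∀ h, χ (t h) = χ h) (ht2 : t * t = 1) (htinv : ∀ h, h * t h ∈ Z)
    (hsq : ∀ h, h * h ∈ Z → h ∈ Z) {Q : Type v} [Group Q] (a : Q →* MulAut H)
    (ha : ∀ q h, χ (a q h) = χ h) (hat : ∀ q, a q * t = t * a q) :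
    ∃ ω' : Representation ℂ Q Ω, (∀ q h, ω' q * ω h = ω (a q h) * ω' q) ∧
      ∀ q, a q = 1 → ω' q = 1 := by
  obtain ⟨τ, hτ, hτ2, htr⟩ := hd.exists_involution hirr hω ht ht2 htinv hsq
  have hτ2' : τ.val * τ.val = 1 := by rw [← Units.val_mul, hτ2, Units.val_one]
  -- Since `a q` commutes with `t`, the conjugate of `τ` by `U` also implements `t` and is a
  -- multiple of `τ`. Both have trace 1, so they are equal.
  have hcomm : ∀ q U, Implements ω (a q) U → Commute U.val τ.val := by
    intro q U hU
    have h1 := (hU.mul hτ).mul hU.inv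
    rw [hat, mul_inv_cancel_right] at h1
    obtain ⟨c, hc⟩ := h1.eq_smul hirr hτ
    have h2 : LinearMap.trace ℂ Ω (U * τ * U⁻¹).val = LinearMap.trace ℂ Ω τ.val := by
      rw [Units.val_mul, LinearMap.trace_mul_comm, ← Units.val_mul, inv_mul_cancel_left]
    rw [hc, map_smul, htr, smul_eq_mul, mul_one] at h2
    rw [h2, one_smul] at hc
    have h3 : U * τ * U⁻¹ = τ := Units.ext hc
    have h4 : U * τ = τ * U := mul_inv_eq_iff_eq_mul.1 h3
    exact congrArg Units.val h4
  have hne : ∀ U : (Module.End ℂ Ω)ˣ, ∀ h : Commute U.val τ.val, detQuotient τ.val U.val h ≠ 0 := by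
    intro U h h0
    have h' : Commute U⁻¹.val τ.val := h.units_inv_left
    have := detQuotient_mul h h' (by rw [Units.mul_inv]; exact Commute.one_left _)
    rw [h0, zero_mul] at this
    simp only [Units.mul_inv] at this
    rw [detQuotient_one] at this
    exact one_ne_zero this
  -- Implementers are unique up to a scalar, and the condition on the determinants selects a single
  -- one.
  have hex : ∀ q, ∃ U, Implements ω (a q) U ∧ ∃ h, detQuotient τ.val U.val h = 1 := by
    intro q
    obtain ⟨U, hU⟩ := hd.exists_implements hirr hω (ha q)
    have h := hcomm q U hU
    have hU' := hU.smul (Units.mk0 _ (inv_ne_zero (hne U h)))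
    refine ⟨_, hU', hcomm q _ hU', ?_⟩
    have := detQuotient_smul hτ2' htr h (inv_ne_zero (hne U h)) (hcomm q _ hU')
    rw [inv_mul_cancel₀ (hne U h)] at this
    exact this
  have huniq : ∀ q U U', Implements ω (a q) U → Implements ω (a q) U' →
      (∃ h, detQuotient τ.val U.val h = 1) → (∃ h, detQuotient τ.val U'.val h = 1) → U = U' := by
    rintro q U U' hU hU' ⟨h, h1⟩ ⟨h', h1'⟩
    obtain ⟨c, hc⟩ := hU.eq_smul hirr hU'
    have hc0 : c ≠ 0 := by
      rintro rfl
      have := ((isIrreducible_iff ω).1 hirr).1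
      rw [zero_smul] at hc
      exact U.ne_zero hc
    have h2 := detQuotient_smul hτ2' htr h' hc0 (hc ▸ h)
    rw [h1', mul_one] at h2
    have h3 : c = 1 := by
      rw [← h2, ← h1]
      congr 1
      exact hc.symm
    rw [h3, one_smul] at hc
    exact Units.ext hc
  choose U hU hU1 using hex
  have hone : ∀ q, a q = 1 → U q = 1 := by
    intro q hq
    refine huniq q _ _ (hU q) ?_ (hU1 q) ⟨Commute.one_left _, detQuotient_one _⟩
    rw [hq]
    exact implements_one
  -- Products of normalised implementers are normalised implementers, so uniqueness yields a genuine
  -- homomorphism rather than a projective one.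
  refine ⟨{ toFun := fun q => (U q).val, map_one' := ?_, map_mul' := ?_ }, hU, ?_⟩
  · rw [hone 1 (by simp), Units.val_one]
  · intro q q'
    rw [← Units.val_mul]
    congr 1
    have h1 := (hU q).mul (hU q')
    rw [← MonoidHom.map_mul] at h1
    refine huniq _ _ _ (hU _) h1 (hU1 _) ?_
    obtain ⟨h, e⟩ := hU1 q
    obtain ⟨h', e'⟩ := hU1 q'
    have hc : Commute ((U q).val * (U q').val) τ.val := h.mul_left h'
    refine ⟨hc, ?_⟩
    have := detQuotient_mul h h' hc
    rw [e, e', one_mul] at this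
    exact this
  · intro q hq
    change (U q).val = 1
    rw [hone q hq, Units.val_one]

end Heisenberg

/-! ### Filtered groups with an involution -/

section Ev

variable {G : Type u} [Group G] {N : Subgroup G}

open Classical in
/-- The value of a character of a subgroup at an element of the group (`1` outside the subgroup). -/
noncomputable def ev (θ : N →* ℂˣ) (x : G) : ℂˣ := if h : x ∈ N then θ ⟨x, h⟩ else 1

theorem ev_coe (θ : N →* ℂˣ) (x : N) : ev θ x = θ x := by simp [ev]

theorem ev_of_mem (θ : N →* ℂˣ) {x : G} (hx : x ∈ N) : ev θ x = θ ⟨x, hx⟩ := by simp [ev, hx]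

theorem ev_mul (θ : N →* ℂˣ) {x y : G} (hx : x ∈ N) (hy : y ∈ N) :
    ev θ (x * y) = ev θ x * ev θ y := by
  rw [ev_of_mem θ hx, ev_of_mem θ hy, ev_of_mem θ (mul_mem hx hy), ← map_mul]
  rfl

theorem ev_one (θ : N →* ℂˣ) : ev θ (1 : G) = 1 := by
  rw [ev_of_mem θ (one_mem N)]
  exact map_one θ

theorem ev_inv (θ : N →* ℂˣ) {x : G} (hx : x ∈ N) : ev θ x⁻¹ = (ev θ x)⁻¹ := by
  rw [ev_of_mem θ hx, ev_of_mem θ (inv_mem hx), ← map_inv]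
  rfl

theorem ev_pow (θ : N →* ℂˣ) {x : G} (hx : x ∈ N) (n : ℕ) : ev θ (x ^ n) = ev θ x ^ n := by
  rw [ev_of_mem θ hx, ev_of_mem θ (pow_mem hx n), ← map_pow]
  rfl

end Ev

/-- The subgroup of fixed points of an automorphism. -/
def fixedSubgroup {G : Type u} [Group G] (T : MulAut G) : Subgroup G where
  carrier := {g | T g = g}
  one_mem' := map_one T
  mul_mem' {x y} hx hy := by
    change T (x * y) = x * y
    rw [map_mul, hx, hy]
  inv_mem' {x} hx := by
    change T x⁻¹ = x⁻¹
    rw [map_inv, hx]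

/-- An element that is congruent to its image under an involution modulo a subgroup with square
roots is congruent to a fixed point. -/
theorem exists_fixed_mul_of_sqrt {G : Type u} [Group G] {T : MulAut G} (hT : ∀ g, T (T g) = g)
    {N : Subgroup G} {m : ℕ} (hm : ∀ x ∈ N, x ^ m * x ^ m = x) {g : G} (hg : g⁻¹ * T g ∈ N) :
    ∃ y ∈ N, T y = y⁻¹ ∧ g * y ∈ fixedSubgroup T := by
  set x := g⁻¹ * T g with hx
  have hTx : T x = x⁻¹ := by
    rw [hx, map_mul, hT, map_inv]
    group
  -- `x ^ m` is a square root of `x = g⁻¹ T g`, and `T` inverts it. Thus `T(g x^m) = g x x^{-m} = g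
  -- x^m`.
  refine ⟨x ^ m, pow_mem hg m, by rw [map_pow, hTx, inv_pow], ?_⟩
  change T (g * x ^ m) = g * x ^ m
  rw [map_mul, map_pow, hTx, inv_pow, mul_inv_eq_iff_eq_mul, mul_assoc, hm x hg, hx,
    mul_inv_cancel_left]

/-- A stable subgroup with square roots is the product of its fixed and its inverted elements. -/
theorem card_eq_fixed_mul_inverted {G : Type u} [Group G] [Finite G] {T : MulAut G}
    (hT : ∀ g, T (T g) = g) {N : Subgroup G} (hN : ∀ x ∈ N, T x ∈ N) {m : ℕ}
    (hm : ∀ x ∈ N, x ^ m * x ^ m = x) :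
    Nat.card N = Nat.card (N ⊓ fixedSubgroup T : Subgroup G) *
      Nat.card {y // y ∈ N ∧ T y = y⁻¹} := by
  rw [← Nat.card_prod]
  symm
  refine Nat.card_congr (Equiv.ofBijective
    (fun x : (N ⊓ fixedSubgroup T : Subgroup G) × {y // y ∈ N ∧ T y = y⁻¹} =>
      (⟨x.1 * x.2, mul_mem x.1.2.1 x.2.2.1⟩ : N)) ⟨?_, ?_⟩)
  · rintro ⟨⟨l, hl⟩, ⟨y, hy⟩⟩ ⟨⟨l', hl'⟩, ⟨y', hy'⟩⟩ h
    have h1 : l * y = l' * y' := congrArg Subtype.val h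
    have hTl : T l = l := hl.2
    have hTl' : T l' = l' := hl'.2
    -- The product `l y` determines `y²`, and squaring is injective because `x ^ m` inverts it.
    have e1 : (T (l * y))⁻¹ * (l * y) = y * y := by
      rw [map_mul, hTl, hy.2]
      group
    have e2 : (T (l' * y'))⁻¹ * (l' * y') = y' * y' := by
      rw [map_mul, hTl', hy'.2]
      group
    rw [h1, e2] at e1
    have h2 : y = y' := by
      rw [← hm y hy.1, ← hm y' hy'.1, ← (Commute.refl y).mul_pow, ← (Commute.refl y').mul_pow, e1]
    subst h2
    have h3 := mul_right_cancel h1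
    subst h3
    rfl
  · rintro ⟨x, hx⟩
    obtain ⟨y, hy, hTy, hxy⟩ := exists_fixed_mul_of_sqrt hT hm
      (mul_mem (inv_mem hx) (hN x hx))
    exact ⟨(⟨x * y, mul_mem hx hy, hxy⟩, ⟨y⁻¹, inv_mem hy, by rw [map_inv, hTy]⟩),
      Subtype.ext (mul_inv_cancel_right _ _)⟩

/-- A finite group with an involution `T` and a `T`-stable filtration `K` by normal subgroups, and a
`T`-invariant character `φ` of the last nontrivial step, such that the commutator pairings
with values in `φ` are nondegenerate on the part inverted by `T`. -/
structure FilteredInvolution {G : Type u} [Group G] (T : MulAut G) (K : ℕ → Subgroup G) (ℓ : ℕ)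
    (φ : K (ℓ - 1) →* ℂˣ) (M : ℕ) : Prop where
  two_le : 2 ≤ ℓ
  invol : ∀ g, T (T g) = g
  normal : ∀ i, (K i).Normal
  anti : Antitone K
  eq_bot : K ℓ = ⊥
  stable : ∀ i, ∀ x ∈ K i, T x ∈ K i
  comm : ∀ i j, 1 ≤ i → 1 ≤ j → ∀ x ∈ K i, ∀ y ∈ K j, x * y * x⁻¹ * y⁻¹ ∈ K (i + j)
  odd : Odd (Nat.card (K 1))
  map_invol : ∀ x ∈ K (ℓ - 1), ev φ (T x) = ev φ x
  nondeg : ∀ i, 1 ≤ i → i + 2 ≤ ℓ → ∀ z ∈ K i, T z = z⁻¹ →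
    (∀ s ∈ K (ℓ - 1 - i), ev φ (s * z * s⁻¹ * z⁻¹) = 1) → z ∈ K (i + 1)
  stab : ∀ g, (∀ x ∈ K (ℓ - 1), ev φ (g * x * g⁻¹) = ev φ x) → g⁻¹ * T g ∈ K 1
  pos : 0 < M
  card : ∀ i, 1 ≤ i → i ≤ ℓ →
    Nat.card (K i) = Nat.card (K i ⊓ fixedSubgroup T : Subgroup G) * M ^ (2 * (ℓ - i))

/-- A `T`-invariant extension of `φ`. -/
structure InvariantExtension {G : Type u} [Group G] (T : MulAut G) {K : ℕ → Subgroup G} {ℓ : ℕ}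
    (φ : K (ℓ - 1) →* ℂˣ) {a : ℕ} (θ : K a →* ℂˣ) : Prop where
  ext : ∀ x ∈ K (ℓ - 1), ev θ x = ev φ x
  inv : ∀ x ∈ K a, ev θ (T x) = ev θ x

namespace FilteredInvolution

variable {G : Type u} [Group G] {T : MulAut G} {K : ℕ → Subgroup G} {ℓ : ℕ}
    {φ : K (ℓ - 1) →* ℂˣ} {M : ℕ} (hF : FilteredInvolution T K ℓ φ M)

include hF

theorem conj_mem {i : ℕ} (g : G) {x : G} (hx : x ∈ K i) : g * x * g⁻¹ ∈ K i :=
  (hF.normal i).conj_mem x hx g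

theorem exists_sqrt [Finite G] : ∃ m : ℕ, ∀ x ∈ K 1, x ^ m * x ^ m = x := by
  obtain ⟨k, hk⟩ := hF.odd
  -- With `|K 1| = 2k + 1`, the power `k + 1` extracts square roots.
  refine ⟨k + 1, fun x hx => ?_⟩
  have h1 : (⟨x, hx⟩ : K 1) ^ Nat.card (K 1) = 1 := pow_card_eq_one'
  have h2 : x ^ Nat.card (K 1) = 1 := congrArg Subtype.val h1
  rw [← pow_add, show k + 1 + (k + 1) = Nat.card (K 1) + 1 by omega, pow_succ, h2, one_mul]

theorem mem_of_sq_mem [Finite G] {N : Subgroup G} {x : G} (hx : x ∈ K 1) (h : x * x ∈ N) :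
    x ∈ N := by
  obtain ⟨m, hm⟩ := hF.exists_sqrt
  have h1 := hm x hx
  rw [← pow_two, ← pow_mul, mul_comm, pow_mul, pow_two] at h1
  rw [← h1]
  exact pow_mem h m

theorem eq_one_of_sq [Finite G] {i : ℕ} (hi : 1 ≤ i) (θ : K i →* ℂˣ) {x : G} (hx : x ∈ K i)
    (h : ev θ x * ev θ x = 1) : ev θ x = 1 := by
  obtain ⟨m, hm⟩ := hF.exists_sqrt
  have h1 := hm x (hF.anti hi hx)
  rw [← h1, ev_mul θ (pow_mem hx m) (pow_mem hx m), ev_pow θ hx, ← mul_pow, h, one_pow]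

/-- An element that is congruent to its image under `T` is congruent to a fixed point. -/
theorem exists_fixed_mul [Finite G] {N : Subgroup G} (hN : N ≤ K 1) {g : G}
    (hg : g⁻¹ * T g ∈ N) :
    ∃ y ∈ N, T y = y⁻¹ ∧ g * y ∈ fixedSubgroup T := by
  obtain ⟨m, hm⟩ := hF.exists_sqrt
  exact exists_fixed_mul_of_sqrt hF.invol (fun x hx => hm x (hN hx)) hg

theorem conj_eq_self {a b : ℕ} (hab : a + b = ℓ) (ha : 1 ≤ a) (hb : 1 ≤ b) {x y : G}
    (hx : x ∈ K b) (hy : y ∈ K a) : x * y * x⁻¹ = y := by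
  have h := hF.comm b a hb ha x hx y hy
  rw [add_comm, hab, hF.eq_bot, Subgroup.mem_bot, mul_inv_eq_one] at h
  exact h

/-- `T`-invariant characters that are conjugate under `g` force `g` to be `T`-fixed modulo `K b`. -/
theorem inv_mul_mem [Finite G] {a b : ℕ} (hab : a + b = ℓ) (hb : 1 ≤ b) (hba : b ≤ a)
    {θ θ' : K a →* ℂˣ} (hθ : InvariantExtension T φ θ) (hθ' : InvariantExtension T φ θ') {g : G}
    (hg : ∀ x ∈ K a, ev θ' (g * x * g⁻¹) = ev θ x) : g⁻¹ * T g ∈ K b := by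
  have hl : K (ℓ - 1) ≤ K a := hF.anti (by omega)
  set y := g⁻¹ * T g with hy
  have hTy : T y = y⁻¹ := by
    rw [hy, map_mul, hF.invol, map_inv]
    group
  -- Both characters are `T`-invariant, so `T g` conjugates them as `g` does, and `y = g⁻¹ T g`
  -- stabilises `θ`.
  have hstab : ∀ x ∈ K a, ev θ (y * x * y⁻¹) = ev θ x := by
    intro x hx
    rw [← hg _ (hF.conj_mem y hx), ← hθ.inv x hx, ← hg _ (hF.stable a x hx),
      ← hθ'.inv _ (hF.conj_mem g (hF.stable a x hx))]
    congr 1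
    rw [hy, map_mul, map_mul, hF.invol, map_inv]
    group
  have h1 : y ∈ K 1 := by
    refine hF.stab g fun x hx => ?_
    rw [← hθ'.ext _ (hF.conj_mem g hx), hg x (hl hx), hθ.ext x hx]
  -- Climb the filtration: while `i < b`, the group `K (ℓ-1-i)` lies in `K a`. Stabilising `θ`
  -- therefore makes the commutator pairing with `y` trivial, and `nondeg` moves `y` to the next
  -- step.
  have key : ∀ i, 1 ≤ i → i ≤ b → y ∈ K i := by
    intro i hi
    induction i, hi using Nat.le_induction with
    | base => exact fun _ => h1
    | succ i hi ih =>
      intro hib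
      have hyi := ih (by omega)
      refine hF.nondeg i hi (by omega) y hyi hTy fun s hs => ?_
      have hs' : s ∈ K a := hF.anti (by omega) hs
      have h2 := hF.comm _ i (by omega) hi s hs y hyi
      rw [Nat.sub_add_cancel (by omega)] at h2
      rw [← hθ.ext _ h2, show s * y * s⁻¹ * y⁻¹ = s * (y * s⁻¹ * y⁻¹) by group,
        ev_mul θ hs' (hF.conj_mem y (inv_mem hs')), hstab _ (inv_mem hs'), ev_inv θ hs',
        mul_inv_cancel]
  exact key b hb le_rfl

/-- The stabiliser of a character. -/
def stabilizer {a : ℕ} (θ : K a →* ℂˣ) : Subgroup G where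
  carrier := {g | ∀ x ∈ K a, ev θ (g * x * g⁻¹) = ev θ x}
  one_mem' := by simp
  mul_mem' {g h} hg hh x hx := by
    rw [← hh x hx, ← hg _ (hF.conj_mem h hx)]
    congr 1
    group
  inv_mem' {g} hg x hx := by
    rw [← hg _ (hF.conj_mem g⁻¹ hx)]
    congr 1
    group

theorem mem_stabilizer {a : ℕ} {θ : K a →* ℂˣ} {g : G} :
    g ∈ hF.stabilizer θ ↔ ∀ x ∈ K a, ev θ (g * x * g⁻¹) = ev θ x := Iff.rfl

theorem le_stabilizer {a b : ℕ} (hab : a + b = ℓ) (ha : 1 ≤ a) (hb : 1 ≤ b)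
    (θ : K a →* ℂˣ) : K b ≤ hF.stabilizer θ := fun g hg x hx => by
  rw [hF.conj_eq_self hab ha hb hg hx]

/-- The elements of `K b` that are inverted by `T` modulo `K a`. -/
def invertedSubgroup {a b : ℕ} (hb : 1 ≤ b) (hba : a ≤ 2 * b) : Subgroup G where
  carrier := {h | h ∈ K b ∧ h * T h ∈ K a}
  one_mem' := ⟨one_mem _, by simp⟩
  mul_mem' {h h'} hh hh' := by
    refine ⟨mul_mem hh.1 hh'.1, ?_⟩
    -- Moving `h'` past `T h` costs a commutator in `K (2b)`, which lies in `K a`.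
    have h1 := hF.comm b b hb hb _ (inv_mem (hF.stable b h hh.1)) h' hh'.1
    have h2 : h * h' * T (h * h') =
        h * T h * ((T h)⁻¹ * h' * (T h)⁻¹⁻¹ * h'⁻¹) * (h' * T h') := by
      rw [map_mul]
      group
    rw [h2]
    exact mul_mem (mul_mem hh.2 (hF.anti (by omega) h1)) hh'.2
  inv_mem' {h} hh := by
    refine ⟨inv_mem hh.1, ?_⟩
    have h1 := inv_mem (hF.conj_mem h⁻¹ hh.2)
    have h2 : h⁻¹ * T h⁻¹ = (h⁻¹ * (h * T h) * h⁻¹⁻¹)⁻¹ := by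
      rw [map_inv]
      group
    rw [h2]
    exact h1

open Classical in
/-- The commutator pairing on the inverted subgroup is nondegenerate. -/
theorem heisenbergDatum [Finite G] {a b : ℕ} (hab : a + b = ℓ) (hb : 1 ≤ b) (hba : a ≤ 2 * b)
    (hba' : b ≤ a) (hba'' : a ≤ b + 1)
    {θ : K a →* ℂˣ} (hθ : InvariantExtension T φ θ) :
    HeisenbergDatum ((K a).subgroupOf (hF.invertedSubgroup hb hba))
      (fun h => if (h : G) ∈ K a then (ev θ h : ℂ) else 0) := by
  have hcm : ∀ h h' : hF.invertedSubgroup hb hba, (h : G) * h' * (h : G)⁻¹ * (h' : G)⁻¹ ∈ K a := fun h h' =>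
    hF.anti (by omega) (hF.comm b b hb hb _ h.2.1 _ h'.2.1)
  refine ⟨?_, ?_, ?_, ?_, ?_, ?_⟩
  · intro z hz h
    apply Subtype.ext
    have := hF.conj_eq_self hab (by omega) hb h.2.1 (Subgroup.mem_subgroupOf.1 hz)
    rw [mul_inv_eq_iff_eq_mul] at this
    exact this.symm
  · exact fun h h' => Subgroup.mem_subgroupOf.2 (hcm h h')
  · simp [ev_one]
  · intro z hz z' hz'
    rw [Subgroup.mem_subgroupOf] at hz hz'
    simp only [Subgroup.coe_mul, if_pos hz, if_pos hz', if_pos (mul_mem hz hz'), ev_mul θ hz hz',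
      Units.val_mul]
  · intro h hh
    rw [Subgroup.mem_subgroupOf] at hh
    exact if_neg hh
  · intro h hh
    rw [Subgroup.mem_subgroupOf]
    have hh' : ∀ h' ∈ hF.invertedSubgroup hb hba, ev θ (h' * h * h'⁻¹ * (h : G)⁻¹) = 1 := by
      intro h' hh'
      have := hh ⟨h', hh'⟩
      rw [if_pos (show ((⟨h', hh'⟩ * h * ⟨h', hh'⟩⁻¹ * h⁻¹ :
        hF.invertedSubgroup hb hba) : G) ∈ K a from hcm ⟨h', hh'⟩ h)] at this
      exact Units.ext this
    -- For even `ℓ` one has `a = b`, so there is nothing to prove. Otherwise `a = b + 1`, and by odd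
    -- order it suffices to place `h²` in `K a`; it differs from `z⁻¹`, with `z = h⁻¹ T h`, by the
    -- element `h T h` of `K a`.
    rcases hba'.eq_or_lt with he | hlt
    · exact he ▸ h.2.1
    have hab' : b + 1 = a := by omega
    have h1 : (h : G) ∈ K 1 := hF.anti hb h.2.1
    apply hF.mem_of_sq_mem h1
    set z := (h : G)⁻¹ * T h with hz
    have hTz : T z = z⁻¹ := by
      rw [hz, map_mul, hF.invol, map_inv]
      group
    have hzb : z ∈ K b := mul_mem (inv_mem h.2.1) (hF.stable b _ h.2.1)
    have hcz : ∀ s ∈ K b, ∀ x ∈ K b, s * x * s⁻¹ * x⁻¹ ∈ K a := fun s hs x hx =>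
      hF.anti (by omega) (hF.comm b b hb hb s hs x hx)
    -- the pairing is multiplicative
    have hmulr : ∀ s ∈ K b, ∀ x ∈ K b, ∀ y ∈ K b, ev θ (s * (x * y) * s⁻¹ * (x * y)⁻¹) =
        ev θ (s * x * s⁻¹ * x⁻¹) * ev θ (s * y * s⁻¹ * y⁻¹) := by
      intro s hs x hx y hy
      rw [← ev_mul θ (hcz s hs x hx) (hcz s hs y hy)]
      congr 1
      have := hF.conj_eq_self hab (by omega) hb hx (hcz s hs y hy)
      calc _ = s * x * s⁻¹ * x⁻¹ * (x * (s * y * s⁻¹ * y⁻¹) * x⁻¹) := by group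
        _ = _ := by rw [this]
    have hmull : ∀ s ∈ K b, ∀ t ∈ K b, ∀ x ∈ K b, ev θ (s * t * x * (s * t)⁻¹ * x⁻¹) =
        ev θ (s * x * s⁻¹ * x⁻¹) * ev θ (t * x * t⁻¹ * x⁻¹) := by
      intro s hs t ht x hx
      rw [mul_comm, ← ev_mul θ (hcz t ht x hx) (hcz s hs x hx)]
      congr 1
      have := hF.conj_eq_self hab (by omega) hb hs (hcz t ht x hx)
      calc _ = (s * (t * x * t⁻¹ * x⁻¹) * s⁻¹) * (s * x * s⁻¹ * x⁻¹) := by group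
        _ = _ := by rw [this]
    -- `z` is trivially paired with the inverted subgroup
    have hz1 : ∀ h' ∈ hF.invertedSubgroup hb hba, ev θ (h' * z * h'⁻¹ * z⁻¹) = 1 := by
      intro h' hh''
      have e1 : z = ((h : G)⁻¹ * (h : G)⁻¹) * (h * T h) := by rw [hz]; group
      have e2 := hmulr h' hh''.1 _ (mul_mem (inv_mem h.2.1) (inv_mem h.2.1)) _
        (hF.anti hba' h.2.2)
      have e3 := hmulr h' hh''.1 _ (inv_mem h.2.1) _ (inv_mem h.2.1)
      have e4 := hmulr h' hh''.1 _ (inv_mem h.2.1) _ h.2.1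
      rw [inv_mul_cancel, hh' h' hh''] at e4
      have e5 : ev θ (h' * (h * T h) * h'⁻¹ * (h * T h)⁻¹) = 1 := by
        rw [hF.conj_eq_self hab (by omega) hb hh''.1 h.2.2, mul_inv_cancel, ev_one]
      have e6 : h' * 1 * h'⁻¹ * 1⁻¹ = 1 := by group
      rw [e6, ev_one, mul_one] at e4
      rw [e1, e2, e3, e5, ← e4]
      simp
    -- For any `s` in `K b` the element `s (T s)⁻¹` lies in the inverted subgroup. Invariance of `θ`
    -- and `T z = z⁻¹` make its pairing with `z` the square of the pairing of `s` with `z`, and odd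
    -- order removes the square. This passes from the inverted subgroup to all of `K b`, as `nondeg`
    -- requires.
    have hz2 : ∀ s ∈ K b, ev θ (s * z * s⁻¹ * z⁻¹) = 1 := by
      intro s hs
      have hTs := hF.stable b s hs
      have hm : s * (T s)⁻¹ ∈ hF.invertedSubgroup hb hba := by
        refine ⟨mul_mem hs (inv_mem hTs), ?_⟩
        rw [map_mul, map_inv, hF.invol]
        have : s * (T s)⁻¹ * (T s * s⁻¹) = 1 := by group
        rw [this]
        exact one_mem _
      have e1 := hz1 _ hm
      rw [hmull s hs _ (inv_mem hTs) z hzb] at e1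
      have e2 := hmull _ hTs _ (inv_mem hTs) z hzb
      rw [mul_inv_cancel, show 1 * z * 1⁻¹ * z⁻¹ = 1 by group, ev_one] at e2
      have e3 : ev θ (T s * z * (T s)⁻¹ * z⁻¹) = ev θ (s * z⁻¹ * s⁻¹ * z⁻¹⁻¹) := by
        rw [← hθ.inv _ (hcz s hs _ (inv_mem hzb))]
        congr 1
        simp only [map_mul, map_inv, hTz, inv_inv]
      have e4 := hmulr s hs _ (inv_mem hzb) z hzb
      rw [inv_mul_cancel, show s * 1 * s⁻¹ * 1⁻¹ = 1 by group, ev_one] at e4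
      apply hF.eq_one_of_sq (by omega) θ (hcz s hs z hzb)
      rw [e3] at e2
      have e5 : ev θ (T s⁻¹ * z * (T s⁻¹)⁻¹ * z⁻¹) = ev θ (s * z * s⁻¹ * z⁻¹) := by
        rw [map_inv]
        apply mul_left_cancel (a := ev θ (s * z⁻¹ * s⁻¹ * z⁻¹⁻¹))
        rw [← e2, ← e4]
      rw [map_inv] at e5
      rw [e5] at e1
      exact e1
    have hz3 : z ∈ K a := by
      rw [← hab']
      refine hF.nondeg b hb (by omega) z hzb hTz fun s hs => ?_
      have hs' : s ∈ K b := by rwa [show ℓ - 1 - b = b by omega] at hs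
      have h2 := hF.comm _ b (by omega) hb s hs z hzb
      rw [Nat.sub_add_cancel (by omega)] at h2
      rw [← hθ.ext _ h2, hz2 s hs']
    have h3 : (h : G) * h = (h * T h) * z⁻¹ := by
      rw [hz]
      group
    rw [h3]
    exact mul_mem h.2.2 (inv_mem hz3)

end FilteredInvolution

/-- The hypothesis says `C = A B`. A choice of `y s` in `B` with `s * y s` in `A` gives the
bijection `(s, k) ↦ (s · y s · k, k⁻¹ · (y s)⁻¹)`; the product of the two coordinates recovers `s`.
-/
theorem card_mul_card_inf {G : Type u} [Group G] (A B C : Subgroup G) (hA : A ≤ C) (hB : B ≤ C)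
    (h : ∀ s ∈ C, ∃ y ∈ B, s * y ∈ A) :
    Nat.card C * Nat.card (A ⊓ B : Subgroup G) = Nat.card A * Nat.card B := by
  choose! y hyB hyA using h
  rw [← Nat.card_prod, ← Nat.card_prod]
  refine Nat.card_congr (Equiv.ofBijective (fun x : C × (A ⊓ B : Subgroup G) => ((⟨x.1 * y x.1 * x.2, mul_mem
    (hyA _ x.1.2) x.2.2.1⟩, ⟨(x.2 : G)⁻¹ * (y x.1)⁻¹,
      mul_mem (inv_mem x.2.2.2) (inv_mem (hyB _ x.1.2))⟩) : A × B)) ⟨?_, ?_⟩)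
  · rintro ⟨⟨s, hs⟩, ⟨k, hk⟩⟩ ⟨⟨s', hs'⟩, ⟨k', hk'⟩⟩ h
    simp only [Prod.mk.injEq, Subtype.mk.injEq] at h
    obtain ⟨h1, h2⟩ := h
    have h3 : s = s' := by
      have := congrArg₂ (· * ·) h1 h2
      simpa [mul_assoc] using this
    subst h3
    simpa using h2
  · rintro ⟨⟨q, hq⟩, ⟨b, hb⟩⟩
    have hs : q * b ∈ C := mul_mem (hA hq) (hB hb)
    refine ⟨(⟨q * b, hs⟩, ⟨(y (q * b))⁻¹ * b⁻¹, ?_, B.mul_mem (B.inv_mem (hyB _ hs)) (B.inv_mem hb)⟩), ?_⟩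
    · have := mul_mem (inv_mem (hyA _ hs)) hq
      have e : (q * b * y (q * b))⁻¹ * q = (y (q * b))⁻¹ * b⁻¹ := by group
      exact e ▸ this
    · ext1
      · ext1
        simp [mul_assoc]
      · ext1
        simp

/-- The inclusion of a subgroup cut down to another subgroup. -/
def subgroupOfIncl {G : Type u} [Group G] (N L : Subgroup G) : N.subgroupOf L →* N where
  toFun x := ⟨x, x.2⟩
  map_one' := rfl
  map_mul' _ _ := rfl

namespace FilteredInvolution

variable {G : Type u} [Group G] {T : MulAut G} {K : ℕ → Subgroup G} {ℓ : ℕ}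
    {φ : K (ℓ - 1) →* ℂˣ} {M : ℕ} (hF : FilteredInvolution T K ℓ φ M)

/-- The restriction of a character to the fixed points of `T`. -/
def fixedRestrict (T : MulAut G) {N : Subgroup G} (θ : N →* ℂˣ) :
    N.subgroupOf (fixedSubgroup T) →* ℂˣ :=
  θ.comp (subgroupOfIncl N (fixedSubgroup T))

theorem fixedRestrict_apply {N : Subgroup G} (θ : N →* ℂˣ)
    (x : N.subgroupOf (fixedSubgroup T)) : fixedRestrict T θ x = ev θ (x : G) := by
  rw [ev_of_mem θ (show (x : G) ∈ N from x.2)]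
  rfl

include hF

theorem cliffordDatum {a : ℕ} (θ : K a →* ℂˣ)
    (hKS : K a ≤ hF.stabilizer θ) :
    CliffordDatum (hF.stabilizer θ).subtype (Subgroup.inclusion hKS) θ where
  inj := Subtype.val_injective
  normal g n := ⟨⟨g * n * g⁻¹, hF.conj_mem g n.2⟩, rfl⟩
  inj' := Subgroup.inclusion_injective hKS
  stab g := by
    rw [Subgroup.range_subtype, mem_stabilizer]
    constructor
    · intro h x hx
      rw [ev_of_mem θ hx, ev_of_mem θ (hF.conj_mem g hx)]
      exact h ⟨x, hx⟩ ⟨_, hF.conj_mem g hx⟩ rfl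
    · intro h n n' hn
      rw [← ev_coe, ← ev_coe, ← h n n.2]
      congr 1

theorem mul_map_mem {a b : ℕ} (hab : a + b = ℓ) (hb : 1 ≤ b) (hba : b ≤ a) {x : G}
    (hx : x ∈ K a) : x * T x ∈ (K a) ⊓ fixedSubgroup T := by
  refine ⟨mul_mem hx (hF.stable _ _ hx), ?_⟩
  change T (x * T x) = x * T x
  rw [map_mul, hF.invol]
  have := hF.conj_eq_self hab (hb.trans hba) hb (hF.anti hba hx) (hF.stable _ _ hx)
  rw [mul_inv_eq_iff_eq_mul] at this
  exact this.symm

/-- Invariant characters that are conjugate on the fixed points are conjugate. -/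
theorem conj_of_fixed_conj [Finite G] {a b : ℕ} (hab : a + b = ℓ) (hb : 1 ≤ b) (hba : b ≤ a)
    {θ θ' : K a →* ℂˣ} (hθ : InvariantExtension T φ θ) (hθ' : InvariantExtension T φ θ') {g : G}
    (hTg : T g = g)
    (h : ∀ x ∈ K a ⊓ fixedSubgroup T, ev θ' (g * x * g⁻¹) = ev θ x) {x : G} (hx : x ∈ K a) :
    ev θ' (g * x * g⁻¹) = ev θ x := by
  have h2 := h _ (hF.mul_map_mem hab hb hba hx)
  have hgx := hF.conj_mem g hx
  have hgT := hF.conj_mem g (hF.stable _ _ hx)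
  have e1 : ∀ y, g * T y * g⁻¹ = T (g * y * g⁻¹) := fun y => by
    rw [map_mul, map_mul, map_inv, hTg]
  have e2 : g * (x * T x) * g⁻¹ = (g * x * g⁻¹) * (g * T x * g⁻¹) := by group
  rw [e2, ev_mul θ' hgx hgT, e1, hθ'.inv _ hgx, ev_mul θ hx (hF.stable _ _ hx), hθ.inv _ hx] at h2
  obtain ⟨m, hm⟩ := hF.exists_sqrt
  -- On the fixed element `x T(x)` an invariant character takes the square of its value at `x`.
  -- Square roots in `K 1` recover the value from its square.
  have h3 : ∀ (η : K a →* ℂˣ) (y : G), y ∈ K a → ev η y = (ev η y * ev η y) ^ m := by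
    intro η y hy
    conv_lhs => rw [← hm y (hF.anti (hb.trans hba) hy)]
    rw [ev_mul η (pow_mem hy m) (pow_mem hy m), ev_pow η hy, mul_pow]
  rw [h3 θ' _ hgx, h2, ← h3 θ x hx]

/-- An invariant character is determined by its restriction to the fixed points, so the stabiliser
of the restriction in `L` is exactly `S ∩ L`. -/
theorem cliffordDatum_fixed [Finite G] {a b : ℕ} (hab : a + b = ℓ) (hb : 1 ≤ b) (hba : b ≤ a)
    {θ : K a →* ℂˣ} (hθ : InvariantExtension T φ θ)
    (hKS : (K a).subgroupOf (fixedSubgroup T) ≤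
      (hF.stabilizer θ).subgroupOf (fixedSubgroup T)) :
    CliffordDatum ((hF.stabilizer θ).subgroupOf (fixedSubgroup T)).subtype
      (Subgroup.inclusion hKS) (fixedRestrict T θ) where
  inj := Subtype.val_injective
  normal g n := ⟨⟨g * n * g⁻¹, hF.conj_mem g.1 n.2⟩, rfl⟩
  inj' := Subgroup.inclusion_injective hKS
  stab g := by
    rw [Subgroup.range_subtype, Subgroup.mem_subgroupOf, mem_stabilizer]
    constructor
    · intro h x hx
      refine hF.conj_of_fixed_conj hab hb hba hθ hθ g.2 (fun y hy => ?_) hx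
      have h2 := h ⟨⟨y, hy.2⟩, hy.1⟩ ⟨g * ⟨y, hy.2⟩ * g⁻¹, hF.conj_mem g.1 hy.1⟩ rfl
      rw [fixedRestrict_apply, fixedRestrict_apply] at h2
      exact h2
    · intro h n n' hn
      rw [fixedRestrict_apply, fixedRestrict_apply, ← h n n.2]
      congr 1
      exact congrArg Subtype.val hn

/-- The involution on the inverted subgroup. -/
def invertedAut {a b : ℕ} (hb : 1 ≤ b) (hba : a ≤ 2 * b) :
    MulAut (hF.invertedSubgroup hb hba) :=
  have hT : ∀ h ∈ hF.invertedSubgroup hb hba, T h ∈ hF.invertedSubgroup hb hba := fun h hh => by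
    refine ⟨hF.stable _ _ hh.1, ?_⟩
    rw [hF.invol]
    have := hF.conj_mem h⁻¹ hh.2
    simpa [mul_assoc] using this
  { toFun := fun h => ⟨T h, hT h h.2⟩
    invFun := fun h => ⟨T h, hT h h.2⟩
    left_inv := fun h => Subtype.ext (hF.invol h)
    right_inv := fun h => Subtype.ext (hF.invol h)
    map_mul' := fun h h' => Subtype.ext (map_mul T _ _) }

/-- The conjugation action of the fixed points on the inverted subgroup. -/
def invertedConj {a b : ℕ} (hb : 1 ≤ b) (hba : a ≤ 2 * b) :
    fixedSubgroup T →* MulAut (hF.invertedSubgroup hb hba) :=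
  have hT : ∀ g ∈ fixedSubgroup T, ∀ h ∈ hF.invertedSubgroup hb hba,
      g * h * g⁻¹ ∈ hF.invertedSubgroup hb hba := fun g hg h hh => by
    refine ⟨hF.conj_mem g hh.1, ?_⟩
    have h1 := hF.conj_mem g hh.2
    have hg' : T g = g := hg
    rw [map_mul, map_mul, map_inv, hg']
    have e : g * h * g⁻¹ * (g * T h * g⁻¹) = g * (h * T h) * g⁻¹ := by group
    rwa [e]
  { toFun := fun g =>
      { toFun := fun h => ⟨g * h * (g : G)⁻¹, hT g g.2 h h.2⟩
        invFun := fun h => ⟨(g : G)⁻¹ * h * (g : G)⁻¹⁻¹, hT _ (inv_mem g.2) h h.2⟩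
        left_inv := fun h => Subtype.ext (by simp [mul_assoc])
        right_inv := fun h => Subtype.ext (by simp [mul_assoc])
        map_mul' := fun h h' => Subtype.ext (by simp [mul_assoc]) }
    map_one' := by
      ext h
      simp
    map_mul' := fun g g' => by
      ext h
      simp [mul_assoc] }

theorem coe_invertedConj {a b : ℕ} (hb : 1 ≤ b) (hba : a ≤ 2 * b) (g : fixedSubgroup T)
    (h : hF.invertedSubgroup hb hba) :
    (hF.invertedConj hb hba g h : G) = g * h * (g : G)⁻¹ := rfl

theorem le_invertedSubgroup {a b : ℕ} (hb : 1 ≤ b) (hba : a ≤ 2 * b) (hba' : b ≤ a) :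
    K a ≤ hF.invertedSubgroup hb hba := fun _ hx =>
  ⟨hF.anti hba' hx, mul_mem hx (hF.stable _ _ hx)⟩

/-- For fixed `x` the condition `x T(x) ∈ K a` reads `x² ∈ K a`, and `K 1` has odd order. -/
theorem fixed_inf_inverted [Finite G] {a b : ℕ} (hb : 1 ≤ b) (hba : a ≤ 2 * b) {x : G}
    (hx : x ∈ fixedSubgroup T) (hx' : x ∈ hF.invertedSubgroup hb hba) : x ∈ K a := by
  apply hF.mem_of_sq_mem (hF.anti hb hx'.1)
  have := hx'.2
  rwa [show T x = x from hx] at this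

/-- Correcting by a square root shows `K b = (K b ∩ L) H`, and the two factors meet in `K a ∩ L`.
The exponent comes from the count for `K b`, as `ℓ - b = a`. -/
theorem card_inverted [Finite G] {a b : ℕ} (hab : a + b = ℓ) (hb : 1 ≤ b) (hba : a ≤ 2 * b)
    (hba' : b ≤ a) : Nat.card (hF.invertedSubgroup hb hba) =
      Nat.card (K a ⊓ fixedSubgroup T : Subgroup G) * M ^ (2 * a) := by
  have h1 := card_mul_card_inf (K b ⊓ fixedSubgroup T) (hF.invertedSubgroup hb hba) (K b)
    inf_le_left (fun _ hx => hx.1) (fun s hs => by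
      obtain ⟨y, hy, hTy, hsy⟩ := hF.exists_fixed_mul (hF.anti hb)
        (mul_mem (inv_mem hs) (hF.stable b s hs))
      exact ⟨y, ⟨hy, by rw [hTy, mul_inv_cancel]; exact one_mem _⟩, mul_mem hs hy, hsy⟩)
  have h2 : K b ⊓ fixedSubgroup T ⊓ hF.invertedSubgroup hb hba = K a ⊓ fixedSubgroup T := by
    ext x
    constructor
    · exact fun hx => ⟨hF.fixed_inf_inverted hb hba hx.1.2 hx.2, hx.1.2⟩
    · exact fun hx => ⟨⟨hF.anti hba' hx.1, hx.2⟩, hF.le_invertedSubgroup hb hba hba' hx.1⟩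
  rw [h2, hF.card b hb (by omega), mul_assoc] at h1
  have h3 := Nat.eq_of_mul_eq_mul_left Nat.card_pos h1
  rw [← h3, show ℓ - b = a by omega, mul_comm]

/-- The factorisation `S = (S ∩ L) H` holds because an element of `S` is `T`-fixed modulo `K b` by
`inv_mul_mem`. -/
theorem card_stabilizer [Finite G] {a b : ℕ} (hab : a + b = ℓ) (hb : 1 ≤ b) (hba : a ≤ 2 * b)
    (hba' : b ≤ a) {θ : K a →* ℂˣ} (hθ : InvariantExtension T φ θ) :
    Nat.card (hF.stabilizer θ) =
      Nat.card ((hF.stabilizer θ).subgroupOf (fixedSubgroup T)) * M ^ (2 * a) := by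
  have hbS := hF.le_stabilizer hab (hb.trans hba') hb θ
  have h1 := card_mul_card_inf (hF.stabilizer θ ⊓ fixedSubgroup T) (hF.invertedSubgroup hb hba)
    (hF.stabilizer θ) inf_le_left (fun _ hx => hbS hx.1) (fun s hs => by
      obtain ⟨y, hy, hTy, hsy⟩ := hF.exists_fixed_mul (hF.anti hb)
        (hF.inv_mul_mem hab hb hba' hθ hθ hs)
      exact ⟨y, ⟨hy, by rw [hTy, mul_inv_cancel]; exact one_mem _⟩, mul_mem hs (hbS hy), hsy⟩)
  have h2 : hF.stabilizer θ ⊓ fixedSubgroup T ⊓ hF.invertedSubgroup hb hba =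
      K a ⊓ fixedSubgroup T := by
    ext x
    constructor
    · exact fun hx => ⟨hF.fixed_inf_inverted hb hba hx.1.2 hx.2, hx.1.2⟩
    · exact fun hx => ⟨⟨hbS (hF.anti hba' hx.1), hx.2⟩, hF.le_invertedSubgroup hb hba hba' hx.1⟩
  have h3 : Nat.card ((hF.stabilizer θ).subgroupOf (fixedSubgroup T)) =
      Nat.card (hF.stabilizer θ ⊓ fixedSubgroup T : Subgroup G) := by
    rw [← Subgroup.inf_subgroupOf_right]
    exact Nat.card_congr (Subgroup.subgroupOfEquivOfLe inf_le_right).toEquiv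
  rw [h2, hF.card_inverted hab hb hba hba', ← h3, mul_comm (Nat.card (K a ⊓ _ : Subgroup G)),
    ← mul_assoc] at h1
  exact Nat.eq_of_mul_eq_mul_right Nat.card_pos h1

open Classical in
-- The Heisenberg representation of the inverted subgroup extends canonically to `S ∩ L`, and
-- tensoring with it is the correspondence. The factor `M ^ (a - b)` is its dimension: 1 for even
-- `ℓ`, `M` for odd `ℓ`.
theorem exists_equiv_stabilizer [Finite G] {a b : ℕ} (hab : a + b = ℓ) (hb : 1 ≤ b)
    (hba : a ≤ 2 * b) (hba' : b ≤ a) (hba'' : a ≤ b + 1) {θ : K a →* ℂˣ}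
    (hθ : InvariantExtension T φ θ) (hKS : K a ≤ hF.stabilizer θ)
    (hKS' : (K a).subgroupOf (fixedSubgroup T) ≤
      (hF.stabilizer θ).subgroupOf (fixedSubgroup T)) :
    ∃ e : Irr.over (Subgroup.inclusion hKS) θ ≃
      Irr.over (Subgroup.inclusion hKS') (fixedRestrict T θ),
      ∀ χ, χ.1.dim = M ^ (a - b) * (e χ).1.dim := by
  have ha := hb.trans hba'
  have hd := hF.heisenbergDatum hab hb hba hba' hba'' hθ
  obtain ⟨ω, hω⟩ := hd.exists_irrRep
  have hHS : hF.invertedSubgroup hb hba ≤ hF.stabilizer θ := fun _ hx => hF.le_stabilizer hab ha hb θ hx.1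
  -- The elements of `S ∩ L` are `T`-fixed, so their conjugation action on the inverted subgroup
  -- commutes with `T`. The lemma also makes `ω'` trivial wherever that action is trivial.
  obtain ⟨ω', hω', hω1⟩ := hd.exists_extension ω.irr hω (t := hF.invertedAut hb hba) (by
      intro h
      change (if T (h : G) ∈ K a then (ev θ (T (h : G)) : ℂ) else 0) =
        if (h : G) ∈ K a then (ev θ (h : G) : ℂ) else 0
      by_cases hh : (h : G) ∈ K a
      · rw [if_pos hh, if_pos (hF.stable _ _ hh), hθ.inv _ hh]
      · rw [if_neg hh, if_neg]
        intro h1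
        have := hF.stable _ _ h1
        rw [hF.invol] at this
        exact hh this) (by
      ext h
      exact hF.invol h) (fun h => h.2.2)
      (fun h hh => hF.mem_of_sq_mem (hF.anti hb h.2.1) hh)
      (Q := (hF.stabilizer θ).subgroupOf (fixedSubgroup T))
      ((hF.invertedConj hb hba).comp (Subgroup.subtype _)) (by
      intro q h
      have hq : (q : G) ∈ hF.stabilizer θ := q.2
      change (if (q : G) * h * (q : G)⁻¹ ∈ K a then (ev θ ((q : G) * h * (q : G)⁻¹) : ℂ) else 0) =
        if (h : G) ∈ K a then (ev θ (h : G) : ℂ) else 0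
      by_cases hh : (h : G) ∈ K a
      · rw [if_pos hh, if_pos (hF.conj_mem _ hh), hq _ hh]
      · rw [if_neg hh, if_neg]
        intro h1
        have := hF.conj_mem (q : G)⁻¹ h1
        apply hh
        simpa [mul_assoc] using this) (by
      intro q
      ext h
      have hq : T (q : G) = q := q.1.2
      change (q : G) * T h * (q : G)⁻¹ = T (q * h * (q : G)⁻¹)
      rw [map_mul, map_mul, map_inv, hq])
  have hmem : ∀ (q : (hF.stabilizer θ).subgroupOf (fixedSubgroup T)) (h : hF.invertedSubgroup hb hba),
      (subgroupOfIncl (hF.stabilizer θ) (fixedSubgroup T)) q = Subgroup.inclusion hHS h →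
      (q : G) = h ∧ (h : G) ∈ K a := by
    intro q h he
    have h1 : (q : G) = h := congrArg Subtype.val he
    exact ⟨h1, hF.fixed_inf_inverted hb hba (h1 ▸ q.1.2) h.2⟩
  -- The common elements lie in `K a ∩ L`. They centralise the inverted subgroup, so `ω'` is 1 there
  -- while `ω` is the scalar `θ`; this is why the correction `c` is `θ`.
  have hE : ExtensionDatum (subgroupOfIncl (hF.stabilizer θ) (fixedSubgroup T))
      (Subgroup.inclusion hHS) ω.ρ ω' (fun q => (ev θ (q : G) : ℂ)) := by
    refine ⟨ω.irr, fun q h => ⟨_, Subtype.ext rfl, hω' q h⟩, ?_, ?_⟩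
    · intro s
      obtain ⟨y, hy, hTy, hsy⟩ := hF.exists_fixed_mul (hF.anti hb)
        (hF.inv_mul_mem hab hb hba' hθ hθ s.2)
      have hyH : y ∈ hF.invertedSubgroup hb hba := ⟨hy, by rw [hTy, mul_inv_cancel]; exact one_mem _⟩
      exact ⟨⟨⟨s * y, hsy⟩, mul_mem s.2 (hHS hyH)⟩, ⟨y⁻¹, inv_mem hyH⟩,
        Subtype.ext (mul_inv_cancel_right _ _).symm⟩
    · intro q h he
      obtain ⟨h1, h2⟩ := hmem q h he
      rw [hω1 q]
      · refine LinearMap.ext fun v => ?_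
        have := hω h (Subgroup.mem_subgroupOf.2 h2) v
        rw [if_pos h2] at this
        rw [this, h1]
        rfl
      · ext x
        rw [MonoidHom.comp_apply, coe_invertedConj]
        change (q : G) * x * (q : G)⁻¹ = x
        rw [h1]
        have := hF.conj_eq_self hab ha hb x.2.1 h2
        rw [mul_inv_eq_iff_eq_mul] at this ⊢
        exact this.symm
  obtain ⟨e, he⟩ := hE.exists_equiv
  have h1 : Irr.containing (Subgroup.inclusion hHS) ω.ρ = Irr.over (Subgroup.inclusion hKS) θ := by
    ext χ
    rw [← Irr.mk_rep χ, Irr.mem_containing_iff, Irr.mem_over_iff, Submodule.ne_bot_iff]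
    constructor
    · rintro ⟨f, hf, hf0⟩
      obtain ⟨w, hw⟩ : ∃ w, f w ≠ 0 := by
        by_contra! h
        exact hf0 (LinearMap.ext h)
      refine ⟨f w, hw, fun n => ?_⟩
      have e1 := hf ⟨n, hF.le_invertedSubgroup hb hba hba' n.2⟩ w
      rw [hω ⟨n, hF.le_invertedSubgroup hb hba hba' n.2⟩ (Subgroup.mem_subgroupOf.2 n.2) w,
        if_pos n.2, map_smul, ev_coe] at e1
      exact e1.symm
    · rintro ⟨v, hv0, hv⟩
      obtain ⟨f, hf0, hf⟩ := hd.exists_hom ω.irr hω (ρ := χ.rep.ρ.comp (Subgroup.inclusion hHS))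
        hv0 (fun z hz => by
          have hz' := Subgroup.mem_subgroupOf.1 hz
          rw [if_pos hz', ev_of_mem θ hz', ← hv ⟨z, hz'⟩]
          rfl)
      exact ⟨f, hf, hf0⟩
  have h2 : Irr.scalarOn (subgroupOfIncl (hF.stabilizer θ) (fixedSubgroup T))
      (Subgroup.inclusion hHS) (fun q => (ev θ (q : G) : ℂ)) =
      Irr.over (Subgroup.inclusion hKS') (fixedRestrict T θ) := by
    ext χ
    rw [← Irr.mk_rep χ, Irr.mem_scalarOn_iff, Irr.mem_over_iff]
    constructor
    · intro h
      have := ((isIrreducible_iff _).1 χ.rep.irr).1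
      obtain ⟨w, hw⟩ := exists_ne (0 : Fin χ.rep.dim → ℂ)
      refine ⟨w, hw, fun n => ?_⟩
      rw [fixedRestrict_apply]
      exact h (Subgroup.inclusion hKS' n) ⟨n, hF.le_invertedSubgroup hb hba hba' n.2⟩ rfl w
    · intro h q x hq w
      obtain ⟨h1, h2⟩ := hmem q x hq
      have := (hF.cliffordDatum_fixed hab hb hba' hθ hKS').smul_of_mem χ.rep.irr h
        ⟨q.1, by rw [Subgroup.mem_subgroupOf, h1]; exact h2⟩ w
      rw [fixedRestrict_apply] at this
      exact this
  refine ⟨(Equiv.setCongr h1.symm).trans (e.trans (Equiv.setCongr h2)), fun χ => ?_⟩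
  -- The index of `K a` in the inverted subgroup is `M^{2a} / M^{2(ℓ-a)} = M^{2(a-b)}`, which is the
  -- square of the dimension.
  have hdim : Module.finrank ℂ (Fin ω.dim → ℂ) = M ^ (a - b) := by
    have e1 := hd.finrank_sq ω.irr hω
    rw [hF.card_inverted hab hb hba hba', Nat.card_congr (Subgroup.subgroupOfEquivOfLe
      (hF.le_invertedSubgroup hb hba hba')).toEquiv, hF.card a ha (by omega), mul_comm,
      mul_assoc, show 2 * a = 2 * (ℓ - a) + (a - b) * 2 by omega, pow_add, pow_mul M (a - b)] at e1
    have e2 := Nat.eq_of_mul_eq_mul_left Nat.card_pos e1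
    have e3 := Nat.eq_of_mul_eq_mul_left (pow_pos hF.pos _) e2
    exact Nat.pow_left_injective two_ne_zero e3
  have := (he ((Equiv.setCongr h1.symm) χ)).2
  rw [hdim] at this
  exact this

/-- The Clifford correspondence in `G`, the tensor correspondence for the stabiliser and the inverse
Clifford correspondence in `L` are composed. The index contributes `M^{2a}` and the tensor factor
takes back `M^{a-b}`, leaving `M^{a+b} = M^ℓ`. -/
theorem exists_equiv_of_invariant [Finite G] {a b : ℕ} (hab : a + b = ℓ) (hb : 1 ≤ b)
    (hba : a ≤ 2 * b) (hba' : b ≤ a) (hba'' : a ≤ b + 1) {θ : K a →* ℂˣ}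
    (hθ : InvariantExtension T φ θ) :
    ∃ e : Irr.over (K a).subtype θ ≃
      Irr.over ((K a).subgroupOf (fixedSubgroup T)).subtype (fixedRestrict T θ),
      ∀ χ, (Nat.card (fixedSubgroup T) : ℝ) * M ^ ℓ * χ.1.dim = Nat.card G * (e χ).1.dim := by
  have ha := hb.trans hba'
  have hKS : K a ≤ hF.stabilizer θ := (hF.anti hba').trans (hF.le_stabilizer hab ha hb θ)
  have hKS' : (K a).subgroupOf (fixedSubgroup T) ≤
      (hF.stabilizer θ).subgroupOf (fixedSubgroup T) := fun _ hx => hKS hx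
  obtain ⟨e₁, h₁⟩ := (hF.cliffordDatum θ hKS).exists_equiv
  obtain ⟨e₂, h₂⟩ := (hF.cliffordDatum_fixed hab hb hba' hθ hKS').exists_equiv
  obtain ⟨e, h⟩ := hF.exists_equiv_stabilizer hab hb hba hba' hba'' hθ hKS hKS'
  refine ⟨e₁.trans (e.trans e₂.symm), fun χ => ?_⟩
  have r1 := h₁ χ
  have r2 := h₂ (e₂.symm (e (e₁ χ)))
  have r3 := h (e₁ χ)
  rw [Equiv.apply_symm_apply] at r2
  rw [hF.card_stabilizer hab hb hba hba' hθ, r3] at r1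
  push_cast at r1
  have hM : (0 : ℝ) < M := by exact_mod_cast hF.pos
  have hS : (0 : ℝ) < Nat.card ((hF.stabilizer θ).subgroupOf (fixedSubgroup T)) := by
    exact_mod_cast Nat.card_pos
  have hpow : (M : ℝ) ^ (2 * a) = M ^ ℓ * M ^ (a - b) := by
    rw [← pow_add]
    congr 1
    omega
  rw [hpow] at r1
  apply mul_left_cancel₀ (mul_pos hS (pow_pos hM (a - b))).ne'
  change _ = _ * ((Nat.card G : ℝ) * ((e₂.symm (e (e₁ χ))).1.dim : ℝ))
  linear_combination (Nat.card (fixedSubgroup T) : ℝ) * r1 - (M : ℝ) ^ (a - b) * Nat.card G * r2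

end FilteredInvolution

/-! ### Conjugate characters, extension to abelian subgroups and gluing of bijections. -/

section Conj

variable {G : Type u} [Group G] {N : Subgroup G}

theorem Irr.mem_over_subtype_iff (θ : N →* ℂˣ) (π : IrrRep G) :
    Irr.mk π ∈ Irr.over N.subtype θ ↔
      ∃ v, v ≠ 0 ∧ ∀ n ∈ N, π.ρ n v = (ev θ n : ℂ) • v := by
  rw [Irr.mem_over_iff]
  refine exists_congr fun v => and_congr_right fun _ => ?_
  constructor
  · intro h n hn
    rw [ev_of_mem θ hn]
    exact h ⟨n, hn⟩
  · intro h n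
    rw [← ev_coe]
    exact h n n.2

/-- The characters of a normal subgroup below an irreducible representation are conjugate. -/
theorem exists_conj_of_mem_over [Finite G] [hN : N.Normal] {θ θ' : N →* ℂˣ} {χ : Irr G}
    (h : χ ∈ Irr.over N.subtype θ) (h' : χ ∈ Irr.over N.subtype θ') :
    ∃ g, ∀ x ∈ N, ev θ' (g * x * g⁻¹) = ev θ x := by
  rw [← Irr.mk_rep χ, Irr.mem_over_subtype_iff] at h
  rw [← Irr.mk_rep χ, Irr.mem_over_iff] at h'
  obtain ⟨v, hv0, hv⟩ := h
  obtain ⟨w, hw0, hw⟩ := h'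
  set ρ := χ.rep.ρ
  set p := charProj (ρ.comp N.subtype) θ' with hp
  -- The translates of `v` span the representation, so the nonzero projection to the `θ'`-eigenspace
  -- cannot kill all of them.
  have hne : ∃ g, p (ρ g v) ≠ 0 := by
    by_contra! hall
    have htop := eq_top_of_stable χ.rep.irr (Submodule.span ℂ (Set.range fun g => ρ g v)) (by
      intro g u hu
      induction hu using Submodule.span_induction with
      | mem u hu =>
        obtain ⟨g', rfl⟩ := hu
        refine Submodule.subset_span ⟨g * g', ?_⟩
        simp only [map_mul]
        rfl
      | zero => simp
      | add x y _ _ hx hy =>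
        rw [map_add]
        exact add_mem hx hy
      | smul c x _ hx =>
        rw [map_smul]
        exact Submodule.smul_mem _ _ hx) (Submodule.subset_span ⟨1, by simp⟩) hv0
    have hw' : w ∈ LinearMap.ker p := by
      have : (⊤ : Submodule ℂ _) ≤ LinearMap.ker p := by
        rw [← htop, Submodule.span_le]
        rintro _ ⟨g, rfl⟩
        exact hall g
      exact this trivial
    rw [LinearMap.mem_ker, hp, charProj_eq_self (mem_charSpace.2 hw)] at hw'
    exact hw0 hw'
  obtain ⟨g, hg⟩ := hne
  refine ⟨g, fun x hx => ?_⟩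
  have hgv : ρ g v ∈ charSpace (ρ.comp N.subtype)
      (θ.comp (MulAut.conjNormal (H := N) g⁻¹).toMonoidHom) := by
    rw [mem_charSpace]
    intro n
    have h1 := hv (g⁻¹ * n * g) (by simpa using hN.conj_mem n n.2 g⁻¹)
    have h2 : ρ n (ρ g v) = ρ g (ρ (g⁻¹ * n * g) v) := by
      rw [← Module.End.mul_apply, ← Module.End.mul_apply, ← map_mul, ← map_mul]
      congr 2
      group
    change ρ n (ρ g v) = _
    have h4 : ((MulAut.conjNormal (H := N) g⁻¹ n : N) : G) = g⁻¹ * n * g := by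
      rw [MulAut.conjNormal_apply, inv_inv]
    rw [h2, h1, map_smul, ← h4, ev_coe]
    rfl
  -- `ρ g v` is an eigenvector for a conjugate of `θ`; a nonzero projection onto the `θ'`-eigenspace
  -- forces equality of the two characters.
  have heq : θ' = θ.comp (MulAut.conjNormal (H := N) g⁻¹).toMonoidHom := by
    by_contra hne
    exact hg (charProj_eq_zero hgv hne)
  have hgx := hN.conj_mem x hx g
  rw [ev_of_mem θ' hgx, heq, ev_of_mem θ hx, MonoidHom.comp_apply]
  congr 1
  ext1
  change (MulAut.conjNormal (H := N) g⁻¹ _ : N).1 = _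
  rw [MulAut.conjNormal_apply]
  group

theorem over_subset_of_conj [hN : N.Normal] {θ θ' : N →* ℂˣ} {g : G}
    (hg : ∀ x ∈ N, ev θ' (g * x * g⁻¹) = ev θ x) :
    Irr.over N.subtype θ ⊆ Irr.over N.subtype θ' := by
  intro χ h
  rw [← Irr.mk_rep χ, Irr.mem_over_subtype_iff] at h ⊢
  obtain ⟨v, hv0, hv⟩ := h
  refine ⟨χ.rep.ρ g v, fun h0 => hv0 ?_, fun n hn => ?_⟩
  · rw [← inv_apply_apply_rep χ.rep.ρ g v, h0, map_zero]
  · have hm : g⁻¹ * n * g ∈ N := by simpa using hN.conj_mem n hn g⁻¹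
    have h2 : χ.rep.ρ n (χ.rep.ρ g v) = χ.rep.ρ g (χ.rep.ρ (g⁻¹ * n * g) v) := by
      rw [← Module.End.mul_apply, ← Module.End.mul_apply, ← map_mul, ← map_mul]
      congr 2
      group
    rw [h2, hv _ hm, map_smul, ← hg _ hm]
    congr 4
    group

theorem over_eq_of_conj [N.Normal] {θ θ' : N →* ℂˣ} {g : G}
    (hg : ∀ x ∈ N, ev θ' (g * x * g⁻¹) = ev θ x) :
    Irr.over N.subtype θ = Irr.over N.subtype θ' := by
  refine (over_subset_of_conj hg).antisymm (over_subset_of_conj (g := g⁻¹) fun x hx => ?_)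
  have hm : g⁻¹ * x * g⁻¹⁻¹ ∈ N := Subgroup.Normal.conj_mem ‹_› x hx g⁻¹
  rw [← hg _ hm]
  congr 1
  group

/-- A character below a representation extends to any larger abelian subgroup. -/
theorem exists_extension_mem_over {N' : Subgroup G} (hN : N ≤ N')
    (hcomm : ∀ x ∈ N', ∀ y ∈ N', x * y = y * x) {φ : N →* ℂˣ} {χ : Irr G}
    (h : χ ∈ Irr.over N.subtype φ) :
    ∃ θ : N' →* ℂˣ, (∀ x ∈ N, ev θ x = ev φ x) ∧ χ ∈ Irr.over N'.subtype θ := by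
  rw [← Irr.mk_rep χ, Irr.mem_over_iff] at h
  obtain ⟨v, hv0, hv⟩ := h
  set ρ := χ.rep.ρ
  set U := charSpace (ρ.comp N.subtype) φ with hU
  have hst : ∀ x : N', ∀ u ∈ U, ρ x u ∈ U := by
    intro x u hu
    rw [hU, mem_charSpace] at hu ⊢
    intro n
    have h2 : ρ n (ρ x u) = ρ x (ρ n u) := by
      rw [← Module.End.mul_apply, ← Module.End.mul_apply, ← map_mul, ← map_mul,
        hcomm _ (hN n.2) _ x.2]
    change ρ n (ρ x u) = _
    have h3 : ρ n u = _ := hu n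
    rw [h2, h3, map_smul]
  let τ : Representation ℂ N' U :=
    { toFun := fun x => (ρ x).restrict (hst x)
      map_one' := by
        ext u
        simp
      map_mul' := fun x y => by
        ext u
        simp }
  have : Nontrivial U := ⟨⟨⟨v, mem_charSpace.2 hv⟩, 0, fun h => hv0 (congrArg Subtype.val h)⟩⟩
  obtain ⟨W, hW⟩ := exists_irreducible_sub τ
  -- The larger group is abelian, so by Schur it acts through scalars on an irreducible piece of the
  -- `φ`-eigenspace; these scalars are the extension.
  have hsc : ∀ x : N', ∃ c : ℂ, ∀ w, W.toRepresentation x w = c • w := fun x => by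
    refine exists_eq_smul_of_commute hW (W.toRepresentation x) fun y w => ?_
    rw [← Module.End.mul_apply, ← Module.End.mul_apply, ← map_mul, ← map_mul]
    congr 2
    exact Subtype.ext (hcomm _ x.2 _ y.2)
  choose c hc using hsc
  have := ((isIrreducible_iff _).1 hW).1
  obtain ⟨w, hw⟩ := exists_ne (0 : W.toSubmodule)
  have hinj : ∀ {c c' : ℂ}, c • w = c' • w → c = c' := fun h => smul_left_injective ℂ hw h
  let θ₀ : N' →* ℂ :=
    { toFun := c
      map_one' := hinj (by rw [← hc, map_one, one_smul]; rfl)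
      map_mul' := fun x y => hinj (by
        rw [← hc, map_mul, Module.End.mul_apply, hc, hc, smul_smul]) }
  refine ⟨θ₀.toHomUnits, fun x hx => ?_, ?_⟩
  · ext
    rw [ev_of_mem _ (hN hx), ev_of_mem _ hx]
    apply hinj
    change c ⟨x, hN hx⟩ • w = _
    rw [← hc]
    apply Subtype.ext
    apply Subtype.ext
    have := mem_charSpace.1 w.1.2 ⟨x, hx⟩
    exact this
  · rw [← Irr.mk_rep χ, Irr.mem_over_iff]
    refine ⟨w.1.1, fun h0 => hw (Subtype.ext (Subtype.ext h0)), fun n => ?_⟩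
    exact congrArg (fun u => (u.1.1 : Fin χ.rep.dim → ℂ)) (hc n w)

/-- Pieces that meet coincide, and so do their partners. The unions are therefore disjoint unions
over classes of indices, and one bijection per class glues. The choice `r` of an index in each class
is needed because equal pieces may come with different bijections. -/
theorem exists_equiv_of_iUnion {X Y I : Type*} (A : I → Set X) (B : I → Set Y) (P : X → Y → Prop)
    (h : ∀ i, ∃ e : A i ≃ B i, ∀ x : A i, P x.1 (e x).1)
    (hA : ∀ i j, (A i ∩ A j).Nonempty → A i = A j ∧ B i = B j)
    (hB : ∀ i j, (B i ∩ B j).Nonempty → A i = A j ∧ B i = B j) :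
    ∃ e : (⋃ i, A i) ≃ (⋃ i, B i), ∀ x : ⋃ i, A i, P x.1 (e x).1 := by
  choose e he using h
  let s : Setoid I := Setoid.ker fun i => (A i, B i)
  let r : I → I := fun i => Quotient.out (Quotient.mk s i)
  have hr : ∀ i, A (r i) = A i ∧ B (r i) = B i := fun i =>
    Prod.mk.inj (Quotient.exact (Quotient.out_eq (Quotient.mk s i)))
  have hrr : ∀ i j, A i = A j ∧ B i = B j → r i = r j := fun i j hij =>
    congrArg Quotient.out (Quotient.sound (s := s) (Prod.ext hij.1 hij.2))
  have hx : ∀ x : ⋃ i, A i, ∃ i, x.1 ∈ A i := fun x => Set.mem_iUnion.1 x.2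
  choose k hk using hx
  have hk' : ∀ x, x.1 ∈ A (r (k x)) := fun x => (hr (k x)).1 ▸ hk x
  have hkr : ∀ x i, x.1 ∈ A i → r (k x) = r i := fun x i hi => hrr _ _ (hA _ _ ⟨x, hk x, hi⟩)
  refine ⟨Equiv.ofBijective (fun x => ⟨e (r (k x)) ⟨x, hk' x⟩, Set.mem_iUnion.2
    ⟨_, (e (r (k x)) ⟨x, hk' x⟩).2⟩⟩) ⟨?_, ?_⟩, fun x => he _ ⟨x, hk' x⟩⟩
  · intro x x' hxx
    have h1 : (e (r (k x)) ⟨x, hk' x⟩ : Y) = e (r (k x')) ⟨x', hk' x'⟩ := congrArg Subtype.val hxx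
    have h2 : r (k x) = r (k x') := by
      have h3 := hB (r (k x)) (r (k x')) ⟨_, (e _ ⟨x, hk' x⟩).2, h1 ▸ (e _ ⟨x', hk' x'⟩).2⟩
      refine hrr _ _ ?_
      rwa [(hr _).1, (hr _).1, (hr _).2, (hr _).2] at h3
    have h4 : ∀ i j (hi : x.1 ∈ A i) (hj : x'.1 ∈ A j), i = j →
        (e i ⟨x, hi⟩ : Y) = e j ⟨x', hj⟩ → x.1 = x'.1 := by
      rintro i _ hi hj rfl heq
      exact congrArg (fun z : A i => (z : X)) ((e i).injective (Subtype.ext heq))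
    exact Subtype.ext (h4 _ _ _ _ h2 h1)
  · rintro ⟨y, hy⟩
    obtain ⟨i, hi⟩ := Set.mem_iUnion.1 hy
    have hi' : y ∈ B (r i) := (hr i).2 ▸ hi
    set x := (e (r i)).symm ⟨y, hi'⟩ with hx
    let x' : ⋃ i, A i := ⟨x, Set.mem_iUnion.2 ⟨_, x.2⟩⟩
    refine ⟨x', Subtype.ext ?_⟩
    have h1 : r (k x') = r i := (hkr x' (r i) x.2).trans (hrr _ _ (hr i))
    have h4 : ∀ i j (hi : x.1 ∈ A i) (hj : x.1 ∈ A j), i = j →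
        (e i ⟨x, hi⟩ : Y) = e j ⟨x, hj⟩ := by
      rintro i _ hi hj rfl
      rfl
    have h5 := h4 _ _ (hk' x') x.2 h1
    change (e (r (k x')) ⟨x, hk' x'⟩ : Y) = y
    rw [h5]
    have h6 : e (r i) x = ⟨y, hi'⟩ := by rw [hx, Equiv.apply_symm_apply]
    exact congrArg Subtype.val h6

end Conj

/-- A character that is trivial on the right kernel of a pairing of finite groups is represented by
an element. -/
theorem exists_eq_of_pairing {A B : Type*} [Group A] [Group B] [Finite A] [Finite B]
    (β : A →* B →* ℂˣ) (δ : B →* ℂˣ) (h : ∀ x, (∀ s, β s x = 1) → δ x = 1) : ∃ s, β s = δ := by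
  by_contra! hne
  have := Fintype.ofFinite A
  have := Fintype.ofFinite B
  classical
  -- Summing over `B` first gives 0 if no `β s` equals `δ`. Summing over `A` first leaves only the
  -- right kernel, where `δ` is trivial, and gives `|A|` times its order, which is positive.
  have h0 : ∑ x : B, ∑ s : A, ((β s x * (δ x)⁻¹ : ℂˣ) : ℂ) = 0 := by
    rw [Finset.sum_comm]
    refine Finset.sum_eq_zero fun s _ => ?_
    refine sum_hom_units_eq_zero ((Units.coeHom ℂ).comp (β s * δ⁻¹)) (fun h => hne s ?_)
    ext x
    have h1 : ((β s x * (δ x)⁻¹ : ℂˣ) : ℂ) = 1 := DFunLike.congr_fun h x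
    rw [mul_inv_eq_one.1 (Units.ext h1)]
  have h1 : ∀ x : B, ∑ s : A, ((β s x * (δ x)⁻¹ : ℂˣ) : ℂ) =
      if ∀ s, β s x = 1 then (Fintype.card A : ℂ) else 0 := by
    intro x
    split_ifs with hx
    · rw [Finset.sum_congr rfl (g := fun _ => (1 : ℂ))]
      · simp
      · intro s _
        rw [h x hx, hx s, inv_one, one_mul, Units.val_one]
    · simp only [Units.val_mul, ← Finset.sum_mul]
      have : ∑ s, ((β s x : ℂˣ) : ℂ) = 0 :=
        sum_hom_units_eq_zero ((Units.coeHom ℂ).comp ((MonoidHom.eval x).comp β)) (fun h' => hx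
          fun s => Units.ext (DFunLike.congr_fun h' s))
      rw [this, zero_mul]
  rw [Finset.sum_congr rfl fun x _ => h1 x, ← Finset.sum_filter, Finset.sum_const,
    nsmul_eq_mul] at h0
  rcases mul_eq_zero.1 h0 with h | h
  · rw [Nat.cast_eq_zero, Finset.card_eq_zero] at h
    have : (1 : B) ∈ Finset.univ.filter fun x => ∀ s, β s x = 1 :=
      Finset.mem_filter.2 ⟨Finset.mem_univ _, fun s => map_one (β s)⟩
    rw [h] at this
    simp at this
  · exact Fintype.card_ne_zero (Nat.cast_eq_zero.1 h)

/-! ### Invariant extensions of the character and the correspondence with the fixed points. -/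

namespace FilteredInvolution

variable {G : Type u} [Group G] {T : MulAut G} {K : ℕ → Subgroup G} {ℓ : ℕ}
    {φ : K (ℓ - 1) →* ℂˣ} {M : ℕ} (hF : FilteredInvolution T K ℓ φ M)

include hF

theorem comm_mem {i j : ℕ} (hi : 1 ≤ i) (hj : 1 ≤ j) (hij : j + i = ℓ - 1) {s x : G}
    (hs : s ∈ K j) (hx : x ∈ K i) : s * x * s⁻¹ * x⁻¹ ∈ K (ℓ - 1) :=
  hij ▸ hF.comm j i hj hi s hs x hx

theorem conj_eq_self_of_last {x y : G} (hx : x ∈ K 1) (hy : y ∈ K (ℓ - 1)) :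
    x * y * x⁻¹ = y := by
  have := hF.two_le
  exact hF.conj_eq_self (a := ℓ - 1) (b := 1) (by omega) (by omega) le_rfl hx hy

/-- Commutators here lie in `K (ℓ - 1)`, which `K 1` centralises, so the commutator pairing is
multiplicative. -/
theorem ev_comm_mul_right {i j : ℕ} (hi : 1 ≤ i) (hj : 1 ≤ j) (hij : j + i = ℓ - 1) {s x y : G}
    (hs : s ∈ K j) (hx : x ∈ K i) (hy : y ∈ K i) :
    ev φ (s * (x * y) * s⁻¹ * (x * y)⁻¹) =
      ev φ (s * x * s⁻¹ * x⁻¹) * ev φ (s * y * s⁻¹ * y⁻¹) := by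
  have h1 := hF.comm_mem hi hj hij hs hy
  rw [← ev_mul φ (hF.comm_mem hi hj hij hs hx) h1]
  congr 1
  have := hF.conj_eq_self_of_last (hF.anti hi hx) h1
  calc _ = s * x * s⁻¹ * x⁻¹ * (x * (s * y * s⁻¹ * y⁻¹) * x⁻¹) := by group
    _ = _ := by rw [this]

theorem ev_comm_mul_left {i j : ℕ} (hi : 1 ≤ i) (hj : 1 ≤ j) (hij : j + i = ℓ - 1) {s t x : G}
    (hs : s ∈ K j) (ht : t ∈ K j) (hx : x ∈ K i) :
    ev φ (s * t * x * (s * t)⁻¹ * x⁻¹) =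
      ev φ (s * x * s⁻¹ * x⁻¹) * ev φ (t * x * t⁻¹ * x⁻¹) := by
  have h1 := hF.comm_mem hi hj hij ht hx
  rw [mul_comm, ← ev_mul φ h1 (hF.comm_mem hi hj hij hs hx)]
  congr 1
  have := hF.conj_eq_self_of_last (hF.anti hj hs) h1
  calc _ = (s * (t * x * t⁻¹ * x⁻¹) * s⁻¹) * (s * x * s⁻¹ * x⁻¹) := by group
    _ = _ := by rw [this]

theorem ev_comm_map {i j : ℕ} (hi : 1 ≤ i) (hj : 1 ≤ j) (hij : j + i = ℓ - 1) {s x : G}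
    (hs : s ∈ K j) (hx : x ∈ K i) :
    ev φ (T s * x * (T s)⁻¹ * x⁻¹) = ev φ (s * T x * s⁻¹ * (T x)⁻¹) := by
  rw [← hF.map_invol _ (hF.comm_mem hi hj hij hs (hF.stable _ _ hx))]
  simp only [map_mul, map_inv, hF.invol]

/-- The pairing with a fixed character of the commutator of `s` and `T s`. -/
noncomputable def commPairing {i j : ℕ} (hi : 1 ≤ i) (hj : 1 ≤ j) (hij : j + i = ℓ - 1) :
    K j →* K i →* ℂˣ := MonoidHom.mk'
  (fun s => MonoidHom.mk'
    (fun x => ev φ (s * x * (s : G)⁻¹ * (x : G)⁻¹) * (ev φ (T s * x * (T s)⁻¹ * (x : G)⁻¹))⁻¹)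
    (fun x y => by
      rw [Subgroup.coe_mul, hF.ev_comm_mul_right hi hj hij s.2 x.2 y.2,
        hF.ev_comm_mul_right hi hj hij (hF.stable _ _ s.2) x.2 y.2, mul_inv, mul_mul_mul_comm]))
  (fun s t => MonoidHom.ext fun x => by
    change ev φ (s * t * x * (s * t : G)⁻¹ * (x : G)⁻¹) *
      (ev φ (T (s * t) * x * (T (s * t))⁻¹ * (x : G)⁻¹))⁻¹ = _
    rw [map_mul, hF.ev_comm_mul_left hi hj hij s.2 t.2 x.2,
      hF.ev_comm_mul_left hi hj hij (hF.stable _ _ s.2) (hF.stable _ _ t.2) x.2, mul_inv,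
      mul_mul_mul_comm]
    rfl)

theorem commPairing_apply {i j : ℕ} (hi : 1 ≤ i) (hj : 1 ≤ j) (hij : j + i = ℓ - 1) (s : K j)
    (x : K i) : hF.commPairing hi hj hij s x =
      ev φ (s * x * (s : G)⁻¹ * (x : G)⁻¹) * (ev φ (T s * x * (T s)⁻¹ * (x : G)⁻¹))⁻¹ := rfl

/-- Trivial pairing of `x` makes `z = x⁻¹ T(x)` pair trivially with `K j`, so `z` lies in `K (i +
1)` by nondegeneracy. There `θ` is already invariant, and `T z = z⁻¹` gives `θ(z)² = 1`, hence `θ(z)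
= 1`. -/
theorem eq_one_of_commPairing [Finite G] {a : ℕ} (ha : 1 ≤ a)
    {θ : K a →* ℂˣ} {i j : ℕ} (hi : a ≤ i) (hi1 : 1 ≤ i)
    (hj : 1 ≤ j) (hij : j + i = ℓ - 1) (hinv : ∀ x ∈ K (i + 1), ev θ (T x) = ev θ x) (x : K i)
    (hx : ∀ s, hF.commPairing hi1 hj hij s x = 1) : ev θ (T x) * (ev θ x)⁻¹ = 1 := by
  have hia : K i ≤ K a := hF.anti hi
  have hTx := hF.stable _ _ x.2
  set z := (x : G)⁻¹ * T x with hz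
  have hzi : z ∈ K i := mul_mem (inv_mem x.2) hTx
  have hTz : T z = z⁻¹ := by
    rw [hz, map_mul, hF.invol, map_inv]
    group
  have hz1 : z ∈ K (i + 1) := by
    refine hF.nondeg i hi1 (by omega) z hzi hTz fun s hs => ?_
    have hs' : s ∈ K j := by rwa [show ℓ - 1 - i = j by omega] at hs
    have h1 := hx ⟨s, hs'⟩
    rw [commPairing_apply, hF.ev_comm_map hi1 hj hij hs' x.2, mul_inv_eq_one] at h1
    have h2 := hF.ev_comm_mul_right hi1 hj hij hs' x.2 hzi
    rw [hz, mul_inv_cancel_left, ← h1] at h2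
    exact (mul_eq_left.1 h2.symm)
  have hδ : ev θ (T x) * (ev θ x)⁻¹ = ev θ z := by
    rw [hz, ev_mul θ (hia (inv_mem x.2)) (hia hTx), ev_inv θ (hia x.2), mul_comm]
  rw [hδ]
  refine hF.eq_one_of_sq ha θ (hia hzi) ?_
  have := hinv z hz1
  rw [hTz, ev_inv θ (hia hzi)] at this
  rw [← mul_inv_cancel (ev θ z), this]

/-- One step of the construction of an invariant conjugate. -/
theorem exists_conj_step [Finite G] {a b : ℕ} (hab : a + b = ℓ) (hb : 1 ≤ b) (hba : b ≤ a)
    {θ : K a →* ℂˣ} (hext : ∀ x ∈ K (ℓ - 1), ev θ x = ev φ x) {i j : ℕ} (hi : a ≤ i)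
    (hj : 1 ≤ j) (hij : j + i = ℓ - 1) (hinv : ∀ x ∈ K (i + 1), ev θ (T x) = ev θ x) :
    ∃ s ∈ K j, ∀ x ∈ K i, ev θ (s * T x * s⁻¹) = ev θ (s * x * s⁻¹) := by
  have ha : 1 ≤ a := hb.trans hba
  have hi1 : 1 ≤ i := ha.trans hi
  have hia : K i ≤ K a := hF.anti hi
  have hla : K (ℓ - 1) ≤ K a := hF.anti (by omega)
  obtain ⟨δ, hδ⟩ : ∃ δ : K i →* ℂˣ, ∀ x : K i, δ x = ev θ (T x) * (ev θ x)⁻¹ :=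
    -- `δ` is the defect of invariance of `θ` on `K i`. An `s` that represents `δ` under the pairing
    -- is the required conjugating element.
    ⟨MonoidHom.mk' (fun x => ev θ (T x) * (ev θ x)⁻¹) (fun x y => by
      rw [Subgroup.coe_mul, map_mul, ev_mul θ (hia (hF.stable _ _ x.2)) (hia (hF.stable _ _ y.2)),
        ev_mul θ (hia x.2) (hia y.2), mul_inv, mul_mul_mul_comm]), fun _ => rfl⟩
  obtain ⟨s, hs⟩ := exists_eq_of_pairing (hF.commPairing hi1 hj hij) δ
    (fun x hx => hδ x ▸ hF.eq_one_of_commPairing ha hi hi1 hj hij hinv x hx)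
  refine ⟨s, s.2, fun x hx => ?_⟩
  have h1 : ev φ (s * x * (s : G)⁻¹ * x⁻¹) * (ev φ (T s * x * (T s)⁻¹ * x⁻¹))⁻¹ =
    ev θ (T x) * (ev θ x)⁻¹ := by
    have := DFunLike.congr_fun hs ⟨x, hx⟩
    rwa [hδ, commPairing_apply] at this
  -- Conjugation by `s` multiplies `θ` by the commutator pairing with `s`.
  have h2 : ∀ y ∈ K i, ev θ (s * y * (s : G)⁻¹) = ev φ (s * y * (s : G)⁻¹ * y⁻¹) * ev θ y := by
    intro y hy
    have h3 := hF.comm_mem hi1 hj hij s.2 hy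
    rw [← hext _ h3, ← ev_mul θ (hla h3) (hia hy), inv_mul_cancel_right]
  rw [h2 x hx, h2 _ (hF.stable _ _ hx), ← hF.ev_comm_map hi1 hj hij s.2 hx]
  have h3 := (mul_inv_eq_iff_eq_mul.1 h1)
  rw [h3, mul_right_comm, inv_mul_cancel_right, mul_comm]

/-- Every extension of `φ` is conjugate to a `T`-invariant one. -/
theorem exists_conj_invariant [Finite G] {a b : ℕ} (hab : a + b = ℓ) (hb : 1 ≤ b) (hba : b ≤ a)
    {θ : K a →* ℂˣ} (hext : ∀ x ∈ K (ℓ - 1), ev θ x = ev φ x) :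
    ∃ (s : G) (θ' : K a →* ℂˣ), InvariantExtension T φ θ' ∧
      ∀ x ∈ K a, ev θ (s * x * s⁻¹) = ev θ' x := by
  have ha : 1 ≤ a := hb.trans hba
  let c : G → K a →* ℂˣ := fun s => MonoidHom.mk' (fun x => ev θ (s * x * s⁻¹)) (fun x y => by
    rw [← ev_mul θ (hF.conj_mem s x.2) (hF.conj_mem s y.2)]
    congr 1
    simp)
  have hc : ∀ s, ∀ x ∈ K a, ev (c s) x = ev θ (s * x * s⁻¹) := fun s x hx => by
    rw [ev_of_mem _ hx]
    rfl
  have hcext : ∀ s ∈ K 1, ∀ x ∈ K (ℓ - 1), ev (c s) x = ev φ x := fun s hs x hx => by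
    rw [hc s x (hF.anti (by omega) hx), hF.conj_eq_self_of_last hs hx, hext x hx]
  -- Downward induction on `i`, starting at `ℓ - 1`, where `θ` is the invariant `φ`. The step from
  -- `K (i+1)` to `K i` needs a further conjugation by an element of `K (ℓ-1-i)`.
  have key : ∀ n, ∀ i, a ≤ i → i + n = ℓ - 1 →
      ∃ s ∈ K 1, ∀ x ∈ K i, ev (c s) (T x) = ev (c s) x := by
    intro n
    induction n with
    | zero =>
      intro i hi hil
      refine ⟨1, one_mem _, fun x hx => ?_⟩
      have hx' : x ∈ K (ℓ - 1) := by
        rw [← hil]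
        exact hx
      rw [hcext 1 (one_mem _) x hx', hcext 1 (one_mem _) _ (hF.stable _ _ hx'), hF.map_invol x hx']
    | succ n ih =>
      intro i hi hil
      obtain ⟨s, hs, hsi⟩ := ih (i + 1) (by omega) (by omega)
      obtain ⟨t, ht, hti⟩ := hF.exists_conj_step hab hb hba (hcext s hs) hi
        (j := n + 1) (by omega) (by omega) hsi
      refine ⟨s * t, mul_mem hs (hF.anti (by omega) ht), fun x hx => ?_⟩
      have hm : ∀ y ∈ K i, ev (c (s * t)) y = ev (c s) (t * y * t⁻¹) := fun y hy => by
        have hya : y ∈ K a := hF.anti hi hy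
        rw [hc _ _ hya, hc _ _ (hF.conj_mem t hya)]
        congr 1
        group
      rw [hm _ (hF.stable _ _ hx), hm _ hx, hti x hx]
  obtain ⟨s, hs, hsi⟩ := key (ℓ - 1 - a) a le_rfl (by omega)
  exact ⟨s, c s, ⟨hcext s hs, hsi⟩, fun x hx => (hc s x hx).symm⟩

/-- A character of the fixed points extends to an invariant character. -/
theorem exists_invariantExtension [Finite G] {a b : ℕ} (hab : a + b = ℓ) (hb : 1 ≤ b)
    (hba : b ≤ a) (χ : (K a).subgroupOf (fixedSubgroup T) →* ℂˣ)
    (hχ : ∀ x (hx : x ∈ fixedSubgroup T), x ∈ K (ℓ - 1) →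
      ev χ (⟨x, hx⟩ : fixedSubgroup T) = ev φ x) :
    ∃ θ : K a →* ℂˣ, InvariantExtension T φ θ ∧ fixedRestrict T θ = χ := by
  obtain ⟨m, hm⟩ := hF.exists_sqrt
  have ha : 1 ≤ a := hb.trans hba
  have hn : ∀ x ∈ K a, x * T x ∈ K a ⊓ fixedSubgroup T := fun x hx =>
    hF.mul_map_mem hab hb hba hx
  have hab' : ∀ x ∈ K a, ∀ y ∈ K a, x * y = y * x := fun x hx y hy =>
    mul_inv_eq_iff_eq_mul.1 (hF.conj_eq_self hab ha hb (hF.anti hba hx) hy)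
  -- An invariant extension must satisfy `θ(x)² = χ(x T(x))`; the power `m` takes the square root.
  let θ : K a →* ℂˣ := MonoidHom.mk'
    (fun x => χ ⟨⟨x * T x, (hn x x.2).2⟩, (hn x x.2).1⟩ ^ m) (fun x y => by
      rw [← mul_pow, ← map_mul]
      congr 2
      ext
      change (x * y : G) * T (x * y) = x * T x * (y * T y)
      rw [map_mul]
      have := hab' _ (hF.stable _ _ x.2) _ y.2
      calc (x * y : G) * (T x * T y) = x * (y * T x) * T y := by group
        _ = _ := by rw [← this]; group)
  have hθ : ∀ x (hx : x ∈ K a), ev θ x = ev χ (⟨x * T x, (hn x hx).2⟩ : fixedSubgroup T) ^ m :=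
    fun x hx => by
      rw [ev_of_mem _ hx, ev_of_mem χ (show (⟨x * T x, (hn x hx).2⟩ : fixedSubgroup T) ∈
        (K a).subgroupOf (fixedSubgroup T) from (hn x hx).1)]
      rfl
  have hsq : ∀ {N : Subgroup G} (η : N →* ℂˣ) (x : G), N ≤ K 1 → x ∈ N →
      (ev η x * ev η x) ^ m = ev η x := by
    intro N η x hN hx
    conv_rhs => rw [← hm x (hN hx)]
    rw [ev_mul η (pow_mem hx m) (pow_mem hx m), ev_pow η hx, mul_pow]
  refine ⟨θ, ⟨fun x hx => ?_, fun x hx => ?_⟩, ?_⟩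
  · have hx' : x ∈ K a := hF.anti (by omega) hx
    rw [hθ x hx', hχ _ _ (mul_mem hx (hF.stable _ _ hx)), ev_mul φ hx (hF.stable _ _ hx),
      hF.map_invol x hx, hsq φ x (hF.anti (by have := hF.two_le; omega)) hx]
  · rw [hθ x hx, hθ _ (hF.stable _ _ hx)]
    congr 3
    rw [hF.invol, hab' _ (hF.stable _ _ hx) _ hx]
  · ext1 x
    have hT : T (x : G) = x := x.1.2
    have hxa : (x : G) ∈ K a := x.2
    rw [fixedRestrict_apply, hθ _ hxa]
    have e1 : (⟨x * T x, (hn x hxa).2⟩ : fixedSubgroup T) = x.1 * x.1 := by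
      ext
      change (x : G) * T x = x * x
      rw [hT]
    have e2 : ((x : fixedSubgroup T) ^ m * (x : fixedSubgroup T) ^ m) = x := by
      ext
      exact hm _ (hF.anti ha hxa)
    rw [e1, ev_mul χ x.2 x.2, ← ev_coe χ x]
    conv_rhs => rw [← e2]
    rw [ev_mul χ (pow_mem x.2 m) (pow_mem x.2 m), ev_pow χ x.2, mul_pow]

/-- The representations of `G` over `φ` correspond to those of the fixed points of `T`. -/
theorem exists_equiv [Finite G] :
    ∃ e : Irr.over (K (ℓ - 1)).subtype φ ≃
      Irr.over ((K (ℓ - 1)).subgroupOf (fixedSubgroup T)).subtype (fixedRestrict T φ),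
      ∀ χ, (Nat.card (fixedSubgroup T) : ℝ) * M ^ ℓ * χ.1.dim = Nat.card G * (e χ).1.dim := by
  -- `a` and `b` are the upper and lower halves of `ℓ`.
  obtain ⟨a, b, hab, hb, hba, hba', hba''⟩ :
      ∃ a b, a + b = ℓ ∧ 1 ≤ b ∧ a ≤ 2 * b ∧ b ≤ a ∧ a ≤ b + 1 := by
    have := hF.two_le
    exact ⟨ℓ - ℓ / 2, ℓ / 2, by omega, by omega, by omega, by omega, by omega⟩
  have ha : 1 ≤ a := hb.trans hba'
  have hla : K (ℓ - 1) ≤ K a := hF.anti (by omega)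
  have hab' : ∀ x ∈ K a, ∀ y ∈ K a, x * y = y * x := fun x hx y hy =>
    mul_inv_eq_iff_eq_mul.1 (hF.conj_eq_self hab ha hb (hF.anti hba' hx) hy)
  have := hF.normal a
  have hnl : ((K a).subgroupOf (fixedSubgroup T)).Normal := inferInstance
  let I := {θ : K a →* ℂˣ // InvariantExtension T φ θ}
  let A : I → Set (Irr G) := fun θ => Irr.over (K a).subtype θ.1
  let B : I → Set (Irr (fixedSubgroup T)) := fun θ =>
    Irr.over ((K a).subgroupOf (fixedSubgroup T)).subtype (fixedRestrict T θ.1)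
  have hfix : ∀ (θ : K a →* ℂˣ) (x : fixedSubgroup T), (x : G) ∈ K a →
      ev (fixedRestrict T θ) x = ev θ (x : G) := fun θ x hx => by
    rw [ev_of_mem (fixedRestrict T θ) (show x ∈ (K a).subgroupOf (fixedSubgroup T) from hx),
      fixedRestrict_apply]
  have hfix' : ∀ (x : fixedSubgroup T), (x : G) ∈ K (ℓ - 1) →
      ev (fixedRestrict T φ) x = ev φ (x : G) := fun x hx => by
    rw [ev_of_mem (fixedRestrict T φ) (show x ∈ (K (ℓ - 1)).subgroupOf (fixedSubgroup T) from hx),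
      fixedRestrict_apply]
  have hconj : ∀ (i j : I) (l : G), l ∈ fixedSubgroup T →
      (∀ x ∈ K a, ev j.1 (l * x * l⁻¹) = ev i.1 x) → A i = A j ∧ B i = B j := by
    intro i j l hl h
    refine ⟨over_eq_of_conj h, over_eq_of_conj (g := ⟨l, hl⟩) fun x hx => ?_⟩
    have hx' : (x : G) ∈ K a := hx
    rw [hfix _ _ hx', hfix _ _ (hF.conj_mem l hx'), ← h x hx']
    rfl
  -- A common representation makes the two characters conjugate. The conjugating element is
  -- `T`-fixed modulo `K b`, and `K b` acts trivially on `K a`, so it may be taken in `L`.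
  have hA : ∀ i j, (A i ∩ A j).Nonempty → A i = A j ∧ B i = B j := by
    rintro i j ⟨χ, h1, h2⟩
    obtain ⟨g, hg⟩ := exists_conj_of_mem_over h1 h2
    obtain ⟨y, hy, -, hgy⟩ := hF.exists_fixed_mul (hF.anti hb)
      (hF.inv_mul_mem hab hb hba' i.2 j.2 hg)
    refine hconj i j _ hgy fun x hx => ?_
    have h3 := hF.conj_eq_self hab ha hb hy hx
    have h4 : g * y * x * (g * y)⁻¹ = g * (y * x * y⁻¹) * g⁻¹ := by group
    rw [h4, h3, hg x hx]
  have hB : ∀ i j, (B i ∩ B j).Nonempty → A i = A j ∧ B i = B j := by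
    rintro i j ⟨χ, h1, h2⟩
    obtain ⟨l, hl⟩ := exists_conj_of_mem_over h1 h2
    refine hconj i j l l.2 fun x hx => hF.conj_of_fixed_conj hab hb hba' i.2 j.2 l.2
      (fun y hy => ?_) hx
    have := hl ⟨y, hy.2⟩ hy.1
    rw [hfix i.1 _ hy.1] at this
    rw [← this]
    exact (hfix j.1 (l * ⟨y, hy.2⟩ * l⁻¹) (hF.conj_mem (l : G) hy.1)).symm
  have hres : ∀ {H : Type u} [Group H] {N N' : Subgroup H} (_ : N ≤ N') (θ : N' →* ℂˣ)
      (η : N →* ℂˣ) (_ : ∀ x ∈ N, ev θ x = ev η x),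
      Irr.over N'.subtype θ ⊆ Irr.over N.subtype η := by
    intro H _ N N' hN θ η h χ hχ
    rw [← Irr.mk_rep χ, Irr.mem_over_subtype_iff] at hχ ⊢
    obtain ⟨v, hv0, hv⟩ := hχ
    exact ⟨v, hv0, fun n hn => by rw [hv n (hN hn), h n hn]⟩
  -- Each representation over `φ` lies over some extension to the abelian `K a`, which may be
  -- replaced by an invariant conjugate.
  have hUA : ⋃ i, A i = Irr.over (K (ℓ - 1)).subtype φ := by
    ext χ
    rw [Set.mem_iUnion]
    constructor
    · rintro ⟨i, hi⟩
      exact hres hla i.1 φ i.2.ext hi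
    · intro h
      obtain ⟨θ, hθ, hχ⟩ := exists_extension_mem_over hla hab' h
      obtain ⟨s, θ', hθ', hs⟩ := hF.exists_conj_invariant hab hb hba' hθ
      refine ⟨⟨θ', hθ'⟩, ?_⟩
      change χ ∈ Irr.over _ _
      rwa [over_eq_of_conj hs]
  have hUB : ⋃ i, B i =
      Irr.over ((K (ℓ - 1)).subgroupOf (fixedSubgroup T)).subtype (fixedRestrict T φ) := by
    ext χ
    rw [Set.mem_iUnion]
    constructor
    · rintro ⟨i, hi⟩
      refine hres (N := (K (ℓ - 1)).subgroupOf (fixedSubgroup T))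
        (N' := (K a).subgroupOf (fixedSubgroup T)) (fun x hx => hla hx)
        (fixedRestrict T i.1) _ (fun x hx => ?_) hi
      have hx' : (x : G) ∈ K (ℓ - 1) := hx
      rw [hfix _ _ (hla hx'), hfix' _ hx', i.2.ext _ hx']
    · intro h
      obtain ⟨θ, hθ, hχ⟩ := exists_extension_mem_over
        (N' := (K a).subgroupOf (fixedSubgroup T)) (fun x hx => hla hx)
        (fun x hx y hy => Subtype.ext (hab' x hx y hy)) h
      obtain ⟨θ', hθ', hr⟩ := hF.exists_invariantExtension hab hb hba' θ (fun x hx hx' => by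
        rw [hθ _ hx', hfix' _ hx'])
      refine ⟨⟨θ', hθ'⟩, ?_⟩
      change χ ∈ Irr.over _ (fixedRestrict T θ')
      rwa [hr]
  rw [← hUA, ← hUB]
  exact exists_equiv_of_iUnion A B
    (fun χ χ' => (Nat.card (fixedSubgroup T) : ℝ) * M ^ ℓ * χ.dim = Nat.card G * χ'.dim)
    (fun i => hF.exists_equiv_of_invariant hab hb hba hba' hba'' i.2) hA hB

end FilteredInvolution

/-! ### Quadratic unramified extensions -/

set_option linter.unusedSectionVars false

/-- A finite level of a quadratic unramified extension, with its involution. -/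
structure QuadraticLevel {R : Type v} [CommRing R] (σ : R →+* R) (𝔪 : Ideal R) (ℓ q : ℕ) :
    Prop where
  finite : Finite R
  invol : ∀ x, σ (σ x) = x
  map_mem : ∀ i, ∀ x ∈ 𝔪 ^ i, σ x ∈ 𝔪 ^ i
  pow_eq_bot : 𝔪 ^ ℓ = ⊥
  two : IsUnit (2 : R)
  skew : ∃ δ, IsUnit δ ∧ σ δ = -δ
  card : ∀ i ≤ ℓ, Nat.card (𝔪 ^ i : Ideal R) = q ^ (2 * (ℓ - i))
  dvd : ∀ i j, i + j + 1 = ℓ → ∀ w ∈ 𝔪 ^ i, w ∉ 𝔪 ^ (i + 1) → ∀ t ∈ 𝔪 ^ (i + j),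
    ∃ s ∈ 𝔪 ^ j, t = w * s
  pos : 0 < q
  principal : ∃ ϖ, 𝔪 = Ideal.span {ϖ}

section Quadratic

variable {o : Type u} [CommRing o] [IsDomain o] [IsDiscreteValuationRing o]
    {O : Type v} [CommRing O] [IsDomain O] [IsDiscreteValuationRing O]
    [Algebra o O] [Module.Finite o O]

theorem algebraMap_injective_of_finrank (hquad : Module.finrank o O = 2) :
    Function.Injective (algebraMap o O) := by
  rw [injective_iff_map_eq_zero]
  intro a ha
  by_contra h0
  have : Module.rank o O = 0 := rank_eq_zero_iff.2 fun x => ⟨a, h0, by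
    rw [Algebra.smul_def, ha, zero_mul]⟩
  rw [Module.finrank, this] at hquad
  simp at hquad

theorem free_of_finrank (hquad : Module.finrank o O = 2) : Module.Free o O := by
  have : FaithfulSMul o O := (faithfulSMul_iff_algebraMap_injective o O).2
    (algebraMap_injective_of_finrank hquad)
  have : Module.IsTorsionFree o O := inferInstance
  infer_instance

theorem isLocalHom_of_finrank (hquad : Module.finrank o O = 2) :
    IsLocalHom (algebraMap o O) := by
  have : FaithfulSMul o O := (faithfulSMul_iff_algebraMap_injective o O).2
    (algebraMap_injective_of_finrank hquad)
  infer_instance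

theorem exists_quadratic (hquad : Module.finrank o O = 2) (x : O) :
    ∃ a b : o, x * x + algebraMap o O a * x + algebraMap o O b = 0 := by
  have := free_of_finrank hquad
  set p := (LinearMap.mulLeft o x).charpoly with hp
  have hdeg : p.natDegree = 2 := by rw [hp, LinearMap.charpoly_natDegree, hquad]
  have hmon : p.Monic := LinearMap.charpoly_monic _
  have h := LinearMap.aeval_self_charpoly (LinearMap.mulLeft o x)
  have h1 := congrArg (fun f : Module.End o O => f 1) h
  simp only [← hp] at h1
  rw [Polynomial.aeval_eq_sum_range, hdeg, Finset.sum_range_succ, Finset.sum_range_succ,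
    Finset.sum_range_one] at h1
  have h2 : p.coeff 2 = 1 := by rw [← hdeg]; exact hmon
  refine ⟨p.coeff 1, p.coeff 0, ?_⟩
  rw [h2] at h1
  simp only [pow_zero, pow_one, one_smul, LinearMap.add_apply, LinearMap.smul_apply,
    Module.End.one_apply, LinearMap.mulLeft_apply, mul_one, LinearMap.zero_apply, pow_two,
    Module.End.mul_apply] at h1
  rw [Algebra.smul_def, Algebra.smul_def] at h1
  linear_combination h1

/-- `x` and `σ x` are roots of the same monic quadratic polynomial over `o`, and `O` is a domain. -/
theorem root_cases (hquad : Module.finrank o O = 2) (σ : O ≃ₐ[o] O) (x : O) :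
    ∃ t : o, σ x = x ∨ σ x = algebraMap o O t - x := by
  obtain ⟨a, b, h⟩ := exists_quadratic hquad x
  have h' := congrArg σ h
  simp only [map_add, map_mul, AlgEquiv.commutes, map_zero] at h'
  refine ⟨-a, ?_⟩
  have h2 : (σ x - x) * (σ x - (algebraMap o O (-a) - x)) = 0 := by
    rw [map_neg]
    linear_combination h' - h
  rcases mul_eq_zero.1 h2 with h3 | h3
  · exact Or.inl (sub_eq_zero.1 h3)
  · exact Or.inr (sub_eq_zero.1 h3)

theorem algEquiv_invol (hquad : Module.finrank o O = 2) (σ : O ≃ₐ[o] O) (x : O) :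
    σ (σ x) = x := by
  obtain ⟨t, h | h⟩ := root_cases hquad σ x
  · rw [h, h]
  · rw [h, map_sub, AlgEquiv.commutes, h, sub_sub_cancel]

/-- If `σ` were trivial on the residue field, uniqueness of lifts through nilpotent ideals for an
unramified algebra would make it trivial modulo every power of the maximal ideal, hence trivial by
Krull's intersection theorem. -/
theorem exists_sub_notMem [Algebra.FormallyUnramified o O] (σ : O ≃ₐ[o] O)
    (hσ : σ ≠ AlgEquiv.refl) : ∃ x, x - σ x ∉ maximalIdeal O := by
  by_contra! h
  apply hσ
  ext x
  rw [← sub_eq_zero, ← Ideal.mem_bot, ← Ideal.iInf_pow_eq_bot_of_isLocalRing (maximalIdeal O)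
    (maximalIdeal.isMaximal O).ne_top, Ideal.mem_iInf]
  intro m
  rw [← Ideal.Quotient.eq]
  refine DFunLike.congr_fun (Algebra.FormallyUnramified.ext (R := o)
    ((maximalIdeal O).map (Ideal.Quotient.mk (maximalIdeal O ^ m))) ⟨m, ?_⟩
    (g₁ := (Ideal.Quotient.mkₐ o (maximalIdeal O ^ m)).comp σ.toAlgHom)
    (g₂ := (Ideal.Quotient.mkₐ o (maximalIdeal O ^ m)).comp (AlgHom.id o O)) ?_) x
  · rw [← Ideal.map_pow, Ideal.map_quotient_self]
    rfl
  · intro y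
    rw [Ideal.Quotient.eq]
    have : σ y - y ∈ maximalIdeal O := by
      rw [← neg_sub]
      exact neg_mem (h y)
    have h2 := Ideal.mem_map_of_mem (Ideal.Quotient.mk (maximalIdeal O ^ m)) this
    rw [map_sub] at h2
    exact h2

theorem exists_skew [Algebra.FormallyUnramified o O] (hquad : Module.finrank o O = 2)
    (σ : O ≃ₐ[o] O) (hσ : σ ≠ AlgEquiv.refl) : ∃ δ, IsUnit δ ∧ σ δ = -δ := by
  obtain ⟨x, hx⟩ := exists_sub_notMem σ hσ
  refine ⟨x - σ x, by rwa [mem_maximalIdeal, mem_nonunits_iff, not_not] at hx, ?_⟩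
  rw [map_sub, algEquiv_invol hquad, neg_sub]

theorem isUnit_two_of_ringChar {A : Type*} [CommRing A] [IsLocalRing A]
    (hodd : ringChar (ResidueField A) ≠ 2) : IsUnit (2 : A) := by
  by_contra h
  have h1 : residue A 2 = 0 := by
    rw [residue_eq_zero_iff]
    exact (mem_maximalIdeal _).2 h
  rw [map_ofNat] at h1
  exact Ring.two_ne_zero hodd h1

/-- `root_cases` gives the trace unless `x` is fixed by `σ`. In that case `x + δ` with `δ` skew is
not fixed and has the same trace as `x`. -/
theorem add_map_mem_range [Algebra.FormallyUnramified o O] (hquad : Module.finrank o O = 2)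
    (hodd : ringChar (ResidueField o) ≠ 2)
    (σ : O ≃ₐ[o] O) (hσ : σ ≠ AlgEquiv.refl) (x : O) : ∃ t : o, algebraMap o O t = x + σ x := by
  obtain ⟨t, h | h⟩ := root_cases hquad σ x
  · obtain ⟨δ, hδ, hσδ⟩ := exists_skew hquad σ hσ
    have h2 : (2 : O) ≠ 0 := by
      have := ((isUnit_two_of_ringChar hodd).map (algebraMap o O)).ne_zero
      rwa [map_ofNat] at this
    obtain ⟨t, h' | h'⟩ := root_cases hquad σ (x + δ)
    · exfalso
      rw [map_add, h, hσδ] at h'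
      have : 2 * δ = 0 := by linear_combination -h'
      rcases mul_eq_zero.1 this with h3 | h3
      · exact h2 h3
      · exact hδ.ne_zero h3
    · refine ⟨t, ?_⟩
      rw [map_add, hσδ] at h'
      linear_combination -h'
  · exact ⟨t, by rw [h]; ring⟩

theorem lvlAut_mk (σ : O ≃+* O) (m : ℕ) (x : O) : lvlAut σ m (toLvl O m x) = toLvl O m (σ x) :=
  rfl

/-- A class fixed by `σ` equals half the trace of any representative, and the trace lies in `o`.
This presents the linear groups over `o_m` as fixed points. -/
theorem mem_baseRing_iff [Algebra.FormallyUnramified o O] (hquad : Module.finrank o O = 2)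
    (hodd : ringChar (ResidueField o) ≠ 2)
    (σ : O ≃ₐ[o] O) (hσ : σ ≠ AlgEquiv.refl) (m : ℕ) (y : Lvl O m) :
    y ∈ baseRing o O m ↔ lvlAut σ.toRingEquiv m y = y := by
  constructor
  · rintro ⟨a, rfl⟩
    change toLvl O m (σ (algebraMap o O a)) = toLvl O m (algebraMap o O a)
    rw [AlgEquiv.commutes]
  · intro h
    obtain ⟨x, rfl⟩ := Ideal.Quotient.mk_surjective y
    obtain ⟨t, ht⟩ := add_map_mem_range hquad hodd σ hσ x
    obtain ⟨c, hc⟩ := (isUnit_two_of_ringChar hodd).exists_right_inv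
    refine ⟨c * t, ?_⟩
    have hc' : (2 : Lvl O m) * toLvl O m (algebraMap o O c) = 1 := by
      have := congrArg (fun z => toLvl O m (algebraMap o O z)) hc
      simpa only [map_mul, map_one, map_ofNat] using this
    have h2 : toLvl O m (σ x) = toLvl O m x := h
    change toLvl O m (algebraMap o O (c * t)) = toLvl O m x
    rw [map_mul, ht, map_mul, map_add, h2]
    linear_combination toLvl O m x * hc'

/-- Unramifiedness makes `𝔭 O` the maximal ideal, so the residue field of `O` has the rank of `O` as
its degree over `k`. -/
theorem card_residue [Algebra.FormallyUnramified o O] (hquad : Module.finrank o O = 2)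
    [Finite (ResidueField o)] :
    Nat.card (O ⧸ maximalIdeal O) = Nat.card (ResidueField o) ^ 2 := by
  have := free_of_finrank hquad
  have := isLocalHom_of_finrank hquad
  have h := IsLocalRing.finrank_quotient_map (R := o) (S := O)
  have hm : Ideal.map (algebraMap o O) (maximalIdeal o) = maximalIdeal O :=
    Algebra.FormallyUnramified.map_maximalIdeal
  let _ : Field (o ⧸ maximalIdeal o) := Ideal.Quotient.field _
  have hfin : Module.Finite (o ⧸ maximalIdeal o)
      (O ⧸ Ideal.map (algebraMap o O) (maximalIdeal o)) :=
    Module.finite_of_finrank_pos (by rw [h, hquad]; norm_num)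
  have h3 := Module.natCard_eq_pow_finrank (K := o ⧸ maximalIdeal o)
    (V := O ⧸ Ideal.map (algebraMap o O) (maximalIdeal o))
  rw [h, hquad] at h3
  rw [← hm]
  exact h3

theorem card_lvl [Algebra.FormallyUnramified o O] (hquad : Module.finrank o O = 2)
    [Finite (ResidueField o)] (m : ℕ) :
    Nat.card (Lvl O m) = Nat.card (ResidueField o) ^ (2 * m) := by
  have h := cardQuot_pow_of_prime (P := maximalIdeal O) (IsDiscreteValuationRing.not_a_field O)
    (i := m)
  rw [Submodule.cardQuot_apply, Submodule.cardQuot_apply] at h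
  rw [pow_mul, ← card_residue (O := O) hquad]
  exact h

theorem finite_lvl [Algebra.FormallyUnramified o O] (hquad : Module.finrank o O = 2)
    [Finite (ResidueField o)] (m : ℕ) : Finite (Lvl O m) := by
  apply Nat.finite_of_card_ne_zero
  rw [card_lvl hquad]
  exact pow_ne_zero _ Nat.card_pos.ne'

/-- The ideal `𝔪 R_ℓ`. -/
def lvlIdeal (O : Type v) [CommRing O] [IsLocalRing O] (ℓ : ℕ) : Ideal (Lvl O ℓ) :=
  (maximalIdeal O).map (toLvl O ℓ)

omit [IsDomain O] [IsDiscreteValuationRing O] in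
theorem mk_mem_lvlIdeal_pow [IsLocalRing O] {i ℓ : ℕ} (hi : i ≤ ℓ) (x : O) :
    toLvl O ℓ x ∈ lvlIdeal O ℓ ^ i ↔ x ∈ maximalIdeal O ^ i := by
  rw [lvlIdeal, ← Ideal.map_pow, Ideal.mem_map_iff_of_surjective _ Ideal.Quotient.mk_surjective]
  constructor
  · rintro ⟨y, hy, hxy⟩
    rw [Ideal.Quotient.eq] at hxy
    have := Ideal.pow_le_pow_right hi hxy
    rw [← sub_sub_cancel y x]
    exact sub_mem hy this
  · exact fun h => ⟨x, h, rfl⟩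

omit [IsDomain O] [IsDiscreteValuationRing O] in
theorem red_eq_zero_iff [IsLocalRing O] {i ℓ : ℕ} (hi : i ≤ ℓ) (x : Lvl O ℓ) :
    red O hi x = 0 ↔ x ∈ lvlIdeal O ℓ ^ i := by
  obtain ⟨y, rfl⟩ := Ideal.Quotient.mk_surjective x
  rw [mk_mem_lvlIdeal_pow hi]
  exact Ideal.Quotient.eq_zero_iff_mem

theorem card_lvlIdeal_pow [Algebra.FormallyUnramified o O] (hquad : Module.finrank o O = 2)
    [Finite (ResidueField o)] {i ℓ : ℕ} (hi : i ≤ ℓ) :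
    Nat.card (lvlIdeal O ℓ ^ i : Ideal (Lvl O ℓ)) =
      Nat.card (ResidueField o) ^ (2 * (ℓ - i)) := by
  have := finite_lvl (o := o) (O := O) hquad ℓ
  have hs : Function.Surjective (red O hi) := Ideal.Quotient.factor_surjective _
  have h1 := (red O hi).toAddMonoidHom.ker.card_eq_card_quotient_mul_card_addSubgroup
  have h2 : Nat.card (Lvl O ℓ ⧸ (red O hi).toAddMonoidHom.ker) = Nat.card (Lvl O i) :=
    Nat.card_congr (QuotientAddGroup.quotientKerEquivOfSurjective _ hs).toEquiv
  have h3 : Nat.card (red O hi).toAddMonoidHom.ker =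
      Nat.card (lvlIdeal O ℓ ^ i : Ideal (Lvl O ℓ)) :=
    Nat.card_congr (Equiv.subtypeEquivRight fun x => red_eq_zero_iff hi x)
  rw [h2, h3, card_lvl (o := o) hquad, card_lvl (o := o) hquad,
    show 2 * ℓ = 2 * i + 2 * (ℓ - i) by omega, pow_add] at h1
  exact (Nat.eq_of_mul_eq_mul_left (pow_pos Nat.card_pos _) h1).symm

theorem quadraticLevel [Algebra.FormallyUnramified o O] (hquad : Module.finrank o O = 2)
    (hodd : ringChar (ResidueField o) ≠ 2) [Finite (ResidueField o)]
    (σ : O ≃ₐ[o] O) (hσ : σ ≠ AlgEquiv.refl) (ℓ : ℕ) :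
    QuadraticLevel (lvlAut σ.toRingEquiv ℓ) (lvlIdeal O ℓ) ℓ (Nat.card (ResidueField o)) where
  finite := finite_lvl (o := o) hquad ℓ
  invol x := by
    obtain ⟨y, rfl⟩ := Ideal.Quotient.mk_surjective x
    change toLvl O ℓ (σ (σ y)) = toLvl O ℓ y
    rw [algEquiv_invol hquad]
  map_mem i x hx := by
    rcases le_total i ℓ with hi | hi
    · obtain ⟨y, rfl⟩ := Ideal.Quotient.mk_surjective x
      change toLvl O ℓ (σ y) ∈ _
      rw [mk_mem_lvlIdeal_pow hi] at hx ⊢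
      exact maximalIdeal_pow_le_comap σ.toRingEquiv i hx
    · have h0 : lvlIdeal O ℓ ^ ℓ = ⊥ := by
        rw [lvlIdeal, ← Ideal.map_pow, Ideal.map_quotient_self]
      have := Ideal.pow_le_pow_right hi hx
      rw [h0, Ideal.mem_bot] at this
      rw [this, map_zero]
      exact zero_mem _
  pow_eq_bot := by rw [lvlIdeal, ← Ideal.map_pow, Ideal.map_quotient_self]
  two := by
    have := (isUnit_two_of_ringChar hodd).map ((toLvl O ℓ).comp (algebraMap o O))
    rwa [map_ofNat] at this
  skew := by
    obtain ⟨δ, hδ, h⟩ := exists_skew hquad σ hσ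
    refine ⟨toLvl O ℓ δ, hδ.map _, ?_⟩
    change toLvl O ℓ (σ δ) = _
    rw [h, map_neg]
  card i hi := card_lvlIdeal_pow hquad hi
  dvd i j hij w hw hw' t ht := by
    obtain ⟨w, rfl⟩ := Ideal.Quotient.mk_surjective w
    obtain ⟨t, rfl⟩ := Ideal.Quotient.mk_surjective t
    rw [mk_mem_lvlIdeal_pow (by omega)] at hw hw' ht
    obtain ⟨ϖ, hϖ⟩ := IsDiscreteValuationRing.exists_irreducible O
    rw [hϖ.maximalIdeal_eq, Ideal.span_singleton_pow, Ideal.mem_span_singleton] at hw hw' ht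
    obtain ⟨u, rfl⟩ := hw
    obtain ⟨r, rfl⟩ := ht
    -- Otherwise `w` would lie one step deeper, in `𝔪 ^ (i + 1)`.
    have hu : IsUnit u := by
      by_contra hu
      have : u ∈ maximalIdeal O := (mem_maximalIdeal _).2 hu
      rw [hϖ.maximalIdeal_eq, Ideal.mem_span_singleton] at this
      obtain ⟨c, rfl⟩ := this
      exact hw' ⟨c, by ring⟩
    obtain ⟨c, hc⟩ := hu.exists_right_inv
    refine ⟨toLvl O ℓ (c * ϖ ^ j * r), ?_, ?_⟩
    · rw [mk_mem_lvlIdeal_pow (by omega), hϖ.maximalIdeal_eq, Ideal.span_singleton_pow,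
        Ideal.mem_span_singleton]
      exact ⟨c * r, by ring⟩
    · change toLvl O ℓ _ = toLvl O ℓ _ * _
      rw [← map_mul]
      congr 1
      linear_combination -ϖ ^ (i + j) * r * hc
  pos := Nat.card_pos
  principal := by
    obtain ⟨ϖ, hϖ⟩ := IsDiscreteValuationRing.exists_irreducible O
    refine ⟨toLvl O ℓ ϖ, ?_⟩
    have h := congrArg (Ideal.map (toLvl O ℓ)) hϖ.maximalIdeal_eq
    rwa [Ideal.map_span, Set.image_singleton] at h

/-- For `x` in `o`, the element `t = x / 2` has `t + σ t = x`. Nontriviality on such traces is what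
pairings with `D`-fixed matrices need. -/
theorem exists_trace_ne_one [Algebra.FormallyUnramified o O] (hquad : Module.finrank o O = 2)
    (hodd : ringChar (ResidueField o) ≠ 2) (σ : O ≃ₐ[o] O) {ℓ : ℕ} (ψ : AddChar (Lvl O ℓ) ℂ)
    (hψ : ∃ x ∈ maximalIdeal o ^ (ℓ - 1), ψ (toLvl O ℓ (algebraMap o O x)) ≠ 1) :
    ∃ t ∈ lvlIdeal O ℓ ^ (ℓ - 1), ψ (t + lvlAut σ.toRingEquiv ℓ t) ≠ 1 := by
  have := isLocalHom_of_finrank hquad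
  obtain ⟨x, hx, hψx⟩ := hψ
  obtain ⟨c, hc⟩ := (isUnit_two_of_ringChar hodd).exists_right_inv
  refine ⟨toLvl O ℓ (algebraMap o O (c * x)), ?_, ?_⟩
  · rw [mk_mem_lvlIdeal_pow (by omega), ← Algebra.FormallyUnramified.map_maximalIdeal (R := o),
      ← Ideal.map_pow]
    exact Ideal.mem_map_of_mem _ (Ideal.mul_mem_left _ _ hx)
  · rw [lvlAut_mk]
    have h1 : σ.toRingEquiv (algebraMap o O (c * x)) = algebraMap o O (c * x) := σ.commutes _
    rw [h1, ← map_add, ← map_add]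
    have h2 : c * x + c * x = x := by linear_combination x * hc
    rwa [h2]

end Quadratic

/-! ### Matrices with entries in an ideal -/

section EntriesIn

variable {R : Type v} [CommRing R]

/-- All entries of the matrix lie in the ideal. -/
def EntriesIn (I : Ideal R) {m n : Type*} (x : Matrix m n R) : Prop := ∀ a b, x a b ∈ I

variable {I J : Ideal R} {m n p : Type*} {x y : Matrix m n R}

theorem EntriesIn.zero : EntriesIn I (0 : Matrix m n R) := fun _ _ => I.zero_mem

theorem EntriesIn.add (hx : EntriesIn I x) (hy : EntriesIn I y) : EntriesIn I (x + y) :=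
  fun a b => I.add_mem (hx a b) (hy a b)

theorem EntriesIn.sub (hx : EntriesIn I x) (hy : EntriesIn I y) : EntriesIn I (x - y) :=
  fun a b => I.sub_mem (hx a b) (hy a b)

theorem EntriesIn.neg (hx : EntriesIn I x) : EntriesIn I (-x) := fun a b => I.neg_mem (hx a b)

theorem EntriesIn.mono (h : I ≤ J) (hx : EntriesIn I x) : EntriesIn J x := fun a b => h (hx a b)

theorem EntriesIn.smul (r : R) (hx : EntriesIn I x) : EntriesIn I (r • x) :=
  fun a b => I.mul_mem_left r (hx a b)

theorem EntriesIn.sum {ι : Type*} {s : Finset ι} {f : ι → Matrix m n R}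
    (h : ∀ i ∈ s, EntriesIn I (f i)) : EntriesIn I (∑ i ∈ s, f i) := fun a b => by
  rw [Matrix.sum_apply]
  exact I.sum_mem fun i hi => h i hi a b

theorem EntriesIn.mul [Fintype n] (hx : EntriesIn I x) {z : Matrix n p R} (hz : EntriesIn J z) :
    EntriesIn (I * J) (x * z) := fun a b => by
  rw [Matrix.mul_apply]
  exact Ideal.sum_mem _ fun i _ => Ideal.mul_mem_mul (hx a i) (hz i b)

theorem EntriesIn.mul_right [Fintype n] (hx : EntriesIn I x) (z : Matrix n p R) :
    EntriesIn I (x * z) := fun a b => by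
  rw [Matrix.mul_apply]
  exact Ideal.sum_mem _ fun i _ => I.mul_mem_right _ (hx a i)

theorem EntriesIn.mul_left [Fintype m] (hx : EntriesIn I x) (z : Matrix p m R) :
    EntriesIn I (z * x) := fun a b => by
  rw [Matrix.mul_apply]
  exact Ideal.sum_mem _ fun i _ => I.mul_mem_left _ (hx i b)

theorem EntriesIn.eq_zero (hx : EntriesIn (⊥ : Ideal R) x) : x = 0 := by
  ext a b
  exact hx a b

theorem entriesIn_iff_map : EntriesIn I x ↔ x.map (Ideal.Quotient.mk I) = 0 := by
  constructor
  · intro h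
    ext a b
    exact Ideal.Quotient.eq_zero_iff_mem.2 (h a b)
  · intro h a b
    exact Ideal.Quotient.eq_zero_iff_mem.1 (congrFun (congrFun h a) b)

theorem EntriesIn.pow_succ_mul [Fintype n] {i j k : ℕ} (hk : k ≤ i + j)
    (hx : EntriesIn (I ^ i) x) {z : Matrix n p R}
    (hz : EntriesIn (I ^ j) z) : EntriesIn (I ^ k) (x * z) :=
  ((hx.mul hz).mono (by rw [← pow_add])).mono (Ideal.pow_le_pow_right hk)

variable [Fintype n] [DecidableEq n]

theorem EntriesIn.pow {x : Matrix n n R} (hx : EntriesIn I x) (k : ℕ) :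
    EntriesIn (I ^ k) (x ^ k) := by
  induction k with
  | zero => exact fun a b => by simp
  | succ k ih =>
    rw [pow_succ, pow_succ]
    exact ih.mul hx

theorem EntriesIn.isUnit_one_add {x : Matrix n n R} (hx : EntriesIn I x) {ℓ : ℕ}
    (hI : I ^ ℓ = ⊥) : IsUnit (1 + x) :=
  IsNilpotent.isUnit_one_add ⟨ℓ, ((hI ▸ hx.pow ℓ : EntriesIn ⊥ (x ^ ℓ))).eq_zero⟩

theorem EntriesIn.det_one_add {x : Matrix n n R} {ϖ : R} (hx : EntriesIn (Ideal.span {ϖ}) x)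
    (h2 : ϖ * ϖ = 0) : (1 + x).det = 1 + x.trace := by
  choose y hy using fun a b => Ideal.mem_span_singleton.1 (hx a b)
  have : x = ϖ • Matrix.of y := by
    ext a b
    exact hy a b
  rw [this, Matrix.det_one_add_smul, pow_two, h2, mul_zero, add_zero, Matrix.trace_smul,
    smul_eq_mul, mul_comm]

/-- The matrices congruent to `1` modulo an ideal. -/
def congKer (n : Type w) [Fintype n] [DecidableEq n] (I : Ideal R) : Subgroup (GL n R) :=
  (GeneralLinearGroup.map (n := n) (Ideal.Quotient.mk I)).ker

instance {n : Type w} [Fintype n] [DecidableEq n] (I : Ideal R) : (congKer n I).Normal := by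
  unfold congKer
  infer_instance

theorem mem_congKer {n : Type w} [Fintype n] [DecidableEq n] {I : Ideal R} {g : GL n R} :
    g ∈ congKer n I ↔ EntriesIn I (g.1 - 1) := by
  rw [congKer, MonoidHom.mem_ker, entriesIn_iff_map, Units.ext_iff]
  change g.1.map _ = 1 ↔ _
  rw [Matrix.map_sub _ (map_sub _), sub_eq_zero, Matrix.map_one _ (map_zero _) (map_one _)]

theorem inv_mul_mem_congKer {n : Type w} [Fintype n] [DecidableEq n] {I : Ideal R} {g h : GL n R} :
    g⁻¹ * h ∈ congKer n I ↔ EntriesIn I (h.1 - g.1) := by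
  rw [mem_congKer]
  have e : h.1 - g.1 = g.1 * ((g⁻¹ * h : GL n R).1 - 1) := by
    rw [mul_sub, Units.val_mul, Units.mul_inv_cancel_left, mul_one]
  constructor
  · intro h1
    rw [e]
    exact h1.mul_left _
  · intro h1
    have : (g⁻¹ * h : GL n R).1 - 1 = (g⁻¹).1 * (h.1 - g.1) := by
      rw [e, Units.inv_mul_cancel_left]
    rw [this]
    exact h1.mul_left _

theorem congKer_mono {n : Type w} [Fintype n] [DecidableEq n] (h : I ≤ J) :
    congKer n I ≤ congKer n J := fun _ hg => mem_congKer.2 ((mem_congKer.1 hg).mono h)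

end EntriesIn

/-! ### Classical involutions -/

/-- An involution of `GL_n` together with its differential. -/
structure ClassicalForm {R : Type v} [CommRing R] (σ : R →+* R) {n : Type w} [Fintype n]
    [DecidableEq n] (F : GL n R →* GL n R) (D : Matrix n n R →+ Matrix n n R) : Prop where
  F_invol : ∀ g, F (F g) = g
  D_smul : ∀ (r : R) x, D (r • x) = σ r • D x
  D_invol : ∀ x, D (D x) = x
  trace_mul : ∀ x y, (D x * D y).trace = σ (x * y).trace
  trace_eq_zero : ∀ x, x.trace = 0 → (D x).trace = 0
  bracket : ∀ x y, D (x * y - y * x) = D x * D y - D y * D x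
  conj : ∀ (g : GL n R) x, D (g.1 * x * g⁻¹.1) = (F g).1 * D x * (F g)⁻¹.1
  cayley : ∀ (u : GL n R) x, u.1 * (1 - x) = 1 + x → (F u).1 * (1 - D x) = 1 + D x
  scalar_det : ∀ (g : GL n R) (k : ℕ), F (GeneralLinearGroup.scalar n (g.det ^ k)) =
    GeneralLinearGroup.scalar n ((F g).det ^ k)

section ClassicalForm

variable {R : Type v} [CommRing R] {σ : R →+* R} {n : Type w} [Fintype n]
    [DecidableEq n] {F : GL n R →* GL n R} {D : Matrix n n R →+ Matrix n n R}
    (hc : ClassicalForm σ F D) {𝔪 : Ideal R} {ℓ q : ℕ} (hR : QuadraticLevel σ 𝔪 ℓ q)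

include hc in
theorem ClassicalForm.entriesIn {I : Ideal R} (hI : ∀ x ∈ I, σ x ∈ I) {x : Matrix n n R}
    (hx : EntriesIn I x) : EntriesIn I (D x) := by
  rw [Matrix.matrix_eq_sum_single x, map_sum]
  refine EntriesIn.sum fun a _ => ?_
  rw [map_sum]
  refine EntriesIn.sum fun b _ => ?_
  have : single a b (x a b) = x a b • single a b (1 : R) := by rw [smul_single, smul_eq_mul, mul_one]
  rw [this, hc.D_smul]
  exact fun c d => I.mul_mem_right _ (hI _ (hx a b))

include hR

theorem QuadraticLevel.isUnit_one_add {x : Matrix n n R} (hx : EntriesIn 𝔪 x) :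
    IsUnit (1 + x) := hx.isUnit_one_add hR.pow_eq_bot

theorem QuadraticLevel.isUnit_two_add {x : Matrix n n R} (hx : EntriesIn 𝔪 x) :
    IsUnit (2 + x) := by
  obtain ⟨c, hc⟩ := hR.two.exists_right_inv
  have h1 := hR.isUnit_one_add (hx.smul c)
  have h2 : (2 : Matrix n n R) + x = (algebraMap R (Matrix n n R) 2) * (1 + c • x) := by
    rw [mul_add, mul_one, map_ofNat, mul_smul_comm, two_mul, smul_add, ← add_smul, ← two_mul, hc,
      one_smul]
  rw [h2]
  exact (hR.two.map _).mul h1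

theorem QuadraticLevel.isUnit_of_sub_mem {r u : R} (hu : IsUnit u) (h : r - u ∈ 𝔪) : IsUnit r := by
  have : IsNilpotent (r - u) := ⟨ℓ, by
    have := Ideal.pow_mem_pow h ℓ
    rwa [hR.pow_eq_bot] at this⟩
  have h1 := this.isUnit_add_left_of_commute hu (Commute.all _ _)
  rwa [add_sub_cancel] at h1

theorem QuadraticLevel.finite_gl : Finite (GL n R) := by
  have := hR.finite
  have : Finite (Matrix n n R) := inferInstanceAs (Finite (n → n → R))
  infer_instance

/-- The principal congruence subgroup has odd order. -/
theorem QuadraticLevel.odd_card : Odd (Nat.card (congKer n (𝔪 ^ 1))) := by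
  have := hR.finite_gl (n := n)
  rw [← Nat.not_even_iff_odd, even_iff_two_dvd]
  intro h2
  have := Fact.mk Nat.prime_two
  obtain ⟨x, hx⟩ := exists_prime_orderOf_dvd_card' 2 h2
  have h1 : x * x = 1 := by rw [← pow_two, ← hx, pow_orderOf_eq_one]
  have hxm : EntriesIn 𝔪 (x.1.1 - 1) := (mem_congKer.1 x.2).mono (pow_one 𝔪).le
  have h3 : x.1.1 * x.1.1 = 1 := congrArg (fun y : congKer n (𝔪 ^ 1) => y.1.1) h1
  have h4 := hR.isUnit_two_add hxm
  -- For an involution `x` congruent to 1, the matrix `x + 1` is invertible because 2 is a unit, so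
  -- `x² - 1 = 0` forces `x = 1`.
  have h5 : (2 + (x.1.1 - 1)) * (x.1.1 - 1) = 0 := by
    have : (2 + (x.1.1 - 1)) * (x.1.1 - 1) = x.1.1 * x.1.1 - 1 := by
      rw [← one_add_one_eq_two]
      noncomm_ring
    rw [this, h3, sub_self]
  have h6 : x.1.1 = 1 := sub_eq_zero.1 ((h4.mul_right_eq_zero).1 h5)
  have h7 : x = 1 := Subtype.ext (Units.ext h6)
  rw [h7, orderOf_one] at hx
  omega

theorem QuadraticLevel.odd_card_subgroupOf (𝒢 : Subgroup (GL n R)) :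
    Odd (Nat.card ((congKer n (𝔪 ^ 1)).subgroupOf 𝒢)) := by
  refine Odd.of_dvd_nat (hR.odd_card (n := n)) ?_
  exact Subgroup.card_dvd_of_injective (subgroupOfIncl _ _)
    (fun x y h => Subtype.ext (Subtype.ext (congrArg (fun z => z.1) h)))

theorem QuadraticLevel.exists_sqrt : ∃ m : ℕ, ∀ x ∈ congKer n (𝔪 ^ 1), x ^ m * x ^ m = x := by
  obtain ⟨k, hk⟩ := hR.odd_card (n := n)
  refine ⟨k + 1, fun x hx => ?_⟩
  have h1 : (⟨x, hx⟩ : congKer n (𝔪 ^ 1)) ^ Nat.card (congKer n (𝔪 ^ 1)) = 1 := pow_card_eq_one'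
  have h2 : x ^ Nat.card (congKer n (𝔪 ^ 1)) = 1 := congrArg Subtype.val h1
  rw [← pow_add, show k + 1 + (k + 1) = Nat.card (congKer n (𝔪 ^ 1)) + 1 by omega, pow_succ, h2,
    one_mul]

omit hR in
theorem pow_le_of_one_le {i : ℕ} (hi : 1 ≤ i) : 𝔪 ^ i ≤ 𝔪 := by
  conv_rhs => rw [← pow_one 𝔪]
  exact Ideal.pow_le_pow_right hi

theorem QuadraticLevel.eq_zero_of_pow {m p : Type*} {x : Matrix m p R} {k : ℕ} (hk : ℓ ≤ k)
    (hx : EntriesIn (𝔪 ^ k) x) : x = 0 := by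
  have := hx.mono (Ideal.pow_le_pow_right hk)
  rw [hR.pow_eq_bot] at this
  exact this.eq_zero

/-- Elements whose determinant is `± 1` and `1` modulo `𝔪`. -/
theorem QuadraticLevel.eq_one_of_sq {r : R} (h : r * r = 1) (h1 : r - 1 ∈ 𝔪) : r = 1 := by
  have h2 : IsUnit (r + 1) := hR.isUnit_of_sub_mem hR.two (by
    rwa [show r + 1 - 2 = r - 1 by ring])
  have h3 : (r + 1) * (r - 1) = 0 := by linear_combination h
  exact sub_eq_zero.1 ((h2.mul_right_eq_zero).1 h3)

omit hR in
theorem det_sub_one_mem {I : Ideal R} {g : Matrix n n R} (hg : EntriesIn I (g - 1)) :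
    g.det - 1 ∈ I := by
  rw [← Ideal.Quotient.eq_zero_iff_mem, map_sub, map_one, RingHom.map_det, sub_eq_zero]
  have h := entriesIn_iff_map.1 hg
  rw [Matrix.map_sub _ (map_sub _), Matrix.map_one _ (map_zero _) (map_one _), sub_eq_zero] at h
  have h2 : (Ideal.Quotient.mk I).mapMatrix g = 1 := h
  rw [h2, det_one]

/-- The Cayley transform. -/
theorem QuadraticLevel.exists_cayley {i : ℕ} (hi : 1 ≤ i) {x : Matrix n n R}
    (hx : EntriesIn (𝔪 ^ i) x) :
    ∃ u : GL n R, u.1 * (1 - x) = 1 + x ∧ u ∈ congKer n (𝔪 ^ i) := by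
  have hx1 := hx.mono (pow_le_of_one_le hi)
  obtain ⟨v, hv⟩ := hR.isUnit_one_add hx1
  obtain ⟨w, hw⟩ := hR.isUnit_one_add hx1.neg
  rw [← sub_eq_add_neg] at hw
  -- `u = (1 + x)(1 - x)⁻¹`.
  refine ⟨v * w⁻¹, ?_, ?_⟩
  · rw [Units.val_mul, mul_assoc, ← hw, Units.inv_mul, mul_one, hv]
  · rw [mem_congKer]
    have : (v * w⁻¹ : GL n R).1 - 1 = (x + x) * (w⁻¹).1 := by
      have e : x + x = v.1 - w.1 := by rw [hv, hw]; abel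
      rw [e, sub_mul, Units.mul_inv, Units.val_mul]
    rw [this]
    exact (hx.add hx).mul_right _

/-- The inverse Cayley transform. -/
theorem QuadraticLevel.exists_cayley_inv {i : ℕ} (hi : 1 ≤ i) {u : GL n R}
    (hu : u ∈ congKer n (𝔪 ^ i)) :
    ∃ x : Matrix n n R, u.1 * (1 - x) = 1 + x ∧ EntriesIn (𝔪 ^ i) x := by
  have hu' := mem_congKer.1 hu
  obtain ⟨v, hv⟩ := hR.isUnit_two_add (hu'.mono (pow_le_of_one_le hi))
  -- Solving the Cayley equation for `x` gives `(u + 1) x = u - 1`, and `v` is `u + 1` written as `2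
  -- + (u - 1)`.
  refine ⟨(v⁻¹).1 * (u.1 - 1), ?_, hu'.mul_left _⟩
  have h1 : (2 + (u.1 - 1)) * ((v⁻¹).1 * (u.1 - 1)) = u.1 - 1 := by
    rw [← hv, Units.mul_inv_cancel_left]
  have h2 : u.1 * (1 - (v⁻¹).1 * (u.1 - 1)) - (1 + (v⁻¹).1 * (u.1 - 1)) =
      u.1 - 1 - (2 + (u.1 - 1)) * ((v⁻¹).1 * (u.1 - 1)) := by noncomm_ring
  rw [h1, sub_self] at h2
  exact sub_eq_zero.1 h2

theorem QuadraticLevel.cayley_inj {u : GL n R} (hu : u ∈ congKer n (𝔪 ^ 1)) {x y : Matrix n n R}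
    (hx : u.1 * (1 - x) = 1 + x) (hy : u.1 * (1 - y) = 1 + y) : x = y := by
  have hu' := mem_congKer.1 hu
  rw [pow_one] at hu'
  have h1 := hR.isUnit_two_add hu'
  have h2 : (2 + (u.1 - 1)) * (x - y) = u.1 * (1 - y) - (1 + y) - (u.1 * (1 - x) - (1 + x)) := by
    noncomm_ring
  rw [hx, hy, sub_self, sub_self, sub_self] at h2
  exact sub_eq_zero.1 ((h1.mul_right_eq_zero).1 h2)

theorem QuadraticLevel.cayley_inj' {u v : GL n R} {x : Matrix n n R} (hx : EntriesIn 𝔪 x)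
    (hu : u.1 * (1 - x) = 1 + x) (hv : v.1 * (1 - x) = 1 + x) : u = v := by
  have h := hR.isUnit_one_add hx.neg
  rw [← sub_eq_add_neg] at h
  exact Units.ext (h.mul_right_cancel (hu.trans hv.symm))

include hc

theorem ClassicalForm.fixed_of_cayley {u : GL n R} {x : Matrix n n R} (hx : EntriesIn 𝔪 x)
    (hu : u.1 * (1 - x) = 1 + x) (hD : D x = x) : F u = u := by
  have h := hc.cayley u x hu
  rw [hD] at h
  exact hR.cayley_inj' hx h hu

theorem ClassicalForm.cayley_of_fixed {u : GL n R} {x : Matrix n n R}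
    (hm : u ∈ congKer n (𝔪 ^ 1)) (hu : u.1 * (1 - x) = 1 + x) (hF : F u = u) : D x = x := by
  have h := hc.cayley u x hu
  rw [hF] at h
  exact hR.cayley_inj hm h hu

/-- A matrix that pairs trivially with the fixed points of `D` is small. -/
theorem ClassicalForm.mem_of_pairing {ψ : AddChar R ℂ}
    (hψ : ∃ t ∈ 𝔪 ^ (ℓ - 1), ψ (t + σ t) ≠ 1) {i j : ℕ} (hij : i + j + 1 = ℓ)
    {W : Matrix n n R} (hDW : EntriesIn (𝔪 ^ (i + 1)) (D W - W))
    {c : R} (hcu : IsUnit c) (hcσ : σ c = c) {X : R → Matrix n n R} {w : R}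
    (hX : ∀ s ∈ 𝔪 ^ j, EntriesIn (𝔪 ^ j) (X s)) (hwX : ∀ s, (W * X s).trace = w * s)
    (h : ∀ s ∈ 𝔪 ^ j, ψ (c * (W * (X s + D (X s))).trace) = 1) (hw : w ∈ 𝔪 ^ i) :
    w ∈ 𝔪 ^ (i + 1) := by
  by_contra hw'
  obtain ⟨t, ht, hψt⟩ := hψ
  obtain ⟨c', hc'⟩ := hcu.exists_right_inv
  -- If `w` were not in `𝔪 ^ (i + 1)`, its multiples by `𝔪 ^ j` would exhaust `𝔪 ^ (ℓ - 1)`.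
  -- Choosing `w s = c⁻¹ t` makes the tested value `ψ(t + σ t)`.
  obtain ⟨s, hs, hts⟩ := hR.dvd i j hij w hw hw' (c' * t) (by
    rw [show i + j = ℓ - 1 by omega]
    exact Ideal.mul_mem_left _ _ ht)
  apply hψt
  rw [← h s hs]
  congr 1
  -- Replacing `W` by `D W` costs a product in `𝔪 ^ (i + 1 + j) = 0`, and `D` turns the trace form
  -- into its `σ`-image.
  have h1 : (W * D (X s)).trace = σ (W * X s).trace := by
    rw [← hc.trace_mul, ← sub_eq_zero, ← trace_sub, ← sub_mul, ← neg_sub (D W), neg_mul,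
      trace_neg]
    have := hR.eq_zero_of_pow (k := ℓ) le_rfl (hDW.pow_succ_mul (k := ℓ) (by omega)
      (hc.entriesIn (hR.map_mem j) (hX s hs)))
    rw [this, trace_zero, neg_zero]
  rw [mul_add, trace_add, h1, hwX, ← hts, mul_add]
  have h2 : c * σ (c' * t) = σ t := by
    conv_lhs => rw [← hcσ]
    rw [← map_mul, ← mul_assoc, hc', one_mul]
  rw [h2, ← mul_assoc, hc', one_mul]

end ClassicalForm

/-! ### The filtered involution attached to a block decomposition -/

section CongChar

variable {R : Type v} [CommRing R] {n : Type w} [Fintype n] [DecidableEq n]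

theorem trace_mul_mul_sub_one {I : Ideal R} (hI : I * I = ⊥) (ξ : Matrix n n R) {g h : Matrix n n R}
    (hg : EntriesIn I (g - 1)) (hh : EntriesIn I (h - 1)) :
    (ξ * (g * h - 1)).trace = (ξ * (g - 1)).trace + (ξ * (h - 1)).trace := by
  have h0 : (g - 1) * (h - 1) = 0 := (hI ▸ hg.mul hh : EntriesIn ⊥ _).eq_zero
  have : g * h - 1 = (g - 1) + (h - 1) := by
    have : g * h - 1 = (g - 1) * (h - 1) + ((g - 1) + (h - 1)) := by noncomm_ring
    rw [this, h0, zero_add]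
  rw [this, mul_add, trace_add]

/-- The character `g ↦ ψ (tr (ξ (g - 1)))` of the congruence subgroup of an ideal of square zero. -/
noncomputable def congChar (𝒢 : Subgroup (GL n R)) {I : Ideal R} (hI : I * I = ⊥)
    (ξ : Matrix n n R) (ψ : AddChar R ℂ) : (congKer n I).subgroupOf 𝒢 →* ℂˣ :=
  MonoidHom.toHomUnits
    { toFun := fun g => ψ (ξ * (g.1.1.1 - 1)).trace
      map_one' := by simp
      map_mul' := fun g h => by
        have e := trace_mul_mul_sub_one hI ξ (g := g.1.1.1) (h := h.1.1.1) (mem_congKer.1 g.2)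
          (mem_congKer.1 h.2)
        exact (congrArg ψ e).trans (AddChar.map_add_eq_mul ψ _ _) }

theorem ev_congChar {𝒢 : Subgroup (GL n R)} {I : Ideal R} (hI : I * I = ⊥)
    (ξ : Matrix n n R) (ψ : AddChar R ℂ) {g : 𝒢} (hg : g ∈ (congKer n I).subgroupOf 𝒢) :
    ((ev (congChar 𝒢 hI ξ ψ) g : ℂˣ) : ℂ) = ψ (ξ * (g.1.1 - 1)).trace := by
  rw [ev_of_mem _ hg]
  rfl

end CongChar

/-- Conjugation by an involution that normalises a subgroup. -/
def conjAut {G : Type u} [Group G] (𝒢 : Subgroup G) (t : G) (ht : t * t = 1)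
    (h : ∀ g ∈ 𝒢, t * g * t⁻¹ ∈ 𝒢) : MulAut 𝒢 where
  toFun g := ⟨t * g * t⁻¹, h g g.2⟩
  invFun g := ⟨t * g * t⁻¹, h g g.2⟩
  left_inv g := Subtype.ext (by
    have : t⁻¹ = t := inv_eq_of_mul_eq_one_left ht
    change t * (t * g * t⁻¹) * t⁻¹ = g
    rw [this, ← mul_assoc, ← mul_assoc, ht, one_mul, mul_assoc, ht, mul_one])
  right_inv g := Subtype.ext (by
    have : t⁻¹ = t := inv_eq_of_mul_eq_one_left ht
    change t * (t * g * t⁻¹) * t⁻¹ = g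
    rw [this, ← mul_assoc, ← mul_assoc, ht, one_mul, mul_assoc, ht, mul_one])
  map_mul' g g' := Subtype.ext (by simp [mul_assoc])

theorem conjAut_invol {G : Type u} [Group G] (𝒢 : Subgroup G) (t : G) (ht : t * t = 1)
    (h : ∀ g ∈ 𝒢, t * g * t⁻¹ ∈ 𝒢) (g : 𝒢) : conjAut 𝒢 t ht h (conjAut 𝒢 t ht h g) = g :=
  (conjAut 𝒢 t ht h).left_inv g

section Block

variable {R : Type v} [CommRing R] {n₁ n₂ : Type w} [Fintype n₁] [DecidableEq n₁]
    [Fintype n₂] [DecidableEq n₂]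

/-- The matrix `diag(1, -1)`. -/
def signGL (R : Type v) [CommRing R] (n₁ n₂ : Type w) [Fintype n₁] [DecidableEq n₁]
    [Fintype n₂] [DecidableEq n₂] : GL (n₁ ⊕ n₂) R where
  val := fromBlocks 1 0 0 (-1)
  inv := fromBlocks 1 0 0 (-1)
  val_inv := by simp [fromBlocks_multiply]
  inv_val := by simp [fromBlocks_multiply]

theorem signGL_mul_self : signGL R n₁ n₂ * signGL R n₁ n₂ = 1 := Units.ext (by
  simp [signGL, fromBlocks_multiply])

theorem inv_signGL : (signGL R n₁ n₂)⁻¹ = signGL R n₁ n₂ :=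
  inv_eq_of_mul_eq_one_left signGL_mul_self

theorem conj_signGL (x : Matrix (n₁ ⊕ n₂) (n₁ ⊕ n₂) R) :
    (signGL R n₁ n₂).1 * x * (signGL R n₁ n₂)⁻¹.1 =
      fromBlocks x.toBlocks₁₁ (-x.toBlocks₁₂) (-x.toBlocks₂₁) x.toBlocks₂₂ := by
  rw [inv_signGL]
  conv_lhs => rw [← fromBlocks_toBlocks x]
  simp [signGL, fromBlocks_multiply]

omit [Fintype n₁] [DecidableEq n₁] [Fintype n₂] [DecidableEq n₂] in
theorem entriesIn_fromBlocks {I : Ideal R} {m₁ m₂ : Type*} {a : Matrix n₁ m₁ R}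
    {b : Matrix n₁ m₂ R} {c : Matrix n₂ m₁ R} {d : Matrix n₂ m₂ R} :
    EntriesIn I (fromBlocks a b c d) ↔
      EntriesIn I a ∧ EntriesIn I b ∧ EntriesIn I c ∧ EntriesIn I d := by
  constructor
  · intro h
    exact ⟨fun i j => h (Sum.inl i) (Sum.inl j), fun i j => h (Sum.inl i) (Sum.inr j),
      fun i j => h (Sum.inr i) (Sum.inl j), fun i j => h (Sum.inr i) (Sum.inr j)⟩
  · rintro ⟨ha, hb, hc, hd⟩ (i | i) (j | j)
    exacts [ha i j, hb i j, hc i j, hd i j]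

/-- A matrix that commutes with `ξ` modulo `J` commutes with polynomials in `ξ` modulo `J`. -/
theorem entriesIn_bracket_aeval {n : Type w} [Fintype n] [DecidableEq n] {J : Ideal R}
    {ξ x : Matrix n n R} (h : EntriesIn J (x * ξ - ξ * x)) (p : Polynomial R) :
    EntriesIn J (x * Polynomial.aeval ξ p - Polynomial.aeval ξ p * x) := by
  induction p using Polynomial.induction_on' with
  | add p q hp hq =>
    rw [map_add]
    have : x * (Polynomial.aeval ξ p + Polynomial.aeval ξ q) -
      (Polynomial.aeval ξ p + Polynomial.aeval ξ q) * x =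
      (x * Polynomial.aeval ξ p - Polynomial.aeval ξ p * x) +
        (x * Polynomial.aeval ξ q - Polynomial.aeval ξ q * x) := by noncomm_ring
    rw [this]
    exact hp.add hq
  | monomial k a =>
    rw [Polynomial.aeval_monomial, ← Algebra.smul_def, mul_smul_comm, smul_mul_assoc, ← smul_sub]
    refine EntriesIn.smul _ ?_
    induction k with
    | zero =>
      rw [pow_zero, mul_one, one_mul, sub_self]
      exact EntriesIn.zero
    | succ k ih =>
      have : x * ξ ^ (k + 1) - ξ ^ (k + 1) * x =
          (x * ξ ^ k - ξ ^ k * x) * ξ + ξ ^ k * (x * ξ - ξ * x) := by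
        rw [pow_succ]
        noncomm_ring
      rw [this]
      exact (ih.mul_right _).add (h.mul_left _)

/-- The off-diagonal blocks of a matrix that commutes with a decomposable matrix are small. -/
theorem entriesIn_offDiag {𝔪 : Ideal R} {i : ℕ} {ξ x : Matrix (n₁ ⊕ n₂) (n₁ ⊕ n₂) R}
    (hp : ∃ p : Polynomial R, EntriesIn 𝔪 (Polynomial.aeval ξ p - fromBlocks 1 0 0 0))
    (hx : EntriesIn (𝔪 ^ i) x) (h : EntriesIn (𝔪 ^ (i + 1)) (x * ξ - ξ * x)) :
    EntriesIn (𝔪 ^ (i + 1)) x.toBlocks₁₂ ∧ EntriesIn (𝔪 ^ (i + 1)) x.toBlocks₂₁ := by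
  obtain ⟨p, hp⟩ := hp
  set P := Polynomial.aeval ξ p
  have h1 := entriesIn_bracket_aeval h p
  have h2 : EntriesIn (𝔪 ^ (i + 1)) (x * (P - fromBlocks 1 0 0 0)) := by
    rw [pow_succ]
    exact hx.mul hp
  have h3 : EntriesIn (𝔪 ^ (i + 1)) ((P - fromBlocks 1 0 0 0) * x) := by
    rw [pow_succ']
    exact hp.mul hx
  -- The entries of this commutator with the projector are, up to sign, exactly the off-diagonal
  -- blocks of `x`.
  have h4 : EntriesIn (𝔪 ^ (i + 1)) (x * fromBlocks 1 0 0 0 - fromBlocks 1 0 0 0 * x) := by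
    have : x * fromBlocks 1 0 0 0 - fromBlocks 1 0 0 0 * x =
      (x * P - P * x) - x * (P - fromBlocks 1 0 0 0) + (P - fromBlocks 1 0 0 0) * x := by
        noncomm_ring
    rw [this]
    exact (h1.sub h2).add h3
  rw [← fromBlocks_toBlocks x, fromBlocks_multiply, fromBlocks_multiply, sub_eq_add_neg,
    fromBlocks_neg, fromBlocks_add, entriesIn_fromBlocks] at h4
  simp only [Matrix.mul_one, Matrix.mul_zero, add_zero, Matrix.one_mul, Matrix.zero_mul,
    neg_zero, zero_add] at h4
  exact ⟨neg_neg x.toBlocks₁₂ ▸ h4.2.1.neg, h4.2.2.1⟩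

/-- A classical group with a block decomposition and a matrix in its Lie algebra that is adapted to
this decomposition. -/
structure LeviDatum (σ : R →+* R) (𝔪 : Ideal R) (ℓ q : ℕ) (special : Prop)
    (F : GL (n₁ ⊕ n₂) R →* GL (n₁ ⊕ n₂) R)
    (D : Matrix (n₁ ⊕ n₂) (n₁ ⊕ n₂) R →+ Matrix (n₁ ⊕ n₂) (n₁ ⊕ n₂) R)
    (𝒢 : Subgroup (GL (n₁ ⊕ n₂) R)) (ξ : Matrix (n₁ ⊕ n₂) (n₁ ⊕ n₂) R) : Prop where
  level : QuadraticLevel σ 𝔪 ℓ q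
  form : ClassicalForm σ F D
  mem : ∀ g, g ∈ 𝒢 ↔ F g = g ∧ (special → g.1.det = 1)
  sign : F (signGL R n₁ n₂) = signGL R n₁ n₂
  card_unit : special → IsUnit (Fintype.card (n₁ ⊕ n₂) : R)
  two_le : 2 ≤ ℓ
  fixed : EntriesIn 𝔪 (D ξ - ξ)
  block : (signGL R n₁ n₂).1 * ξ * (signGL R n₁ n₂)⁻¹.1 = ξ
  poly : ∃ p : Polynomial R, EntriesIn 𝔪 (Polynomial.aeval ξ p - fromBlocks 1 0 0 0)

namespace LeviDatum

variable {σ : R →+* R} {𝔪 : Ideal R} {ℓ q : ℕ} {special : Prop}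
    {F : GL (n₁ ⊕ n₂) R →* GL (n₁ ⊕ n₂) R}
    {D : Matrix (n₁ ⊕ n₂) (n₁ ⊕ n₂) R →+ Matrix (n₁ ⊕ n₂) (n₁ ⊕ n₂) R}
    {𝒢 : Subgroup (GL (n₁ ⊕ n₂) R)} {ξ : Matrix (n₁ ⊕ n₂) (n₁ ⊕ n₂) R}
    (hL : LeviDatum σ 𝔪 ℓ q special F D 𝒢 ξ)

include hL

theorem conj_sign_mem (g : GL (n₁ ⊕ n₂) R) (hg : g ∈ 𝒢) :
    signGL R n₁ n₂ * g * (signGL R n₁ n₂)⁻¹ ∈ 𝒢 := by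
  rw [hL.mem] at hg ⊢
  refine ⟨by rw [map_mul, map_mul, map_inv, hL.sign, hg.1], fun hs => ?_⟩
  rw [← hg.2 hs, Units.val_mul, Units.val_mul, det_mul, det_mul, mul_right_comm, ← det_mul,
    Units.mul_inv, det_one, one_mul]

/-- Conjugation by `diag(1, -1)`. -/
def invol : MulAut 𝒢 := conjAut 𝒢 (signGL R n₁ n₂) signGL_mul_self hL.conj_sign_mem

theorem coe_invol (g : 𝒢) : (hL.invol g : GL (n₁ ⊕ n₂) R) =
    signGL R n₁ n₂ * g * (signGL R n₁ n₂)⁻¹ := rfl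

theorem sq_eq_bot : 𝔪 ^ (ℓ - 1) * 𝔪 ^ (ℓ - 1) = ⊥ := by
  have := hL.two_le
  rw [← pow_add, eq_bot_iff, ← hL.level.pow_eq_bot]
  exact Ideal.pow_le_pow_right (by omega)

/-- The Cayley transform of a small matrix inverted by the involution lies in the group. -/
theorem cayley_mem {i : ℕ} (hi : 1 ≤ i) {x : Matrix (n₁ ⊕ n₂) (n₁ ⊕ n₂) R}
    (hx : EntriesIn (𝔪 ^ i) x) (hD : D x = x)
    (hsx : (signGL R n₁ n₂).1 * x * (signGL R n₁ n₂)⁻¹.1 = -x) {u : GL (n₁ ⊕ n₂) R}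
    (hu : u.1 * (1 - x) = 1 + x) (hui : u ∈ congKer (n₁ ⊕ n₂) (𝔪 ^ i)) :
    u ∈ 𝒢 ∧ signGL R n₁ n₂ * u * (signGL R n₁ n₂)⁻¹ = u⁻¹ := by
  set t := signGL R n₁ n₂ with ht
  have hx1 := hx.mono (pow_le_of_one_le hi)
  have h1 : t * u * t⁻¹ = u⁻¹ := by
    refine hL.level.cayley_inj' hx1.neg ?_ ?_
    · have : (1 : Matrix (n₁ ⊕ n₂) (n₁ ⊕ n₂) R) - -x = t.1 * (1 - x) * t⁻¹.1 := by
        rw [mul_sub, sub_mul, hsx, mul_one, Units.mul_inv]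
      rw [this, Units.val_mul, Units.val_mul]
      have e : t.1 * u.1 * t⁻¹.1 * (t.1 * (1 - x) * t⁻¹.1) = t.1 * (u.1 * (1 - x)) * t⁻¹.1 := by
        simp only [mul_assoc, Units.inv_mul_cancel_left]
      rw [e, hu, mul_add, add_mul, hsx, mul_one, Units.mul_inv]
    · rw [sub_neg_eq_add, ← hu, Units.inv_mul_cancel_left, sub_eq_add_neg]
  refine ⟨(hL.mem u).2 ⟨hL.form.fixed_of_cayley hL.level hx1 hu hD, fun _ => ?_⟩, h1⟩
  -- `u` is conjugate to `u⁻¹`, so its determinant squares to 1. It is also 1 modulo `𝔪`, and the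
  -- determinant condition is therefore automatic on inverted elements.
  refine hL.level.eq_one_of_sq ?_ (det_sub_one_mem
    ((mem_congKer.1 hui).mono (pow_le_of_one_le hi)))
  have h2 := congrArg (fun g : GL (n₁ ⊕ n₂) R => g.1.det) h1
  simp only [Units.val_mul, det_mul] at h2
  rw [mul_right_comm, ← det_mul, Units.mul_inv, det_one, one_mul] at h2
  conv_lhs =>
    congr
    · skip
    · rw [h2]
  rw [← det_mul, Units.mul_inv, det_one]

/-- The Cayley coordinate of an element is unique, so the symmetries of `u` under `F` and under the
sign matrix carry over to `x`. -/
theorem cayley_inv {i : ℕ} (hi : 1 ≤ i) {u : GL (n₁ ⊕ n₂) R} (hu : u ∈ 𝒢)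
    (hui : u ∈ congKer (n₁ ⊕ n₂) (𝔪 ^ i))
    (hT : signGL R n₁ n₂ * u * (signGL R n₁ n₂)⁻¹ = u⁻¹) :
    ∃ x : Matrix (n₁ ⊕ n₂) (n₁ ⊕ n₂) R, u.1 * (1 - x) = 1 + x ∧ EntriesIn (𝔪 ^ i) x ∧ D x = x ∧
      (signGL R n₁ n₂).1 * x * (signGL R n₁ n₂)⁻¹.1 = -x := by
  set t := signGL R n₁ n₂ with ht
  have hu1 : u ∈ congKer (n₁ ⊕ n₂) (𝔪 ^ 1) := congKer_mono (Ideal.pow_le_pow_right hi) hui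
  obtain ⟨x, hx, hxi⟩ := hL.level.exists_cayley_inv hi hui
  refine ⟨x, hx, hxi, hL.form.cayley_of_fixed hL.level hu1 hx ((hL.mem u).1 hu).1, ?_⟩
  refine hL.level.cayley_inj (u := u⁻¹) (inv_mem hu1) ?_ ?_
  · have : (1 : Matrix (n₁ ⊕ n₂) (n₁ ⊕ n₂) R) - t.1 * x * t⁻¹.1 = t.1 * (1 - x) * t⁻¹.1 := by
      rw [mul_sub, sub_mul, mul_one, Units.mul_inv]
    rw [this, ← hT, Units.val_mul, Units.val_mul]
    have e : t.1 * u.1 * t⁻¹.1 * (t.1 * (1 - x) * t⁻¹.1) = t.1 * (u.1 * (1 - x)) * t⁻¹.1 := by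
      simp only [mul_assoc, Units.inv_mul_cancel_left]
    rw [e, hx, mul_add, add_mul, mul_one, Units.mul_inv]
  · rw [sub_neg_eq_add, ← hx, Units.inv_mul_cancel_left, sub_eq_add_neg]

/-- The number of off-diagonal elements of the Lie algebra. -/
theorem card_offDiag {i : ℕ} (hi : i ≤ ℓ) :
    Nat.card {x : Matrix (n₁ ⊕ n₂) (n₁ ⊕ n₂) R // EntriesIn (𝔪 ^ i) x ∧ D x = x ∧
      (signGL R n₁ n₂).1 * x * (signGL R n₁ n₂)⁻¹.1 = -x} =
      (q ^ (Fintype.card n₁ * Fintype.card n₂)) ^ (2 * (ℓ - i)) := by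
  have := hL.level.finite
  have hfin : Finite (Matrix (n₁ ⊕ n₂) (n₁ ⊕ n₂) R) :=
    inferInstanceAs (Finite (n₁ ⊕ n₂ → n₁ ⊕ n₂ → R))
  obtain ⟨δ, hδ, hσδ⟩ := hL.level.skew
  obtain ⟨δ', hδ'⟩ := hδ.exists_right_inv
  obtain ⟨c, hc⟩ := hL.level.two.exists_right_inv
  set t := signGL R n₁ n₂ with ht
  have hσc : σ c = c := by
    have h1 := congrArg σ hc
    rw [map_mul, map_ofNat, map_one] at h1
    linear_combination c * h1 - σ c * hc
  have hDt : ∀ x, D (t.1 * x * t⁻¹.1) = t.1 * D x * t⁻¹.1 := fun x => by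
    rw [hL.form.conj, hL.sign]
  let X := {x : Matrix (n₁ ⊕ n₂) (n₁ ⊕ n₂) R // EntriesIn (𝔪 ^ i) x ∧ t.1 * x * t⁻¹.1 = -x}
  let Y := {x : Matrix (n₁ ⊕ n₂) (n₁ ⊕ n₂) R // EntriesIn (𝔪 ^ i) x ∧ D x = x ∧
      t.1 * x * t⁻¹.1 = -x}
  have hsm : ∀ (r : R) (x : Matrix (n₁ ⊕ n₂) (n₁ ⊕ n₂) R), t.1 * x * t⁻¹.1 = -x →
      t.1 * (r • x) * t⁻¹.1 = -(r • x) := fun r x h => by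
    rw [mul_smul_comm, smul_mul_assoc, h, smul_neg]
  -- Multiplication by the skew unit `δ` exchanges the matrices with `D x = x` and `D x = -x`. As 2
  -- is invertible, all off-diagonal matrices decompose as `x + δ y` with `x`, `y` fixed by `D`.
  have hXY : Nat.card (Y × Y) = Nat.card X := by
    refine Nat.card_congr (Equiv.ofBijective (fun p : Y × Y => (⟨p.1.1 + δ • p.2.1,
      p.1.2.1.add (p.2.2.1.smul δ), by
        rw [mul_add, add_mul, p.1.2.2.2, hsm δ _ p.2.2.2.2, neg_add]⟩ : X)) ⟨?_, ?_⟩)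
    · rintro ⟨⟨x, hx⟩, ⟨y, hy⟩⟩ ⟨⟨x', hx'⟩, ⟨y', hy'⟩⟩ h
      have h1 : x + δ • y = x' + δ • y' := congrArg Subtype.val h
      have h2 := congrArg D h1
      rw [map_add, map_add, hL.form.D_smul, hL.form.D_smul, hx.2.1, hx'.2.1, hy.2.1, hy'.2.1,
        hσδ, neg_smul, neg_smul] at h2
      have h3 : (2 : R) • x = (2 : R) • x' := by
        rw [two_smul, two_smul]
        have : x + δ • y + (x + -(δ • y)) = x' + δ • y' + (x' + -(δ • y')) :=
          congrArg₂ (· + ·) h1 h2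
        have e : ∀ a b : Matrix (n₁ ⊕ n₂) (n₁ ⊕ n₂) R, a + b + (a + -b) = a + a := fun a b => by
          abel
        rwa [e, e] at this
      have h4 : x = x' := by
        have := congrArg (fun z => c • z) h3
        simpa only [smul_smul, mul_comm c 2, hc, one_smul] using this
      subst h4
      have h5 := add_left_cancel h1
      have h6 : y = y' := by
        have := congrArg (fun z => δ' • z) h5
        simpa only [smul_smul, mul_comm δ' δ, hδ', one_smul] using this
      subst h6
      rfl
    · rintro ⟨x, hx, htx⟩
      have hDx : EntriesIn (𝔪 ^ i) (D x) := hL.form.entriesIn (hL.level.map_mem i) hx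
      have htDx : t.1 * D x * t⁻¹.1 = -D x := by rw [← hDt, htx, map_neg]
      have hσδ' : σ δ' = -δ' := by
        have h1 := congrArg σ hδ'
        rw [map_mul, map_one, hσδ] at h1
        linear_combination -δ' * h1 - σ δ' * hδ'
      refine ⟨(⟨c • (x + D x), (hx.add hDx).smul c, ?_, hsm _ _ ?_⟩,
        ⟨(c * δ') • (x - D x), (hx.sub hDx).smul _, ?_, hsm _ _ ?_⟩), ?_⟩
      · rw [hL.form.D_smul, map_add, hL.form.D_invol, hσc, add_comm]
      · rw [mul_add, add_mul, htx, htDx, neg_add]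
      · rw [hL.form.D_smul, map_sub, hL.form.D_invol, map_mul, hσc, hσδ', mul_neg, neg_smul,
          ← smul_neg, neg_sub]
      · rw [mul_sub, sub_mul, htx, htDx, neg_sub_neg, neg_sub]
      · apply Subtype.ext
        change c • (x + D x) + δ • (c * δ') • (x - D x) = x
        rw [smul_smul, show δ * (c * δ') = c by linear_combination c * hδ', ← smul_add,
          add_add_sub_cancel, ← two_smul R x, smul_smul, mul_comm, hc, one_smul]
  have hX : Nat.card X = (q ^ (2 * (ℓ - i))) ^ (2 * (Fintype.card n₁ * Fintype.card n₂)) := by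
    have e : X ≃ ((n₁ → n₂ → (𝔪 ^ i : Ideal R)) × (n₂ → n₁ → (𝔪 ^ i : Ideal R))) :=
      { toFun := fun x => (fun a b => ⟨x.1 (Sum.inl a) (Sum.inr b), x.2.1 _ _⟩,
          fun a b => ⟨x.1 (Sum.inr a) (Sum.inl b), x.2.1 _ _⟩)
        invFun := fun y => ⟨fromBlocks 0 (Matrix.of fun a b => (y.1 a b : R))
          (Matrix.of fun a b => (y.2 a b : R)) 0, entriesIn_fromBlocks.2 ⟨EntriesIn.zero,
            fun a b => (y.1 a b).2, fun a b => (y.2 a b).2, EntriesIn.zero⟩, by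
          rw [ht, conj_signGL, fromBlocks_neg]
          simp⟩
        left_inv := fun x => by
          have h : (signGL R n₁ n₂).1 * x.1 * (signGL R n₁ n₂)⁻¹.1 = -x.1 := x.2.2
          rw [conj_signGL] at h
          have h1 : ∀ a b, x.1 (Sum.inl a) (Sum.inl b) = 0 := fun a b => by
            have := congrFun (congrFun h (Sum.inl a)) (Sum.inl b)
            change x.1 (Sum.inl a) (Sum.inl b) = - x.1 (Sum.inl a) (Sum.inl b) at this
            linear_combination c * this - x.1 (Sum.inl a) (Sum.inl b) * hc
          have h2 : ∀ a b, x.1 (Sum.inr a) (Sum.inr b) = 0 := fun a b => by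
            have := congrFun (congrFun h (Sum.inr a)) (Sum.inr b)
            change x.1 (Sum.inr a) (Sum.inr b) = - x.1 (Sum.inr a) (Sum.inr b) at this
            linear_combination c * this - x.1 (Sum.inr a) (Sum.inr b) * hc
          apply Subtype.ext
          ext (a | a) (b | b)
          · exact (h1 a b).symm
          · rfl
          · rfl
          · exact (h2 a b).symm
        right_inv := fun y => rfl }
    rw [Nat.card_congr e, Nat.card_prod]
    simp only [Nat.card_fun, Nat.card_eq_fintype_card (α := n₁),
      Nat.card_eq_fintype_card (α := n₂), hL.level.card i hi]
    ring
  rw [Nat.card_prod, hX] at hXY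
  have h2 : (q ^ (2 * (ℓ - i))) ^ (2 * (Fintype.card n₁ * Fintype.card n₂)) =
      (q ^ (Fintype.card n₁ * Fintype.card n₂)) ^ (2 * (ℓ - i)) *
      (q ^ (Fintype.card n₁ * Fintype.card n₂)) ^ (2 * (ℓ - i)) := by ring
  rw [h2] at hXY
  exact Nat.mul_self_inj.1 hXY

end LeviDatum

end Block

/-! ### First-order commutators of Cayley transforms. -/

section Commutator

variable {R : Type v} [CommRing R] {σ : R →+* R} {n : Type w} [Fintype n]
    [DecidableEq n] {𝔪 : Ideal R} {ℓ q : ℕ} (hR : QuadraticLevel σ 𝔪 ℓ q)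

omit [Fintype n] in
theorem val_commutator_sub_one [Fintype n] (s z : GL n R) : (s * z * s⁻¹ * z⁻¹).1 - 1 =
    ((s.1 - 1) * (z.1 - 1) - (z.1 - 1) * (s.1 - 1)) * (s⁻¹ * z⁻¹).1 := by
  have h1 : (s.1 - 1) * (z.1 - 1) - (z.1 - 1) * (s.1 - 1) = (s * z).1 - (z * s).1 := by
    rw [Units.val_mul, Units.val_mul]
    noncomm_ring
  rw [h1, sub_mul, ← Units.val_mul, ← Units.val_mul, ← mul_assoc, ← mul_assoc, mul_assoc z s,
    mul_inv_cancel, mul_one, mul_inv_cancel, Units.val_one]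

theorem commutator_mem_congKer {I J K : Ideal R} (hIJ : I * J ≤ K) {s z : GL n R}
    (hs : s ∈ congKer n I) (hz : z ∈ congKer n J) : s * z * s⁻¹ * z⁻¹ ∈ congKer n K := by
  rw [mem_congKer] at *
  rw [val_commutator_sub_one]
  refine EntriesIn.mul_right (((hs.mul hz).mono hIJ).sub ((hz.mul hs).mono ?_)) _
  rwa [mul_comm]

theorem sub_one_of_cayley {u : GL n R} {x : Matrix n n R} (h : u.1 * (1 - x) = 1 + x) :
    u.1 - 1 = x + x + (u.1 - 1) * x := by
  have e : u.1 - 1 - (x + x + (u.1 - 1) * x) = u.1 * (1 - x) - (1 + x) := by noncomm_ring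
  rw [h, sub_self] at e
  exact sub_eq_zero.1 e

theorem mem_congKer_of_cayley {I : Ideal R} {u : GL n R} {x : Matrix n n R}
    (h : u.1 * (1 - x) = 1 + x) (hx : EntriesIn I x) : u ∈ congKer n I := by
  rw [mem_congKer, sub_one_of_cayley h]
  exact (hx.add hx).add (hx.mul_left _)

include hR

/-- The commutator of two Cayley transforms, to first order. -/
theorem QuadraticLevel.commutator_cayley {i j : ℕ} (hi : 1 ≤ i) (hj : 1 ≤ j) (hij : i + j + 1 = ℓ)
    {s z : GL n R} {S y : Matrix n n R} (hs : s.1 * (1 - S) = 1 + S) (hz : z.1 * (1 - y) = 1 + y)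
    (hS : EntriesIn (𝔪 ^ j) S) (hy : EntriesIn (𝔪 ^ i) y) :
    (s * z * s⁻¹ * z⁻¹).1 - 1 = (4 : R) • (S * y - y * S) := by
  have hsm := mem_congKer.1 (mem_congKer_of_cayley hs hS)
  have hzm := mem_congKer.1 (mem_congKer_of_cayley hz hy)
  have hu : EntriesIn (𝔪 ^ 1) ((s⁻¹ * z⁻¹).1 - 1) := mem_congKer.1 (mul_mem
    (inv_mem (congKer_mono (Ideal.pow_le_pow_right hj) (mem_congKer_of_cayley hs hS)))
    (inv_mem (congKer_mono (Ideal.pow_le_pow_right hi) (mem_congKer_of_cayley hz hy))))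
  set a := s.1 - 1 with ha
  set b := z.1 - 1 with hb
  have ha' : a = S + S + a * S := sub_one_of_cayley hs
  have hb' : b = y + y + b * y := sub_one_of_cayley hz
  have haS : EntriesIn (𝔪 ^ (j + 1)) (a * S) := hsm.pow_succ_mul (by omega) hS
  have hby : EntriesIn (𝔪 ^ (i + 1)) (b * y) := hzm.pow_succ_mul (by omega) hy
  -- To leading order `a = 2S` and `b = 2y`; each correction adds one power of `𝔪`, so its
  -- contribution lies in `𝔪 ^ ℓ = 0`.
  have h1 : a * b = (4 : R) • (S * y) := by
    have e1 : a * b = (S + S) * (y + y) + (S + S) * (b * y) + (a * S) * b := by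
      have e0 : a * b = (S + S) * b + (a * S) * b := by
        conv_lhs => rw [ha', add_mul]
      have e0' : (S + S) * b = (S + S) * (y + y) + (S + S) * (b * y) := by
        conv_lhs => rw [hb', mul_add]
      rw [e0, e0']
    have e2 : (S + S) * (b * y) = 0 :=
      hR.eq_zero_of_pow le_rfl ((hS.add hS).pow_succ_mul (by omega) hby)
    have e3 : (a * S) * b = 0 := hR.eq_zero_of_pow le_rfl (haS.pow_succ_mul (by omega) hzm)
    rw [e1, e2, e3, add_zero, add_zero, ← two_smul R S, ← two_smul R y, smul_mul_smul_comm]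
    norm_num
  have h2 : b * a = (4 : R) • (y * S) := by
    have e1 : b * a = (y + y) * (S + S) + (y + y) * (a * S) + (b * y) * a := by
      have e0 : b * a = (y + y) * a + (b * y) * a := by
        conv_lhs => rw [hb', add_mul]
      have e0' : (y + y) * a = (y + y) * (S + S) + (y + y) * (a * S) := by
        conv_lhs => rw [ha', mul_add]
      rw [e0, e0']
    have e2 : (y + y) * (a * S) = 0 :=
      hR.eq_zero_of_pow le_rfl ((hy.add hy).pow_succ_mul (by omega) haS)
    have e3 : (b * y) * a = 0 := hR.eq_zero_of_pow le_rfl (hby.pow_succ_mul (by omega) hsm)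
    rw [e1, e2, e3, add_zero, add_zero, ← two_smul R S, ← two_smul R y, smul_mul_smul_comm]
    norm_num
  rw [val_commutator_sub_one, ← ha, ← hb, h1, h2, ← smul_sub]
  have h3 : EntriesIn (𝔪 ^ (i + j)) ((4 : R) • (S * y - y * S)) :=
    ((hS.pow_succ_mul (by omega) hy).sub (hy.pow_succ_mul (by omega) hS)).smul _
  -- The right factor of the commutator formula is 1 modulo `𝔪`, and the left one already lies in `𝔪
  -- ^ (ℓ - 1)`.
  have h4 : ((4 : R) • (S * y - y * S)) * ((s⁻¹ * z⁻¹).1 - 1) = 0 :=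
    hR.eq_zero_of_pow le_rfl (h3.pow_succ_mul (by omega) hu)
  rwa [mul_sub, mul_one, sub_eq_zero] at h4

end Commutator

section Block

variable {R : Type v} [CommRing R] {n₁ n₂ : Type w} [Fintype n₁] [DecidableEq n₁]
    [Fintype n₂] [DecidableEq n₂]

theorem toBlocks_eq_zero_of_conj_signGL (h2 : IsUnit (2 : R))
    {x : Matrix (n₁ ⊕ n₂) (n₁ ⊕ n₂) R}
    (h : (signGL R n₁ n₂).1 * x * (signGL R n₁ n₂)⁻¹.1 = -x) :
    x.toBlocks₁₁ = 0 ∧ x.toBlocks₂₂ = 0 := by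
  obtain ⟨c, hc⟩ := h2.exists_right_inv
  have key : ∀ r : R, r = -r → r = 0 := fun r hr => by linear_combination c * hr - r * hc
  rw [conj_signGL] at h
  constructor
  · ext a b
    exact key _ (congrFun (congrFun h (Sum.inl a)) (Sum.inl b))
  · ext a b
    exact key _ (congrFun (congrFun h (Sum.inr a)) (Sum.inr b))

theorem conj_signGL_single {a b : n₁ ⊕ n₂} (hab : a.isLeft ≠ b.isLeft) (s : R) :
    (signGL R n₁ n₂).1 * single a b s * (signGL R n₁ n₂)⁻¹.1 = -single a b s := by
  rw [conj_signGL]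
  ext (c | c) (e | e) <;> rcases a with a | a <;> rcases b with b | b <;>
    simp [toBlocks₁₁, toBlocks₁₂, toBlocks₂₁, toBlocks₂₂, single_apply] at hab ⊢

end Block

/-! ### Nondegeneracy, stabiliser and counting for the congruence filtration. -/

namespace LeviDatum

variable {R : Type v} [CommRing R] {n₁ n₂ : Type w} [Fintype n₁] [DecidableEq n₁]
    [Fintype n₂] [DecidableEq n₂] {σ : R →+* R} {𝔪 : Ideal R} {ℓ q : ℕ} {special : Prop}
    {F : GL (n₁ ⊕ n₂) R →* GL (n₁ ⊕ n₂) R}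
    {D : Matrix (n₁ ⊕ n₂) (n₁ ⊕ n₂) R →+ Matrix (n₁ ⊕ n₂) (n₁ ⊕ n₂) R}
    {𝒢 : Subgroup (GL (n₁ ⊕ n₂) R)} {ξ : Matrix (n₁ ⊕ n₂) (n₁ ⊕ n₂) R}
    (hL : LeviDatum σ 𝔪 ℓ q special F D 𝒢 ξ)

include hL

theorem sign_D {x : Matrix (n₁ ⊕ n₂) (n₁ ⊕ n₂) R}
    (hx : (signGL R n₁ n₂).1 * x * (signGL R n₁ n₂)⁻¹.1 = -x) :
    (signGL R n₁ n₂).1 * D x * (signGL R n₁ n₂)⁻¹.1 = -D x := by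
  have := hL.form.conj (signGL R n₁ n₂) x
  rw [hL.sign] at this
  rw [← this, hx, map_neg]

/-- The commutator pairing on the off-diagonal part is nondegenerate. -/
theorem nondeg {ψ : AddChar R ℂ} (hψ : ∃ t ∈ 𝔪 ^ (ℓ - 1), ψ (t + σ t) ≠ 1) {i : ℕ} (hi : 1 ≤ i)
    (hi2 : i + 2 ≤ ℓ) {z : GL (n₁ ⊕ n₂) R} (hz : z ∈ 𝒢) (hzi : z ∈ congKer (n₁ ⊕ n₂) (𝔪 ^ i))
    (hT : signGL R n₁ n₂ * z * (signGL R n₁ n₂)⁻¹ = z⁻¹)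
    (h : ∀ s ∈ 𝒢, s ∈ congKer (n₁ ⊕ n₂) (𝔪 ^ (ℓ - 1 - i)) →
      ψ (ξ * ((s * z * s⁻¹ * z⁻¹).1 - 1)).trace = 1) : z ∈ congKer (n₁ ⊕ n₂) (𝔪 ^ (i + 1)) := by
  obtain ⟨j, hij⟩ : ∃ j, i + j + 1 = ℓ := ⟨ℓ - 1 - i, by omega⟩
  have hj : 1 ≤ j := by omega
  rw [show ℓ - 1 - i = j by omega] at h
  obtain ⟨y, hzy, hyi, hDy, hty⟩ := hL.cayley_inv hi hz hzi hT
  -- The character of the commutator of the Cayley transforms of `S` and `y` is `ψ(4 tr(W S))` with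
  -- `W = [y, ξ]`. The hypothesis is thus a statement about `W`.
  have hW : EntriesIn (𝔪 ^ i) (y * ξ - ξ * y) := (hyi.mul_right _).sub (hyi.mul_left _)
  have htW : (signGL R n₁ n₂).1 * (y * ξ - ξ * y) * (signGL R n₁ n₂)⁻¹.1 = -(y * ξ - ξ * y) := by
    have e : (signGL R n₁ n₂).1 * (y * ξ - ξ * y) * (signGL R n₁ n₂)⁻¹.1 =
      ((signGL R n₁ n₂).1 * y * (signGL R n₁ n₂)⁻¹.1) *
        ((signGL R n₁ n₂).1 * ξ * (signGL R n₁ n₂)⁻¹.1) -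
      ((signGL R n₁ n₂).1 * ξ * (signGL R n₁ n₂)⁻¹.1) *
        ((signGL R n₁ n₂).1 * y * (signGL R n₁ n₂)⁻¹.1) := by
      simp only [mul_sub, sub_mul, mul_assoc, Units.inv_mul_cancel_left]
    rw [e, hty, hL.block]
    noncomm_ring
  -- `D` preserves brackets and fixes `y`, and it fixes `ξ` modulo `𝔪`.
  have hDW : EntriesIn (𝔪 ^ (i + 1)) (D (y * ξ - ξ * y) - (y * ξ - ξ * y)) := by
    rw [hL.form.bracket, hDy]
    have e : y * D ξ - D ξ * y - (y * ξ - ξ * y) = y * (D ξ - ξ) - (D ξ - ξ) * y := by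
      noncomm_ring
    rw [e]
    have h1 := hL.fixed
    rw [← pow_one 𝔪] at h1
    exact (hyi.pow_succ_mul le_rfl h1).sub (h1.pow_succ_mul (by omega) hyi)
  have hoff : ∀ a b : n₁ ⊕ n₂, a.isLeft ≠ b.isLeft → (y * ξ - ξ * y) a b ∈ 𝔪 ^ (i + 1) := by
    intro a b hab
    have hXs : ∀ s : R, (signGL R n₁ n₂).1 * single b a s * (signGL R n₁ n₂)⁻¹.1 = -single b a s :=
      fun s => conj_signGL_single hab.symm s
    have hXm : ∀ s ∈ 𝔪 ^ j, EntriesIn (𝔪 ^ j) (single b a s) := fun s hs c e => by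
      rw [single_apply]
      split_ifs
      exacts [hs, zero_mem _]
    have h4 : IsUnit (4 : R) := by
      rw [show (4 : R) = 2 * 2 by norm_num]
      exact hL.level.two.mul hL.level.two
    refine hL.form.mem_of_pairing hL.level hψ hij hDW h4 (map_ofNat σ 4) hXm
      (fun s => trace_mul_single _ _ _ _) (fun s hs => ?_) (hW a b)
    have hSm : EntriesIn (𝔪 ^ j) (single b a s + D (single b a s)) :=
      (hXm s hs).add (hL.form.entriesIn (hL.level.map_mem j) (hXm s hs))
    obtain ⟨u, hu, hum⟩ := hL.level.exists_cayley hj hSm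
    have hu𝒢 := (hL.cayley_mem hj hSm (by rw [map_add, hL.form.D_invol, add_comm])
      (by rw [mul_add, add_mul, hXs, hL.sign_D (hXs s), neg_add]) hu hum).1
    have h5 := h u hu𝒢 hum
    rw [hL.level.commutator_cayley hi hj hij hu hzy hSm hyi, mul_smul_comm, trace_smul,
      smul_eq_mul] at h5
    rw [← h5]
    congr 2
    rw [mul_sub, sub_mul, trace_sub, trace_sub, ← mul_assoc, ← mul_assoc, trace_mul_cycle,
      trace_mul_cycle]
  -- `y` is off-diagonal and `ξ` block diagonal, so `W` is off-diagonal. Off-diagonal test matrices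
  -- suffice, and their Cayley transforms have determinant 1 automatically.
  have hWall : EntriesIn (𝔪 ^ (i + 1)) (y * ξ - ξ * y) := by
    obtain ⟨h11, h22⟩ := toBlocks_eq_zero_of_conj_signGL hL.level.two htW
    rintro (a | a) (b | b)
    · have := congrFun (congrFun h11 a) b
      change (y * ξ - ξ * y) (Sum.inl a) (Sum.inl b) = 0 at this
      rw [this]
      exact zero_mem _
    · exact hoff _ _ (by simp)
    · exact hoff _ _ (by simp)
    · have := congrFun (congrFun h22 a) b
      change (y * ξ - ξ * y) (Sum.inr a) (Sum.inr b) = 0 at this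
      rw [this]
      exact zero_mem _
  obtain ⟨h12, h21⟩ := entriesIn_offDiag hL.poly hyi hWall
  obtain ⟨h11, h22⟩ := toBlocks_eq_zero_of_conj_signGL hL.level.two hty
  refine mem_congKer_of_cayley hzy ?_
  rw [← fromBlocks_toBlocks y, h11, h22]
  exact entriesIn_fromBlocks.2 ⟨EntriesIn.zero, h12, h21, EntriesIn.zero⟩

/-- Elements of the Lie algebra of the last congruence subgroup. -/
theorem one_add_mem {X : Matrix (n₁ ⊕ n₂) (n₁ ⊕ n₂) R} (hX : EntriesIn (𝔪 ^ (ℓ - 1)) X)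
    (hD : D X = X) (htr : special → X.trace = 0) :
    ∃ u : GL (n₁ ⊕ n₂) R, u.1 = 1 + X ∧ u ∈ 𝒢 ∧ u ∈ congKer (n₁ ⊕ n₂) (𝔪 ^ (ℓ - 1)) := by
  have hℓ := hL.two_le
  have hX1 := hX.mono (pow_le_of_one_le (by omega : 1 ≤ ℓ - 1))
  obtain ⟨u, hu⟩ := hL.level.isUnit_one_add hX1
  have hX2 : X * X = 0 := hL.level.eq_zero_of_pow le_rfl (hX.pow_succ_mul (by omega) hX)
  refine ⟨u, hu, (hL.mem u).2 ⟨?_, fun hs => ?_⟩, mem_congKer.2 ?_⟩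
  · obtain ⟨c, hc⟩ := hL.level.two.exists_right_inv
    have hσc : σ c = c := by
      have h1 := congrArg σ hc
      rw [map_mul, map_ofNat, map_one] at h1
      linear_combination c * h1 - σ c * hc
    -- As `X² = 0`, the matrix `1 + X` is the Cayley transform of `X / 2`.
    refine hL.form.fixed_of_cayley hL.level (hX1.smul c) ?_ (by rw [hL.form.D_smul, hσc, hD])
    rw [hu, mul_sub, mul_one, mul_smul_comm, add_mul, one_mul, hX2, add_zero]
    have : X = c • X + c • X := by rw [← add_smul, ← two_mul, hc, one_smul]
    nth_rw 1 [this]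
    abel
  · obtain ⟨ϖ, hϖ⟩ := hL.level.principal
    have hp : 𝔪 ^ (ℓ - 1) = Ideal.span {ϖ ^ (ℓ - 1)} := by rw [hϖ, Ideal.span_singleton_pow]
    have hz : ϖ ^ (ℓ - 1) * ϖ ^ (ℓ - 1) = 0 := by
      have : ϖ ^ (ℓ - 1) ∈ 𝔪 ^ (ℓ - 1) := hp ▸ Ideal.mem_span_singleton_self _
      have h2 := Ideal.mul_mem_mul this this
      rwa [hL.sq_eq_bot] at h2
    rw [hu, EntriesIn.det_one_add (hp ▸ hX) hz, htr hs, add_zero]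
  · rw [hu, add_sub_cancel_left]
    exact hX

/-- The stabiliser of the character is fixed by the involution modulo the principal congruence
subgroup. -/
theorem stab {ψ : AddChar R ℂ} (hψ : ∃ t ∈ 𝔪 ^ (ℓ - 1), ψ (t + σ t) ≠ 1)
    {g : GL (n₁ ⊕ n₂) R} (hg : g ∈ 𝒢)
    (h : ∀ u ∈ 𝒢, u ∈ congKer (n₁ ⊕ n₂) (𝔪 ^ (ℓ - 1)) →
      ψ (ξ * ((g * u * g⁻¹).1 - 1)).trace = ψ (ξ * (u.1 - 1)).trace) :
    g⁻¹ * (signGL R n₁ n₂ * g * (signGL R n₁ n₂)⁻¹) ∈ congKer (n₁ ⊕ n₂) (𝔪 ^ 1) := by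
  have hℓ := hL.two_le
  have hFg : F g = g := ((hL.mem g).1 hg).1
  -- Stabilising the character means that `W` pairs trivially with the Lie algebra of the last
  -- congruence subgroup. The goal is that `W` vanishes modulo `𝔪`.
  obtain ⟨W, hWdef⟩ : ∃ W, W = g⁻¹.1 * ξ * g.1 - ξ := ⟨_, rfl⟩
  have hDW : EntriesIn (𝔪 ^ (0 + 1)) (D W - W) := by
    have h1 := hL.form.conj g⁻¹ ξ
    rw [map_inv, hFg, inv_inv] at h1
    have e : D W - W = g⁻¹.1 * (D ξ - ξ) * g.1 - (D ξ - ξ) := by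
      rw [hWdef, map_sub, h1, mul_sub, sub_mul]
      abel
    rw [e, zero_add, pow_one]
    exact ((hL.fixed.mul_left _).mul_right _).sub hL.fixed
  have key : ∀ (X : R → Matrix (n₁ ⊕ n₂) (n₁ ⊕ n₂) R) (w : R),
      (∀ s ∈ 𝔪 ^ (ℓ - 1), EntriesIn (𝔪 ^ (ℓ - 1)) (X s)) → (∀ s, (W * X s).trace = w * s) →
      (special → ∀ s, (X s).trace = 0) → w ∈ 𝔪 := by
    intro X w hX hwX htr
    have := hL.form.mem_of_pairing hL.level hψ (i := 0) (j := ℓ - 1) (by omega) hDW isUnit_one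
      (map_one σ) hX hwX (fun s hs => ?_) (by simp)
    · rwa [zero_add, pow_one] at this
    · have hXD : EntriesIn (𝔪 ^ (ℓ - 1)) (X s + D (X s)) :=
        (hX s hs).add (hL.form.entriesIn (hL.level.map_mem _) (hX s hs))
      obtain ⟨u, hu, hu𝒢, hum⟩ := hL.one_add_mem hXD
        (by rw [map_add, hL.form.D_invol, add_comm])
        (fun hs' => by
          rw [trace_add, htr hs', hL.form.trace_eq_zero _ (htr hs' s), add_zero])
      have h1 := h u hu𝒢 hum
      have e1 : (g * u * g⁻¹).1 - 1 = g.1 * (u.1 - 1) * g⁻¹.1 := by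
        rw [mul_sub, sub_mul, mul_one, Units.mul_inv, Units.val_mul, Units.val_mul]
      have e2 : (ξ * (g.1 * (u.1 - 1) * g⁻¹.1)).trace = (g⁻¹.1 * ξ * g.1 * (u.1 - 1)).trace := by
        rw [← mul_assoc, trace_mul_comm, ← mul_assoc, ← mul_assoc]
      rw [e1, e2, hu, add_sub_cancel_left] at h1
      have e3 : (g⁻¹.1 * ξ * g.1 * (X s + D (X s))).trace =
          (W * (X s + D (X s))).trace + (ξ * (X s + D (X s))).trace := by
        rw [hWdef, sub_mul, trace_sub, sub_add_cancel]
      rw [e3, AddChar.map_add_eq_mul] at h1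
      rw [one_mul]
      exact mul_right_cancel₀ (ψ.val_isUnit _).ne_zero (h1.trans (one_mul _).symm)
  have hsingle : ∀ a b : n₁ ⊕ n₂, ∀ s ∈ 𝔪 ^ (ℓ - 1), EntriesIn (𝔪 ^ (ℓ - 1)) (single b a s) :=
    fun a b s hs c e => by
      rw [single_apply]
      split_ifs
      exacts [hs, zero_mem _]
  have hoff : ∀ a b, a ≠ b → W a b ∈ 𝔪 := fun a b hab =>
    key (fun s => single b a s) (W a b) (hsingle a b) (fun s => trace_mul_single _ _ _ _)
      fun _ s => trace_single_eq_of_ne _ _ _ hab.symm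
  have hW : EntriesIn 𝔪 W := by
    intro a b
    rcases ne_or_eq a b with hab | rfl
    · exact hoff a b hab
    by_cases hs : special
    -- With the determinant condition only traceless test matrices are allowed, and they see `W` up
    -- to scalars. The trace of `W` is zero and the matrix size is invertible, so the scalar
    -- vanishes too.
    · have hdiff : ∀ b, W a a - W b b ∈ 𝔪 := fun b =>
        key (fun s => single a a s - single b b s) _
          (fun s hs => (hsingle a a s hs).sub (hsingle b b s hs))
          (fun s => by rw [mul_sub, trace_sub, trace_mul_single, trace_mul_single, sub_mul]; rfl)
          fun _ s => by rw [trace_sub, trace_single_eq_same, trace_single_eq_same, sub_self]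
      have htr : W.trace = 0 := by
        rw [hWdef, trace_sub, trace_mul_comm, ← mul_assoc, Units.mul_inv, one_mul, sub_self]
      have h1 : (Fintype.card (n₁ ⊕ n₂) : R) * W a a = ∑ b, (W a a - W b b) := by
        rw [Finset.sum_sub_distrib, Finset.sum_const, Finset.card_univ, nsmul_eq_mul]
        change _ = _ - W.trace
        rw [htr, sub_zero]
      obtain ⟨c, hc⟩ := (hL.card_unit hs).exists_left_inv
      rw [← one_mul (W a a), ← hc, mul_assoc, h1]
      exact Ideal.mul_mem_left _ _ (sum_mem fun b _ => hdiff b)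
    · exact key (fun s => single a a s) (W a a) (hsingle a a) (fun s => trace_mul_single _ _ _ _)
        fun hs' => absurd hs' hs
  -- Thus `g` commutes with `ξ` modulo `𝔪`, its off-diagonal blocks vanish there, and conjugation by
  -- the sign matrix does not change it modulo `𝔪`.
  have hgξ : EntriesIn (𝔪 ^ (0 + 1)) (g.1 * ξ - ξ * g.1) := by
    have e : g.1 * ξ - ξ * g.1 = -(g.1 * W) := by
      rw [hWdef, mul_sub, mul_assoc, Units.mul_inv_cancel_left, neg_sub]
    rw [e, zero_add, pow_one]
    exact (hW.mul_left _).neg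
  obtain ⟨h12, h21⟩ := entriesIn_offDiag hL.poly (i := 0) (x := g.1)
    (fun a b => by simp) hgξ
  rw [zero_add] at h12 h21
  rw [inv_mul_mem_congKer, Units.val_mul, Units.val_mul, conj_signGL]
  conv =>
    arg 2
    rw [← fromBlocks_toBlocks g.1]
  rw [sub_eq_add_neg, fromBlocks_neg, fromBlocks_add, entriesIn_fromBlocks]
  simp only [toBlocks_fromBlocks₁₁, toBlocks_fromBlocks₁₂, toBlocks_fromBlocks₂₁,
    toBlocks_fromBlocks₂₂, add_neg_cancel]
  exact ⟨EntriesIn.zero, h12.neg.add h12.neg, h21.neg.add h21.neg, EntriesIn.zero⟩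

/-- The filtration by congruence subgroups. -/
theorem filteredInvolution {ψ : AddChar R ℂ} (hψ : ∃ t ∈ 𝔪 ^ (ℓ - 1), ψ (t + σ t) ≠ 1)
    (hq : 0 < q) :
    FilteredInvolution hL.invol (fun i => (congKer (n₁ ⊕ n₂) (𝔪 ^ i)).subgroupOf 𝒢) ℓ
      (congChar 𝒢 hL.sq_eq_bot ξ ψ) (q ^ (Fintype.card n₁ * Fintype.card n₂)) where
  two_le := hL.two_le
  invol := conjAut_invol _ _ _ _
  normal i := inferInstance
  anti i j hij := Subgroup.subgroupOf_mono _ (congKer_mono (Ideal.pow_le_pow_right hij))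
  eq_bot := by
    rw [eq_bot_iff]
    intro g hg
    have := mem_congKer.1 (Subgroup.mem_subgroupOf.1 hg)
    rw [hL.level.pow_eq_bot] at this
    exact Subtype.ext (Units.ext (sub_eq_zero.1 this.eq_zero))
  stable i x hx := (inferInstance : (congKer (n₁ ⊕ n₂) (𝔪 ^ i)).Normal).conj_mem _ hx _
  comm i j _ _ x hx y hy := commutator_mem_congKer (pow_add 𝔪 i j).ge hx hy
  odd := hL.level.odd_card_subgroupOf 𝒢
  map_invol x hx := by
    apply Units.ext
    have hx' : hL.invol x ∈ (congKer (n₁ ⊕ n₂) (𝔪 ^ (ℓ - 1))).subgroupOf 𝒢 :=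
      (inferInstance : (congKer (n₁ ⊕ n₂) (𝔪 ^ (ℓ - 1))).Normal).conj_mem _ hx _
    rw [ev_congChar _ _ _ hx, ev_congChar _ _ _ hx', hL.coe_invol]
    congr 1
    have e : (signGL R n₁ n₂ * x.1 * (signGL R n₁ n₂)⁻¹).1 - 1 =
        (signGL R n₁ n₂).1 * (x.1.1 - 1) * (signGL R n₁ n₂)⁻¹.1 := by
      rw [mul_sub, sub_mul, mul_one, Units.mul_inv, Units.val_mul, Units.val_mul]
    rw [e, ← mul_assoc, trace_mul_comm, ← mul_assoc, ← mul_assoc]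
    have hb := hL.block
    rw [inv_signGL] at hb ⊢
    rw [hb]
  nondeg i hi hi2 z hz hTz h := hL.nondeg hψ hi hi2 z.2 hz (congrArg Subtype.val hTz)
    fun s hs hsm => by
      have h1 := h ⟨s, hs⟩ hsm
      have h2 : (⟨s, hs⟩ : 𝒢) * z * (⟨s, hs⟩ : 𝒢)⁻¹ * z⁻¹ ∈
          (congKer (n₁ ⊕ n₂) (𝔪 ^ (ℓ - 1))).subgroupOf 𝒢 :=
        commutator_mem_congKer (by rw [← pow_add, show ℓ - 1 - i + i = ℓ - 1 by omega]) hsm hz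
      have h3 := congrArg (fun u : ℂˣ => (u : ℂ)) h1
      simp only [ev_congChar _ _ _ h2, Units.val_one] at h3
      exact h3
  stab g h := hL.stab hψ g.2 fun u hu hum => by
    have h1 := h ⟨u, hu⟩ hum
    have h2 : g * ⟨u, hu⟩ * g⁻¹ ∈ (congKer (n₁ ⊕ n₂) (𝔪 ^ (ℓ - 1))).subgroupOf 𝒢 :=
      (inferInstance : (congKer (n₁ ⊕ n₂) (𝔪 ^ (ℓ - 1))).Normal).conj_mem _ hum _
    have h3 := congrArg (fun u : ℂˣ => (u : ℂ)) h1
    rw [ev_congChar _ _ _ h2, ev_congChar _ _ _ (g := ⟨u, hu⟩) hum] at h3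
    exact h3
  pos := Nat.pow_pos hq
  card i hi hiℓ := by
    have := hL.level.finite_gl (n := n₁ ⊕ n₂)
    obtain ⟨m, hm⟩ := hL.level.exists_sqrt (n := n₁ ⊕ n₂)
    -- The group splits as a set into fixed and inverted elements. The Cayley transform identifies
    -- the latter with the off-diagonal part of the Lie algebra, counted by `card_offDiag`.
    rw [card_eq_fixed_mul_inverted (T := hL.invol) (conjAut_invol _ _ _ _)
      (N := (congKer (n₁ ⊕ n₂) (𝔪 ^ i)).subgroupOf 𝒢)
      (fun x hx => (inferInstance : (congKer (n₁ ⊕ n₂) (𝔪 ^ i)).Normal).conj_mem _ hx _)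
      (m := m) (fun x hx => Subtype.ext
        (hm x.1 (congKer_mono (Ideal.pow_le_pow_right hi) hx))), ← hL.card_offDiag hiℓ]
    congr 1
    symm
    choose c hc hcm using fun x : {x : Matrix (n₁ ⊕ n₂) (n₁ ⊕ n₂) R // EntriesIn (𝔪 ^ i) x ∧
      D x = x ∧ (signGL R n₁ n₂).1 * x * (signGL R n₁ n₂)⁻¹.1 = -x} =>
        hL.level.exists_cayley hi x.2.1
    have hc𝒢 := fun x => hL.cayley_mem hi x.2.1 x.2.2.1 x.2.2.2 (hc x) (hcm x)
    refine Nat.card_congr (Equiv.ofBijective (fun x => ⟨⟨c x, (hc𝒢 x).1⟩, hcm x,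
      Subtype.ext (hc𝒢 x).2⟩) ⟨fun x y h => ?_, fun y => ?_⟩)
    · have h1 : c x = c y := congrArg (fun z => z.1.1) h
      refine Subtype.ext (hL.level.cayley_inj (u := c x)
        (congKer_mono (Ideal.pow_le_pow_right hi) (hcm x)) (hc x) ?_)
      rw [h1]
      exact hc y
    · obtain ⟨x, hx, hxi, hDx, htx⟩ := hL.cayley_inv hi y.1.2 y.2.1 (congrArg Subtype.val y.2.2)
      refine ⟨⟨x, hxi, hDx, htx⟩, Subtype.ext (Subtype.ext ?_)⟩
      exact hL.level.cayley_inj' (hxi.mono (pow_le_of_one_le hi)) (hc ⟨x, hxi, hDx, htx⟩) hx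

end LeviDatum

/-! ### Representations with an eigenvector for a function on a subgroup -/

section Above

variable {G : Type u} [Group G]

/-- The representations that contain a vector on which a subgroup acts through `f`. -/
def Irr.above (N : Subgroup G) (f : G → ℂ) : Set (Irr G) :=
  {χ | ∃ π : IrrRep G, Irr.mk π = χ ∧ ∃ v : Fin π.dim → ℂ, v ≠ 0 ∧ ∀ n ∈ N, π.ρ n v = f n • v}

theorem Irr.mk_mem_above_of_equiv {N : Subgroup G} {f : G → ℂ} {V : Type*} [AddCommGroup V]
    [Module ℂ V] {ρ : Representation ℂ G V} (π : IrrRep G) (e : ρ.Equiv π.ρ) {v : V} (hv : v ≠ 0)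
    (h : ∀ n ∈ N, ρ n v = f n • v) : Irr.mk π ∈ Irr.above N f := by
  refine ⟨π, rfl, e v, fun h0 => hv ?_, fun n hn => ?_⟩
  · exact (map_eq_zero_iff e.toLinearEquiv e.toLinearEquiv.injective).1 h0
  · rw [← equiv_apply e n v, h n hn]
    exact map_smul e.toLinearEquiv _ _

theorem Irr.mk_mem_above_iff {N : Subgroup G} {f : G → ℂ} (π : IrrRep G) :
    Irr.mk π ∈ Irr.above N f ↔ ∃ v, v ≠ 0 ∧ ∀ n ∈ N, π.ρ n v = f n • v := by
  constructor
  · rintro ⟨π', h, v, hv, hv'⟩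
    obtain ⟨e⟩ := Irr.exact h
    refine ⟨e v, fun h0 => hv ?_, fun n hn => ?_⟩
    · exact (map_eq_zero_iff e.toLinearEquiv e.toLinearEquiv.injective).1 h0
    · rw [← equiv_apply e n v, hv' n hn]
      exact map_smul e.toLinearEquiv _ _
  · rintro ⟨v, hv⟩
    exact ⟨π, rfl, v, hv⟩

theorem Irr.over_subtype_eq_above {N : Subgroup G} (θ : N →* ℂˣ) :
    Irr.over N.subtype θ = Irr.above N fun g => (ev θ g : ℂ) := by
  ext χ
  rw [← Irr.mk_rep χ, Irr.mem_over_subtype_iff, Irr.mk_mem_above_iff]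

theorem Irr.above_congr {N : Subgroup G} {f f' : G → ℂ} (h : ∀ n ∈ N, f n = f' n) :
    Irr.above N f = Irr.above N f' := by
  ext χ
  rw [← Irr.mk_rep χ, Irr.mk_mem_above_iff, Irr.mk_mem_above_iff]
  refine exists_congr fun v => and_congr_right fun _ => forall₂_congr fun n hn => ?_
  rw [h n hn]

/-- Pulling back an irreducible representation along an isomorphism. -/
def IrrRep.comap {G' : Type v} [Group G'] (e : G ≃* G') (π : IrrRep G') : IrrRep G where
  dim := π.dim
  ρ := π.ρ.comp e.toMonoidHom
  irr := (isIrreducible_iff _).2 ⟨((isIrreducible_iff _).1 π.irr).1, fun U hU =>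
    ((isIrreducible_iff _).1 π.irr).2 U fun g v hv => by
      have := hU (e.symm g) v hv
      simpa using this⟩

/-- The bijection between isomorphism classes given by an isomorphism of groups. -/
def Irr.congr {G' : Type v} [Group G'] (e : G ≃* G') : Irr G' ≃ Irr G where
  toFun := Quotient.map (IrrRep.comap e) fun _ _ ⟨i⟩ =>
    ⟨.mk i.toLinearEquiv fun g => LinearMap.ext fun v => equiv_apply i (e g) v⟩
  invFun := Quotient.map (IrrRep.comap e.symm) fun _ _ ⟨i⟩ =>
    ⟨.mk i.toLinearEquiv fun g => LinearMap.ext fun v => equiv_apply i (e.symm g) v⟩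
  left_inv := by
    intro χ
    induction χ using Quotient.inductionOn with
    | _ π =>
      refine Quotient.sound ⟨.mk (LinearEquiv.refl ℂ _) fun g => LinearMap.ext fun v => ?_⟩
      change π.ρ (e (e.symm g)) v = π.ρ g v
      rw [e.apply_symm_apply]
  right_inv := by
    intro χ
    induction χ using Quotient.inductionOn with
    | _ π =>
      refine Quotient.sound ⟨.mk (LinearEquiv.refl ℂ _) fun g => LinearMap.ext fun v => ?_⟩
      change π.ρ (e.symm (e g)) v = π.ρ g v
      rw [e.symm_apply_apply]

theorem Irr.dim_congr {G' : Type v} [Group G'] (e : G ≃* G') (χ : Irr G') :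
    (Irr.congr e χ).dim = χ.dim := by
  induction χ using Quotient.inductionOn with
  | _ π => rfl

theorem Irr.exists_equiv_above {G' : Type v} [Group G'] (e : G ≃* G') {N : Subgroup G}
    {N' : Subgroup G'} {f : G → ℂ} {f' : G' → ℂ} (hN : ∀ g, g ∈ N ↔ e g ∈ N')
    (hf : ∀ g ∈ N, f g = f' (e g)) :
    ∃ i : Irr.above N' f' ≃ Irr.above N f, ∀ χ, (i χ).1.dim = χ.1.dim := by
  refine ⟨(Irr.congr e).subtypeEquiv fun χ => ?_, fun χ => Irr.dim_congr e χ.1⟩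
  induction χ using Quotient.inductionOn with
  | _ π =>
    change Irr.mk π ∈ _ ↔ Irr.mk (π.comap e) ∈ _
    rw [Irr.mk_mem_above_iff, Irr.mk_mem_above_iff]
    refine exists_congr fun v => and_congr_right fun _ => ⟨fun h n hn => ?_, fun h n hn => ?_⟩
    · rw [hf n hn]
      exact h _ ((hN n).1 hn)
    · have h1 := h (e.symm n) ((hN _).2 (by rwa [e.apply_symm_apply]))
      rw [hf _ ((hN _).2 (by rwa [e.apply_symm_apply])), e.apply_symm_apply] at h1
      refine Eq.trans ?_ h1
      change _ = π.ρ (e (e.symm n)) v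
      rw [e.apply_symm_apply]

end Above

/-! ### Finiteness -/

/-- As a function of `w` the sum is an intertwiner from `ω` to `ρ`, so it vanishes by Schur. -/
theorem sum_dual_smul_eq_zero {G : Type*} [Group G] [Fintype G] {Ω V : Type*} [AddCommGroup Ω]
    [Module ℂ Ω] [AddCommGroup V] [Module ℂ V] {ω : Representation ℂ G Ω}
    {ρ : Representation ℂ G V} (hω : ω.IsIrreducible) (hρ : ρ.IsIrreducible)
    (hne : ¬ Nonempty (ω.Equiv ρ)) (l : Module.Dual ℂ Ω) (w : Ω) (v : V) :
    ∑ g, l (ω g⁻¹ w) • ρ g v = 0 := by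
  obtain ⟨F, hF⟩ : ∃ F : Ω →ₗ[ℂ] V, ∀ w, F w = ∑ g, l (ω g⁻¹ w) • ρ g v :=
    ⟨∑ g, (l ∘ₗ ω g⁻¹).smulRight (ρ g v), fun w => by simp⟩
  rw [← hF]
  by_contra h0
  refine hne (nonempty_equiv_of_ne_zero hω hρ F (fun h w => ?_) h0)
  rw [hF, hF, map_sum, ← (Group.mulLeft_bijective h).sum_comp]
  refine Finset.sum_congr rfl fun g _ => ?_
  rw [map_smul, ← Module.End.mul_apply, ← Module.End.mul_apply, ← map_mul, ← map_mul,
    _root_.mul_inv_rev, inv_mul_cancel_right]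

/-- A finite group has finitely many irreducible representations. -/
instance {G : Type u} [Group G] [Finite G] : Finite (Irr G) := by
  have := Fintype.ofFinite G
  have h1 : ∀ χ : Irr G, ∃ (l : Module.Dual ℂ (Fin χ.rep.dim → ℂ)) (w : Fin χ.rep.dim → ℂ),
      l w ≠ 0 := fun χ => by
    refine ⟨LinearMap.proj ⟨0, χ.rep.dim_pos⟩, fun _ => 1, ?_⟩
    simp
  choose l w hlw using h1
  -- One nonzero matrix coefficient per class: by orthogonality these are linearly independent in
  -- the finite-dimensional space of functions on `G`.
  have hli : LinearIndependent ℂ fun (χ : Irr G) (g : G) => l χ (χ.rep.ρ g⁻¹ (w χ)) := by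
    rw [linearIndependent_iff']
    intro s a ha χ hχ
    have h2 : ∑ g, (∑ χ' ∈ s, a χ' • l χ' (χ'.rep.ρ g⁻¹ (w χ'))) • χ.rep.ρ g (w χ) = 0 := by
      refine Finset.sum_eq_zero fun g _ => ?_
      have := congrFun ha g
      rw [Finset.sum_apply] at this
      simp only [Pi.smul_apply, Pi.zero_apply] at this
      rw [this, zero_smul]
    simp only [Finset.sum_smul] at h2
    rw [Finset.sum_comm, Finset.sum_eq_single χ] at h2
    · simp only [smul_assoc] at h2
      rw [← Finset.smul_sum, sum_dual_smul_of_irreducible χ.rep.irr, smul_smul] at h2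
      have hw : w χ ≠ 0 := fun h => hlw χ (by rw [h, map_zero])
      have h3 := (smul_eq_zero.1 h2).resolve_right hw
      have h4 : (Module.finrank ℂ (Fin χ.rep.dim → ℂ) : ℂ) ≠ 0 := by
        rw [← χ.rep.dim_eq_finrank]
        exact_mod_cast χ.rep.dim_pos.ne'
      have h5 : (Nat.card G : ℂ) ≠ 0 := by exact_mod_cast Nat.card_pos.ne'
      exact (mul_eq_zero.1 h3).resolve_right (mul_ne_zero (div_ne_zero h5 h4) (hlw χ))
    · intro χ' _ hne
      simp only [smul_assoc]
      rw [← Finset.smul_sum, sum_dual_smul_eq_zero χ'.rep.irr χ.rep.irr ?_, smul_zero]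
      intro h
      apply hne
      rw [← Irr.mk_rep χ', ← Irr.mk_rep χ]
      exact Irr.sound h
    · intro h
      exact absurd hχ h
  exact hli.finite

/-! ### Representations of a product of two groups -/

section Product

open TensorProduct

variable {G₁ : Type u} {G₂ : Type v} [Group G₁] [Group G₂]

/-- The exterior tensor product. -/
noncomputable def extTensor {V W : Type*} [AddCommGroup V] [Module ℂ V] [AddCommGroup W]
    [Module ℂ W] (ρ : Representation ℂ G₁ V) (τ : Representation ℂ G₂ W) :
    Representation ℂ (G₁ × G₂) (V ⊗[ℂ] W) where
  toFun g := TensorProduct.map (ρ g.1) (τ g.2)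
  map_one' := by
    rw [Prod.fst_one, Prod.snd_one, map_one, map_one]
    exact TensorProduct.map_id
  map_mul' g h := by
    rw [Prod.fst_mul, Prod.snd_mul, map_mul, map_mul]
    exact TensorProduct.map_mul _ _ _ _

theorem extTensor_apply {V W : Type*} [AddCommGroup V] [Module ℂ V] [AddCommGroup W]
    [Module ℂ W] (ρ : Representation ℂ G₁ V) (τ : Representation ℂ G₂ W) (g : G₁ × G₂) :
    extTensor ρ τ g = TensorProduct.map (ρ g.1) (τ g.2) := rfl

/-- A product is the extension situation with trivial intersection: `G₂` acts trivially on the space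
of `ω`, and the scalars `c` are 1. -/
theorem extensionDatum_prod {Ω : Type} [AddCommGroup Ω] [Module ℂ Ω]
    {ω : Representation ℂ G₁ Ω} (hω : ω.IsIrreducible) :
    ExtensionDatum (MonoidHom.inr G₁ G₂) (MonoidHom.inl G₁ G₂) ω 1 (fun _ => 1) where
  irr := hω
  act q h := ⟨h, by simp, by simp⟩
  cover s := ⟨s.2, s.1, by simp⟩
  compat q h hqh := by
    have h1 : (1, q) = (h, (1 : G₂)) := hqh
    obtain ⟨rfl, rfl⟩ := Prod.mk.inj h1
    simp

theorem extTensor_inr {V W : Type*} [AddCommGroup V] [Module ℂ V] [AddCommGroup W]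
    [Module ℂ W] (ρ : Representation ℂ G₁ V) (τ : Representation ℂ G₂ W) (q : G₂) :
    extTensor ρ τ (MonoidHom.inr G₁ G₂ q) =
      TensorProduct.map ((1 : Representation ℂ G₂ V) q) (τ q) := by
  rw [extTensor_apply, MonoidHom.inr_apply, map_one]
  rfl

theorem extTensor_inl {V W : Type*} [AddCommGroup V] [Module ℂ V] [AddCommGroup W]
    [Module ℂ W] (ρ : Representation ℂ G₁ V) (τ : Representation ℂ G₂ W) (h : G₁) :
    extTensor ρ τ (MonoidHom.inl G₁ G₂ h) = TensorProduct.map (ρ h) LinearMap.id := by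
  rw [extTensor_apply, MonoidHom.inl_apply, map_one]
  rfl

theorem isIrreducible_extTensor [Finite G₁] {V W : Type} [AddCommGroup V] [Module ℂ V]
    [AddCommGroup W] [Module ℂ W] [FiniteDimensional ℂ V] [FiniteDimensional ℂ W]
    {ρ : Representation ℂ G₁ V} {τ : Representation ℂ G₂ W} (hρ : ρ.IsIrreducible)
    (hτ : τ.IsIrreducible) : (extTensor ρ τ).IsIrreducible :=
  (extensionDatum_prod (G₂ := G₂) hρ).irreducible_tensorRep hτ (extTensor_inr ρ τ)
    (extTensor_inl ρ τ)

section Slice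

variable {V W V' W' : Type*} [AddCommGroup V] [Module ℂ V] [AddCommGroup W] [Module ℂ W]
  [AddCommGroup V'] [Module ℂ V'] [AddCommGroup W'] [Module ℂ W']

/-- Contraction of the first factor of a tensor product. -/
noncomputable def sliceLeft (l : Module.Dual ℂ V) : V ⊗[ℂ] W →ₗ[ℂ] W :=
  (TensorProduct.lid ℂ W).toLinearMap ∘ₗ l.rTensor W

/-- Contraction of the second factor of a tensor product. -/
noncomputable def sliceRight (l : Module.Dual ℂ W) : V ⊗[ℂ] W →ₗ[ℂ] V :=
  (TensorProduct.rid ℂ V).toLinearMap ∘ₗ l.lTensor V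

theorem sliceLeft_map (l : Module.Dual ℂ V) (B : W →ₗ[ℂ] W') (t : V ⊗[ℂ] W) :
    sliceLeft l (TensorProduct.map LinearMap.id B t) = B (sliceLeft l t) := by
  induction t with
  | zero => simp
  | tmul v w => simp [sliceLeft]
  | add x y hx hy => rw [map_add, map_add, hx, hy, map_add, map_add]

theorem sliceRight_map (l : Module.Dual ℂ W) (A : V →ₗ[ℂ] V') (t : V ⊗[ℂ] W) :
    sliceRight l (TensorProduct.map A LinearMap.id t) = A (sliceRight l t) := by
  induction t with
  | zero => simp
  | tmul v w => simp [sliceRight]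
  | add x y hx hy => rw [map_add, map_add, hx, hy, map_add, map_add]

theorem exists_sliceLeft_ne_zero [FiniteDimensional ℂ V] {t : V ⊗[ℂ] W} (ht : t ≠ 0) :
    ∃ l : Module.Dual ℂ V, sliceLeft l t ≠ 0 := by
  by_contra! h
  apply ht
  refine (TensorProduct.equivFinsuppOfBasisLeft (Module.finBasis ℂ V)).injective ?_
  ext1 i
  rw [TensorProduct.equivFinsuppOfBasisLeft_apply, map_zero]
  exact h _

theorem exists_sliceRight_ne_zero [FiniteDimensional ℂ W] {t : V ⊗[ℂ] W} (ht : t ≠ 0) :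
    ∃ l : Module.Dual ℂ W, sliceRight l t ≠ 0 := by
  by_contra! h
  apply ht
  refine (TensorProduct.equivFinsuppOfBasisRight (Module.finBasis ℂ W)).injective ?_
  ext1 i
  rw [TensorProduct.equivFinsuppOfBasisRight_apply, map_zero]
  exact h _

theorem tmul_ne_zero {v : V} {w : W} (hv : v ≠ 0) (hw : w ≠ 0) : v ⊗ₜ[ℂ] w ≠ 0 := by
  intro h
  obtain ⟨l, hl⟩ : ∃ l : Module.Dual ℂ V, l v ≠ 0 := by
    by_contra! h0
    exact hv ((Module.forall_dual_apply_eq_zero_iff ℂ v).1 h0)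
  have h1 := congrArg (sliceLeft l) h
  rw [map_zero] at h1
  have h2 : l v • w = 0 := h1
  exact (smul_ne_zero hl hw) h2

end Slice

variable [Finite G₁]

/-- The exterior tensor product of two irreducible representations. -/
noncomputable def IrrRep.prod (π₁ : IrrRep G₁) (π₂ : IrrRep G₂) : IrrRep (G₁ × G₂) :=
  IrrRep.of (extTensor π₁.ρ π₂.ρ) (isIrreducible_extTensor π₁.irr π₂.irr)

/-- The defining equivalence of `IrrRep.prod`. -/
noncomputable def IrrRep.prodEquiv (π₁ : IrrRep G₁) (π₂ : IrrRep G₂) :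
    (extTensor π₁.ρ π₂.ρ).Equiv (π₁.prod π₂).ρ :=
  IrrRep.ofEquiv _ _

theorem IrrRep.dim_prod (π₁ : IrrRep G₁) (π₂ : IrrRep G₂) :
    (π₁.prod π₂).dim = π₁.dim * π₂.dim := by
  rw [(π₁.prod π₂).dim_eq_of_equiv (π₁.prodEquiv π₂).symm, Module.finrank_tensorProduct]
  simp

omit [Finite G₁] in
-- Fixing a vector in one factor and contracting the image against a functional gives an equivariant
-- map between the other factors. The functional is chosen so that this map is nonzero.
theorem nonempty_equiv_of_extTensor {V W V' W' : Type} [AddCommGroup V] [Module ℂ V]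
    [AddCommGroup W] [Module ℂ W] [AddCommGroup V'] [Module ℂ V'] [AddCommGroup W'] [Module ℂ W']
    [FiniteDimensional ℂ V'] [FiniteDimensional ℂ W']
    {ρ : Representation ℂ G₁ V} {τ : Representation ℂ G₂ W} {ρ' : Representation ℂ G₁ V'}
    {τ' : Representation ℂ G₂ W'} (hρ : ρ.IsIrreducible) (hτ : τ.IsIrreducible)
    (hρ' : ρ'.IsIrreducible) (hτ' : τ'.IsIrreducible)
    (e : (extTensor ρ τ).Equiv (extTensor ρ' τ')) :
    Nonempty (ρ.Equiv ρ') ∧ Nonempty (τ.Equiv τ') := by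
  have := ((isIrreducible_iff _).1 hρ).1
  have := ((isIrreducible_iff _).1 hτ).1
  obtain ⟨v, hv⟩ := exists_ne (0 : V)
  obtain ⟨w, hw⟩ := exists_ne (0 : W)
  have hne : e.toLinearEquiv (v ⊗ₜ w) ≠ 0 := fun h =>
    tmul_ne_zero hv hw ((map_eq_zero_iff _ e.toLinearEquiv.injective).1 h)
  have he : ∀ g t, e.toLinearEquiv (extTensor ρ τ g t) = extTensor ρ' τ' g (e.toLinearEquiv t) :=
    equiv_apply e
  constructor
  · obtain ⟨l, hl⟩ := exists_sliceRight_ne_zero hne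
    refine nonempty_equiv_of_ne_zero hρ hρ' (sliceRight l ∘ₗ e.toLinearEquiv.toLinearMap ∘ₗ
      (TensorProduct.mk ℂ V W).flip w) (fun g x => ?_) hl
    have h1 := he (g, 1) (x ⊗ₜ w)
    rw [extTensor_apply, extTensor_apply, map_one, map_one, TensorProduct.map_tmul] at h1
    change sliceRight l (e.toLinearEquiv (ρ g x ⊗ₜ w)) = _
    refine (congrArg (sliceRight l) h1).trans ?_
    exact sliceRight_map l (ρ' g) _
  · obtain ⟨l, hl⟩ := exists_sliceLeft_ne_zero hne
    refine nonempty_equiv_of_ne_zero hτ hτ' (sliceLeft l ∘ₗ e.toLinearEquiv.toLinearMap ∘ₗ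
      TensorProduct.mk ℂ V W v) (fun g x => ?_) hl
    have h1 := he (1, g) (v ⊗ₜ x)
    rw [extTensor_apply, extTensor_apply, map_one, map_one, TensorProduct.map_tmul] at h1
    change sliceLeft l (e.toLinearEquiv (v ⊗ₜ τ g x)) = _
    refine (congrArg (sliceLeft l) h1).trans ?_
    exact sliceLeft_map l (τ' g) _

/-- An irreducible constituent of the restriction to `G₁` serves as `ω`; the extension
correspondence supplies the factor for `G₂`. -/
theorem IrrRep.exists_prod_equiv [Finite G₂] (π : IrrRep (G₁ × G₂)) :
    ∃ π₁ : IrrRep G₁, ∃ π₂ : IrrRep G₂, Nonempty ((π₁.prod π₂).ρ.Equiv π.ρ) := by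
  have := ((isIrreducible_iff _).1 π.irr).1
  obtain ⟨U, hU⟩ := exists_irreducible_sub (π.ρ.comp (MonoidHom.inl G₁ G₂))
  have h1 := ((isIrreducible_iff _).1 hU).1
  obtain ⟨u, hu⟩ := exists_ne (0 : U.toSubmodule)
  obtain ⟨i⟩ : Nonempty (U.toRepresentation.Equiv (IrrRep.of _ hU).ρ) := ⟨IrrRep.ofEquiv _ hU⟩
  have hD := extensionDatum_prod (G₂ := G₂) (IrrRep.of _ hU).irr
  have hmem : Irr.mk π ∈ Irr.containing (MonoidHom.inl G₁ G₂) (IrrRep.of _ hU).ρ := by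
    rw [Irr.mem_containing_iff]
    intro hb
    have h2 : U.toSubmodule.subtype ∘ₗ i.symm.toLinearEquiv.toLinearMap ∈
        homSpace (MonoidHom.inl G₁ G₂) (IrrRep.of _ hU).ρ π.ρ := fun h w =>
      congrArg Subtype.val (equiv_apply i.symm h w)
    rw [hb, Submodule.mem_bot] at h2
    apply hu
    have h3 := LinearMap.congr_fun h2 (i.toLinearEquiv u)
    apply Subtype.ext
    refine Eq.trans ?_ h3
    exact congrArg Subtype.val (i.toLinearEquiv.symm_apply_apply u).symm
  obtain ⟨e, he⟩ := hD.exists_equiv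
  obtain ⟨j⟩ : Nonempty ((Irr.mk π).rep.ρ.Equiv π.ρ) := Irr.exact (Irr.mk_rep _)
  refine ⟨IrrRep.of _ hU, (e ⟨_, hmem⟩).1.rep, ?_⟩
  obtain ⟨k⟩ := hD.nonempty_tensorRep_equiv (Irr.mk π).rep.irr (e ⟨_, hmem⟩).1.rep.irr
    (extTensor_inr _ _) (extTensor_inl _ _) (he ⟨_, hmem⟩).1
  exact ⟨((IrrRep.prodEquiv _ _).symm.trans k).trans j⟩

/-- Contracting an eigenvector for `N₁ × N₂` against suitable functionals gives eigenvectors in the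
two factors; conversely eigenvectors are tensored. -/
theorem IrrRep.prod_mem_above_iff {N₁ : Subgroup G₁} {N₂ : Subgroup G₂} {f₁ : G₁ → ℂ}
    {f₂ : G₂ → ℂ} (hf₁ : f₁ 1 = 1) (hf₂ : f₂ 1 = 1) (π₁ : IrrRep G₁) (π₂ : IrrRep G₂) :
    Irr.mk (π₁.prod π₂) ∈ Irr.above (N₁.prod N₂) (fun g => f₁ g.1 * f₂ g.2) ↔
      Irr.mk π₁ ∈ Irr.above N₁ f₁ ∧ Irr.mk π₂ ∈ Irr.above N₂ f₂ := by
  rw [Irr.mk_mem_above_iff π₁, Irr.mk_mem_above_iff π₂]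
  constructor
  · intro h
    rw [Irr.mk_mem_above_iff] at h
    obtain ⟨v, hv, h⟩ := h
    obtain ⟨e⟩ : Nonempty ((π₁.prod π₂).ρ.Equiv (extTensor π₁.ρ π₂.ρ)) :=
      ⟨(π₁.prodEquiv π₂).symm⟩
    have hne : e.toLinearEquiv v ≠ 0 := fun h =>
      hv ((map_eq_zero_iff _ e.toLinearEquiv.injective).1 h)
    have he : ∀ g ∈ N₁.prod N₂, extTensor π₁.ρ π₂.ρ g (e.toLinearEquiv v) =
        (f₁ g.1 * f₂ g.2) • e.toLinearEquiv v := fun g hg => by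
      rw [← map_smul, ← h g hg]
      exact (equiv_apply e g v).symm
    constructor
    · obtain ⟨l, hl⟩ := exists_sliceRight_ne_zero hne
      refine ⟨_, hl, fun n hn => ?_⟩
      rw [← sliceRight_map, ← map_smul]
      have h1 := he (n, 1) ⟨hn, one_mem _⟩
      rw [extTensor_apply, map_one, hf₂, mul_one] at h1
      exact congrArg _ h1
    · obtain ⟨l, hl⟩ := exists_sliceLeft_ne_zero hne
      refine ⟨_, hl, fun n hn => ?_⟩
      rw [← sliceLeft_map, ← map_smul]
      have h1 := he (1, n) ⟨one_mem _, hn⟩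
      rw [extTensor_apply, map_one, hf₁, one_mul] at h1
      exact congrArg _ h1
  · rintro ⟨⟨v, hv, h₁⟩, ⟨w, hw, h₂⟩⟩
    refine Irr.mk_mem_above_of_equiv _ (π₁.prodEquiv π₂) (tmul_ne_zero hv hw) fun n hn => ?_
    rw [extTensor_apply, TensorProduct.map_tmul, h₁ _ hn.1, h₂ _ hn.2,
      TensorProduct.smul_tmul_smul]

theorem Irr.exists_equiv_prod [Finite G₂] {N₁ : Subgroup G₁} {N₂ : Subgroup G₂} {f₁ : G₁ → ℂ}
    {f₂ : G₂ → ℂ} (hf₁ : f₁ 1 = 1) (hf₂ : f₂ 1 = 1) :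
    ∃ e : Irr.above (N₁.prod N₂) (fun g => f₁ g.1 * f₂ g.2) ≃ Irr.above N₁ f₁ × Irr.above N₂ f₂,
      ∀ χ, χ.1.dim = (e χ).1.1.dim * (e χ).2.1.dim := by
  have hm : ∀ p : Irr.above N₁ f₁ × Irr.above N₂ f₂, Irr.mk (p.1.1.rep.prod p.2.1.rep) ∈
      Irr.above (N₁.prod N₂) (fun g => f₁ g.1 * f₂ g.2) := fun p => by
    rw [IrrRep.prod_mem_above_iff hf₁ hf₂, Irr.mk_rep, Irr.mk_rep]
    exact ⟨p.1.2, p.2.2⟩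
  have hb : Function.Bijective fun p : Irr.above N₁ f₁ × Irr.above N₂ f₂ =>
      (⟨_, hm p⟩ : Irr.above (N₁.prod N₂) (fun g => f₁ g.1 * f₂ g.2)) := by
    constructor
    · intro p p' h
      obtain ⟨e⟩ := Irr.exact (congrArg Subtype.val h)
      obtain ⟨h1, h2⟩ := nonempty_equiv_of_extTensor p.1.1.rep.irr p.2.1.rep.irr p'.1.1.rep.irr
        p'.2.1.rep.irr (((IrrRep.prodEquiv _ _).trans e).trans (IrrRep.prodEquiv _ _).symm)
      refine Prod.ext (Subtype.ext ?_) (Subtype.ext ?_)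
      · rw [← Irr.mk_rep p.1.1, ← Irr.mk_rep p'.1.1]
        exact Irr.sound h1
      · rw [← Irr.mk_rep p.2.1, ← Irr.mk_rep p'.2.1]
        exact Irr.sound h2
    · rintro ⟨χ, hχ⟩
      obtain ⟨π₁, π₂, ⟨e⟩⟩ := χ.rep.exists_prod_equiv
      have h1 : Irr.mk (π₁.prod π₂) = χ := (Irr.sound ⟨e⟩).trans (Irr.mk_rep χ)
      have h2 := hχ
      rw [← h1, IrrRep.prod_mem_above_iff hf₁ hf₂] at h2
      refine ⟨(⟨_, h2.1⟩, ⟨_, h2.2⟩), Subtype.ext ?_⟩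
      change Irr.mk ((Irr.mk π₁).rep.prod (Irr.mk π₂).rep) = χ
      rw [← h1]
      obtain ⟨i⟩ := Irr.rep_mk π₁
      obtain ⟨j⟩ := Irr.rep_mk π₂
      refine Irr.sound ⟨((IrrRep.prodEquiv _ _).symm.trans ?_).trans (IrrRep.prodEquiv _ _)⟩
      refine .mk (TensorProduct.congr i.symm.toLinearEquiv j.symm.toLinearEquiv) fun g => ?_
      refine TensorProduct.ext' fun v w => ?_
      exact congrArg₂ (· ⊗ₜ ·) (equiv_apply i.symm g.1 v) (equiv_apply j.symm g.2 w)
  refine ⟨(Equiv.ofBijective _ hb).symm, fun χ => ?_⟩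
  obtain ⟨p, rfl⟩ := (Equiv.ofBijective _ hb).surjective χ
  rw [Equiv.symm_apply_apply]
  change (p.1.1.rep.prod p.2.1.rep).dim = _
  rw [IrrRep.dim_prod, Irr.dim_rep, Irr.dim_rep]

end Product

/-! ### The linear and the unitary involution -/

section Forms

variable {R : Type v} [CommRing R] {n : Type w} [Fintype n] [DecidableEq n]

theorem classicalForm_linear (σ : R →+* R) (hσ : ∀ x, σ (σ x) = x) :
    ClassicalForm (n := n) σ (GeneralLinearGroup.map σ) σ.mapMatrix.toAddMonoidHom where
  F_invol g := Units.ext (by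
    ext a b
    exact hσ _)
  D_smul r x := by
    ext a b
    exact map_mul σ _ _
  D_invol x := by
    ext a b
    exact hσ _
  trace_mul x y := by
    change (σ.mapMatrix x * σ.mapMatrix y).trace = _
    rw [← map_mul]
    exact (AddMonoidHom.map_trace σ.toAddMonoidHom (x * y)).symm
  trace_eq_zero x hx := by
    have := (AddMonoidHom.map_trace σ.toAddMonoidHom x).symm
    rw [hx, map_zero] at this
    exact this
  bracket x y := by
    change σ.mapMatrix (x * y - y * x) = σ.mapMatrix x * σ.mapMatrix y - σ.mapMatrix y * σ.mapMatrix x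
    rw [map_sub, map_mul, map_mul]
  conj g x := by
    change σ.mapMatrix (g.1 * x * g⁻¹.1) = _
    rw [map_mul, map_mul]
    rfl
  cayley u x h := by
    have := congrArg σ.mapMatrix h
    rwa [map_mul, map_sub, map_add, map_one] at this
  scalar_det g k := Units.ext (by
    have h : (GeneralLinearGroup.map σ g).det = Units.map (σ : R →* R) g.det :=
      Units.ext (RingHom.map_det σ g.1).symm
    rw [h, ← map_pow (Units.map (σ : R →* R))]
    ext a b
    change σ (Matrix.scalar n ((g.det ^ k : Rˣ) : R) a b) =
      Matrix.scalar n (σ ((g.det ^ k : Rˣ) : R)) a b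
    simp only [scalar_apply, diagonal_apply]
    split_ifs <;> simp)

/-- The adjoint of a matrix with respect to the sesquilinear form `(x, y) ↦ (x^σ)ᵀ J y`. -/
def formAdjoint (σ : R →+* R) (J : GL n R) : Matrix n n R →+ Matrix n n R where
  toFun x := J⁻¹.1 * (x.map σ)ᵀ * J.1
  map_zero' := by simp [Matrix.map_zero]
  map_add' x y := by
    rw [Matrix.map_add σ (map_add σ), transpose_add, mul_add, add_mul]

variable (σ : R →+* R) (J : GL n R)

theorem formAdjoint_apply (x : Matrix n n R) : formAdjoint σ J x = J⁻¹.1 * (x.map σ)ᵀ * J.1 := rfl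

theorem formAdjoint_one : formAdjoint σ J 1 = 1 := by
  rw [formAdjoint_apply, Matrix.map_one _ (map_zero σ) (map_one σ), transpose_one, mul_one,
    Units.inv_mul]

theorem formAdjoint_mul (x y : Matrix n n R) :
    formAdjoint σ J (x * y) = formAdjoint σ J y * formAdjoint σ J x := by
  simp only [formAdjoint_apply, Matrix.map_mul, transpose_mul, mul_assoc,
    Units.mul_inv_cancel_left]

theorem formAdjoint_smul (r : R) (x : Matrix n n R) :
    formAdjoint σ J (r • x) = σ r • formAdjoint σ J x := by
  have : ((r • x).map σ) = σ r • x.map σ := by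
    ext a b
    exact map_mul σ _ _
  rw [formAdjoint_apply, this, transpose_smul, mul_smul_comm, smul_mul_assoc]
  rfl

theorem trace_formAdjoint (x : Matrix n n R) : (formAdjoint σ J x).trace = σ x.trace := by
  rw [formAdjoint_apply, trace_mul_comm, ← mul_assoc, Units.mul_inv, one_mul, trace_transpose]
  exact (AddMonoidHom.map_trace σ.toAddMonoidHom x).symm

theorem det_formAdjoint (x : Matrix n n R) : (formAdjoint σ J x).det = σ x.det := by
  rw [formAdjoint_apply, det_mul, det_mul, mul_right_comm, ← det_mul, Units.inv_mul, det_one,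
    one_mul, det_transpose]
  exact (RingHom.map_det σ x).symm

variable {σ J}

theorem formAdjoint_invol (hσ : ∀ x, σ (σ x) = x) (hJ : (J.1.map σ)ᵀ = J.1) (x : Matrix n n R) :
    formAdjoint σ J (formAdjoint σ J x) = x := by
  have h1 : (((x.map σ)ᵀ).map σ)ᵀ = x := by
    ext a b
    exact hσ _
  have h2 : (J⁻¹.1.map σ)ᵀ * J.1 = 1 := by
    conv_lhs => rw [← hJ]
    rw [← transpose_mul, ← Matrix.map_mul, Units.mul_inv, Matrix.map_one _ (map_zero σ) (map_one σ),
      transpose_one]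
  rw [formAdjoint_apply, formAdjoint_apply, Matrix.map_mul, Matrix.map_mul, transpose_mul,
    transpose_mul, h1, hJ, mul_assoc, mul_assoc, mul_assoc, h2, mul_one, Units.inv_mul_cancel_left]

variable (σ J)

/-- The involution of `GL_n` whose fixed points form the unitary group. -/
def unitaryInvol : GL n R →* GL n R where
  toFun g :=
    { val := formAdjoint σ J g⁻¹.1
      inv := formAdjoint σ J g.1
      val_inv := by rw [← formAdjoint_mul, Units.mul_inv, formAdjoint_one]
      inv_val := by rw [← formAdjoint_mul, Units.inv_mul, formAdjoint_one] }
  map_one' := Units.ext (by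
    change formAdjoint σ J ((1 : GL n R)⁻¹).1 = 1
    rw [inv_one]
    exact formAdjoint_one σ J)
  map_mul' g h := Units.ext (by
    change formAdjoint σ J (g * h)⁻¹.1 = formAdjoint σ J g⁻¹.1 * formAdjoint σ J h⁻¹.1
    rw [_root_.mul_inv_rev, Units.val_mul, formAdjoint_mul])

theorem val_unitaryInvol (g : GL n R) : (unitaryInvol σ J g).1 = formAdjoint σ J g⁻¹.1 := rfl

theorem val_inv_unitaryInvol (g : GL n R) : (unitaryInvol σ J g)⁻¹.1 = formAdjoint σ J g.1 := rfl

variable {σ J}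

/-- The equation says that `(u + 1)/2` is a left inverse of `1 - x`, hence a two-sided one. The
reversed form is needed because the adjoint reverses products. -/
theorem cayley_comm (h2 : IsUnit (2 : R)) {u x : Matrix n n R} (h : u * (1 - x) = 1 + x) :
    (1 - x) * u = 1 + x := by
  obtain ⟨c, hc⟩ := h2.exists_right_inv
  have e1 : (u + 1) * (1 - x) = (2 : R) • (1 : Matrix n n R) := by
    rw [add_mul, h, two_smul]
    noncomm_ring
  have e2 : (c • (u + 1)) * (1 - x) = 1 := by
    rw [smul_mul_assoc, e1, smul_smul, mul_comm, hc, one_smul]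
  have e3 := mul_eq_one_comm.1 e2
  rw [mul_smul_comm] at e3
  have e4 := congrArg (fun z => (2 : R) • z) e3
  simp only [smul_smul, hc, one_smul] at e4
  rw [mul_add, mul_one, two_smul] at e4
  rw [eq_sub_of_add_eq e4]
  abel

theorem classicalForm_unitary (h2 : IsUnit (2 : R)) (hσ : ∀ x, σ (σ x) = x)
    (hJ : (J.1.map σ)ᵀ = J.1) :
    ClassicalForm σ (unitaryInvol σ J) (-formAdjoint σ J) where
  F_invol g := Units.ext (by
    rw [val_unitaryInvol, val_inv_unitaryInvol, formAdjoint_invol hσ hJ])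
  D_smul r x := by
    rw [AddMonoidHom.neg_apply, AddMonoidHom.neg_apply, formAdjoint_smul, smul_neg]
  D_invol x := by
    rw [AddMonoidHom.neg_apply, AddMonoidHom.neg_apply, map_neg, neg_neg, formAdjoint_invol hσ hJ]
  trace_mul x y := by
    rw [AddMonoidHom.neg_apply, AddMonoidHom.neg_apply, neg_mul_neg, ← formAdjoint_mul,
      trace_formAdjoint, trace_mul_comm]
  trace_eq_zero x hx := by
    rw [AddMonoidHom.neg_apply, trace_neg, trace_formAdjoint, hx, map_zero, neg_zero]
  bracket x y := by
    simp only [AddMonoidHom.neg_apply, map_sub, formAdjoint_mul]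
    noncomm_ring
  conj g x := by
    rw [AddMonoidHom.neg_apply, AddMonoidHom.neg_apply, formAdjoint_mul, formAdjoint_mul,
      val_unitaryInvol, val_inv_unitaryInvol, mul_neg, neg_mul, mul_assoc]
  cayley u x h := by
    have h1 := congrArg (formAdjoint σ J) (cayley_comm h2 h)
    rw [formAdjoint_mul, map_sub, map_add, formAdjoint_one] at h1
    rw [AddMonoidHom.neg_apply, sub_neg_eq_add, ← h1, val_unitaryInvol, ← mul_assoc,
      ← formAdjoint_mul, Units.mul_inv, formAdjoint_one, one_mul, sub_eq_add_neg]
  scalar_det g k := Units.ext (by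
    have h : (unitaryInvol σ J g).det = Units.map (σ : R →* R) g.det⁻¹ := Units.ext (by
      rw [← map_inv]
      exact det_formAdjoint σ J _)
    rw [h, ← map_pow (Units.map (σ : R →* R)), val_unitaryInvol, ← map_inv]
    change formAdjoint σ J (Matrix.scalar n (((g.det ^ k)⁻¹ : Rˣ) : R)) =
      Matrix.scalar n (σ (((g.det⁻¹) ^ k : Rˣ) : R))
    rw [inv_pow, Matrix.scalar_apply, Matrix.scalar_apply, ← Matrix.smul_one_eq_diagonal,
      ← Matrix.smul_one_eq_diagonal, formAdjoint_smul, formAdjoint_one])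

end Forms

/-! ### The classical groups as fixed points -/

/-- The types of groups with a determinant condition. -/
def GroupType.Special (T : GroupType) : Prop := T = .SL ∨ T = .SU

section Types

variable {R : Type v} [CommRing R] {n : Type w} [Fintype n] [DecidableEq n]

/-- The involution of `GL_n` attached to a type and a Hermitian form. -/
def formInvol (T : GroupType) (σ : R →+* R) (J : GL n R) : GL n R →* GL n R :=
  match T with
  | .GL | .SL => GeneralLinearGroup.map σ
  | .GU | .SU => unitaryInvol σ J

/-- The differential of `formInvol`. -/
def formLie (T : GroupType) (σ : R →+* R) (J : GL n R) : Matrix n n R →+ Matrix n n R :=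
  match T with
  | .GL | .SL => σ.mapMatrix.toAddMonoidHom
  | .GU | .SU => -formAdjoint σ J

theorem classicalForm (T : GroupType) {σ : R →+* R} {J : GL n R} (h2 : IsUnit (2 : R))
    (hσ : ∀ x, σ (σ x) = x) (hJ : (J.1.map σ)ᵀ = J.1) :
    ClassicalForm σ (formInvol T σ J) (formLie T σ J) := by
  cases T
  exacts [classicalForm_linear σ hσ, classicalForm_unitary h2 hσ hJ, classicalForm_linear σ hσ,
    classicalForm_unitary h2 hσ hJ]

variable {S : Type v} [CommRing S] {f : R →+* S} {σ : R →+* R} {τ : S →+* S}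

theorem map_formAdjoint (hf : ∀ x, f (σ x) = τ (f x)) (J : GL n R) (x : Matrix n n R) :
    (formAdjoint σ J x).map f = formAdjoint τ (GeneralLinearGroup.map f J) (x.map f) := by
  have h1 : ((x.map σ)ᵀ).map f = ((x.map f).map τ)ᵀ := by
    ext a b
    exact hf _
  rw [formAdjoint_apply, formAdjoint_apply, Matrix.map_mul, Matrix.map_mul, h1, ← map_inv]
  rfl

theorem map_formInvol (T : GroupType) (hf : ∀ x, f (σ x) = τ (f x)) (J g : GL n R) :
    GeneralLinearGroup.map f (formInvol T σ J g) =
      formInvol T τ (GeneralLinearGroup.map f J) (GeneralLinearGroup.map f g) := by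
  have h1 : GeneralLinearGroup.map f (GeneralLinearGroup.map σ g) =
      GeneralLinearGroup.map τ (GeneralLinearGroup.map f g) := Units.ext (by
    ext a b
    exact hf _)
  have h2 : GeneralLinearGroup.map f (unitaryInvol σ J g) =
      unitaryInvol τ (GeneralLinearGroup.map f J) (GeneralLinearGroup.map f g) := Units.ext (by
    rw [val_unitaryInvol, ← map_inv]
    exact map_formAdjoint hf J _)
  cases T
  exacts [h1, h2, h1, h2]

theorem map_formLie (T : GroupType) (hf : ∀ x, f (σ x) = τ (f x)) (J : GL n R)
    (x : Matrix n n R) :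
    (formLie T σ J x).map f = formLie T τ (GeneralLinearGroup.map f J) (x.map f) := by
  have h1 : (σ.mapMatrix x).map f = τ.mapMatrix (x.map f) := by
    ext a b
    exact hf _
  have h2 : ((-formAdjoint σ J) x).map f =
      (-formAdjoint τ (GeneralLinearGroup.map f J)) (x.map f) := by
    rw [AddMonoidHom.neg_apply, AddMonoidHom.neg_apply, ← map_formAdjoint hf]
    ext a b
    exact map_neg f _
  cases T
  exacts [h1, h2, h1, h2]

omit [Fintype n] [DecidableEq n] in
theorem map_eq_self_iff {x : Matrix n n R} : x.map σ = x ↔ ∀ a b, σ (x a b) = x a b :=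
  ⟨fun h a b => congrFun (congrFun h a) b, fun h => Matrix.ext h⟩

theorem glMap_eq_self_iff {g : GL n R} :
    GeneralLinearGroup.map σ g = g ↔ ∀ a b, σ (g.1 a b) = g.1 a b := by
  rw [Units.ext_iff, ← map_eq_self_iff]
  rfl

theorem unitaryInvol_eq_self_iff {J g : GL n R} :
    unitaryInvol σ J g = g ↔ (g.1.map σ)ᵀ * J.1 * g.1 = J.1 := by
  have h1 : unitaryInvol σ J g = g ↔ (unitaryInvol σ J g)⁻¹.1 * g.1 = 1 := by
    rw [← Units.val_mul, ← Units.val_one, ← Units.ext_iff, inv_mul_eq_one]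
  rw [h1, val_inv_unitaryInvol, formAdjoint_apply]
  constructor
  · intro h
    have := congrArg (fun z => J.1 * z) h
    simpa only [mul_assoc, Units.mul_inv_cancel_left, mul_one] using this
  · intro h
    rw [mul_assoc, mul_assoc, ← mul_assoc _ J.1, h, Units.inv_mul]

theorem neg_formAdjoint_eq_self_iff {J : GL n R} {x : Matrix n n R} :
    (-formAdjoint σ J) x = x ↔ (x.map σ)ᵀ * J.1 + J.1 * x = 0 := by
  rw [AddMonoidHom.neg_apply, neg_eq_iff_add_eq_zero, formAdjoint_apply]
  have e : J.1 * (J⁻¹.1 * (x.map σ)ᵀ * J.1 + x) = (x.map σ)ᵀ * J.1 + J.1 * x := by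
    rw [mul_add, mul_assoc, Units.mul_inv_cancel_left]
  rw [← e]
  constructor
  · intro h
    rw [h, mul_zero]
  · intro h
    have := congrArg (fun z => J⁻¹.1 * z) h
    simpa only [Units.inv_mul_cancel_left, mul_zero] using this

end Types

section Groups

variable {o : Type u} [CommRing o] [IsDomain o] [IsDiscreteValuationRing o]
    {O : Type v} [CommRing O] [IsDomain O] [IsDiscreteValuationRing O]
    [Algebra o O] [Module.Finite o O] [Algebra.FormallyUnramified o O]
    (hquad : Module.finrank o O = 2) (hodd : ringChar (IsLocalRing.ResidueField o) ≠ 2)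
    (σ : O ≃ₐ[o] O) (hσ : σ ≠ AlgEquiv.refl) {n : Type w} [Fintype n] [DecidableEq n]

omit [IsDomain o] [IsDiscreteValuationRing o] [IsDomain O] [IsDiscreteValuationRing O]
  [Module.Finite o O] [Algebra.FormallyUnramified o O] in
theorem red_lvlAut [IsLocalRing O] {i m : ℕ} (hi : i ≤ m) (x : Lvl O m) :
    red O hi (lvlAut σ.toRingEquiv m x) = lvlAut σ.toRingEquiv i (red O hi x) := by
  obtain ⟨y, rfl⟩ := Ideal.Quotient.mk_surjective x
  rfl

omit [IsDomain o] [IsDiscreteValuationRing o] [IsDomain O] [IsDiscreteValuationRing O]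
  [Module.Finite o O] [Algebra.FormallyUnramified o O] in
theorem mem_linearGroup_iff [IsLocalRing O] {m : ℕ} {g : GL n (Lvl O m)} :
    g ∈ linearGroup o O n m ↔
      (∀ a b, g.1 a b ∈ baseRing o O m) ∧ ∀ a b, g⁻¹.1 a b ∈ baseRing o O m := by
  constructor
  · rintro ⟨h, rfl⟩
    refine ⟨fun a b => (h.1 a b).2, fun a b => ?_⟩
    rw [← map_inv]
    exact (h⁻¹.1 a b).2
  · rintro ⟨h1, h2⟩
    have hinj : Function.Injective fun x : Matrix n n (baseRing o O m) =>
        x.map (baseRing o O m).subtype := Matrix.map_injective Subtype.val_injective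
    refine ⟨⟨of fun a b => ⟨_, h1 a b⟩, of fun a b => ⟨_, h2 a b⟩, hinj ?_, hinj ?_⟩,
      Units.ext rfl⟩
    · simp only
      rw [Matrix.map_mul, Matrix.map_one _ (map_zero _) (map_one _)]
      exact g.mul_inv
    · simp only
      rw [Matrix.map_mul, Matrix.map_one _ (map_zero _) (map_one _)]
      exact g.inv_mul

include hquad hodd hσ

theorem mem_classicalGroup_iff (T : GroupType) (J : GL n O) {m : ℕ} {g : GL n (Lvl O m)} :
    g ∈ classicalGroup o σ.toRingEquiv J.1 T m ↔
      formInvol T (lvlAut σ.toRingEquiv m) (GeneralLinearGroup.map (toLvl O m) J) g = g ∧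
        (T.Special → g.1.det = 1) := by
  have h1 : g ∈ linearGroup o O n m ↔ GeneralLinearGroup.map (lvlAut σ.toRingEquiv m) g = g := by
    rw [mem_linearGroup_iff]
    have key := fun x => mem_baseRing_iff hquad hodd σ hσ m x
    constructor
    · rintro ⟨h1, -⟩
      have h3 : ∀ a b, lvlAut σ.toRingEquiv m (g.1 a b) = g.1 a b := fun a b =>
        (key _).1 (h1 a b)
      rw [glMap_eq_self_iff]
      exact h3
    · intro h
      have h2 : GeneralLinearGroup.map (lvlAut σ.toRingEquiv m) g⁻¹ = g⁻¹ := by rw [map_inv, h]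
      rw [glMap_eq_self_iff] at h h2
      exact ⟨fun a b => (key _).2 (h a b), fun a b => (key _).2 (h2 a b)⟩
  have h2 : g ∈ unitaryGrp σ.toRingEquiv J.1 m ↔ unitaryInvol (lvlAut σ.toRingEquiv m)
      (GeneralLinearGroup.map (toLvl O m) J) g = g := by
    rw [unitaryInvol_eq_self_iff]
    exact Iff.rfl
  have h3 : g ∈ (GeneralLinearGroup.det (n := n) (R := Lvl O m)).ker ↔ g.1.det = 1 := by
    rw [MonoidHom.mem_ker, Units.ext_iff]
    rfl
  cases T
  · refine Iff.trans ?_ (and_iff_left fun h => ?_).symm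
    · exact h1
    · simp [GroupType.Special] at h
  · refine Iff.trans ?_ (and_iff_left fun h => ?_).symm
    · exact h2
    · simp [GroupType.Special] at h
  · simp only [GroupType.Special, true_or, forall_const]
    exact and_congr h1 h3
  · simp only [GroupType.Special, or_true, forall_const]
    exact and_congr h2 h3

theorem mem_lieAlg_iff (T : GroupType) (J : GL n O) {m : ℕ} {x : Matrix n n (Lvl O m)} :
    x ∈ lieAlg o σ.toRingEquiv J.1 T m ↔
      formLie T (lvlAut σ.toRingEquiv m) (GeneralLinearGroup.map (toLvl O m) J) x = x ∧
        (T.Special → x.trace = 0) := by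
  have h1 : (∀ a b, x a b ∈ baseRing o O m) ↔ (lvlAut σ.toRingEquiv m).mapMatrix x = x := by
    have h3 : (lvlAut σ.toRingEquiv m).mapMatrix x = x ↔
        ∀ a b, lvlAut σ.toRingEquiv m (x a b) = x a b := map_eq_self_iff
    rw [h3]
    exact forall₂_congr fun a b => mem_baseRing_iff hquad hodd σ hσ m _
  have h2 : (x.map (lvlAut σ.toRingEquiv m))ᵀ * J.1.map (toLvl O m) + J.1.map (toLvl O m) * x = 0 ↔
      (-formAdjoint (lvlAut σ.toRingEquiv m) (GeneralLinearGroup.map (toLvl O m) J)) x = x := by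
    rw [neg_formAdjoint_eq_self_iff]
    exact Iff.rfl
  cases T
  · refine Iff.trans ?_ (and_iff_left fun h => ?_).symm
    · exact h1
    · simp [GroupType.Special] at h
  · refine Iff.trans ?_ (and_iff_left fun h => ?_).symm
    · exact h2
    · simp [GroupType.Special] at h
  · simp only [GroupType.Special, true_or, forall_const]
    exact and_congr h1 Iff.rfl
  · simp only [GroupType.Special, or_true, forall_const]
    exact and_congr h2 Iff.rfl

end Groups

/-! ### Lifting -/

section Lifting

variable {R : Type v} [CommRing R] {σ : R →+* R} {n : Type w} [Fintype n]
    [DecidableEq n] {F : GL n R →* GL n R} {D : Matrix n n R →+ Matrix n n R}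
    (hc : ClassicalForm σ F D) {𝔪 : Ideal R} {ℓ q : ℕ} (hR : QuadraticLevel σ 𝔪 ℓ q)

include hR

/-- Lift the entries arbitrarily: the determinant is a unit modulo the nilpotent `𝔪`, hence a unit.
-/
theorem QuadraticLevel.exists_gl_lift {S : Type*} [CommRing S] {f : R →+* S}
    (hs : Function.Surjective f) (hf : ∀ x, f x = 0 → x ∈ 𝔪) (s : GL n S) :
    ∃ g : GL n R, GeneralLinearGroup.map f g = s := by
  choose x hx using fun a b => hs (s.1 a b)
  have h1 : (of x).map f = s.1 := by
    ext a b
    exact hx a b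
  have h2 : f (of x).det = s.1.det := by rw [← h1]; exact RingHom.map_det f _
  obtain ⟨r, hr⟩ := hs (s⁻¹.1.det)
  have h3 : IsUnit ((of x).det * r) := by
    refine hR.isUnit_of_sub_mem isUnit_one (hf _ ?_)
    rw [map_sub, map_mul, h2, hr, ← det_mul, Units.mul_inv, det_one, map_one, sub_self]
  obtain ⟨g, hg⟩ := (Matrix.isUnit_iff_isUnit_det _).2 (isUnit_of_mul_isUnit_left h3)
  refine ⟨g, Units.ext ?_⟩
  change g.1.map f = _
  rw [hg, h1]

/-- Unipotent scalars without torsion of order the size of the matrices. -/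
theorem QuadraticLevel.eq_one_of_pow {d : ℕ} (hd : IsUnit (d : R)) {r : R} (h : r ^ d = 1)
    (h1 : r - 1 ∈ 𝔪) : r = 1 := by
  have h2 : (∑ i ∈ Finset.range d, r ^ i) * (r - 1) = 0 := by rw [geom_sum_mul, h, sub_self]
  have h3 : IsUnit (∑ i ∈ Finset.range d, r ^ i) := by
    refine hR.isUnit_of_sub_mem hd ?_
    have e : (d : R) = ∑ i ∈ Finset.range d, 1 := by simp
    rw [e, ← Finset.sum_sub_distrib]
    refine sum_mem fun i _ => ?_
    have := sub_dvd_pow_sub_pow r 1 i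
    rw [one_pow] at this
    exact Ideal.mem_of_dvd _ this h1
  exact sub_eq_zero.1 (h3.mul_right_eq_zero.1 h2)

omit hR in
theorem scalar_mem_congKer {I : Ideal R} {r : Rˣ} (h : (r : R) - 1 ∈ I) :
    GeneralLinearGroup.scalar n r ∈ congKer n I := by
  rw [mem_congKer]
  intro a b
  change (Matrix.scalar n (r : R) - 1) a b ∈ I
  rw [Matrix.sub_apply, Matrix.scalar_apply, Matrix.diagonal_apply, Matrix.one_apply]
  split_ifs
  · exact h
  · rw [sub_zero]
    exact zero_mem _

omit hR in
theorem pow_sub_one_mem {r : R} {I : Ideal R} (h : r - 1 ∈ I) (k : ℕ) :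
    r ^ k - 1 ∈ I := by
  have := sub_dvd_pow_sub_pow r 1 k
  rw [one_pow] at this
  exact Ideal.mem_of_dvd _ this h

/-- Fixed matrices with determinant `1` modulo `𝔪` can be scaled to have determinant `1`. -/
theorem exists_scalar_det_eq_one (hd : IsUnit (Fintype.card n : R)) {g : GL n R}
    (h1 : g.1.det - 1 ∈ 𝔪) : ∃ k : ℕ,
      (g * GeneralLinearGroup.scalar n (g.det ^ k)).1.det = 1 := by
  have := hR.finite
  -- A common factor would give a nontrivial power of the determinant that is torsion of order
  -- dividing the matrix size. It is congruent to 1, and `eq_one_of_pow` excludes this.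
  have hcop : Nat.Coprime (orderOf g.det) (Fintype.card n) := by
    by_contra hne
    obtain ⟨a, ha⟩ := Nat.gcd_dvd_left (orderOf g.det) (Fintype.card n)
    obtain ⟨b, hb⟩ := Nat.gcd_dvd_right (orderOf g.det) (Fintype.card n)
    have h2 : (g.det ^ a) ^ Fintype.card n = 1 := by
      rw [← pow_mul, hb, mul_comm _ b, mul_left_comm, mul_comm a, ← ha, mul_comm, pow_mul,
        pow_orderOf_eq_one, one_pow]
    have h3 : g.det ^ a = 1 := Units.ext (by
      refine hR.eq_one_of_pow hd ?_ ?_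
      · rw [← Units.val_pow_eq_pow_val, h2, Units.val_one]
      · rw [Units.val_pow_eq_pow_val]
        exact pow_sub_one_mem h1 a)
    have h4 := orderOf_dvd_of_pow_eq_one h3
    have hpos : 0 < orderOf g.det := orderOf_pos _
    have ha0 : a ≠ 0 := by
      rintro rfl
      omega
    have h5 := Nat.le_of_dvd (Nat.pos_of_ne_zero ha0) h4
    have h6 : 0 < Nat.gcd (orderOf g.det) (Fintype.card n) := Nat.gcd_pos_of_pos_left _ hpos
    have h7 : 2 * a ≤ Nat.gcd (orderOf g.det) (Fintype.card n) * a :=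
      Nat.mul_le_mul_right a (by
        have : Nat.gcd (orderOf g.det) (Fintype.card n) ≠ 1 := hne
        omega)
    omega
  -- `b` inverts the matrix size on exponents of the determinant, and the further exponent `orderOf
  -- g.det - 1` means inversion. The determinant of the scalar matrix is then the inverse of
  -- `g.det`.
  obtain ⟨b, hb⟩ := exists_pow_eq_self_of_coprime (x := g.det) hcop.symm
  refine ⟨b * (orderOf g.det - 1), ?_⟩
  have hs : (GeneralLinearGroup.scalar n (g.det ^ (b * (orderOf g.det - 1)))).1.det =
      ((g.det ^ (b * (orderOf g.det - 1)) : Rˣ) : R) ^ Fintype.card n := by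
    change (Matrix.scalar n _).det = _
    rw [Matrix.scalar_apply, Matrix.det_diagonal, Finset.prod_const, Finset.card_univ]
  rw [Units.val_mul, det_mul, hs]
  have h2 : g.det * (g.det ^ (b * (orderOf g.det - 1))) ^ Fintype.card n = 1 := by
    rw [← pow_mul, show b * (orderOf g.det - 1) * Fintype.card n =
      (Fintype.card n * b) * (orderOf g.det - 1) by ring, pow_mul, pow_mul, hb, ← pow_succ',
      Nat.sub_add_cancel (orderOf_pos _), pow_orderOf_eq_one]
  exact congrArg Units.val h2

include hc

/-- The involution of a classical form as an automorphism. -/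
def ClassicalForm.mulAut : MulAut (GL n R) where
  toFun := F
  invFun := F
  left_inv := hc.F_invol
  right_inv := hc.F_invol
  map_mul' := map_mul F

/-- Points of the classical group over a quotient lift. -/
theorem ClassicalForm.exists_lift {S : Type*} [CommRing S] {f : R →+* S}
    (hs : Function.Surjective f) (hf : ∀ x, f x = 0 ↔ x ∈ 𝔪) {F' : GL n S →* GL n S}
    (hF : ∀ g, GeneralLinearGroup.map f (F g) = F' (GeneralLinearGroup.map f g))
    {special : Prop} (hd : special → IsUnit (Fintype.card n : R)) {s : GL n S} (hs' : F' s = s)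
    (hdet : special → s.1.det = 1) :
    ∃ g : GL n R, F g = g ∧ (special → g.1.det = 1) ∧ GeneralLinearGroup.map f g = s := by
  have := hR.finite_gl (n := n)
  have hker : ∀ g h : GL n R, g⁻¹ * h ∈ congKer n (𝔪 ^ 1) ↔
      GeneralLinearGroup.map f g = GeneralLinearGroup.map f h := fun g h => by
    rw [inv_mul_mem_congKer, pow_one, Units.ext_iff]
    constructor
    · intro hgh
      refine Matrix.ext fun a b => ?_
      have := (hf _).2 (hgh a b)
      rw [Matrix.sub_apply, map_sub, sub_eq_zero] at this
      exact this.symm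
    · intro hgh a b
      rw [← hf, Matrix.sub_apply, map_sub, sub_eq_zero]
      exact (congrFun (congrFun hgh a) b).symm
  obtain ⟨g₀, hg₀⟩ := hR.exists_gl_lift hs (fun x => (hf x).1) s
  obtain ⟨m, hm⟩ := hR.exists_sqrt (n := n)
  -- An arbitrary lift is fixed by `F` modulo the congruence kernel, and square roots there correct
  -- it to a fixed point.
  obtain ⟨y, hy, -, hgy⟩ := exists_fixed_mul_of_sqrt (T := hc.mulAut) hc.F_invol hm (g := g₀)
    ((hker _ _).2 (by
      change _ = GeneralLinearGroup.map f (F g₀)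
      rw [hF, hg₀, hs']))
  have hgy' : F (g₀ * y) = g₀ * y := hgy
  have hgs : GeneralLinearGroup.map f (g₀ * y) = s := by
    rw [← hg₀]
    refine ((hker _ _).1 ?_).symm
    rwa [inv_mul_cancel_left]
  by_cases hsp : special
  · have h1 : (g₀ * y).1.det - 1 ∈ 𝔪 := by
      rw [← hf, map_sub, map_one]
      have : f (g₀ * y).1.det = s.1.det := by
        rw [← hgs]
        exact RingHom.map_det f _
      rw [this, hdet hsp, sub_self]
    -- The correcting scalar is a power of the determinant, so `scalar_det` keeps the product fixed
    -- by `F`. It is congruent to 1, so the reduction is unchanged.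
    obtain ⟨k, hk⟩ := exists_scalar_det_eq_one hR (hd hsp) h1
    refine ⟨_, ?_, fun _ => hk, ?_⟩
    · rw [map_mul, hc.scalar_det, hgy']
    · rw [← hgs]
      refine ((hker _ _).1 ?_).symm
      rw [inv_mul_cancel_left, pow_one]
      refine scalar_mem_congKer ?_
      rw [Units.val_pow_eq_pow_val]
      exact pow_sub_one_mem h1 k
  · exact ⟨_, hgy', fun h => absurd h hsp, hgs⟩

end Lifting

/-! ### Representations over an orbit in terms of congruence subgroups -/

section IrrOver

variable {O : Type v} [CommRing O] [IsLocalRing O] {n : Type w} [Fintype n] [DecidableEq n]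

theorem mem_congKer_iff_red {i ℓ : ℕ} (hi : i ≤ ℓ) {g : GL n (Lvl O ℓ)} :
    g ∈ congKer n (lvlIdeal O ℓ ^ i) ↔ GeneralLinearGroup.map (red O hi) g = 1 := by
  rw [mem_congKer, Units.ext_iff]
  have h1 : ∀ a b, red O hi ((g.1 - 1) a b) =
      (GeneralLinearGroup.map (red O hi) g).1 a b - (1 : Matrix n n (Lvl O i)) a b := fun a b => by
    rw [Matrix.sub_apply, map_sub, one_apply, one_apply]
    split_ifs
    · rw [map_one]; rfl
    · rw [map_zero]; rfl
  constructor
  · intro h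
    refine Matrix.ext fun a b => ?_
    rw [← sub_eq_zero]
    exact (h1 a b).symm.trans ((red_eq_zero_iff hi _).2 (h a b))
  · intro h a b
    rw [← red_eq_zero_iff hi, h1, h, Units.val_one, sub_self]

theorem inv_mul_mem_congKer_iff_red {i ℓ : ℕ} (hi : i ≤ ℓ) {g h : GL n (Lvl O ℓ)} :
    g⁻¹ * h ∈ congKer n (lvlIdeal O ℓ ^ i) ↔
      GeneralLinearGroup.map (red O hi) g = GeneralLinearGroup.map (red O hi) h := by
  rw [mem_congKer_iff_red hi, map_mul, map_inv, inv_mul_eq_one]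

theorem entriesIn_iff_red {i ℓ : ℕ} (hi : i ≤ ℓ) {m p : Type*} {x : Matrix m p (Lvl O ℓ)} :
    EntriesIn (lvlIdeal O ℓ ^ i) x ↔ x.map (red O hi) = 0 := by
  constructor
  · intro h
    ext a b
    exact (red_eq_zero_iff hi _).2 (h a b)
  · intro h a b
    exact (red_eq_zero_iff hi _).1 (congrFun (congrFun h a) b)

theorem lvlIdeal_pow_eq_bot (ℓ : ℕ) : lvlIdeal O ℓ ^ ℓ = ⊥ := by
  rw [eq_bot_iff]
  intro x hx
  obtain ⟨y, rfl⟩ := Ideal.Quotient.mk_surjective x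
  rw [mk_mem_lvlIdeal_pow le_rfl] at hx
  exact Ideal.Quotient.eq_zero_iff_mem.2 hx

omit [DecidableEq n] in
theorem trace_mul_congr {ℓ : ℕ} (hℓ : 1 ≤ ℓ) {x y z : Matrix n n (Lvl O ℓ)}
    (hxy : x.map (red O hℓ) = y.map (red O hℓ)) (hz : EntriesIn (lvlIdeal O ℓ ^ (ℓ - 1)) z) :
    (x * z).trace = (y * z).trace := by
  have h1 : EntriesIn (lvlIdeal O ℓ ^ 1) (x - y) := by
    rw [entriesIn_iff_red hℓ, Matrix.map_sub _ (map_sub _), hxy, sub_self]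
  have h2 : EntriesIn (lvlIdeal O ℓ ^ ℓ) ((x - y) * z) := h1.pow_succ_mul (by omega) hz
  rw [lvlIdeal_pow_eq_bot] at h2
  rw [← sub_eq_zero, ← trace_sub, ← sub_mul, h2.eq_zero, trace_zero]

omit [IsLocalRing O] in
theorem trace_conj_mul (x : Matrix n n O) (k g : GL n O) :
    (k.1 * x * k⁻¹.1 * ((k * g * k⁻¹).1 - 1)).trace = (x * (g.1 - 1)).trace := by
  have e : (k * g * k⁻¹).1 - 1 = k.1 * (g.1 - 1) * k⁻¹.1 := by
    rw [mul_sub, sub_mul, mul_one, Units.mul_inv, Units.val_mul, Units.val_mul]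
  have e2 : k.1 * x * k⁻¹.1 * (k.1 * (g.1 - 1) * k⁻¹.1) = k.1 * (x * (g.1 - 1)) * k⁻¹.1 := by
    simp only [mul_assoc, Units.inv_mul_cancel_left]
  rw [e, e2, trace_mul_comm, Units.inv_mul_cancel_left]

/-- The representations over an orbit are the representations over the character of a fixed
lift. -/
theorem irrOver_eq_above {ℓ : ℕ} (hℓ : 1 ≤ ℓ) (𝒢 : (m : ℕ) → Subgroup (GL n (Lvl O m)))
    (hs : ∀ h ∈ 𝒢 1, ∃ g ∈ 𝒢 ℓ, GeneralLinearGroup.map (red O hℓ) g = h)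
    (ψ : AddChar (Lvl O ℓ) ℂ) (x : Matrix n n (Lvl O ℓ)) :
    IrrOver 𝒢 ℓ ψ (x.map (red O hℓ)) =
      Irr.above ((congKer n (lvlIdeal O ℓ ^ (ℓ - 1))).subgroupOf (𝒢 ℓ))
        (fun g => ψ (x * (g.1.1 - 1)).trace) := by
  have hsurj : ∀ z : Matrix n n (Lvl O ℓ), ∃ η : Matrix n n O, η.map (toLvl O ℓ) = z := fun z => by
    choose η hη using fun a b => Ideal.Quotient.mk_surjective (z a b)
    exact ⟨of η, Matrix.ext hη⟩
  have hred : ∀ η : Matrix n n O, η.map (toLvl O 1) = (η.map (toLvl O ℓ)).map (red O hℓ) :=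
    fun η => rfl
  ext χ
  constructor
  · rintro ⟨π, rfl, h, hh, v, hv, H⟩
    -- The element moving `ξ` within its orbit is lifted to the group, and its inverse moves the
    -- eigenvector to one for the character of `x` itself.
    obtain ⟨g₀, hg₀, rfl⟩ := hs h hh
    obtain ⟨k, rfl⟩ : ∃ k : 𝒢 ℓ, k.1 = g₀ := ⟨⟨g₀, hg₀⟩, rfl⟩
    have hinj : π.ρ k⁻¹ v ≠ 0 := fun h0 => hv (by
      rw [← apply_inv_apply_rep π.ρ k v, h0, map_zero])
    refine ⟨π, rfl, _, hinj, fun g hg => ?_⟩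
    have hc : k.1 * g.1 * k.1⁻¹ ∈ congKer n (lvlIdeal O ℓ ^ (ℓ - 1)) :=
      (inferInstance : (congKer n (lvlIdeal O ℓ ^ (ℓ - 1))).Normal).conj_mem _ hg _
    obtain ⟨η, hη⟩ := hsurj (k.1.1 * x * k.1⁻¹.1)
    have hc' := (mem_congKer_iff_red (Nat.sub_le ℓ 1)).1 hc
    have hη' : η.map (toLvl O 1) = (GeneralLinearGroup.map (red O hℓ) k.1).1 *
        x.map (red O hℓ) * (GeneralLinearGroup.map (red O hℓ) k.1)⁻¹.1 := by
      rw [hred, hη, Matrix.map_mul, Matrix.map_mul, ← map_inv]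
      rfl
    have h1 : π.ρ (k * g * k⁻¹) v = _ := H (k * g * k⁻¹) hc' η hη'
    have h2 : π.ρ g (π.ρ k⁻¹ v) = π.ρ k⁻¹ (π.ρ (k * g * k⁻¹) v) := by
      rw [← Module.End.mul_apply, ← Module.End.mul_apply, ← map_mul, ← map_mul]
      congr 2
      group
    rw [h2, h1, map_smul, hη]
    exact congrArg (fun z => ψ z • π.ρ k⁻¹ v) (trace_conj_mul x k.1 g.1)
  · rintro ⟨π, rfl, v, hv, H⟩
    refine ⟨π, rfl, 1, one_mem _, v, hv, fun g hg η hη => ?_⟩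
    have hgm := (mem_congKer_iff_red (Nat.sub_le ℓ 1)).2 hg
    have hη' : x.map (red O hℓ) = (η.map (toLvl O ℓ)).map (red O hℓ) := by
      rw [← hred, hη, inv_one, Units.val_one, mul_one, one_mul]
    exact (H g hgm).trans (congrArg (fun z => ψ z • v)
      (trace_mul_congr hℓ hη' (mem_congKer.1 hgm)))

end IrrOver

/-! ### Block diagonal matrices -/

section BlockDiagonal

variable {R : Type v} [CommRing R] {n₁ n₂ : Type w} [Fintype n₁] [DecidableEq n₁]
    [Fintype n₂] [DecidableEq n₂]

theorem aeval_fromBlocks (a : Matrix n₁ n₁ R) (d : Matrix n₂ n₂ R) (p : Polynomial R) :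
    Polynomial.aeval (fromBlocks a 0 0 d) p =
      fromBlocks (Polynomial.aeval a p) 0 0 (Polynomial.aeval d p) := by
  induction p using Polynomial.induction_on' with
  | add p q hp hq => rw [map_add, map_add, map_add, hp, hq, fromBlocks_add, add_zero, add_zero]
  | monomial k r =>
    simp only [Polynomial.aeval_monomial, ← Algebra.smul_def]
    have : ∀ k : ℕ, fromBlocks a 0 0 d ^ k = fromBlocks (a ^ k) 0 0 (d ^ k) := fun k => by
      induction k with
      | zero => simp
      | succ k ih =>
        rw [pow_succ, ih, fromBlocks_multiply, pow_succ, pow_succ]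
        simp
    rw [this, fromBlocks_smul, smul_zero, smul_zero]

/-- Coprime characteristic polynomials separate the blocks. -/
theorem exists_aeval_eq_of_isCoprime {a : Matrix n₁ n₁ R} {d : Matrix n₂ n₂ R}
    (h : IsCoprime a.charpoly d.charpoly) :
    ∃ p : Polynomial R, Polynomial.aeval (fromBlocks a 0 0 d) p = fromBlocks 1 0 0 0 := by
  obtain ⟨b, c, hbc⟩ := h
  have ha := aeval_self_charpoly a
  have hd := aeval_self_charpoly d
  -- By Bézout and Cayley–Hamilton this polynomial takes the value 1 at `a` and 0 at `d`.
  refine ⟨c * d.charpoly, ?_⟩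
  have h1 := congrArg (Polynomial.aeval a) hbc
  rw [map_add, map_mul, ha, mul_zero, zero_add, map_one] at h1
  rw [aeval_fromBlocks, h1, map_mul, hd, mul_zero]

/-- Commuting with the sign matrix kills the off-diagonal blocks as 2 is a unit. The inverse
commutes as well, so its diagonal blocks invert those of `g`. -/
theorem mem_range_blockDiag_iff (h2 : IsUnit (2 : R)) {g : GL (n₁ ⊕ n₂) R} :
    g ∈ (blockDiag R n₁ n₂).range ↔ signGL R n₁ n₂ * g * (signGL R n₁ n₂)⁻¹ = g := by
  have h1 : ∀ g : GL (n₁ ⊕ n₂) R, signGL R n₁ n₂ * g * (signGL R n₁ n₂)⁻¹ = g ↔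
      g.1 = fromBlocks g.1.toBlocks₁₁ 0 0 g.1.toBlocks₂₂ := fun g => by
    rw [Units.ext_iff, Units.val_mul, Units.val_mul, conj_signGL]
    constructor
    · intro h
      obtain ⟨c, hc⟩ := h2.exists_right_inv
      have key : ∀ r : R, -r = r → r = 0 := fun r hr => by linear_combination -c * hr - r * hc
      conv_lhs => rw [← fromBlocks_toBlocks g.1]
      congr 1
      · ext a b
        exact key _ (congrFun (congrFun h (Sum.inl a)) (Sum.inr b))
      · ext a b
        exact key _ (congrFun (congrFun h (Sum.inr a)) (Sum.inl b))
    · intro h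
      conv_rhs => rw [h]
      rw [h]
      simp
  constructor
  · rintro ⟨x, rfl⟩
    rw [h1]
    simp [blockDiag]
  · intro h
    have h' : signGL R n₁ n₂ * g⁻¹ * (signGL R n₁ n₂)⁻¹ = g⁻¹ := by
      conv_rhs => rw [← h]
      group
    rw [h1] at h h'
    have e1 := g.mul_inv
    have e2 := g.inv_mul
    rw [h, h', fromBlocks_multiply, ← fromBlocks_one, fromBlocks_inj] at e1 e2
    simp only [Matrix.mul_zero, Matrix.zero_mul, add_zero, zero_add] at e1 e2
    exact ⟨(⟨_, _, e1.1, e2.1⟩, ⟨_, _, e1.2.2.2, e2.2.2.2⟩), Units.ext h.symm⟩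

end BlockDiagonal

theorem card_eq_mul_of_surjective {G H : Type*} [Group G] [Group H] {A : Subgroup G}
    {B : Subgroup H} {K : Subgroup G} (f : G →* H) (hAB : ∀ g ∈ A, f g ∈ B)
    (hs : ∀ h ∈ B, ∃ g ∈ A, f g = h) (hK : ∀ g, g ∈ K ↔ f g = 1) :
    Nat.card A = Nat.card B * Nat.card (K.subgroupOf A) := by
  obtain ⟨F, hF⟩ : ∃ F : A →* B, ∀ a, (F a : H) = f a :=
    ⟨(f.comp A.subtype).codRestrict B fun a => hAB a a.2, fun _ => rfl⟩
  have hsurj : Function.Surjective F := fun ⟨h, hh⟩ => by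
    obtain ⟨g, hg, rfl⟩ := hs h hh
    exact ⟨⟨g, hg⟩, Subtype.ext (hF _)⟩
  have hker : F.ker = K.subgroupOf A := by
    ext a
    rw [MonoidHom.mem_ker, Subgroup.mem_subgroupOf, hK, ← hF, Subtype.ext_iff]
    rfl
  rw [← hker, F.ker.card_eq_card_quotient_mul_card_subgroup,
    Nat.card_congr (QuotientGroup.quotientKerEquivOfSurjective F hsurj).toEquiv]

section Hermitian

variable {o : Type u} {O : Type v} [CommRing o] [CommRing O] [Algebra o O] (σ : O ≃ₐ[o] O)

/-- The image of a form modulo `𝔓 ^ m`. -/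
abbrev lvlForm [IsLocalRing O] {n : Type w} [Fintype n] [DecidableEq n] (J : GL n O)
    (m : ℕ) : GL n (Lvl O m) := GeneralLinearGroup.map (toLvl O m) J

theorem hermitian_lvlForm [IsLocalRing O] {n : Type w} [Fintype n] [DecidableEq n]
    {J : GL n O} (hJ : (J.1.map σ)ᵀ = J.1) (m : ℕ) :
    ((lvlForm J m).1.map (lvlAut σ.toRingEquiv m))ᵀ = (lvlForm J m).1 := by
  refine Matrix.ext fun a b => ?_
  exact congrArg (toLvl O m) (congrFun (congrFun hJ a) b)

theorem hermitian_blockDiag {n₁ n₂ : Type w} [Fintype n₁] [DecidableEq n₁] [Fintype n₂]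
    [DecidableEq n₂] {J₁ : GL n₁ O} {J₂ : GL n₂ O} (hJ₁ : (J₁.1.map σ)ᵀ = J₁.1)
    (hJ₂ : (J₂.1.map σ)ᵀ = J₂.1) :
    ((blockDiag O n₁ n₂ (J₁, J₂)).1.map σ)ᵀ = (blockDiag O n₁ n₂ (J₁, J₂)).1 := by
  change ((fromBlocks J₁.1 0 0 J₂.1).map σ)ᵀ = fromBlocks J₁.1 0 0 J₂.1
  rw [fromBlocks_map, fromBlocks_transpose, hJ₁, hJ₂, Matrix.map_zero _ (map_zero σ),
    Matrix.map_zero _ (map_zero σ), transpose_zero, transpose_zero]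

end Hermitian

theorem map_aeval {R S : Type*} [CommRing R] [CommRing S] (f : R →+* S) {n : Type*} [Fintype n]
    [DecidableEq n] (x : Matrix n n R) (p : Polynomial R) :
    (Polynomial.aeval x p).map f = Polynomial.aeval (x.map f) (p.map f) := by
  refine Polynomial.map_aeval_eq_aeval_map (φ := f) (ψ := (f.mapMatrix : Matrix n n R →+* _))
    (RingHom.ext fun r => Matrix.ext fun a b => ?_) p x
  change algebraMap S (Matrix n n S) (f r) a b = f (algebraMap R (Matrix n n R) r a b)
  rw [Matrix.algebraMap_matrix_apply, Matrix.algebraMap_matrix_apply]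
  split_ifs
  · rfl
  · rw [map_zero]

/-! ### The classical groups over the finite levels and their Levi data. -/

section Concrete

variable {o : Type u} [CommRing o] [IsDomain o] [IsDiscreteValuationRing o]
    [Finite (IsLocalRing.ResidueField o)]
    {O : Type v} [CommRing O] [IsDomain O] [IsDiscreteValuationRing O]
    [Algebra o O] [Module.Finite o O] [Algebra.FormallyUnramified o O]
    (hquad : Module.finrank o O = 2) (hodd : ringChar (IsLocalRing.ResidueField o) ≠ 2)
    (σ : O ≃ₐ[o] O) (hσ : σ ≠ AlgEquiv.refl) (T : GroupType)

section General

variable {n : Type w} [Fintype n] [DecidableEq n] {J : GL n O}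
    (hJ : (J.1.map σ)ᵀ = J.1)

include hquad hodd hσ

include hJ in
theorem classicalForm_lvl (ℓ : ℕ) :
    ClassicalForm (lvlAut σ.toRingEquiv ℓ) (formInvol T (lvlAut σ.toRingEquiv ℓ) (lvlForm J ℓ))
      (formLie T (lvlAut σ.toRingEquiv ℓ) (lvlForm J ℓ)) :=
  have hR := quadraticLevel hquad hodd σ hσ ℓ
  classicalForm T hR.two hR.invol (hermitian_lvlForm σ hJ ℓ)

omit [Finite (IsLocalRing.ResidueField o)] in
theorem red_mem_classicalGroup {ℓ : ℕ} (hℓ : 1 ≤ ℓ) {g : GL n (Lvl O ℓ)}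
    (hg : g ∈ classicalGroup o σ.toRingEquiv J.1 T ℓ) :
    GeneralLinearGroup.map (red O hℓ) g ∈ classicalGroup o σ.toRingEquiv J.1 T 1 := by
  rw [mem_classicalGroup_iff hquad hodd σ hσ] at hg ⊢
  refine ⟨?_, fun hs => ?_⟩
  · have h1 := map_formInvol T (red_lvlAut σ hℓ) (lvlForm J ℓ) g
    rw [hg.1] at h1
    exact h1.symm
  · have h1 := RingHom.map_det (red O hℓ) g.1
    rw [hg.2 hs, map_one] at h1
    exact h1.symm

include hJ

theorem exists_lift_classicalGroup {ℓ : ℕ} (hℓ : 1 ≤ ℓ)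
    (hd : T.Special → IsUnit (Fintype.card n : Lvl O ℓ)) {h : GL n (Lvl O 1)}
    (hh : h ∈ classicalGroup o σ.toRingEquiv J.1 T 1) :
    ∃ g ∈ classicalGroup o σ.toRingEquiv J.1 T ℓ, GeneralLinearGroup.map (red O hℓ) g = h := by
  rw [mem_classicalGroup_iff hquad hodd σ hσ] at hh
  have hR := quadraticLevel hquad hodd σ hσ ℓ
  have hc := classicalForm_lvl hquad hodd σ hσ T hJ ℓ
  have hF := map_formInvol T (red_lvlAut σ hℓ) (lvlForm J ℓ)
  have hs : Function.Surjective (red O hℓ) := Ideal.Quotient.factor_surjective _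
  have hf : ∀ x, red O hℓ x = 0 ↔ x ∈ lvlIdeal O ℓ := fun x => by
    rw [red_eq_zero_iff, pow_one]
  obtain ⟨g, h1, h2, h3⟩ := hc.exists_lift hR hs hf hF hd hh.1 hh.2
  exact ⟨g, (mem_classicalGroup_iff hquad hodd σ hσ T J).2 ⟨h1, h2⟩, h3⟩

theorem card_classicalGroup {ℓ : ℕ} (hℓ : 1 ≤ ℓ)
    (hd : T.Special → IsUnit (Fintype.card n : Lvl O ℓ)) :
    Nat.card (classicalGroup o σ.toRingEquiv J.1 T ℓ) =
      Nat.card (classicalGroup o σ.toRingEquiv J.1 T 1) *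
        Nat.card ((congKer n (lvlIdeal O ℓ ^ 1)).subgroupOf
          (classicalGroup o σ.toRingEquiv J.1 T ℓ)) :=
  card_eq_mul_of_surjective (GeneralLinearGroup.map (red O hℓ))
    (fun _ hg => red_mem_classicalGroup hquad hodd σ hσ T hℓ hg)
    (fun _ hh => exists_lift_classicalGroup hquad hodd σ hσ T hJ hℓ hd hh)
    (fun _ => mem_congKer_iff_red hℓ)

end General

section Levi

variable {n₁ n₂ : Type w} [Fintype n₁] [DecidableEq n₁] [Fintype n₂] [DecidableEq n₂]
    {J₁ : GL n₁ O} {J₂ : GL n₂ O} (hJ₁ : (J₁.1.map σ)ᵀ = J₁.1) (hJ₂ : (J₂.1.map σ)ᵀ = J₂.1)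

theorem formInvol_signGL {R : Type v} [CommRing R] (τ : R →+* R) (A : GL n₁ R) (B : GL n₂ R) :
    formInvol T τ (blockDiag R n₁ n₂ (A, B)) (signGL R n₁ n₂) = signGL R n₁ n₂ := by
  have h0 : (signGL R n₁ n₂).1.map τ = (signGL R n₁ n₂).1 := by
    change (fromBlocks 1 0 0 (-1)).map τ = fromBlocks 1 0 0 (-1)
    rw [fromBlocks_map, Matrix.map_one _ (map_zero τ) (map_one τ), Matrix.map_zero _ (map_zero τ),
      Matrix.map_zero _ (map_zero τ)]
    congr 1
    ext a b
    simp [one_apply]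
  have h1 : GeneralLinearGroup.map τ (signGL R n₁ n₂) = signGL R n₁ n₂ := Units.ext h0
  have h2 : unitaryInvol τ (blockDiag R n₁ n₂ (A, B)) (signGL R n₁ n₂) = signGL R n₁ n₂ := by
    rw [unitaryInvol_eq_self_iff, h0]
    change (fromBlocks 1 0 0 (-1))ᵀ * fromBlocks A.1 0 0 B.1 * fromBlocks 1 0 0 (-1) =
      fromBlocks A.1 0 0 B.1
    simp [fromBlocks_transpose, fromBlocks_multiply]
  cases T
  exacts [h1, h2, h1, h2]

theorem map_blockDiag {R S : Type v} [CommRing R] [CommRing S] (f : R →+* S) (A : GL n₁ R)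
    (B : GL n₂ R) : GeneralLinearGroup.map f (blockDiag R n₁ n₂ (A, B)) =
      blockDiag S n₁ n₂ (GeneralLinearGroup.map f A, GeneralLinearGroup.map f B) := Units.ext (by
  change (fromBlocks A.1 0 0 B.1).map f = _
  rw [fromBlocks_map, Matrix.map_zero _ (map_zero f), Matrix.map_zero _ (map_zero f)]
  rfl)

include hquad hodd hσ hJ₁ hJ₂

theorem leviDatum {ℓ : ℕ} (hℓ : 2 ≤ ℓ) (hd : T.Special → IsUnit (Fintype.card (n₁ ⊕ n₂) : Lvl O ℓ))
    (x₁ : Matrix n₁ n₁ (Lvl O ℓ)) (x₂ : Matrix n₂ n₂ (Lvl O ℓ))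
    (hx : (fromBlocks x₁ 0 0 x₂).map (red O (one_le_two.trans hℓ)) ∈
      lieAlg o σ.toRingEquiv (fromBlocks J₁.1 0 0 J₂.1) T 1)
    (hcop : IsCoprime (x₁.map (red O (one_le_two.trans hℓ))).charpoly
      (x₂.map (red O (one_le_two.trans hℓ))).charpoly) :
    LeviDatum (lvlAut σ.toRingEquiv ℓ) (lvlIdeal O ℓ) ℓ (Nat.card (ResidueField o)) T.Special
      (formInvol T (lvlAut σ.toRingEquiv ℓ) (lvlForm (blockDiag O n₁ n₂ (J₁, J₂)) ℓ))
      (formLie T (lvlAut σ.toRingEquiv ℓ) (lvlForm (blockDiag O n₁ n₂ (J₁, J₂)) ℓ))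
      (classicalGroup o σ.toRingEquiv (fromBlocks J₁.1 0 0 J₂.1) T ℓ) (fromBlocks x₁ 0 0 x₂) where
  level := quadraticLevel hquad hodd σ hσ ℓ
  form := classicalForm_lvl hquad hodd σ hσ T (hermitian_blockDiag σ hJ₁ hJ₂) ℓ
  mem g := mem_classicalGroup_iff hquad hodd σ hσ T (blockDiag O n₁ n₂ (J₁, J₂))
  sign := by
    rw [lvlForm, map_blockDiag]
    exact formInvol_signGL T _ _ _
  card_unit := hd
  two_le := hℓ
  fixed := by
    have h1 := ((mem_lieAlg_iff hquad hodd σ hσ T (blockDiag O n₁ n₂ (J₁, J₂))).1 hx).1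
    have h2 := map_formLie T (red_lvlAut σ (one_le_two.trans hℓ))
      (lvlForm (blockDiag O n₁ n₂ (J₁, J₂)) ℓ) (fromBlocks x₁ 0 0 x₂)
    have h3 : (formLie T (lvlAut σ.toRingEquiv ℓ) (lvlForm (blockDiag O n₁ n₂ (J₁, J₂)) ℓ)
        (fromBlocks x₁ 0 0 x₂)).map (red O (one_le_two.trans hℓ)) =
        (fromBlocks x₁ 0 0 x₂).map (red O (one_le_two.trans hℓ)) := h2.trans h1
    rw [← pow_one (lvlIdeal O ℓ), entriesIn_iff_red (one_le_two.trans hℓ),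
      Matrix.map_sub _ (map_sub _), h3, sub_self]
  block := by
    rw [conj_signGL]
    simp
  poly := by
    obtain ⟨p, hp⟩ := exists_aeval_eq_of_isCoprime hcop
    have hs : Function.Surjective (red O (one_le_two.trans hℓ)) :=
      Ideal.Quotient.factor_surjective _
    obtain ⟨P, rfl⟩ := Polynomial.map_surjective _ hs p
    refine ⟨P, ?_⟩
    have h1 : (Polynomial.aeval (fromBlocks x₁ 0 0 x₂) P).map (red O (one_le_two.trans hℓ)) =
        Polynomial.aeval ((fromBlocks x₁ 0 0 x₂).map (red O (one_le_two.trans hℓ)))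
          (P.map (red O (one_le_two.trans hℓ))) := map_aeval _ _ _
    rw [← pow_one (lvlIdeal O ℓ), entriesIn_iff_red (one_le_two.trans hℓ),
      Matrix.map_sub _ (map_sub _), h1, sub_eq_zero, fromBlocks_map, fromBlocks_map,
      Matrix.map_zero _ (map_zero _), Matrix.map_zero _ (map_zero _),
      Matrix.map_zero _ (map_zero _), Matrix.map_one _ (map_zero _) (map_one _), hp]

end Levi

end Concrete

/-! ### The correspondence for a block diagonal matrix. -/

section LeviEquiv

variable {o : Type u} [CommRing o] [IsDomain o] [IsDiscreteValuationRing o]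
    [Finite (IsLocalRing.ResidueField o)]
    {O : Type v} [CommRing O] [IsDomain O] [IsDiscreteValuationRing O]
    [Algebra o O] [Module.Finite o O] [Algebra.FormallyUnramified o O]
    (hquad : Module.finrank o O = 2) (hodd : ringChar (IsLocalRing.ResidueField o) ≠ 2)
    (σ : O ≃ₐ[o] O) (hσ : σ ≠ AlgEquiv.refl) (T : GroupType)
    {n₁ n₂ : Type w} [Fintype n₁] [DecidableEq n₁] [Fintype n₂] [DecidableEq n₂]
    {J₁ : GL n₁ O} {J₂ : GL n₂ O} (hJ₁ : (J₁.1.map σ)ᵀ = J₁.1) (hJ₂ : (J₂.1.map σ)ᵀ = J₂.1)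

theorem LeviDatum.mem_fixedSubgroup_iff {R : Type v} [CommRing R] {τ : R →+* R} {𝔪 : Ideal R}
    {ℓ q : ℕ} {special : Prop} {F : GL (n₁ ⊕ n₂) R →* GL (n₁ ⊕ n₂) R}
    {D : Matrix (n₁ ⊕ n₂) (n₁ ⊕ n₂) R →+ Matrix (n₁ ⊕ n₂) (n₁ ⊕ n₂) R}
    {𝒢 : Subgroup (GL (n₁ ⊕ n₂) R)} {ξ : Matrix (n₁ ⊕ n₂) (n₁ ⊕ n₂) R}
    (hL : LeviDatum τ 𝔪 ℓ q special F D 𝒢 ξ) (g : 𝒢) :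
    g ∈ fixedSubgroup hL.invol ↔ g.1 ∈ (blockDiag R n₁ n₂).range := by
  rw [mem_range_blockDiag_iff hL.level.two]
  change hL.invol g = g ↔ _
  rw [Subtype.ext_iff, hL.coe_invol]

/-- The fixed points of the involution as a subgroup of `GL_n`. -/
def LeviDatum.fixedEquiv {R : Type v} [CommRing R] {τ : R →+* R} {𝔪 : Ideal R}
    {ℓ q : ℕ} {special : Prop} {F : GL (n₁ ⊕ n₂) R →* GL (n₁ ⊕ n₂) R}
    {D : Matrix (n₁ ⊕ n₂) (n₁ ⊕ n₂) R →+ Matrix (n₁ ⊕ n₂) (n₁ ⊕ n₂) R}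
    {𝒢 : Subgroup (GL (n₁ ⊕ n₂) R)} {ξ : Matrix (n₁ ⊕ n₂) (n₁ ⊕ n₂) R}
    (hL : LeviDatum τ 𝔪 ℓ q special F D 𝒢 ξ) :
    fixedSubgroup hL.invol ≃* (𝒢 ⊓ (blockDiag R n₁ n₂).range : Subgroup (GL (n₁ ⊕ n₂) R)) where
  toFun g := ⟨g.1.1, g.1.2, (hL.mem_fixedSubgroup_iff g.1).1 g.2⟩
  invFun g := ⟨⟨g.1, g.2.1⟩, (hL.mem_fixedSubgroup_iff ⟨g.1, g.2.1⟩).2 g.2.2⟩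
  left_inv _ := rfl
  right_inv _ := rfl
  map_mul' _ _ := rfl

/-- The reduction to the block diagonal subgroup, for groups of matrices over a finite ring. -/
theorem LeviDatum.exists_equiv {R : Type v} [CommRing R] {τ : R →+* R} {𝔪 : Ideal R}
    {ℓ q : ℕ} {special : Prop} {F : GL (n₁ ⊕ n₂) R →* GL (n₁ ⊕ n₂) R}
    {D : Matrix (n₁ ⊕ n₂) (n₁ ⊕ n₂) R →+ Matrix (n₁ ⊕ n₂) (n₁ ⊕ n₂) R}
    {𝒢 : Subgroup (GL (n₁ ⊕ n₂) R)} {ξ : Matrix (n₁ ⊕ n₂) (n₁ ⊕ n₂) R}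
    (hL : LeviDatum τ 𝔪 ℓ q special F D 𝒢 ξ) {ψ : AddChar R ℂ}
    (hψ : ∃ t ∈ 𝔪 ^ (ℓ - 1), ψ (t + τ t) ≠ 1) :
    ∃ e : Irr.above ((congKer (n₁ ⊕ n₂) (𝔪 ^ (ℓ - 1))).subgroupOf 𝒢)
        (fun g => ψ (ξ * (g.1.1 - 1)).trace) ≃
      Irr.above ((congKer (n₁ ⊕ n₂) (𝔪 ^ (ℓ - 1))).subgroupOf (𝒢 ⊓ (blockDiag R n₁ n₂).range))
        (fun g => ψ (ξ * (g.1.1 - 1)).trace),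
      ∀ χ, (Nat.card (𝒢 ⊓ (blockDiag R n₁ n₂).range : Subgroup (GL (n₁ ⊕ n₂) R)) : ℝ) *
        (q ^ (Fintype.card n₁ * Fintype.card n₂) : ℕ) ^ ℓ * χ.1.dim = Nat.card 𝒢 * (e χ).1.dim := by
  have := hL.level.finite_gl (n := n₁ ⊕ n₂)
  have hF := hL.filteredInvolution hψ hL.level.pos
  obtain ⟨e, he⟩ := hF.exists_equiv
  obtain ⟨i, hi⟩ := Irr.exists_equiv_above hL.fixedEquiv
    (N := ((congKer (n₁ ⊕ n₂) (𝔪 ^ (ℓ - 1))).subgroupOf 𝒢).subgroupOf (fixedSubgroup hL.invol))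
    (N' := (congKer (n₁ ⊕ n₂) (𝔪 ^ (ℓ - 1))).subgroupOf (𝒢 ⊓ (blockDiag R n₁ n₂).range))
    (f := fun g => (ev (FilteredInvolution.fixedRestrict hL.invol
      (congChar 𝒢 hL.sq_eq_bot ξ ψ)) g : ℂ)) (f' := fun g => ψ (ξ * (g.1.1 - 1)).trace)
    (fun g => Iff.rfl) (fun g hg => by
      rw [ev_of_mem _ hg]
      rfl)
  have h1 : Irr.above ((congKer (n₁ ⊕ n₂) (𝔪 ^ (ℓ - 1))).subgroupOf 𝒢)
      (fun g => ψ (ξ * (g.1.1 - 1)).trace) =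
      Irr.over ((congKer (n₁ ⊕ n₂) (𝔪 ^ (ℓ - 1))).subgroupOf 𝒢).subtype
        (congChar 𝒢 hL.sq_eq_bot ξ ψ) := by
    rw [Irr.over_subtype_eq_above]
    exact Irr.above_congr fun g hg => (ev_congChar hL.sq_eq_bot ξ ψ hg).symm
  have h2 := Irr.over_subtype_eq_above (FilteredInvolution.fixedRestrict hL.invol
      (congChar 𝒢 hL.sq_eq_bot ξ ψ))
  rw [h1]
  refine ⟨(e.trans (Equiv.setCongr h2)).trans i.symm, fun χ => ?_⟩
  have h3 := he χ
  rw [Nat.card_congr hL.fixedEquiv.toEquiv] at h3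
  rw [h3]
  congr 2
  have h4 := hi (i.symm (Equiv.setCongr h2 (e χ)))
  rw [Equiv.apply_symm_apply] at h4
  exact h4

/-- The order of the principal congruence subgroup of the block diagonal subgroup. -/
theorem LeviDatum.card_congKer {R : Type v} [CommRing R] {τ : R →+* R} {𝔪 : Ideal R}
    {ℓ q : ℕ} {special : Prop} {F : GL (n₁ ⊕ n₂) R →* GL (n₁ ⊕ n₂) R}
    {D : Matrix (n₁ ⊕ n₂) (n₁ ⊕ n₂) R →+ Matrix (n₁ ⊕ n₂) (n₁ ⊕ n₂) R}
    {𝒢 : Subgroup (GL (n₁ ⊕ n₂) R)} {ξ : Matrix (n₁ ⊕ n₂) (n₁ ⊕ n₂) R}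
    (hL : LeviDatum τ 𝔪 ℓ q special F D 𝒢 ξ) {ψ : AddChar R ℂ}
    (hψ : ∃ t ∈ 𝔪 ^ (ℓ - 1), ψ (t + τ t) ≠ 1) :
    Nat.card ((congKer (n₁ ⊕ n₂) (𝔪 ^ 1)).subgroupOf 𝒢) =
      Nat.card ((congKer (n₁ ⊕ n₂) (𝔪 ^ 1)).subgroupOf (𝒢 ⊓ (blockDiag R n₁ n₂).range)) *
        (q ^ (Fintype.card n₁ * Fintype.card n₂)) ^ (2 * (ℓ - 1)) := by
  have hℓ := hL.two_le
  have hF := hL.filteredInvolution hψ hL.level.pos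
  rw [hF.card 1 le_rfl (by omega)]
  congr 1
  refine Nat.card_congr
    { toFun := fun g => ⟨⟨g.1.1, g.1.2, (hL.mem_fixedSubgroup_iff g.1).1 g.2.2⟩, g.2.1⟩
      invFun := fun g => ⟨⟨g.1.1, g.1.2.1⟩, g.2,
        (hL.mem_fixedSubgroup_iff ⟨g.1.1, g.1.2.1⟩).2 g.1.2.2⟩
      left_inv := fun _ => rfl
      right_inv := fun _ => rfl }

/-- Block diagonal matrices modulo `𝔪` lift to the block diagonal subgroup. -/
theorem LeviDatum.exists_blockDiag_lift {R : Type v} [CommRing R] {τ : R →+* R} {𝔪 : Ideal R}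
    {ℓ q : ℕ} {special : Prop} {F : GL (n₁ ⊕ n₂) R →* GL (n₁ ⊕ n₂) R}
    {D : Matrix (n₁ ⊕ n₂) (n₁ ⊕ n₂) R →+ Matrix (n₁ ⊕ n₂) (n₁ ⊕ n₂) R}
    {𝒢 : Subgroup (GL (n₁ ⊕ n₂) R)} {ξ : Matrix (n₁ ⊕ n₂) (n₁ ⊕ n₂) R}
    (hL : LeviDatum τ 𝔪 ℓ q special F D 𝒢 ξ) {ψ : AddChar R ℂ}
    (hψ : ∃ t ∈ 𝔪 ^ (ℓ - 1), ψ (t + τ t) ≠ 1) {g : GL (n₁ ⊕ n₂) R} (hg : g ∈ 𝒢)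
    (h : g⁻¹ * (signGL R n₁ n₂ * g * (signGL R n₁ n₂)⁻¹) ∈ congKer (n₁ ⊕ n₂) (𝔪 ^ 1)) :
    ∃ y ∈ congKer (n₁ ⊕ n₂) (𝔪 ^ 1), g * y ∈ 𝒢 ⊓ (blockDiag R n₁ n₂).range := by
  have := hL.level.finite_gl (n := n₁ ⊕ n₂)
  have hF := hL.filteredInvolution hψ hL.level.pos
  obtain ⟨y, hy, -, hgy⟩ := hF.exists_fixed_mul le_rfl (g := ⟨g, hg⟩) h
  exact ⟨y.1, hy, (⟨g, hg⟩ * y : 𝒢).2, (hL.mem_fixedSubgroup_iff _).1 hgy⟩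

theorem map_signGL {R S : Type v} [CommRing R] [CommRing S] (f : R →+* S) :
    GeneralLinearGroup.map f (signGL R n₁ n₂) = signGL S n₁ n₂ := Units.ext (by
  change (fromBlocks 1 0 0 (-1)).map f = fromBlocks 1 0 0 (-1)
  rw [fromBlocks_map, Matrix.map_one _ (map_zero f) (map_one f), Matrix.map_zero _ (map_zero f),
    Matrix.map_zero _ (map_zero f)]
  congr 1
  ext a b
  simp [one_apply])

/-- The congruence kernels contribute `M^{2(ℓ-1)}` to the quotient of group orders; cancelling the
`M^ℓ` of the abstract correspondence leaves `M^{ℓ-2}`. -/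
theorem dim_ratio {L G L₁ G₁ k K M ℓ : ℕ} {a b : ℝ} (hℓ : 2 ≤ ℓ) (cG : G = G₁ * K)
    (cL : L = L₁ * k) (cK : K = k * M ^ (2 * (ℓ - 1))) (hk : 0 < k) (hM : 0 < M)
    (h : (L : ℝ) * (M : ℝ) ^ ℓ * a = G * b) : (L₁ : ℝ) * a = G₁ * (M : ℝ) ^ (ℓ - 2) * b := by
  subst cG cL cK
  have hk' : (k : ℝ) ≠ 0 := by exact_mod_cast hk.ne'
  have hM' : (M : ℝ) ^ ℓ ≠ 0 := pow_ne_zero _ (by exact_mod_cast hM.ne')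
  refine mul_left_cancel₀ (mul_ne_zero hk' hM') ?_
  rw [show 2 * (ℓ - 1) = ℓ + (ℓ - 2) by omega] at h
  push_cast at h
  rw [pow_add] at h
  linear_combination h

include hquad hodd hσ hJ₁ hJ₂

/-- The reduction to the block diagonal subgroup, if the matrix is block diagonal. -/
theorem exists_equiv_levi {ℓ : ℕ} (hℓ : 2 ≤ ℓ)
    (hd : T.Special → IsUnit (Fintype.card (n₁ ⊕ n₂) : Lvl O ℓ))
    (x₁ : Matrix n₁ n₁ (Lvl O ℓ)) (x₂ : Matrix n₂ n₂ (Lvl O ℓ))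
    (hx : (fromBlocks x₁ 0 0 x₂).map (red O (one_le_two.trans hℓ)) ∈
      lieAlg o σ.toRingEquiv (fromBlocks J₁.1 0 0 J₂.1) T 1)
    (hcop : IsCoprime (x₁.map (red O (one_le_two.trans hℓ))).charpoly
      (x₂.map (red O (one_le_two.trans hℓ))).charpoly) {ψ : AddChar (Lvl O ℓ) ℂ}
    (hψ : ∃ t ∈ lvlIdeal O ℓ ^ (ℓ - 1), ψ (t + lvlAut σ.toRingEquiv ℓ t) ≠ 1) :
    (∀ h ∈ leviGroup o σ.toRingEquiv J₁.1 J₂.1 T 1, ∃ g ∈ leviGroup o σ.toRingEquiv J₁.1 J₂.1 T ℓ,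
      GeneralLinearGroup.map (red O (one_le_two.trans hℓ)) g = h) ∧
    ∃ e : IrrOver (classicalGroup o σ.toRingEquiv (fromBlocks J₁.1 0 0 J₂.1) T) ℓ ψ
        ((fromBlocks x₁ 0 0 x₂).map (red O (one_le_two.trans hℓ))) ≃
      IrrOver (leviGroup o σ.toRingEquiv J₁.1 J₂.1 T) ℓ ψ
        ((fromBlocks x₁ 0 0 x₂).map (red O (one_le_two.trans hℓ))),
      ∀ χ, (Nat.card (leviGroup o σ.toRingEquiv J₁.1 J₂.1 T 1) : ℝ) * χ.1.dim =
        Nat.card (classicalGroup o σ.toRingEquiv (fromBlocks J₁.1 0 0 J₂.1) T 1) *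
        (Nat.card (ResidueField o) : ℝ) ^ (Fintype.card n₁ * Fintype.card n₂ * (ℓ - 2)) *
        (e χ).1.dim := by
  have hℓ1 := one_le_two.trans hℓ
  have hL := leviDatum hquad hodd σ hσ T hJ₁ hJ₂ hℓ hd x₁ x₂ hx hcop
  have hfin := hL.level.finite_gl (n := n₁ ⊕ n₂)
  have hL1 := quadraticLevel hquad hodd σ hσ 1
  have hfin1 := hL1.finite_gl (n := n₁ ⊕ n₂)
  have hs : ∀ h ∈ leviGroup o σ.toRingEquiv J₁.1 J₂.1 T 1,
      ∃ g ∈ leviGroup o σ.toRingEquiv J₁.1 J₂.1 T ℓ,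
        GeneralLinearGroup.map (red O hℓ1) g = h := by
    rintro h ⟨hh, hh'⟩
    obtain ⟨g, hg, rfl⟩ := exists_lift_classicalGroup hquad hodd σ hσ T
      (hermitian_blockDiag σ hJ₁ hJ₂) hℓ1 hd hh
    -- A lift of a block diagonal element is fixed by the involution modulo the congruence kernel
    -- and can be corrected inside that kernel.
    obtain ⟨y, hy, hgy⟩ := hL.exists_blockDiag_lift hψ hg (by
      rw [inv_mul_mem_congKer_iff_red hℓ1, map_mul, map_mul, map_inv, map_signGL]
      exact ((mem_range_blockDiag_iff hL1.two).1 hh').symm)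
    refine ⟨g * y, hgy, ?_⟩
    rw [map_mul, (mem_congKer_iff_red hℓ1).1 hy, mul_one]
  refine ⟨hs, ?_⟩
  have hsG : ∀ h ∈ classicalGroup o σ.toRingEquiv (fromBlocks J₁.1 0 0 J₂.1) T 1,
      ∃ g ∈ classicalGroup o σ.toRingEquiv (fromBlocks J₁.1 0 0 J₂.1) T ℓ,
        GeneralLinearGroup.map (red O hℓ1) g = h := fun h hh =>
    exists_lift_classicalGroup hquad hodd σ hσ T (hermitian_blockDiag σ hJ₁ hJ₂) hℓ1 hd hh
  rw [irrOver_eq_above hℓ1 _ hsG, irrOver_eq_above hℓ1 _ hs]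
  obtain ⟨e, he⟩ := hL.exists_equiv hψ
  refine ⟨e, fun χ => ?_⟩
  have h1 := he χ
  have cG : Nat.card (classicalGroup o σ.toRingEquiv (fromBlocks J₁.1 0 0 J₂.1) T ℓ) =
      Nat.card (classicalGroup o σ.toRingEquiv (fromBlocks J₁.1 0 0 J₂.1) T 1) * _ :=
    card_classicalGroup hquad hodd σ hσ T (hermitian_blockDiag σ hJ₁ hJ₂) hℓ1 hd
  have cL : Nat.card (leviGroup o σ.toRingEquiv J₁.1 J₂.1 T ℓ) =
      Nat.card (leviGroup o σ.toRingEquiv J₁.1 J₂.1 T 1) *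
        Nat.card ((congKer (n₁ ⊕ n₂) (lvlIdeal O ℓ ^ 1)).subgroupOf
          (leviGroup o σ.toRingEquiv J₁.1 J₂.1 T ℓ)) := by
    refine card_eq_mul_of_surjective (GeneralLinearGroup.map (red O hℓ1)) ?_ hs
      (fun _ => mem_congKer_iff_red hℓ1)
    rintro _ ⟨hg, ⟨x, rfl⟩⟩
    refine ⟨red_mem_classicalGroup hquad hodd σ hσ T (J := blockDiag O n₁ n₂ (J₁, J₂)) hℓ1 hg, ?_⟩
    exact ⟨_, (map_blockDiag (red O hℓ1) x.1 x.2).symm⟩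
  have cK := hL.card_congKer hψ
  have hk : 0 < Nat.card ((congKer (n₁ ⊕ n₂) (lvlIdeal O ℓ ^ 1)).subgroupOf
      (leviGroup o σ.toRingEquiv J₁.1 J₂.1 T ℓ)) := Nat.card_pos
  have h2 := dim_ratio hℓ cG cL cK hk (Nat.pow_pos (n := Fintype.card n₁ * Fintype.card n₂)
    hL.level.pos) h1
  rw [h2, Nat.cast_pow, ← pow_mul]
  rfl

end LeviEquiv

/-! ### Hilbert's theorem 90 and norms for finite commutative rings with involution -/

theorem isUnit_of_mul_eq_zero {B : Type*} [CommRing B] [Finite B] {u : B}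
    (h : ∀ x, u * x = 0 → x = 0) : IsUnit u := by
  rw [isUnit_iff_mem_nonZeroDivisors_of_finite, mem_nonZeroDivisors_iff]
  exact ⟨h, fun x hx => h x (by rw [mul_comm, hx])⟩

/-- Powers are eventually periodic. An exponent that is a multiple of the period and past its start
gives an idempotent. -/
theorem exists_isIdempotentElem_pow {M : Type*} [Monoid M] [Finite M] (x : M) :
    ∃ N, IsIdempotentElem (x ^ (N + 1)) := by
  obtain ⟨a, b, hab, h⟩ := Finite.exists_ne_map_eq_of_infinite fun n : ℕ => x ^ n
  wlog hlt : a < b generalizing a b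
  · exact this b a hab.symm h.symm (lt_of_le_of_ne (not_lt.1 hlt) hab.symm)
  obtain ⟨k, rfl⟩ := Nat.exists_eq_add_of_lt hlt
  have h1 : ∀ m, a ≤ m → x ^ (m + (k + 1)) = x ^ m := fun m hm => by
    obtain ⟨j, rfl⟩ := Nat.exists_eq_add_of_le hm
    have h : x ^ a = x ^ (a + k + 1) := h
    rw [show a + j + (k + 1) = (a + k + 1) + j by ring, pow_add, ← h, ← pow_add]
  have h2 : ∀ i m, a ≤ m → x ^ (m + i * (k + 1)) = x ^ m := fun i => by
    induction i with
    | zero => simp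
    | succ i ih =>
      intro m hm
      rw [add_mul, one_mul, ← add_assoc, h1 _ (hm.trans (Nat.le_add_right _ _)), ih m hm]
  refine ⟨(a + 1) * (k + 1) - 1, ?_⟩
  have h3 : (a + 1) * (k + 1) - 1 + 1 = (a + 1) * (k + 1) :=
    Nat.sub_add_cancel (Nat.mul_pos a.succ_pos k.succ_pos)
  rw [h3, IsIdempotentElem, ← pow_add]
  refine h2 _ _ ?_
  nlinarith

section Involution

variable {B : Type*} [CommRing B] [Finite B] (τ : B →+* B) (hτ : ∀ x, τ (τ x) = x)
    (h2 : IsUnit (2 : B)) {δ : B} (hδu : IsUnit δ) (hδ : τ δ = -δ)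

include h2 hδu hδ

/-- Hilbert's theorem 90. -/
theorem exists_eq_mul_map {b : B} (hb : b * τ b = 1) : ∃ u : B, IsUnit u ∧ u = b * τ u := by
  -- The naive solution `1 + b` of `u = b τ(u)` need not be a unit. The idempotent power `f` splits
  -- the ring into a part where `1 + b` is invertible and a part where it is nilpotent.
  obtain ⟨N, hN⟩ := exists_isIdempotentElem_pow (1 + b)
  set f := (1 + b) ^ (N + 1) with hf
  have hff : f * f = f := hN
  have h1 : b * τ (1 + b) = 1 + b := by
    rw [map_add, map_one, mul_add, hb, mul_one, add_comm]
  have e1 : b ^ (N + 1) * τ f = f := by rw [hf, map_pow, ← mul_pow, h1]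
  have e2 : (τ b) ^ (N + 1) * f = τ f := by
    calc _ = (τ b) ^ (N + 1) * (b ^ (N + 1) * τ f) := by rw [e1]
      _ = τ f := by rw [← mul_assoc, ← mul_pow, mul_comm (τ b), hb, one_pow, one_mul]
  have hτff : τ f * τ f = τ f := by rw [← map_mul, hff]
  have hτf : τ f = f := by
    have a1 : f * τ f = f := by
      calc _ = (b ^ (N + 1) * τ f) * τ f := by rw [e1]
        _ = f := by rw [mul_assoc, hτff, e1]
    have a2 : f * τ f = τ f := by
      calc _ = f * ((τ b) ^ (N + 1) * f) := by rw [e2]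
        _ = τ f := by rw [mul_left_comm, hff, e2]
    rw [← a2, a1]
  -- On the nilpotent part `1 - b = 2 - (1 + b)` is invertible, and `(1 - b) δ` also solves the
  -- equation, the sign being absorbed by the skew `δ`.
  refine ⟨f * (1 + b) + (1 - f) * (1 - b) * δ, isUnit_of_mul_eq_zero fun x hx => ?_, ?_⟩
  · have h3 : f * (1 + b) * x = 0 := by
      linear_combination f * hx + (-(1 + b) * x + (1 - b) * δ * x) * hff
    have h4 : f * x = 0 := by
      have : (1 + b) ^ N * (f * (1 + b) * x) = f * f * x := by
        rw [hf, pow_succ]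
        ring
      rw [← hff, ← this, h3, mul_zero]
    have h5 : (1 - b) * x = 0 := by
      refine hδu.mul_right_eq_zero.1 ?_
      linear_combination hx + (-(1 + b) + (1 - b) * δ) * h4
    have h6 : (1 + b) * x = 2 * x := by linear_combination -h5
    have h7 : ∀ k : ℕ, (1 + b) ^ k * x = 2 ^ k * x := fun k => by
      induction k with
      | zero => simp
      | succ k ih => rw [pow_succ', mul_assoc, ih, mul_left_comm, h6, pow_succ]; ring
    have h8 := h7 (N + 1)
    rw [← hf, h4] at h8
    exact (h2.pow _).mul_right_eq_zero.1 h8.symm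
  · rw [map_add, map_mul, map_mul, map_mul, map_sub, map_sub, map_add, map_one, hτf, hδ]
    linear_combination (-(f + (1 - f) * δ)) * hb

/-- Units fixed by the involution are norms. -/
theorem exists_norm_mul_eq_one (hτ : ∀ x, τ (τ x) = x) {b : B} (hb : IsUnit b) (hτb : τ b = b) :
    ∃ u : B, IsUnit u ∧ τ u * u * b = 1 := by
  let t : Bˣ →* Bˣ := Units.map τ
  let N : Bˣ →* Bˣ := MonoidHom.id Bˣ * t
  let φ : Bˣ →* Bˣ := MonoidHom.id Bˣ / t
  have ht : ∀ u, t (t u) = u := fun u => Units.ext (hτ u)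
  have h1 : N.ker ≤ φ.range := fun x hx => by
    have hx' : x * t x = 1 := hx
    obtain ⟨_, ⟨u, rfl⟩, hu⟩ := exists_eq_mul_map τ h2 hδu hδ
      (b := (x : B)) (congrArg Units.val hx')
    refine ⟨u, ?_⟩
    change u / t u = x
    rw [div_eq_iff_eq_mul]
    exact Units.ext hu
  have h3 : N.range ≤ φ.ker := by
    rintro _ ⟨u, rfl⟩
    change (u * t u) / t (u * t u) = 1
    rw [map_mul, ht, mul_comm, div_self']
  have c1 : Nat.card φ.ker * Nat.card φ.range = Nat.card Bˣ := by
    rw [← Subgroup.index_ker, mul_comm, Subgroup.index_mul_card]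
  have c2 : Nat.card N.ker * Nat.card N.range = Nat.card Bˣ := by
    rw [← Subgroup.index_ker, mul_comm, Subgroup.index_mul_card]
  have c3 : Nat.card N.ker ≤ Nat.card φ.range := Subgroup.card_le_of_le h1
  -- Hilbert 90 bounds the kernel of the norm by the image of `u ↦ u / τ u`. The products of kernel
  -- and image orders agree for both maps, so the image of the norm is all fixed units.
  have h4 : N.range = φ.ker := Subgroup.eq_of_le_of_card_ge h3 (by
    have : 0 < Nat.card N.ker := Nat.card_pos
    by_contra hlt
    nlinarith)
  obtain ⟨b, rfl⟩ := hb
  obtain ⟨u, hu⟩ : b⁻¹ ∈ N.range := by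
    rw [h4]
    change b⁻¹ / t b⁻¹ = 1
    rw [div_eq_one, map_inv]
    congr 1
    exact Units.ext hτb.symm
  have hu' : u * t u = b⁻¹ := hu
  refine ⟨u, u.isUnit, ?_⟩
  have h5 : t u * u * b = 1 := by rw [mul_comm (t u), hu', inv_mul_cancel]
  exact congrArg Units.val h5

end Involution

section Semilinear

variable {R A : Type*} [CommRing R] [Ring A] [Algebra R A] [Finite A] {σ : R →+* R}
    {t : A →+ A} (t_one : t 1 = 1) (t_smul : ∀ (r : R) x, t (r • x) = σ r • t x)
    (t_mul : ∀ x y, Commute x y → t (x * y) = t x * t y)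
    {c : A}

/-- A semilinear involution restricted to a commutative subalgebra. -/
def adjoinMap (hc : t c ∈ Algebra.adjoin R {c}) :
    Algebra.adjoin R {c} →+* Algebra.adjoin R {c} where
  toFun x := ⟨t x.1, by
    have hcomm : ∀ x y : Algebra.adjoin R {c}, Commute x.1 y.1 := fun x y =>
      congrArg Subtype.val (mul_comm x y)
    refine Algebra.adjoin_induction (p := fun x _ => t x ∈ Algebra.adjoin R {c}) ?_ ?_ ?_ ?_ x.2
    · rintro _ rfl
      exact hc
    · intro r
      rw [Algebra.algebraMap_eq_smul_one, t_smul, t_one]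
      exact Subalgebra.smul_mem _ (one_mem _) _
    · intro x y _ _ hx hy
      rw [map_add]
      exact add_mem hx hy
    · intro x y hx' hy' hx hy
      rw [t_mul x y (hcomm ⟨x, hx'⟩ ⟨y, hy'⟩)]
      exact mul_mem hx hy⟩
  map_one' := Subtype.ext t_one
  map_mul' x y := Subtype.ext (t_mul _ _ (congrArg Subtype.val (mul_comm x y)))
  map_zero' := Subtype.ext (map_zero t)
  map_add' x y := Subtype.ext (map_add t _ _)

variable (h2 : IsUnit (2 : R)) (hδ : ∃ δ : R, IsUnit δ ∧ σ δ = -δ)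

omit [Finite A] in
theorem isUnit_two_adjoin (h2 : IsUnit (2 : R)) (c : A) :
    IsUnit (2 : Algebra.adjoin R {c}) := by
  have := h2.map (algebraMap R (Algebra.adjoin R {c}))
  rwa [← one_add_one_eq_two, map_add, map_one, one_add_one_eq_two] at this

omit [Finite A] in
include t_one t_smul in
theorem adjoinMap_skew (hc : t c ∈ Algebra.adjoin R {c}) {δ : R} (hδ : σ δ = -δ) :
    adjoinMap t_one t_smul t_mul hc (algebraMap R _ δ) = -algebraMap R _ δ := Subtype.ext (by
  change t (algebraMap R A δ) = -algebraMap R A δ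
  rw [Algebra.algebraMap_eq_smul_one, t_smul, t_one, hδ, neg_smul])

include t_one t_smul t_mul h2 hδ

/-- Hilbert 90 is applied in the finite commutative algebra `R[c]`. It is stable under `t` because
`t c` is the inverse of `c`, and `c` is already invertible inside it. -/
theorem exists_unit_eq_mul_map (hc : c * t c = 1) :
    ∃ u : Aˣ, u.1 ∈ Algebra.adjoin R {c} ∧ u.1 = c * t u.1 := by
  obtain ⟨δ, hδu, hδ⟩ := hδ
  let b : Algebra.adjoin R {c} := ⟨c, Algebra.self_mem_adjoin_singleton R c⟩
  obtain ⟨b', hb'⟩ : IsUnit b := isUnit_of_mul_eq_zero fun x hx => Subtype.ext (by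
    have h1 : c * x.1 = 0 := congrArg Subtype.val hx
    have h3 : t c * c = 1 := by
      exact mul_eq_one_comm.1 hc
    change x.1 = 0
    rw [← one_mul x.1, ← h3, mul_assoc, h1, mul_zero])
  have hc' : t c ∈ Algebra.adjoin R {c} := by
    have h1 : c * (b'⁻¹.1).1 = 1 := by
      have := congrArg Subtype.val (b'.mul_inv)
      rw [hb'] at this
      exact this
    have h3 : t c = (b'⁻¹.1).1 := left_inv_eq_right_inv (mul_eq_one_comm.1 hc) h1
    rw [h3]
    exact (b'⁻¹.1).2
  obtain ⟨_, ⟨u, rfl⟩, hu⟩ := exists_eq_mul_map (adjoinMap t_one t_smul t_mul hc')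
    (b := b) (isUnit_two_adjoin h2 c)
    (hδu.map (algebraMap R (Algebra.adjoin R {c})))
    (adjoinMap_skew t_one t_smul t_mul hc' hδ) (Subtype.ext hc)
  exact ⟨Units.map (Algebra.adjoin R {c}).val.toMonoidHom u, u.1.2, congrArg Subtype.val hu⟩

/-- Here `t` fixes `c`, so `R[c]` is `t`-stable and the statement is surjectivity of the norm in it.
Only multiplicativity on commuting elements is used, so `t` may be an anti-automorphism. -/
theorem exists_unit_norm_mul_eq_one (t_invol : ∀ x, t (t x) = x) (hcu : IsUnit c) (hc : t c = c) :
    ∃ u : Aˣ, u.1 ∈ Algebra.adjoin R {c} ∧ t u.1 * c * u.1 = 1 := by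
  obtain ⟨δ, hδu, hδ⟩ := hδ
  let b : Algebra.adjoin R {c} := ⟨c, Algebra.self_mem_adjoin_singleton R c⟩
  have hb : IsUnit b := isUnit_of_mul_eq_zero fun x hx => Subtype.ext
    (hcu.mul_right_eq_zero.1 (congrArg Subtype.val hx))
  have hc' : t c ∈ Algebra.adjoin R {c} := by
    rw [hc]
    exact b.2
  obtain ⟨_, ⟨u, rfl⟩, hu⟩ := exists_norm_mul_eq_one (adjoinMap t_one t_smul t_mul hc')
    (isUnit_two_adjoin h2 c)
    (hδu.map (algebraMap R (Algebra.adjoin R {c})))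
    (adjoinMap_skew t_one t_smul t_mul hc' hδ) (fun x => Subtype.ext (t_invol _)) hb
    (Subtype.ext hc)
  refine ⟨Units.map (Algebra.adjoin R {c}).val.toMonoidHom u, u.1.2, ?_⟩
  rw [mul_right_comm] at hu
  exact congrArg Subtype.val hu

end Semilinear

/-! ### Transport between conjugate matrices -/

section Transport

variable {R : Type v} [CommRing R] {n : Type w} [Fintype n] [DecidableEq n]

theorem formAdjoint_conj {σ : R →+* R} {J D γ : GL n R}
    (hγ : (γ.1.map σ)ᵀ * J.1 * γ.1 = D.1) (y : Matrix n n R) :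
    formAdjoint σ J (γ.1 * y * γ⁻¹.1) = γ.1 * formAdjoint σ D y * γ⁻¹.1 := by
  have h0 : (γ⁻¹.1.map σ)ᵀ * (γ.1.map σ)ᵀ = 1 := by
    rw [← transpose_mul, ← Matrix.map_mul, Units.mul_inv,
      Matrix.map_one _ (map_zero σ) (map_one σ), transpose_one]
  have h1 : (γ.1.map σ)ᵀ * J.1 = D.1 * γ⁻¹.1 := by
    rw [← hγ, mul_assoc _ γ.1, Units.mul_inv, mul_one]
  have h2 : J⁻¹.1 * (γ⁻¹.1.map σ)ᵀ = γ.1 * D⁻¹.1 := by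
    have h3 : J.1 = (γ⁻¹.1.map σ)ᵀ * (D.1 * γ⁻¹.1) := by
      rw [← h1, ← mul_assoc, h0, one_mul]
    have h4 : (J⁻¹.1 * (γ⁻¹.1.map σ)ᵀ) * (D.1 * γ⁻¹.1) = 1 := by
      rw [mul_assoc, ← h3, Units.inv_mul]
    calc _ = (J⁻¹.1 * (γ⁻¹.1.map σ)ᵀ) * ((D.1 * γ⁻¹.1) * (γ.1 * D⁻¹.1)) := by
          rw [mul_assoc D.1, Units.inv_mul_cancel_left, Units.mul_inv, mul_one]
      _ = _ := by rw [← mul_assoc, h4, one_mul]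
  rw [formAdjoint_apply, formAdjoint_apply, Matrix.map_mul, Matrix.map_mul, transpose_mul,
    transpose_mul]
  calc _ = (J⁻¹.1 * (γ⁻¹.1.map σ)ᵀ) * (y.map σ)ᵀ * ((γ.1.map σ)ᵀ * J.1) := by
        simp only [mul_assoc]
    _ = _ := by rw [h1, h2]; simp only [mul_assoc]

theorem commute_map_of_mem_adjoin {S : Type v} [CommRing S] {f : R →+* S} {c u : Matrix n n R}
    {X : Matrix n n S} (hu : u ∈ Algebra.adjoin R {c}) (hc : Commute (c.map f) X) :
    Commute (u.map f) X := by
  refine Algebra.adjoin_induction (p := fun u _ => Commute (u.map f) X) ?_ ?_ ?_ ?_ hu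
  · rintro _ rfl
    exact hc
  · intro r
    have : (algebraMap R (Matrix n n R) r).map f = f r • (1 : Matrix n n S) := by
      ext a b
      rw [map_apply, Matrix.algebraMap_matrix_apply, Matrix.smul_apply, one_apply, smul_eq_mul]
      split_ifs <;> simp
    rw [this]
    exact (Commute.one_left X).smul_left _
  · intro x y _ _ hx hy
    rw [Matrix.map_add _ (map_add f)]
    exact hx.add_left hy
  · intro x y _ _ hx hy
    rw [Matrix.map_mul]
    exact hx.mul_left hy

theorem conj_mul_of_commute {g u : GL n R} {X : Matrix n n R} (h : Commute u.1 X) :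
    (g * u).1 * X * (g * u)⁻¹.1 = g.1 * X * g⁻¹.1 := by
  rw [_root_.mul_inv_rev, Units.val_mul, Units.val_mul, mul_assoc g.1, h.eq]
  simp only [mul_assoc, Units.mul_inv_cancel_left]

variable {S : Type v} [CommRing S] {f : R →+* S} {σ : R →+* R} {τ : S →+* S}
    (hf : ∀ x, f (σ x) = τ (f x)) {𝔪 : Ideal R} {ℓ q : ℕ} (hR : QuadraticLevel σ 𝔪 ℓ q)

include hf hR

/-- `c = g⁻¹ σ(g)` is a cocycle, and its reduction commutes with `X` since `X` and its conjugate are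
both `τ`-fixed. Hilbert 90 yields `u` in `R[c]` with `g u` fixed by `σ`; as `u` commutes with `X`
after reduction, the conjugate is unchanged. -/
theorem exists_linear_transport {g : GL n R} {X : Matrix n n S} (hX : X.map τ = X)
    (hY : ((GeneralLinearGroup.map f g).1 * X * (GeneralLinearGroup.map f g)⁻¹.1).map τ =
      (GeneralLinearGroup.map f g).1 * X * (GeneralLinearGroup.map f g)⁻¹.1) :
    ∃ γ : GL n R, GeneralLinearGroup.map σ γ = γ ∧
      (GeneralLinearGroup.map f γ).1 * X * (GeneralLinearGroup.map f γ)⁻¹.1 =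
      (GeneralLinearGroup.map f g).1 * X * (GeneralLinearGroup.map f g)⁻¹.1 := by
  have := hR.finite
  have hc := classicalForm_linear (n := n) σ hR.invol
  set c := g⁻¹ * GeneralLinearGroup.map σ g with hcdef
  have hc1 : c * GeneralLinearGroup.map σ c = 1 := by
    have h1 := hc.F_invol g
    rw [hcdef, map_mul, map_inv, h1]
    group
  obtain ⟨u, hu, hu'⟩ := exists_unit_eq_mul_map (t := σ.mapMatrix.toAddMonoidHom)
    (map_one (σ.mapMatrix (m := n))) hc.D_smul (fun x y _ => map_mul σ.mapMatrix x y) hR.two hR.skew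
    (c := c.1) (congrArg Units.val hc1)
  have hu2 : u = c * GeneralLinearGroup.map σ u := Units.ext hu'
  refine ⟨g * u, ?_, ?_⟩
  · conv_rhs => rw [hu2, hcdef]
    rw [map_mul]
    group
  · rw [map_mul]
    refine conj_mul_of_commute (commute_map_of_mem_adjoin hu ?_)
    set G := GeneralLinearGroup.map f g with hG
    have h1 : GeneralLinearGroup.map f c = G⁻¹ * GeneralLinearGroup.map τ G := by
      rw [hcdef, map_mul, map_inv]
      congr 1
      exact map_formInvol .GL hf 1 g
    have h2 : (GeneralLinearGroup.map τ G).1 * X * (GeneralLinearGroup.map τ G)⁻¹.1 =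
        G.1 * X * G⁻¹.1 := by
      rw [← hY, Matrix.map_mul, Matrix.map_mul, hX]
      rfl
    change (GeneralLinearGroup.map f c).1 * X = X * (GeneralLinearGroup.map f c).1
    rw [h1, Units.val_mul]
    have h3 := congrArg (fun z => G⁻¹.1 * z * (GeneralLinearGroup.map τ G).1) h2
    simp only [mul_assoc, Units.inv_mul_cancel_left, Units.inv_mul, mul_one] at h3
    rw [mul_assoc, h3]

/-- `c = D⁻¹ g* J g`, with `g*` the transpose of `σ(g)`, compares the pulled-back form with `D`. It
is self-adjoint for `D`, and its reduction commutes with `X` because `X` and its conjugate are skew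
for their forms. Solving `u^† c u = 1` in `R[c]`, with `†` the adjoint for `D`, makes `g u` an
isometry without changing the conjugate of `X`. -/
theorem exists_unitary_transport {g J D : GL n R} (hJ : (J.1.map σ)ᵀ = J.1)
    (hD : (D.1.map σ)ᵀ = D.1) {X : Matrix n n S}
    (hX : (X.map τ)ᵀ * (GeneralLinearGroup.map f D).1 + (GeneralLinearGroup.map f D).1 * X = 0)
    (hY : (((GeneralLinearGroup.map f g).1 * X * (GeneralLinearGroup.map f g)⁻¹.1).map τ)ᵀ *
      (GeneralLinearGroup.map f J).1 + (GeneralLinearGroup.map f J).1 *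
      ((GeneralLinearGroup.map f g).1 * X * (GeneralLinearGroup.map f g)⁻¹.1) = 0) :
    ∃ γ : GL n R, (γ.1.map σ)ᵀ * J.1 * γ.1 = D.1 ∧
      (GeneralLinearGroup.map f γ).1 * X * (GeneralLinearGroup.map f γ)⁻¹.1 =
      (GeneralLinearGroup.map f g).1 * X * (GeneralLinearGroup.map f g)⁻¹.1 := by
  have := hR.finite
  have hσT : ∀ x : Matrix n n R, (((x.map σ)ᵀ).map σ)ᵀ = x := fun x => by
    ext a b
    exact hR.invol _
  obtain ⟨gT, hgT⟩ : IsUnit (g.1.map σ)ᵀ :=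
    (Matrix.isUnit_transpose _).2 ((GeneralLinearGroup.map σ g).isUnit)
  set c := D⁻¹ * (gT * J * g) with hcdef
  have hDc : D.1 * c.1 = (g.1.map σ)ᵀ * J.1 * g.1 := by
    rw [hcdef, Units.val_mul, Units.mul_inv_cancel_left, Units.val_mul, Units.val_mul, hgT]
  have hc : formAdjoint σ D c.1 = c.1 := by
    have h1 : (c.1.map σ)ᵀ * D.1 = D.1 * c.1 := by
      conv_lhs => rw [← hD]
      rw [← transpose_mul, ← Matrix.map_mul, hDc, Matrix.map_mul, Matrix.map_mul, transpose_mul,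
        transpose_mul, hσT, hJ, mul_assoc]
    rw [formAdjoint_apply, mul_assoc, h1, Units.inv_mul_cancel_left]
  obtain ⟨u, hu, hu'⟩ := exists_unit_norm_mul_eq_one (t := formAdjoint σ D)
    (formAdjoint_one σ D) (formAdjoint_smul σ D) (fun x y h => by rw [h.eq, formAdjoint_mul])
    hR.two hR.skew (formAdjoint_invol hR.invol hD) c.isUnit hc
  refine ⟨g * u, ?_, ?_⟩
  · rw [Units.val_mul, Matrix.map_mul, transpose_mul]
    calc _ = (u.1.map σ)ᵀ * ((g.1.map σ)ᵀ * J.1 * g.1) * u.1 := by simp only [mul_assoc]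
      _ = D.1 * (formAdjoint σ D u.1 * c.1 * u.1) := by
        rw [← hDc, formAdjoint_apply]
        simp only [mul_assoc, Units.mul_inv_cancel_left]
      _ = D.1 := by rw [hu', mul_one]
  · rw [map_mul]
    refine conj_mul_of_commute (commute_map_of_mem_adjoin hu ?_)
    set G := GeneralLinearGroup.map f g with hG
    set J' := GeneralLinearGroup.map f J
    set D' := GeneralLinearGroup.map f D with hD'
    set C := c.1.map f
    have h1 : D'.1 * C = (G.1.map τ)ᵀ * J'.1 * G.1 := by
      have h2 : ((g.1.map σ)ᵀ).map f = (G.1.map τ)ᵀ := by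
        ext a b
        exact hf _
      have h3 := congrArg (fun z : Matrix n n R => z.map f) hDc
      simp only [Matrix.map_mul, h2] at h3
      exact h3
    set Y := G.1 * X * G⁻¹.1 with hYdef
    have hYG : Y * G.1 = G.1 * X := by rw [hYdef, mul_assoc _ G⁻¹.1, Units.inv_mul, mul_one]
    have hY' : J'.1 * Y = -((Y.map τ)ᵀ * J'.1) := by rw [eq_neg_iff_add_eq_zero, add_comm, hY]
    have hX' : D'.1 * X = -((X.map τ)ᵀ * D'.1) := by rw [eq_neg_iff_add_eq_zero, add_comm, hX]
    have hYT : (G.1.map τ)ᵀ * (Y.map τ)ᵀ = (X.map τ)ᵀ * (G.1.map τ)ᵀ := by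
      rw [← transpose_mul, ← transpose_mul, ← Matrix.map_mul, ← Matrix.map_mul, hYG]
    have key : D'.1 * (C * X) = D'.1 * (X * C) := by
      calc _ = (G.1.map τ)ᵀ * (J'.1 * Y) * G.1 := by
            rw [← mul_assoc, h1, mul_assoc _ G.1, ← hYG]
            simp only [mul_assoc]
        _ = -((X.map τ)ᵀ * ((G.1.map τ)ᵀ * J'.1 * G.1)) := by
            rw [hY', mul_neg, neg_mul, ← mul_assoc, hYT]
            simp only [mul_assoc]
        _ = _ := by rw [← h1, ← mul_assoc, ← neg_mul, ← hX', mul_assoc]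
    have h3 : C * X = X * C := by
      have := congrArg (fun z => D'⁻¹.1 * z) key
      simpa only [Units.inv_mul_cancel_left] using this
    exact h3

theorem exists_transport (T : GroupType) {g J D : GL n R} (hJ : (J.1.map σ)ᵀ = J.1)
    (hD : (D.1.map σ)ᵀ = D.1) {X : Matrix n n S}
    (hX : formLie T τ (GeneralLinearGroup.map f D) X = X)
    (hY : formLie T τ (GeneralLinearGroup.map f J)
      ((GeneralLinearGroup.map f g).1 * X * (GeneralLinearGroup.map f g)⁻¹.1) =
      (GeneralLinearGroup.map f g).1 * X * (GeneralLinearGroup.map f g)⁻¹.1) :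
    ∃ γ : GL n R, (∀ h, formInvol T σ J (γ * h * γ⁻¹) = γ * formInvol T σ D h * γ⁻¹) ∧
      (GeneralLinearGroup.map f γ).1 * X * (GeneralLinearGroup.map f γ)⁻¹.1 =
      (GeneralLinearGroup.map f g).1 * X * (GeneralLinearGroup.map f g)⁻¹.1 := by
  have lin : ∀ γ : GL n R, GeneralLinearGroup.map σ γ = γ → ∀ h, GeneralLinearGroup.map σ
      (γ * h * γ⁻¹) = γ * GeneralLinearGroup.map σ h * γ⁻¹ := fun γ hγ h => by
    rw [map_mul, map_mul, map_inv, hγ]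
  have uni : ∀ γ : GL n R, (γ.1.map σ)ᵀ * J.1 * γ.1 = D.1 → ∀ h, unitaryInvol σ J
      (γ * h * γ⁻¹) = γ * unitaryInvol σ D h * γ⁻¹ := fun γ hγ h => Units.ext (by
    rw [val_unitaryInvol, show (γ * h * γ⁻¹)⁻¹ = γ * h⁻¹ * γ⁻¹ by group, Units.val_mul,
      Units.val_mul, formAdjoint_conj hγ]
    rfl)
  cases T
  · obtain ⟨γ, h1, h2⟩ := exists_linear_transport hf hR hX hY
    exact ⟨γ, lin γ h1, h2⟩
  · obtain ⟨γ, h1, h2⟩ := exists_unitary_transport hf hR hJ hD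
      (neg_formAdjoint_eq_self_iff.1 hX) (neg_formAdjoint_eq_self_iff.1 hY)
    exact ⟨γ, uni γ h1, h2⟩
  · obtain ⟨γ, h1, h2⟩ := exists_linear_transport hf hR hX hY
    exact ⟨γ, lin γ h1, h2⟩
  · obtain ⟨γ, h1, h2⟩ := exists_unitary_transport hf hR hJ hD
      (neg_formAdjoint_eq_self_iff.1 hX) (neg_formAdjoint_eq_self_iff.1 hY)
    exact ⟨γ, uni γ h1, h2⟩

end Transport

/-! ### Transport of representations along isomorphic families of groups. -/

section IrrOver

variable {O : Type v} [CommRing O] [IsLocalRing O] {n m : Type w} [Fintype n] [DecidableEq n]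
    [Fintype m] [DecidableEq m]

/-- Isomorphic families of groups have the same representations over corresponding orbits. -/
theorem exists_equiv_irrOver {ℓ : ℕ} (hℓ : 1 ≤ ℓ) [Finite (GL n (Lvl O ℓ))]
    (𝒢 : (i : ℕ) → Subgroup (GL n (Lvl O i)))
    (ℋ : (i : ℕ) → Subgroup (GL m (Lvl O i)))
    (hr : ∀ g ∈ 𝒢 ℓ, GeneralLinearGroup.map (red O hℓ) g ∈ 𝒢 1)
    (hs : ∀ h ∈ 𝒢 1, ∃ g ∈ 𝒢 ℓ, GeneralLinearGroup.map (red O hℓ) g = h)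
    (hr' : ∀ g ∈ ℋ ℓ, GeneralLinearGroup.map (red O hℓ) g ∈ ℋ 1)
    (hs' : ∀ h ∈ ℋ 1, ∃ g ∈ ℋ ℓ, GeneralLinearGroup.map (red O hℓ) g = h)
    (φ : GL n (Lvl O ℓ) ≃* GL m (Lvl O ℓ)) (hφ : ∀ g, g ∈ 𝒢 ℓ ↔ φ g ∈ ℋ ℓ)
    (hK : ∀ i g, g ∈ congKer n (lvlIdeal O ℓ ^ i) ↔ φ g ∈ congKer m (lvlIdeal O ℓ ^ i))
    (ψ : AddChar (Lvl O ℓ) ℂ) {x : Matrix n n (Lvl O ℓ)} {y : Matrix m m (Lvl O ℓ)}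
    (hxy : ∀ g, (x * (g.1 - 1)).trace = (y * ((φ g).1 - 1)).trace) :
    Nat.card (𝒢 1) = Nat.card (ℋ 1) ∧
    ∃ e : IrrOver 𝒢 ℓ ψ (x.map (red O hℓ)) ≃ IrrOver ℋ ℓ ψ (y.map (red O hℓ)),
      ∀ χ, χ.1.dim = (e χ).1.dim := by
  let e : 𝒢 ℓ ≃* ℋ ℓ :=
    { toFun := fun g => ⟨φ g.1, (hφ _).1 g.2⟩
      invFun := fun h => ⟨φ.symm h.1, (hφ _).2 (by
        rw [φ.apply_symm_apply]
        exact h.2)⟩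
      left_inv := fun g => Subtype.ext (φ.symm_apply_apply _)
      right_inv := fun g => Subtype.ext (φ.apply_symm_apply _)
      map_mul' := fun g h => Subtype.ext (map_mul φ _ _) }
  constructor
  · have c1 := card_eq_mul_of_surjective (GeneralLinearGroup.map (red O hℓ)) hr hs
      (fun _ => mem_congKer_iff_red hℓ)
    have c2 := card_eq_mul_of_surjective (GeneralLinearGroup.map (red O hℓ)) hr' hs'
      (fun _ => mem_congKer_iff_red hℓ)
    have c3 : Nat.card ((congKer n (lvlIdeal O ℓ ^ 1)).subgroupOf (𝒢 ℓ)) =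
        Nat.card ((congKer m (lvlIdeal O ℓ ^ 1)).subgroupOf (ℋ ℓ)) :=
      Nat.card_congr (e.toEquiv.subtypeEquiv fun g => hK 1 g.1)
    rw [Nat.card_congr e.toEquiv, c2, c3] at c1
    have h0 : 0 < Nat.card ((congKer n (lvlIdeal O ℓ ^ 1)).subgroupOf (𝒢 ℓ)) := Nat.card_pos
    rw [c3] at h0
    exact (Nat.eq_of_mul_eq_mul_right h0 c1).symm
  · rw [irrOver_eq_above hℓ _ hs, irrOver_eq_above hℓ _ hs']
    obtain ⟨i, hi⟩ := Irr.exists_equiv_above e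
      (N := (congKer n (lvlIdeal O ℓ ^ (ℓ - 1))).subgroupOf (𝒢 ℓ))
      (N' := (congKer m (lvlIdeal O ℓ ^ (ℓ - 1))).subgroupOf (ℋ ℓ))
      (f := fun g => ψ (x * (g.1.1 - 1)).trace) (f' := fun g => ψ (y * (g.1.1 - 1)).trace)
      (fun g => hK _ g.1) (fun g _ => congrArg ψ (hxy g.1))
    refine ⟨i.symm, fun χ => ?_⟩
    have := hi (i.symm χ)
    rw [Equiv.apply_symm_apply] at this
    exact this

end IrrOver

/-! ### Reindexing of matrices and forms. -/

section Reindex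

variable {n m : Type w} [Fintype n] [DecidableEq n] [Fintype m] [DecidableEq m] (e : n ≃ m)

/-- Reindexing of invertible matrices. -/
def reindexGL (R : Type v) [CommRing R] : GL n R ≃* GL m R :=
  Units.mapEquiv (reindexAlgEquiv R R e).toMulEquiv

variable {R : Type v} [CommRing R] {S : Type v} [CommRing S]

theorem val_reindexGL (g : GL n R) : (reindexGL e R g).1 = reindexAlgEquiv R R e g.1 := rfl

theorem formAdjoint_reindex (σ : R →+* R) (J : GL n R) (x : Matrix n n R) :
    formAdjoint σ (reindexGL e R J) (reindexAlgEquiv R R e x) =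
      reindexAlgEquiv R R e (formAdjoint σ J x) := by
  rw [formAdjoint_apply, formAdjoint_apply, map_mul, map_mul]
  rfl

theorem formInvol_reindex (T : GroupType) (σ : R →+* R) (J g : GL n R) :
    formInvol T σ (reindexGL e R J) (reindexGL e R g) = reindexGL e R (formInvol T σ J g) := by
  have h1 : GeneralLinearGroup.map σ (reindexGL e R g) =
      reindexGL e R (GeneralLinearGroup.map σ g) := Units.ext rfl
  have h2 : unitaryInvol σ (reindexGL e R J) (reindexGL e R g) =
      reindexGL e R (unitaryInvol σ J g) := Units.ext (by
    rw [val_unitaryInvol, ← map_inv]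
    exact formAdjoint_reindex e σ J _)
  cases T
  exacts [h1, h2, h1, h2]

theorem formLie_reindex (T : GroupType) (σ : R →+* R) (J : GL n R) (x : Matrix n n R) :
    formLie T σ (reindexGL e R J) (reindexAlgEquiv R R e x) =
      reindexAlgEquiv R R e (formLie T σ J x) := by
  have h2 : (-formAdjoint σ (reindexGL e R J)) (reindexAlgEquiv R R e x) =
      reindexAlgEquiv R R e ((-formAdjoint σ J) x) := by
    rw [AddMonoidHom.neg_apply, AddMonoidHom.neg_apply, formAdjoint_reindex, map_neg]
  cases T
  exacts [rfl, h2, rfl, h2]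

theorem map_reindexGL (f : R →+* S) (g : GL n R) :
    GeneralLinearGroup.map f (reindexGL e R g) = reindexGL e S (GeneralLinearGroup.map f g) :=
  Units.ext rfl

theorem trace_reindex (x : Matrix n n R) : (reindexAlgEquiv R R e x).trace = x.trace :=
  e.symm.sum_comp fun a => x a a

theorem mem_congKer_reindexGL {I : Ideal R} {g : GL n R} :
    reindexGL e R g ∈ congKer m I ↔ g ∈ congKer n I := by
  have h1 : (reindexGL e R g).1 - 1 = reindexAlgEquiv R R e (g.1 - 1) := by
    rw [map_sub, map_one]
    rfl
  rw [mem_congKer, mem_congKer, h1]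
  constructor
  · intro h a b
    have := h (e a) (e b)
    rw [coe_reindexAlgEquiv, reindex_apply, submatrix_apply, e.symm_apply_apply,
      e.symm_apply_apply] at this
    exact this
  · intro h a b
    exact h _ _

end Reindex

/-! ### Change of form and of indexing for the classical groups. -/

section Concrete

variable {o : Type u} [CommRing o] [IsDomain o] [IsDiscreteValuationRing o]
    [Finite (IsLocalRing.ResidueField o)]
    {O : Type v} [CommRing O] [IsDomain O] [IsDiscreteValuationRing O]
    [Algebra o O] [Module.Finite o O] [Algebra.FormallyUnramified o O]
    (hquad : Module.finrank o O = 2) (hodd : ringChar (IsLocalRing.ResidueField o) ≠ 2)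
    (σ : O ≃ₐ[o] O) (hσ : σ ≠ AlgEquiv.refl) (T : GroupType)
    {n : Type w} [Fintype n] [DecidableEq n]

include hquad hodd hσ

/-- A conjugator over `K` lifts to `O_ℓ` and is replaced by one carrying `F` for one form to `F` for
the other. Conjugation by it is an isomorphism of the groups at level `ℓ` that matches the
characters. -/
theorem exists_equiv_conj {J D : GL n O} (hJ : (J.1.map σ)ᵀ = J.1) (hD : (D.1.map σ)ᵀ = D.1)
    {ℓ : ℕ} (hℓ : 1 ≤ ℓ) (hd : T.Special → IsUnit (Fintype.card n : Lvl O ℓ))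
    (ψ : AddChar (Lvl O ℓ) ℂ) (x : Matrix n n (Lvl O ℓ)) {ξ : Matrix n n (Lvl O 1)}
    {g : GL n (Lvl O 1)} (hξ : ξ = g.1 * x.map (red O hℓ) * g⁻¹.1)
    (hX : formLie T (lvlAut σ.toRingEquiv 1) (lvlForm D 1) (x.map (red O hℓ)) = x.map (red O hℓ))
    (hY : formLie T (lvlAut σ.toRingEquiv 1) (lvlForm J 1) ξ = ξ) :
    Nat.card (classicalGroup o σ.toRingEquiv J.1 T 1) =
      Nat.card (classicalGroup o σ.toRingEquiv D.1 T 1) ∧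
    ∃ e : IrrOver (classicalGroup o σ.toRingEquiv J.1 T) ℓ ψ ξ ≃
        IrrOver (classicalGroup o σ.toRingEquiv D.1 T) ℓ ψ (x.map (red O hℓ)),
      ∀ χ, χ.1.dim = (e χ).1.dim := by
  have hR := quadraticLevel hquad hodd σ hσ ℓ
  have := hR.finite_gl (n := n)
  have hs : Function.Surjective (red O hℓ) := Ideal.Quotient.factor_surjective _
  obtain ⟨g, rfl⟩ := hR.exists_gl_lift hs (fun y hy => by
    rwa [red_eq_zero_iff, pow_one] at hy) g
  subst hξ
  obtain ⟨γ, hγ, hγx⟩ := exists_transport (red_lvlAut σ hℓ) hR T (hermitian_lvlForm σ hJ ℓ)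
    (hermitian_lvlForm σ hD ℓ) hX hY
  rw [← hγx]
  have hy : (GeneralLinearGroup.map (red O hℓ) γ).1 * x.map (red O hℓ) *
      (GeneralLinearGroup.map (red O hℓ) γ)⁻¹.1 = (γ.1 * x * γ⁻¹.1).map (red O hℓ) := by
    rw [Matrix.map_mul, Matrix.map_mul, ← map_inv]
    rfl
  rw [hy]
  have hφ : ∀ h, MulAut.conj γ⁻¹ h = γ⁻¹ * h * γ := fun h => by
    rw [MulAut.conj_apply, inv_inv]
  refine exists_equiv_irrOver hℓ _ _ (fun _ h => red_mem_classicalGroup hquad hodd σ hσ T hℓ h)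
    (fun _ h => exists_lift_classicalGroup hquad hodd σ hσ T hJ hℓ hd h)
    (fun _ h => red_mem_classicalGroup hquad hodd σ hσ T hℓ h)
    (fun _ h => exists_lift_classicalGroup hquad hodd σ hσ T hD hℓ hd h)
    (MulAut.conj γ⁻¹) (fun h => ?_) (fun i h => ?_) ψ (fun h => ?_)
  · rw [mem_classicalGroup_iff hquad hodd σ hσ, mem_classicalGroup_iff hquad hodd σ hσ, hφ]
    have h1 := hγ (γ⁻¹ * h * γ)
    rw [show γ * (γ⁻¹ * h * γ) * γ⁻¹ = h by group] at h1
    rw [h1, mul_inv_eq_iff_eq_mul, ← eq_inv_mul_iff_mul_eq, ← mul_assoc]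
    have h2 : (γ⁻¹ * h * γ).1.det = h.1.det := by
      rw [Units.val_mul, Units.val_mul, det_mul, det_mul, mul_right_comm, ← det_mul, Units.inv_mul,
        det_one, one_mul]
    rw [h2]
  · rw [hφ]
    have hN : (congKer n (lvlIdeal O ℓ ^ i)).Normal := inferInstance
    constructor
    · intro hh
      have := hN.conj_mem _ hh γ⁻¹
      rwa [inv_inv] at this
    · intro hh
      have := hN.conj_mem _ hh γ
      rwa [show γ * (γ⁻¹ * h * γ) * γ⁻¹ = h by group] at this
  · rw [hφ, ← trace_conj_mul x γ (γ⁻¹ * h * γ), show γ * (γ⁻¹ * h * γ) * γ⁻¹ = h by group]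

theorem exists_equiv_reindex {m : Type w} [Fintype m] [DecidableEq m] (e : n ≃ m) {J : GL n O}
    (hJ : (J.1.map σ)ᵀ = J.1) {ℓ : ℕ} (hℓ : 1 ≤ ℓ)
    (hd : T.Special → IsUnit (Fintype.card n : Lvl O ℓ)) (ψ : AddChar (Lvl O ℓ) ℂ)
    (x : Matrix n n (Lvl O ℓ)) :
    Nat.card (classicalGroup o σ.toRingEquiv J.1 T 1) =
      Nat.card (classicalGroup o σ.toRingEquiv (reindexGL e O J).1 T 1) ∧
    ∃ i : IrrOver (classicalGroup o σ.toRingEquiv J.1 T) ℓ ψ (x.map (red O hℓ)) ≃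
        IrrOver (classicalGroup o σ.toRingEquiv (reindexGL e O J).1 T) ℓ ψ
          ((reindexAlgEquiv (Lvl O ℓ) (Lvl O ℓ) e x).map (red O hℓ)),
      ∀ χ, χ.1.dim = (i χ).1.dim := by
  have hR := quadraticLevel hquad hodd σ hσ ℓ
  have := hR.finite_gl (n := n)
  have hJ' : ((reindexGL e O J).1.map σ)ᵀ = (reindexGL e O J).1 :=
    congrArg (fun z : Matrix n n O => reindexAlgEquiv O O e z) hJ
  have hd' : T.Special → IsUnit (Fintype.card m : Lvl O ℓ) := by
    rwa [← Fintype.card_congr e]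
  refine exists_equiv_irrOver hℓ _ _ (fun _ h => red_mem_classicalGroup hquad hodd σ hσ T hℓ h)
    (fun _ h => exists_lift_classicalGroup hquad hodd σ hσ T hJ hℓ hd h)
    (fun _ h => red_mem_classicalGroup hquad hodd σ hσ T hℓ h)
    (fun _ h => exists_lift_classicalGroup hquad hodd σ hσ T hJ' hℓ hd' h)
    (reindexGL e _) (fun h => ?_) (fun i h => (mem_congKer_reindexGL e).symm) ψ (fun h => ?_)
  · rw [mem_classicalGroup_iff hquad hodd σ hσ, mem_classicalGroup_iff hquad hodd σ hσ,
      map_reindexGL, formInvol_reindex, EmbeddingLike.apply_eq_iff_eq, val_reindexGL,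
      coe_reindexAlgEquiv, det_reindex_self]
  · rw [← trace_reindex e, map_mul, map_sub, map_one]
    rfl

end Concrete

/-! ### Compatibility of involutions, congruence kernels and traces with block diagonal matrices. -/

section BlockDiag

variable {n₁ n₂ : Type w} [Fintype n₁] [DecidableEq n₁] [Fintype n₂] [DecidableEq n₂]
    {R : Type v} [CommRing R]

theorem blockDiag_injective : Function.Injective (blockDiag R n₁ n₂) := fun x y h => by
  have h1 : fromBlocks x.1.1 0 0 x.2.1 = fromBlocks y.1.1 0 0 y.2.1 := congrArg Units.val h
  rw [fromBlocks_inj] at h1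
  exact Prod.ext (Units.ext h1.1) (Units.ext h1.2.2.2)

theorem formInvol_blockDiag (T : GroupType) (σ : R →+* R) (A : GL n₁ R) (B : GL n₂ R)
    (x : GL n₁ R × GL n₂ R) : formInvol T σ (blockDiag R n₁ n₂ (A, B)) (blockDiag R n₁ n₂ x) =
      blockDiag R n₁ n₂ (formInvol T σ A x.1, formInvol T σ B x.2) := by
  have h1 := map_blockDiag σ x.1 x.2
  have h2 : unitaryInvol σ (blockDiag R n₁ n₂ (A, B)) (blockDiag R n₁ n₂ x) =
      blockDiag R n₁ n₂ (unitaryInvol σ A x.1, unitaryInvol σ B x.2) := Units.ext (by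
    rw [val_unitaryInvol, ← map_inv, formAdjoint_apply, ← map_inv]
    change fromBlocks A⁻¹.1 0 0 B⁻¹.1 * ((fromBlocks x.1⁻¹.1 0 0 x.2⁻¹.1).map σ)ᵀ *
      fromBlocks A.1 0 0 B.1 = fromBlocks (formAdjoint σ A x.1⁻¹.1) 0 0 (formAdjoint σ B x.2⁻¹.1)
    rw [fromBlocks_map, fromBlocks_transpose, fromBlocks_multiply, fromBlocks_multiply,
      Matrix.map_zero _ (map_zero σ), Matrix.map_zero _ (map_zero σ), formAdjoint_apply,
      formAdjoint_apply]
    simp)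
  cases T
  exacts [h1, h2, h1, h2]

theorem val_blockDiag_sub_one (x : GL n₁ R × GL n₂ R) :
    (blockDiag R n₁ n₂ x).1 - 1 = fromBlocks (x.1.1 - 1) 0 0 (x.2.1 - 1) := by
  change fromBlocks x.1.1 0 0 x.2.1 - 1 = _
  rw [← fromBlocks_one, sub_eq_add_neg, fromBlocks_neg, fromBlocks_add]
  simp only [neg_zero, add_zero, ← sub_eq_add_neg]

theorem mem_congKer_blockDiag {I : Ideal R} {x : GL n₁ R × GL n₂ R} :
    blockDiag R n₁ n₂ x ∈ congKer (n₁ ⊕ n₂) I ↔ x.1 ∈ congKer n₁ I ∧ x.2 ∈ congKer n₂ I := by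
  rw [mem_congKer, mem_congKer, mem_congKer, val_blockDiag_sub_one]
  constructor
  · exact fun h => ⟨fun a b => h (.inl a) (.inl b), fun a b => h (.inr a) (.inr b)⟩
  · rintro ⟨h1, h2⟩ (a | a) (b | b)
    exacts [h1 a b, I.zero_mem, I.zero_mem, h2 a b]

theorem trace_blockDiag_mul (x₁ : Matrix n₁ n₁ R) (x₂ : Matrix n₂ n₂ R) (g : GL n₁ R × GL n₂ R) :
    (fromBlocks x₁ 0 0 x₂ * ((blockDiag R n₁ n₂ g).1 - 1)).trace =
      (x₁ * (g.1.1 - 1)).trace + (x₂ * (g.2.1 - 1)).trace := by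
  rw [val_blockDiag_sub_one, fromBlocks_multiply, trace, Fintype.sum_sum_type]
  simp [trace]

end BlockDiag

/-! ### The block diagonal subgroup as a product, and the reduction for general `ξ`. -/

section Concrete

variable {o : Type u} [CommRing o] [IsDomain o] [IsDiscreteValuationRing o]
    [Finite (IsLocalRing.ResidueField o)]
    {O : Type v} [CommRing O] [IsDomain O] [IsDiscreteValuationRing O]
    [Algebra o O] [Module.Finite o O] [Algebra.FormallyUnramified o O]
    (hquad : Module.finrank o O = 2) (hodd : ringChar (IsLocalRing.ResidueField o) ≠ 2)
    (σ : O ≃ₐ[o] O) (hσ : σ ≠ AlgEquiv.refl) (T : GroupType)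
    {n₁ n₂ : Type w} [Fintype n₁] [DecidableEq n₁] [Fintype n₂] [DecidableEq n₂]
    {J₁ : GL n₁ O} {J₂ : GL n₂ O} (hJ₁ : (J₁.1.map σ)ᵀ = J₁.1) (hJ₂ : (J₂.1.map σ)ᵀ = J₂.1)

include hquad hodd hσ

omit [Finite (IsLocalRing.ResidueField o)] in
theorem blockDiag_mem_leviGroup_iff (hT : ¬ T.Special) (J₁ : GL n₁ O) (J₂ : GL n₂ O) {m : ℕ}
    {x : GL n₁ (Lvl O m) × GL n₂ (Lvl O m)} :
    blockDiag (Lvl O m) n₁ n₂ x ∈ leviGroup o σ.toRingEquiv J₁.1 J₂.1 T m ↔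
      x.1 ∈ classicalGroup o σ.toRingEquiv J₁.1 T m ∧
        x.2 ∈ classicalGroup o σ.toRingEquiv J₂.1 T m := by
  have h1 : blockDiag (Lvl O m) n₁ n₂ x ∈ leviGroup o σ.toRingEquiv J₁.1 J₂.1 T m ↔
      blockDiag (Lvl O m) n₁ n₂ x ∈
        classicalGroup o σ.toRingEquiv (blockDiag O n₁ n₂ (J₁, J₂)).1 T m :=
    and_iff_left ⟨x, rfl⟩
  rw [h1, mem_classicalGroup_iff hquad hodd σ hσ, mem_classicalGroup_iff hquad hodd σ hσ,
    mem_classicalGroup_iff hquad hodd σ hσ, map_blockDiag, formInvol_blockDiag,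
    blockDiag_injective.eq_iff, Prod.ext_iff]
  simp [hT]

/-- The embedding `(a, b) ↦ diag(a, b)` for groups without determinant condition. -/
def leviHom (hT : ¬ T.Special) (J₁ : GL n₁ O) (J₂ : GL n₂ O) (m : ℕ) :
    classicalGroup o σ.toRingEquiv J₁.1 T m × classicalGroup o σ.toRingEquiv J₂.1 T m →*
      leviGroup o σ.toRingEquiv J₁.1 J₂.1 T m where
  toFun x := ⟨blockDiag (Lvl O m) n₁ n₂ (x.1.1, x.2.1),
    (blockDiag_mem_leviGroup_iff hquad hodd σ hσ T hT J₁ J₂).2 ⟨x.1.2, x.2.2⟩⟩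
  map_one' := Subtype.ext (map_one (blockDiag (Lvl O m) n₁ n₂))
  map_mul' x y := Subtype.ext
    (map_mul (blockDiag (Lvl O m) n₁ n₂) (x.1.1, x.2.1) (y.1.1, y.2.1))

/-- For groups without determinant condition the block diagonal subgroup is a product. -/
noncomputable def leviEquiv (hT : ¬ T.Special) (J₁ : GL n₁ O) (J₂ : GL n₂ O) (m : ℕ) :
    classicalGroup o σ.toRingEquiv J₁.1 T m × classicalGroup o σ.toRingEquiv J₂.1 T m ≃*
      leviGroup o σ.toRingEquiv J₁.1 J₂.1 T m :=
  MulEquiv.ofBijective (leviHom hquad hodd σ hσ T hT J₁ J₂ m) ⟨fun x y h => by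
      have h1 := Prod.ext_iff.1 (blockDiag_injective (congrArg Subtype.val h))
      exact Prod.ext (Subtype.ext h1.1) (Subtype.ext h1.2), by
    rintro ⟨_, hg, ⟨x, rfl⟩⟩
    have h1 := (blockDiag_mem_leviGroup_iff hquad hodd σ hσ T hT J₁ J₂).1 ⟨hg, ⟨x, rfl⟩⟩
    exact ⟨(⟨x.1, h1.1⟩, ⟨x.2, h1.2⟩), rfl⟩⟩

omit [Finite (IsLocalRing.ResidueField o)] in
theorem coe_leviEquiv (hT : ¬ T.Special) (J₁ : GL n₁ O) (J₂ : GL n₂ O) (m : ℕ)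
    (x : classicalGroup o σ.toRingEquiv J₁.1 T m × classicalGroup o σ.toRingEquiv J₂.1 T m) :
    (leviEquiv hquad hodd σ hσ T hT J₁ J₂ m x).1 = blockDiag (Lvl O m) n₁ n₂ (x.1.1, x.2.1) := rfl

include hJ₁ hJ₂

/-- The trace splits over the blocks, so the character of the congruence kernel is an exterior
product and the classification for products of groups applies. -/
theorem exists_equiv_leviGroup_prod (hT : ¬ T.Special) {ℓ : ℕ} (hℓ : 1 ≤ ℓ)
    (x₁ : Matrix n₁ n₁ (Lvl O ℓ)) (x₂ : Matrix n₂ n₂ (Lvl O ℓ)) (ψ : AddChar (Lvl O ℓ) ℂ) :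
    ∃ e : IrrOver (leviGroup o σ.toRingEquiv J₁.1 J₂.1 T) ℓ ψ
          ((fromBlocks x₁ 0 0 x₂).map (red O hℓ)) ≃
        IrrOver (classicalGroup o σ.toRingEquiv J₁.1 T) ℓ ψ (x₁.map (red O hℓ)) ×
          IrrOver (classicalGroup o σ.toRingEquiv J₂.1 T) ℓ ψ (x₂.map (red O hℓ)),
      ∀ χ, χ.1.dim = (e χ).1.1.dim * (e χ).2.1.dim := by
  have hR := quadraticLevel hquad hodd σ hσ ℓ
  have := hR.finite_gl (n := n₁)
  have := hR.finite_gl (n := n₂)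
  have hs₁ : ∀ h ∈ classicalGroup o σ.toRingEquiv J₁.1 T 1,
      ∃ g ∈ classicalGroup o σ.toRingEquiv J₁.1 T ℓ, GeneralLinearGroup.map (red O hℓ) g = h :=
    fun h hh => exists_lift_classicalGroup hquad hodd σ hσ T hJ₁ hℓ (fun h => absurd h hT) hh
  have hs₂ : ∀ h ∈ classicalGroup o σ.toRingEquiv J₂.1 T 1,
      ∃ g ∈ classicalGroup o σ.toRingEquiv J₂.1 T ℓ, GeneralLinearGroup.map (red O hℓ) g = h :=
    fun h hh => exists_lift_classicalGroup hquad hodd σ hσ T hJ₂ hℓ (fun h => absurd h hT) hh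
  have hs : ∀ h ∈ leviGroup o σ.toRingEquiv J₁.1 J₂.1 T 1,
      ∃ g ∈ leviGroup o σ.toRingEquiv J₁.1 J₂.1 T ℓ,
        GeneralLinearGroup.map (red O hℓ) g = h := by
    rintro _ ⟨hh, ⟨y, rfl⟩⟩
    obtain ⟨h1, h2⟩ := (blockDiag_mem_leviGroup_iff hquad hodd σ hσ T hT J₁ J₂).1 ⟨hh, ⟨y, rfl⟩⟩
    obtain ⟨g₁, hg₁, e₁⟩ := hs₁ _ h1
    obtain ⟨g₂, hg₂, e₂⟩ := hs₂ _ h2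
    refine ⟨blockDiag (Lvl O ℓ) n₁ n₂ (g₁, g₂),
      (blockDiag_mem_leviGroup_iff hquad hodd σ hσ T hT J₁ J₂).2 ⟨hg₁, hg₂⟩, ?_⟩
    rw [map_blockDiag, e₁, e₂]
  rw [irrOver_eq_above hℓ _ hs, irrOver_eq_above hℓ _ hs₁, irrOver_eq_above hℓ _ hs₂]
  obtain ⟨i, hi⟩ := Irr.exists_equiv_above (leviEquiv hquad hodd σ hσ T hT J₁ J₂ ℓ)
    (N := ((congKer n₁ (lvlIdeal O ℓ ^ (ℓ - 1))).subgroupOf _).prod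
      ((congKer n₂ (lvlIdeal O ℓ ^ (ℓ - 1))).subgroupOf _))
    (N' := (congKer (n₁ ⊕ n₂) (lvlIdeal O ℓ ^ (ℓ - 1))).subgroupOf _)
    (f := fun g => ψ (x₁ * (g.1.1.1 - 1)).trace * ψ (x₂ * (g.2.1.1 - 1)).trace)
    (f' := fun g => ψ (fromBlocks x₁ 0 0 x₂ * (g.1.1 - 1)).trace)
    (fun g => Subgroup.mem_prod.trans
      (mem_congKer_blockDiag (x := (g.1.1, g.2.1))).symm) (fun g _ => by
      rw [coe_leviEquiv, trace_blockDiag_mul, AddChar.map_add_eq_mul])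
  obtain ⟨e, he⟩ := Irr.exists_equiv_prod
    (N₁ := (congKer n₁ (lvlIdeal O ℓ ^ (ℓ - 1))).subgroupOf
      (classicalGroup o σ.toRingEquiv J₁.1 T ℓ))
    (N₂ := (congKer n₂ (lvlIdeal O ℓ ^ (ℓ - 1))).subgroupOf
      (classicalGroup o σ.toRingEquiv J₂.1 T ℓ))
    (f₁ := fun g => ψ (x₁ * (g.1.1 - 1)).trace) (f₂ := fun g => ψ (x₂ * (g.1.1 - 1)).trace)
    (by simp) (by simp)
  refine ⟨i.trans e, fun χ => ?_⟩
  rw [← hi χ, he]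
  rfl

omit hJ₁ hJ₂ in
omit [Finite (IsLocalRing.ResidueField o)] in
theorem card_leviGroup (hT : ¬ T.Special) (J₁ : GL n₁ O) (J₂ : GL n₂ O) (m : ℕ) :
    Nat.card (leviGroup o σ.toRingEquiv J₁.1 J₂.1 T m) =
      Nat.card (classicalGroup o σ.toRingEquiv J₁.1 T m) *
        Nat.card (classicalGroup o σ.toRingEquiv J₂.1 T m) := by
  rw [← Nat.card_congr (leviEquiv hquad hodd σ hσ T hT J₁ J₂ m).toEquiv, Nat.card_prod]

/-- The reduction to the block diagonal subgroup. -/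
theorem exists_equiv_leviGroup {n : Type w} [Fintype n] [DecidableEq n] (i : n₁ ⊕ n₂ ≃ n)
    {J : GL n O} (hJ : (J.1.map σ)ᵀ = J.1) {ℓ : ℕ} (hℓ : 2 ≤ ℓ)
    (hd : T.Special → IsUnit (Fintype.card n : Lvl O ℓ)) (x₁ : Matrix n₁ n₁ (Lvl O ℓ))
    (x₂ : Matrix n₂ n₂ (Lvl O ℓ)) {ξ : Matrix n n (Lvl O 1)}
    (hξ : ξ ∈ lieAlg o σ.toRingEquiv J.1 T 1)
    (hx : (fromBlocks x₁ 0 0 x₂).map (red O (one_le_two.trans hℓ)) ∈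
      lieAlg o σ.toRingEquiv (fromBlocks J₁.1 0 0 J₂.1) T 1)
    (hconj : ∃ g : GL n (Lvl O 1), ξ = g.1 *
      ((fromBlocks x₁ 0 0 x₂).map (red O (one_le_two.trans hℓ))).reindex i i * g⁻¹.1)
    (hcop : IsCoprime (x₁.map (red O (one_le_two.trans hℓ))).charpoly
      (x₂.map (red O (one_le_two.trans hℓ))).charpoly) {ψ : AddChar (Lvl O ℓ) ℂ}
    (hψ : ∃ t ∈ lvlIdeal O ℓ ^ (ℓ - 1), ψ (t + lvlAut σ.toRingEquiv ℓ t) ≠ 1) :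
    ∃ e : IrrOver (classicalGroup o σ.toRingEquiv J.1 T) ℓ ψ ξ ≃
      IrrOver (leviGroup o σ.toRingEquiv J₁.1 J₂.1 T) ℓ ψ
        ((fromBlocks x₁ 0 0 x₂).map (red O (one_le_two.trans hℓ))),
      ∀ χ, Nat.card (leviGroup o σ.toRingEquiv J₁.1 J₂.1 T 1) * χ.1.dim =
        Nat.card (classicalGroup o σ.toRingEquiv J.1 T 1) *
        Nat.card (ResidueField o) ^ (Fintype.card n₁ * Fintype.card n₂ * (ℓ - 2)) *
        (e χ).1.dim := by
  have hℓ1 := one_le_two.trans hℓ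
  have hD := hermitian_blockDiag σ hJ₁ hJ₂
  have hD' : ((reindexGL i O (blockDiag O n₁ n₂ (J₁, J₂))).1.map σ)ᵀ =
      (reindexGL i O (blockDiag O n₁ n₂ (J₁, J₂))).1 :=
    congrArg (fun z : Matrix _ _ O => reindexAlgEquiv O O i z) hD
  have hd' : T.Special → IsUnit (Fintype.card (n₁ ⊕ n₂) : Lvl O ℓ) := by
    rwa [Fintype.card_congr i]
  have hX := ((mem_lieAlg_iff hquad hodd σ hσ T (blockDiag O n₁ n₂ (J₁, J₂))).1 hx).1
  have hX' := formLie_reindex i T (lvlAut σ.toRingEquiv 1)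
    (lvlForm (blockDiag O n₁ n₂ (J₁, J₂)) 1) ((fromBlocks x₁ 0 0 x₂).map (red O hℓ1))
  rw [hX] at hX'
  obtain ⟨g, hg⟩ := hconj
  obtain ⟨c1, e1, h1⟩ := exists_equiv_conj hquad hodd σ hσ T hJ hD' hℓ1 hd ψ
    (reindexAlgEquiv (Lvl O ℓ) (Lvl O ℓ) i (fromBlocks x₁ 0 0 x₂)) (ξ := ξ) (g := g) hg hX'
    ((mem_lieAlg_iff hquad hodd σ hσ T J).1 hξ).1
  obtain ⟨c2, e2, h2⟩ := exists_equiv_reindex hquad hodd σ hσ T i hD hℓ1 hd' ψ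
    (fromBlocks x₁ 0 0 x₂)
  obtain ⟨-, e3, h3⟩ := exists_equiv_levi hquad hodd σ hσ T hJ₁ hJ₂ hℓ hd' x₁ x₂ hx hcop hψ
  refine ⟨(e1.trans e2.symm).trans e3, fun χ => ?_⟩
  have h4 := h2 (e2.symm (e1 χ))
  rw [Equiv.apply_symm_apply] at h4
  have h5 := h3 (e2.symm (e1 χ))
  have c2' : Nat.card (classicalGroup o σ.toRingEquiv (fromBlocks J₁.1 0 0 J₂.1) T 1) = _ := c2
  rw [h1, c1, ← c2', ← h4]
  exact_mod_cast h5

end Concrete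

/-! ### Dimensions and zeta functions -/

theorem GroupType.dim_sub_leviDim (T : GroupType) (d₁ d₂ : ℕ) :
    T.dim (d₁ + d₂) - T.leviDim d₁ d₂ = 2 * (d₁ * d₂ : ℕ) := by
  cases T <;> simp only [GroupType.dim, GroupType.leviDim] <;> push_cast <;> ring

theorem GroupType.dim_sub_dim {T : GroupType} (hT : T = .GL ∨ T = .GU) (d₁ d₂ : ℕ) :
    T.dim (d₁ + d₂) - T.dim d₁ - T.dim d₂ = 2 * (d₁ * d₂ : ℕ) := by
  rcases hT with rfl | rfl <;> simp only [GroupType.dim] <;> push_cast <;> ring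

theorem natCast_pow_cpow (q M : ℕ) (z : ℂ) : ((q ^ M : ℕ) : ℂ) ^ z = (q : ℂ) ^ (M * z) := by
  rw [Complex.cpow_nat_mul]
  induction M with
  | zero => simp
  | succ M ih => rw [pow_succ, Nat.cast_mul, Complex.natCast_mul_natCast_cpow, ih, pow_succ]

theorem rpow_dim_eq {a : ℤ} {N ℓ : ℕ} (q : ℕ) (ha : a = 2 * (N : ℕ)) (hℓ : 2 ≤ ℓ) :
    (q : ℝ) ^ ((a : ℝ) * ((ℓ : ℝ) - 2) / 2) = (q : ℝ) ^ (N * (ℓ - 2)) := by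
  rw [← Real.rpow_natCast, ha]
  congr 1
  push_cast [Nat.cast_sub hℓ]
  ring

theorem cpow_dim_eq {a : ℤ} {N ℓ : ℕ} (q : ℕ) (ha : a = 2 * (N : ℕ)) (hℓ : 2 ≤ ℓ) (s : ℂ) :
    (q : ℂ) ^ (-((a : ℂ) * ((ℓ : ℂ) - 2) / 2 * s)) = ((q ^ (N * (ℓ - 2)) : ℕ) : ℂ) ^ (-s) := by
  rw [natCast_pow_cpow, ha]
  congr 1
  push_cast [Nat.cast_sub hℓ]
  ring

/-- Complex powers of natural numbers are multiplicative, so the identity of dimensions may be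
raised to the power `-s` once all denominators are cleared. -/
theorem natCast_cpow_mul_eq {L a G Q b : ℕ} (hL : L ≠ 0) (h : L * a = G * Q * b) (s : ℂ) :
    (a : ℂ) ^ (-s) = (G : ℂ) ^ (-s) / (L : ℂ) ^ (-s) * (Q : ℂ) ^ (-s) * (b : ℂ) ^ (-s) := by
  have h1 : (L : ℂ) ^ (-s) ≠ 0 := by
    rw [Ne, Complex.cpow_eq_zero_iff]
    exact fun h => hL (Nat.cast_eq_zero.1 h.1)
  have h2 := congrArg (fun n : ℕ => (n : ℂ) ^ (-s)) h
  change ((L * a : ℕ) : ℂ) ^ (-s) = ((G * Q * b : ℕ) : ℂ) ^ (-s) at h2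
  rw [Nat.cast_mul, Complex.natCast_mul_natCast_cpow, Nat.cast_mul (G * Q),
    Complex.natCast_mul_natCast_cpow, Nat.cast_mul, Complex.natCast_mul_natCast_cpow] at h2
  field_simp
  linear_combination h2

theorem zeta_eq_mul_of_equiv {G : Type u} {H : Type v} [Group G] [Group H] {S : Set (Irr G)}
    {S' : Set (Irr H)} (e : S ≃ S') {L c Q : ℕ} (hL : L ≠ 0)
    (h : ∀ χ, L * χ.1.dim = c * Q * (e χ).1.dim) (s : ℂ) :
    zeta S s = (c : ℂ) ^ (-s) / (L : ℂ) ^ (-s) * (Q : ℂ) ^ (-s) * zeta S' s := by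
  rw [zeta, zeta, ← e.tsum_eq, ← tsum_mul_left]
  exact tsum_congr fun χ => natCast_cpow_mul_eq hL (h χ) s

theorem zeta_eq_mul_of_equiv_prod {G : Type u} {H₁ : Type v} {H₂ : Type w} [Group G] [Group H₁]
    [Group H₂] [Finite H₁] [Finite H₂] {S : Set (Irr G)} {S₁ : Set (Irr H₁)} {S₂ : Set (Irr H₂)}
    (e : S ≃ S₁ × S₂) (h : ∀ χ, χ.1.dim = (e χ).1.1.dim * (e χ).2.1.dim) (s : ℂ) :
    zeta S s = zeta S₁ s * zeta S₂ s := by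
  have := Fintype.ofFinite S₁
  have := Fintype.ofFinite S₂
  rw [zeta, zeta, zeta, ← e.symm.tsum_eq, tsum_fintype, tsum_fintype, tsum_fintype,
    Finset.sum_mul_sum, Fintype.sum_prod_type]
  refine Finset.sum_congr rfl fun x _ => Finset.sum_congr rfl fun y _ => ?_
  have h1 := h (e.symm (x, y))
  rw [e.apply_symm_apply] at h1
  rw [h1, Nat.cast_mul, Complex.natCast_mul_natCast_cpow]

theorem dim_eq_div_mul {L a G Q b : ℕ} (hL : L ≠ 0) (h : L * a = G * Q * b) :
    (a : ℝ) = G / L * Q * b := by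
  have hL' : (L : ℝ) ≠ 0 := by exact_mod_cast hL
  have h' : (L : ℝ) * a = G * Q * b := by exact_mod_cast h
  field_simp
  linear_combination h'

theorem isUnit_natCast_lvl {o : Type u} {O : Type v} [CommRing o] [IsLocalRing o] [CommRing O]
    [IsLocalRing O] [Algebra o O] {d : ℕ} (h : ¬ ringChar (ResidueField o) ∣ d) (m : ℕ) :
    IsUnit (d : Lvl O m) := by
  have h1 : (d : ResidueField o) ≠ 0 := fun h0 => h (ringChar.dvd h0)
  have h2 : IsUnit (d : o) := by
    rw [← map_natCast (residue o), residue_ne_zero_iff_isUnit] at h1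
    exact h1
  have h3 := h2.map ((toLvl O m).comp (algebraMap o O))
  rwa [map_natCast] at h3

theorem exists_map_red_eq {O : Type v} [CommRing O] [IsLocalRing O] {n : Type w} {ℓ : ℕ}
    (hℓ : 1 ≤ ℓ) (x : Matrix n n (Lvl O 1)) :
    ∃ y : Matrix n n (Lvl O ℓ), y.map (red O hℓ) = x := by
  have hs : Function.Surjective (red O hℓ) := Ideal.Quotient.factor_surjective _
  choose y hy using fun a b => hs (x a b)
  exact ⟨of y, Matrix.ext hy⟩

end DimRed

/-! ### The main theorem. -/

theorem theoremD
    -- a compact discrete valuation ring of odd residue characteristic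
    {o : Type u} [CommRing o] [IsDomain o] [IsDiscreteValuationRing o]
    [IsAdicComplete (IsLocalRing.maximalIdeal o) o] [Finite (IsLocalRing.ResidueField o)]
    (hodd : ringChar (IsLocalRing.ResidueField o) ≠ 2)
    -- a quadratic unramified extension with its nontrivial automorphism
    {O : Type v} [CommRing O] [IsDomain O] [IsDiscreteValuationRing O]
    [Algebra o O] [Module.Finite o O] [Algebra.FormallyUnramified o O]
    (hquad : Module.finrank o O = 2)
    (σ : O ≃ₐ[o] O) (hσ : σ ≠ AlgEquiv.refl)
    -- the type of the group and the size of the matrices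
    (T : DimRed.GroupType) (d₁ d₂ d : ℕ) (hd : d₁ + d₂ = d)
    (hp : T = .SL ∨ T = .SU → ¬ ringChar (IsLocalRing.ResidueField o) ∣ d)
    -- nondegenerate Hermitian forms
    (J : Matrix (Fin d) (Fin d) O) (hJ : (J.map σ).transpose = J) (hJu : IsUnit J.det)
    (J₁ : Matrix (Fin d₁) (Fin d₁) O) (hJ₁ : (J₁.map σ).transpose = J₁) (hJ₁u : IsUnit J₁.det)
    (J₂ : Matrix (Fin d₂) (Fin d₂) O) (hJ₂ : (J₂.map σ).transpose = J₂) (hJ₂u : IsUnit J₂.det)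
    -- the level and a primitive character
    (ℓ : ℕ) (hℓ : 2 ≤ ℓ) (ψ : AddChar (DimRed.Lvl O ℓ) ℂ)
    (hψ : ∃ x ∈ IsLocalRing.maximalIdeal o ^ (ℓ - 1),
      ψ (DimRed.toLvl O ℓ (algebraMap o O x)) ≠ 1)
    -- the decomposable matrix
    (ξ : Matrix (Fin d) (Fin d) (DimRed.Lvl O 1))
    (ξ₁ : Matrix (Fin d₁) (Fin d₁) (DimRed.Lvl O 1))
    (ξ₂ : Matrix (Fin d₂) (Fin d₂) (DimRed.Lvl O 1))
    (hξ : ξ ∈ DimRed.lieAlg o σ.toRingEquiv J T 1)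
    (hξ₁₂ : Matrix.fromBlocks ξ₁ 0 0 ξ₂ ∈
      DimRed.lieAlg o σ.toRingEquiv (Matrix.fromBlocks J₁ 0 0 J₂) T 1)
    (hconj : ∃ g : Matrix.GeneralLinearGroup (Fin d) (DimRed.Lvl O 1),
      ξ = g.1 * (Matrix.fromBlocks ξ₁ 0 0 ξ₂).reindex
        (finSumFinEquiv.trans (finCongr hd)) (finSumFinEquiv.trans (finCongr hd)) * g⁻¹.1)
    (hcop : IsCoprime ξ₁.charpoly ξ₂.charpoly) :
    let q : ℕ := Nat.card (IsLocalRing.ResidueField o)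
    let G := DimRed.classicalGroup o σ.toRingEquiv J T
    let G₁ := DimRed.classicalGroup o σ.toRingEquiv J₁ T
    let G₂ := DimRed.classicalGroup o σ.toRingEquiv J₂ T
    let L := DimRed.leviGroup o σ.toRingEquiv J₁ J₂ T
    let ξ₁₂ := Matrix.fromBlocks ξ₁ 0 0 ξ₂
    -- all four types, with the block diagonal subgroup `L = G ∩ (GL_{d₁} × GL_{d₂})`
    ((∃ e : DimRed.IrrOver G ℓ ψ ξ ≃ DimRed.IrrOver L ℓ ψ ξ₁₂, ∀ χ,
        (χ.1.dim : ℝ) = (Nat.card (G 1) : ℝ) / (Nat.card (L 1) : ℝ) *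
          (q : ℝ) ^ (((T.dim d - T.leviDim d₁ d₂ : ℤ) : ℝ) * ((ℓ : ℝ) - 2) / 2) *
          ((e χ).1.dim : ℝ)) ∧
      ∀ s : ℂ, DimRed.zeta (DimRed.IrrOver G ℓ ψ ξ) s =
        (Nat.card (G 1) : ℂ) ^ (-s) / (Nat.card (L 1) : ℂ) ^ (-s) *
          (q : ℂ) ^ (-(((T.dim d - T.leviDim d₁ d₂ : ℤ) : ℂ) * ((ℓ : ℂ) - 2) / 2 * s)) *
          DimRed.zeta (DimRed.IrrOver L ℓ ψ ξ₁₂) s) ∧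
    -- for `GL` and `GU`, where `L = G₁ × G₂`
    (T = .GL ∨ T = .GU →
      (∃ e : DimRed.IrrOver G ℓ ψ ξ ≃ DimRed.IrrOver G₁ ℓ ψ ξ₁ × DimRed.IrrOver G₂ ℓ ψ ξ₂, ∀ χ,
        (χ.1.dim : ℝ) = (Nat.card (G 1) : ℝ) / ((Nat.card (G₁ 1) : ℝ) * (Nat.card (G₂ 1) : ℝ)) *
          (q : ℝ) ^ (((T.dim d - T.dim d₁ - T.dim d₂ : ℤ) : ℝ) * ((ℓ : ℝ) - 2) / 2) *
          (((e χ).1.1.dim : ℝ) * ((e χ).2.1.dim : ℝ))) ∧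
      ∀ s : ℂ, DimRed.zeta (DimRed.IrrOver G ℓ ψ ξ) s =
        (Nat.card (G 1) : ℂ) ^ (-s) /
            ((Nat.card (G₁ 1) : ℂ) ^ (-s) * (Nat.card (G₂ 1) : ℂ) ^ (-s)) *
          (q : ℂ) ^ (-(((T.dim d - T.dim d₁ - T.dim d₂ : ℤ) : ℂ) * ((ℓ : ℂ) - 2) / 2 * s)) *
          DimRed.zeta (DimRed.IrrOver G₁ ℓ ψ ξ₁) s *
          DimRed.zeta (DimRed.IrrOver G₂ ℓ ψ ξ₂) s) := by
  classical
  subst hd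
  obtain ⟨J, rfl⟩ := (Matrix.isUnit_iff_isUnit_det J).2 hJu
  obtain ⟨J₁, rfl⟩ := (Matrix.isUnit_iff_isUnit_det J₁).2 hJ₁u
  obtain ⟨J₂, rfl⟩ := (Matrix.isUnit_iff_isUnit_det J₂).2 hJ₂u
  have hℓ1 : 1 ≤ ℓ := one_le_two.trans hℓ
  -- Lifting the blocks to `O_ℓ` expresses the characters by one fixed matrix over `O_ℓ`; the choice
  -- of lift does not affect them.
  obtain ⟨x₁, rfl⟩ := DimRed.exists_map_red_eq hℓ1 ξ₁
  obtain ⟨x₂, rfl⟩ := DimRed.exists_map_red_eq hℓ1 ξ₂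
  have hx : fromBlocks (x₁.map (DimRed.red O hℓ1)) 0 0 (x₂.map (DimRed.red O hℓ1)) =
      (fromBlocks x₁ 0 0 x₂).map (DimRed.red O hℓ1) := by
    rw [fromBlocks_map, Matrix.map_zero _ (map_zero _), Matrix.map_zero _ (map_zero _)]
  rw [hx] at hξ₁₂ hconj
  have hu : T.Special → IsUnit (Fintype.card (Fin (d₁ + d₂)) : DimRed.Lvl O ℓ) := fun hT => by
    rw [Fintype.card_fin]
    exact DimRed.isUnit_natCast_lvl (hp hT) ℓ
  have hfin := (DimRed.quadraticLevel hquad hodd σ hσ 1).finite_gl (n := Fin d₁ ⊕ Fin d₂)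
  have hL0 : Nat.card (DimRed.leviGroup o σ.toRingEquiv J₁.1 J₂.1 T 1) ≠ 0 := Nat.card_pos.ne'
  obtain ⟨e, he⟩ := DimRed.exists_equiv_leviGroup hquad hodd σ hσ T hJ₁ hJ₂
    (finSumFinEquiv.trans (finCongr rfl)) hJ hℓ hu x₁ x₂ hξ hξ₁₂ hconj hcop
    (DimRed.exists_trace_ne_one hquad hodd σ ψ hψ)
  simp only [Fintype.card_fin] at he
  intro q G G₁ G₂ L ξ₁₂
  have hdim := T.dim_sub_leviDim d₁ d₂
  have hξ' : ξ₁₂ = (fromBlocks x₁ 0 0 x₂).map (DimRed.red O hℓ1) := hx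
  rw [hξ']
  have hzeta : ∀ s : ℂ, DimRed.zeta (DimRed.IrrOver G ℓ ψ ξ) s =
      (Nat.card (G 1) : ℂ) ^ (-s) / (Nat.card (L 1) : ℂ) ^ (-s) *
        ((q ^ (d₁ * d₂ * (ℓ - 2)) : ℕ) : ℂ) ^ (-s) *
        DimRed.zeta (DimRed.IrrOver L ℓ ψ ((fromBlocks x₁ 0 0 x₂).map (DimRed.red O hℓ1))) s :=
    DimRed.zeta_eq_mul_of_equiv e hL0 he
  refine ⟨⟨⟨e, fun χ => ?_⟩, fun s => ?_⟩, fun hT => ?_⟩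
  · rw [DimRed.rpow_dim_eq q hdim hℓ, DimRed.dim_eq_div_mul hL0 (he χ), Nat.cast_pow]
  · rw [DimRed.cpow_dim_eq q hdim hℓ, hzeta]
  · have hdim' := DimRed.GroupType.dim_sub_dim hT d₁ d₂
    have hS : ¬ T.Special := by rcases hT with rfl | rfl <;> simp [DimRed.GroupType.Special]
    obtain ⟨i, hi⟩ := DimRed.exists_equiv_leviGroup_prod hquad hodd σ hσ T hJ₁ hJ₂ hS hℓ1 x₁ x₂ ψ
    have hcard : Nat.card (L 1) = Nat.card (G₁ 1) * Nat.card (G₂ 1) :=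
      DimRed.card_leviGroup hquad hodd σ hσ T hS J₁ J₂ 1
    have hfin₁ := (DimRed.quadraticLevel hquad hodd σ hσ ℓ).finite_gl (n := Fin d₁)
    have hfin₂ := (DimRed.quadraticLevel hquad hodd σ hσ ℓ).finite_gl (n := Fin d₂)
    refine ⟨⟨e.trans i, fun χ => ?_⟩, fun s => ?_⟩
    · rw [DimRed.rpow_dim_eq q hdim' hℓ, DimRed.dim_eq_div_mul hL0 (he χ), Nat.cast_pow, hi,
        Nat.cast_mul, ← Nat.cast_mul (Nat.card (G₁ 1)), ← hcard]
      rfl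
    · rw [DimRed.cpow_dim_eq q hdim' hℓ, hzeta, hcard, Nat.cast_mul,
        Complex.natCast_mul_natCast_cpow, DimRed.zeta_eq_mul_of_equiv_prod i hi, mul_assoc _
        (DimRed.zeta (DimRed.IrrOver G₁ ℓ ψ _) s)]
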